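/- **Dessins.** A dessin d'enfant with $m\ge1$ labelled poles of orders $\mu=(\mu_1,\dots,\mu_m)$, $\mu_j\ge1$, is a connected bicoloured ribbon graph with $d=|\mu|=\mu_1+\dots+\mu_m$ edges. It is given by two permutations $\sigma_0,\sigma_1$ of the set of edges that generate a transitive group, with a labelling of the cycles of $\sigma_0\sigma_1$ by $1,\dots,m$ such that the $j$-th cycle has length $\mu_j$. (It corresponds to a Belyi map $f$ of degree $d$; the cycles of $\sigma_0,\sigma_1,\sigma_0\sigma_1$ are the points over $0,1,\infty$.) Let $N_{k,l}(\mu)=\sum_\Gamma 1/|\mathrm{Aut}\,\Gamma|$, where $\Gamma$ runs over the isomorphism classes of such dessins for which $\sigma_0$ has $k$ cycles and $\sigma_1$ has $l$ cycles, and isomorphisms and automorphisms preserve the labels. Put $$\langle\tau_{\mu_1}\cdots\tau_{\mu_m}\rangle(u,v,\epsilon)=\sum_{g\ge0,\ k,l\ge1,\ 2g+k+l=|\mu|-m+2}N_{k,l}(\mu)\,u^kv^l\epsilon^{2g-2},$$ $$\mathcal F_{\rm dessins}(u,v,\mathbf p;\epsilon)=\sum_{m\ge1}\sum_{\mu_1,\dots,\mu_m\ge1}\langle\tau_{\mu_1}\cdots\tau_{\mu_m}\rangle(u,v,\epsilon)\frac{p_{\mu_1}\cdots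 p_{\mu_m}}{m!},\qquad Z_{\rm dessins}=e^{\mathcal F_{\rm dessins}},$$ where $\mathbf p=(p_1,p_2,\dots)$. **Corrected partition function.** Let $a\in\mathbb C\setminus\{0\}$, and let $x$ range over the complex numbers with $x,\,x+a\notin(-\infty,0]$; logarithms are principal. All series are formal power series in $\mathbf p$ (or $\mathbf t$) whose coefficients are formal Laurent series in $\epsilon$ with coefficients holomorphic in $x$, and $\Lambda=e^{\epsilon\partial_x}$ is the shift $f(x)\mapsto f(x+\epsilon)$. Put $$\begin{aligned}\mathcal F(x,\mathbf p;a;\epsilon)={}&\mathcal F_{\rm dessins}(x,x+a,\mathbf p;\epsilon)+\frac1{\epsilon^2}\Bigl(\frac{x^2}2\log x+\frac{(x+a)^2}2\log(x+a)-\frac{a^2}2\log a-\frac32x(x+a)\Bigr)\\&-\frac1{12}\bigl(\log x+\log(x+a)-\log a\bigr)+\zeta'(-1)+\sum_{g\ge2}\frac{B_{2g}\,\epsilon^{2g-2}}{4g(g-1)}\Bigl(\frac1{x^{2g-2}}+\frac1{(x+a)^{2g-2}}-\frac1{a^{2g-2}}\Bigr)\end{aligned}$$ and let $Z=e^{\mathcal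 F}$ as a formal exponential. (Thus $Z$ is the product of $Z_{\rm dessins}(u,v,\mathbf p;\epsilon)$ at $u=x$, $v=x+a$ and the factor $\epsilon^{-\frac1{12}+\frac{uv}{\epsilon^2}}(2\pi)^{-\frac u\epsilon}\,G(1+\frac u\epsilon)G(1+\frac v\epsilon)/G(1+\frac{v-u}\epsilon)$, with the Barnes functions $G$ replaced by the exponentials of the formal asymptotics of their logarithms as $\epsilon\to0$.) **Toda lattice hierarchy.** A pair $(V,W)$ of power series in $\mathbf t=(t_0,t_1,\dots)$ solves the Toda lattice hierarchy if $L=\Lambda+V+W\Lambda^{-1}$ satisfies $\partial L/\partial t_i=\epsilon^{-1}[(L^{i+1})_+,L]$ for all $i\ge0$, where $\bigl(\sum_kP_k\Lambda^k\bigr)_+=\sum_{k\ge0}P_k\Lambda^k$. The basic matrix resolvent of $L$ is the $2\times2$ matrix $R(\lambda)$ of power series in $\lambda^{-1}$ with $$\Lambda(R)U-UR=0,\quad U=\begin{pmatrix}V-\lambda&W\\-1&0\end{pmatrix},\quad \mathrm{tr}\,R=1,\quad\det R=0,\quad R=\begin{pmatrix}1&0\\0&0\end{pmatrix}+O(\lambda^{-1}).$$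 Let $S_i$ be the coefficient of $\lambda^{-i-2}$ in $\Lambda(R_{21})$, and define $\Omega_{i,j}$ by $$\sum_{i,j\ge0}\Omega_{i,j}\lambda^{-i-2}\mu^{-j-2}=\frac{\mathrm{tr}\,R(\lambda)R(\mu)-1}{(\lambda-\mu)^2}.$$ A formal exponential $\tau(x,\mathbf t;\epsilon)$ is the tau-function of the solution $(V,W)$ if for all $i,j\ge0$ $$\epsilon^2\frac{\partial^2\log\tau}{\partial t_i\partial t_j}=\Omega_{i,j},\qquad \epsilon\frac{\partial}{\partial t_i}\log\frac{\tau(x+\epsilon)}{\tau(x)}=S_i,\qquad \frac{\tau(x+\epsilon)\tau(x-\epsilon)}{\tau(x)^2}=W.$$ **Theorem.** Define $$V(x,\mathbf p;\epsilon)=\epsilon(\Lambda-1)\frac{\partial\log Z(x,\mathbf p;a;\epsilon)}{\partial p_1},\qquad W(x,\mathbf p;\epsilon)=\frac{Z(x+\epsilon,\mathbf p;a;\epsilon)\,Z(x-\epsilon,\mathbf p;a;\epsilon)}{Z(x,\mathbf p;a;\epsilon)^2}.$$ The ratio $W$ is a well-defined power series in $\mathbf p$ of the above kind. Under the substitution $t_i=p_{i+1}/(i+1)$,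 $i\ge0$, the pair $(V,W)$ solves the Toda lattice hierarchy, and $Z$ is the tau-function of this solution. Moreover, $$V(x,\mathbf 0;\epsilon)=2x+a+\epsilon,\qquad W(x,\mathbf 0;\epsilon)=x(x+a),$$ and $(V,W)$ is the only solution of the Toda lattice hierarchy with these initial data. -/

import Mathlib

open TopologicalSpace

noncomputable section

namespace DessinToda

/-! ## Dessins and their weighted counts -/

/-- A (connected) dessin d'enfant with `m` labelled poles of type `(k, l, μ)`, as a bicoloured
ribbon graph with edge set `Fin (∑ j, μ j)`.  The edges are the preimages of the open segment
`(0, 1)` under the Belyi map; `white` and `black` are the monodromies around `0` and `1`, which turn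
the edges around the points over `0` and over `1`.  The points over `0`, `1`, `∞` are the cycles of
`white`, `black` and `white * black`, and the length of a cycle is the ramification index. -/
structure Dessin {m : ℕ} (k l : ℕ) (μ : Fin m → ℕ) where
  white : Equiv.Perm (Fin (∑ j, μ j))
  black : Equiv.Perm (Fin (∑ j, μ j))
  /-- the label of the pole that an edge is turned around by `white * black` -/
  pole : Fin (∑ j, μ j) → Fin m
  connected :
    MulAction.IsPretransitive (Subgroup.closure {white, black}) (Fin (∑ j, μ j))
  card_white : Nat.card (Quotient (Equiv.Perm.SameCycle.setoid white)) = k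
  card_black : Nat.card (Quotient (Equiv.Perm.SameCycle.setoid black)) = l
  pole_eq_iff : ∀ x y, pole x = pole y ↔ (white * black).SameCycle x y
  pole_order : ∀ j, Nat.card {x // pole x = j} = μ j

namespace Dessin

variable {m k l : ℕ} {μ : Fin m → ℕ}

/-- `e` is an isomorphism of dessins that preserves the labels of the poles. -/
def IsIso (Γ Γ' : Dessin k l μ) (e : Equiv.Perm (Fin (∑ j, μ j))) : Prop :=
  e * Γ.white = Γ'.white * e ∧ e * Γ.black = Γ'.black * e ∧ ∀ x, Γ'.pole (e x) = Γ.pole x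

/-- Isomorphism of dessins with labelled poles. -/
def isoSetoid (k l : ℕ) (μ : Fin m → ℕ) : Setoid (Dessin k l μ) where
  r Γ Γ' := ∃ e, IsIso Γ Γ' e
  iseqv :=
    { refl := fun Γ => ⟨1, by simp [IsIso]⟩
      symm := by
        rintro Γ Γ' ⟨e, h1, h2, h3⟩
        refine ⟨e⁻¹, ?_, ?_, fun x => ?_⟩
        · rw [inv_mul_eq_iff_eq_mul, ← mul_assoc, h1, mul_assoc, mul_inv_cancel, mul_one]
        · rw [inv_mul_eq_iff_eq_mul, ← mul_assoc, h2, mul_assoc, mul_inv_cancel, mul_one]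
        · rw [← h3]; simp
      trans := by
        rintro Γ Γ' Γ'' ⟨e, h1, h2, h3⟩ ⟨e', h1', h2', h3'⟩
        refine ⟨e' * e, ?_, ?_, fun x => ?_⟩
        · rw [mul_assoc, h1, ← mul_assoc, h1', mul_assoc]
        · rw [mul_assoc, h2, ← mul_assoc, h2', mul_assoc]
        · rw [Equiv.Perm.mul_apply, h3', h3] }

/-- The number of automorphisms of a dessin that fix every pole. -/
def autCard (Γ : Dessin k l μ) : ℕ := Nat.card {e // IsIso Γ Γ e}

end Dessin

/-- The weighted count `N_{k,l}(μ)`: the sum of `1 / |Aut Γ|` over the isomorphism classes of dessins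
of type `(k, l, μ)` with labelled poles (`Γ.out` is a representative of the class `Γ`). -/
def dessinCount {m : ℕ} (k l : ℕ) (μ : Fin m → ℕ) : ℚ :=
  ∑ᶠ Γ : Quotient (Dessin.isoSetoid k l μ), 1 / (Γ.out.autCard : ℚ)

/-! ## Coefficient rings -/

/-- The algebra of holomorphic functions on `U`. -/
def holSubalgebra (U : Opens ℂ) : Subalgebra ℂ (U → ℂ) where
  carrier := {f | ∃ g : ℂ → ℂ, DifferentiableOn ℂ g U ∧ ∀ x : U, f x = g x}
  mul_mem' := by
    rintro f f' ⟨g, hg, h⟩ ⟨g', hg', h'⟩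
    exact ⟨g * g', hg.mul hg', fun x => by simp [h, h']⟩
  add_mem' := by
    rintro f f' ⟨g, hg, h⟩ ⟨g', hg', h'⟩
    exact ⟨g + g', hg.add hg', fun x => by simp [h, h']⟩
  algebraMap_mem' := fun c => ⟨fun _ => c, differentiableOn_const c, fun _ => rfl⟩

/-- The ring of holomorphic functions of `x ∈ U`. -/
abbrev Hol (U : Opens ℂ) : Type := holSubalgebra U

/-- Formal Laurent series in `ε` whose coefficients are holomorphic functions of `x ∈ U`. -/
abbrev Coef (U : Opens ℂ) : Type := LaurentSeries (Hol U)

/-- Formal power series in infinitely many variables indexed by `ℕ`, with coefficients in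
`Coef U`.  The variable of index `i` is `p_{i+1}` or `t_i`. -/
abbrev Ser (U : Opens ℂ) : Type := MvPowerSeries ℕ (Coef U)

section Operations

variable {U : Opens ℂ}

/-- The holomorphic function on `U` given by a function on `ℂ`. -/
def Hol.ofFun (g : ℂ → ℂ) (hg : DifferentiableOn ℂ g U) : Hol U :=
  ⟨fun x => g x, g, hg, fun _ => rfl⟩

/-- The derivative `∂/∂x` of a holomorphic function. -/
def Hol.D (f : Hol U) : Hol U :=
  ⟨fun x => deriv f.2.choose x, deriv f.2.choose, f.2.choose_spec.1.deriv U.isOpen, fun _ => rfl⟩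

/-- `Hol.D` does not depend on the function on `ℂ` that represents `f` on `U`. -/
theorem Hol.D_ofFun (g : ℂ → ℂ) (hg : DifferentiableOn ℂ g U) (x : U) :
    (Hol.D (Hol.ofFun g hg)).1 x = deriv g x := by
  refine Filter.EventuallyEq.deriv_eq ?_
  filter_upwards [U.isOpen.mem_nhds x.2] with y hy
  exact ((Hol.ofFun g hg).2.choose_spec.2 ⟨y, hy⟩).symm

/-- The pointwise exponential of a holomorphic function. -/
def Hol.exp (f : Hol U) : Hol U :=
  ⟨fun x => Complex.exp (f.1 x), fun x => Complex.exp (f.2.choose x),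
    f.2.choose_spec.1.cexp, fun x => congrArg Complex.exp (f.2.choose_spec.2 x)⟩

/-- The shift `Λ^k = exp (k ε ∂_x) : f(x) ↦ f(x + k ε)` on Laurent series in `ε`. -/
def Coef.shift (k : ℤ) (f : Coef U) : Coef U :=
  HahnSeries.ofSuppBddBelow
    (fun n => ∑ᶠ j : ℕ, ((k : ℂ) ^ j / (j.factorial : ℂ)) • Hol.D^[j] (f.coeff (n - j))) (by
      have hD : Hol.D (0 : Hol U) = 0 := by
        have h0 : (0 : Hol U) = Hol.ofFun (fun _ => 0) (differentiableOn_const 0) := rfl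
        ext x
        conv_lhs => rw [h0, Hol.D_ofFun]
        simp
      refine ⟨f.order, fun n hn => ?_⟩
      by_contra hlt
      refine hn (finsum_eq_zero_of_forall_eq_zero fun j => ?_)
      rw [HahnSeries.coeff_eq_zero_of_lt_order (by omega), Function.iterate_fixed hD, smul_zero])

/-- The shift `Λ^k`, applied to every coefficient of a power series. -/
def Ser.shift (k : ℤ) (f : Ser U) : Ser U := fun n => Coef.shift k (MvPowerSeries.coeff n f)

variable (U) in
/-- The formal parameter `ε`. -/
def eps : Coef U := HahnSeries.single 1 1

variable (U) in
/-- The inverse of `ε`. -/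
def epsInv : Coef U := HahnSeries.single (-1) 1

/-- The derivation `∂/∂t_i` (or `∂/∂p_{i+1}`). -/
def Ser.d (i : ℕ) (f : Ser U) : Ser U := MvPowerSeries.pderiv (Coef U) i f

/-! ## Formal exponentials -/

/-- `w = exp f`.  The coefficient of `f` at `t = 0` has no negative powers of `ε`; `c` is its
value at `ε = 0`, whose exponential is taken pointwise, `q` is the rest of it, and `h` is the part
of `f` that vanishes at `t = 0`; `exp q` and `exp h` are given by the exponential power series. -/
def IsExpOf (f w : Ser U) : Prop :=
  ∃ (c : Hol U) (q : PowerSeries (Hol U)) (h : Ser U),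
    PowerSeries.constantCoeff q = 0 ∧ MvPowerSeries.constantCoeff h = 0 ∧
    f = MvPowerSeries.C (HahnSeries.C c + HahnSeries.ofPowerSeries ℤ (Hol U) q) + h ∧
    w = MvPowerSeries.C (HahnSeries.C (Hol.exp c) *
          HahnSeries.ofPowerSeries ℤ (Hol U) (PowerSeries.subst q (PowerSeries.exp ℂ))) *
        PowerSeries.subst h (PowerSeries.exp ℂ)

variable (U) in
/-- Formal exponentials `exp F` of power series `F`, which may have negative powers of `ε` and are
multiplied by adding exponents. -/
abbrev FormalExp : Type := Multiplicative (Ser U)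

/-- The formal exponential `exp F`. -/
def FormalExp.exp (F : Ser U) : FormalExp U := Multiplicative.ofAdd F

/-- `log τ`. -/
def FormalExp.log (τ : FormalExp U) : Ser U := Multiplicative.toAdd τ

/-- The shift `τ(x) ↦ τ(x + k ε)`. -/
def FormalExp.shift (k : ℤ) (τ : FormalExp U) : FormalExp U := exp (Ser.shift k τ.log)

/-- The formal exponential `τ` converges to the series `w`. -/
def FormalExp.HasValue (τ : FormalExp U) (w : Ser U) : Prop := IsExpOf τ.log w

/-- The ratio `τ(x + ε) τ(x - ε) / τ(x) ^ 2`. -/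
def FormalExp.ratio (τ : FormalExp U) : FormalExp U := τ.shift 1 * τ.shift (-1) / τ ^ 2

/-! ## Difference operators and the Toda lattice hierarchy -/

variable (U) in
/-- Difference operators `∑ P_k Λ^k` (finite sums); `P_k` is the value at `k`. -/
abbrev DiffOp : Type := ℤ →₀ Ser U

/-- Composition of difference operators: `(a Λ^i) (b Λ^j) = a Λ^i(b) Λ^{i+j}`. -/
def DiffOp.comp (A B : DiffOp U) : DiffOp U :=
  A.sum fun i a => B.sum fun j b => Finsupp.single (i + j) (a * Ser.shift i b)

/-- Powers of a difference operator. -/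
def DiffOp.pow (A : DiffOp U) : ℕ → DiffOp U
  | 0 => Finsupp.single 0 1
  | n + 1 => A.comp (DiffOp.pow A n)

/-- The part `P_+ = ∑_{k ≥ 0} P_k Λ^k`. -/
def DiffOp.plus (A : DiffOp U) : DiffOp U := A.filter fun k => 0 ≤ k

/-- The Lax operator `L = Λ + V + W Λ⁻¹`. -/
def lax (V W : Ser U) : DiffOp U :=
  Finsupp.single 1 1 + Finsupp.single 0 V + Finsupp.single (-1) W

/-- `(V, W)` is a solution of the Toda lattice hierarchy
`∂L/∂t_i = ε⁻¹ [(L^{i+1})_+, L]` for all `i ≥ 0`, stated for the coefficient of every `Λ^k`. -/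
def IsTodaSolution (V W : Ser U) : Prop :=
  ∀ (i : ℕ) (k : ℤ),
    Ser.d i (lax V W k) =
      MvPowerSeries.C (epsInv U) *
        ((DiffOp.plus ((lax V W).pow (i + 1))).comp (lax V W) k -
          (lax V W).comp (DiffOp.plus ((lax V W).pow (i + 1))) k)

/-! ## The basic matrix resolvent and tau-functions -/

/-- The shift `Λ^k`, applied to every coefficient of a power series in `z = λ⁻¹`. -/
def shiftZ (k : ℤ) (f : PowerSeries (Ser U)) : PowerSeries (Ser U) :=
  PowerSeries.mk fun n => Ser.shift k (PowerSeries.coeff n f)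

/-- The matrix `λ⁻¹ U(λ)`, where `U(λ)` has the rows `(V - λ, W)` and `(-1, 0)`, written in
`z = λ⁻¹`. -/
def zU (V W : Ser U) : Matrix (Fin 2) (Fin 2) (PowerSeries (Ser U)) :=
  !![PowerSeries.X * PowerSeries.C V - 1, PowerSeries.X * PowerSeries.C W; -PowerSeries.X, 0]

/-- `R` is the basic matrix resolvent of `L = Λ + V + W Λ⁻¹`, as a power series in `z = λ⁻¹`:
`Λ(R) U - U R = 0`, `tr R = 1`, `det R = 0`, and `R = diag (1, 0) + O(λ⁻¹)`. -/
structure IsBasicResolvent (V W : Ser U)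
    (R : Matrix (Fin 2) (Fin 2) (PowerSeries (Ser U))) : Prop where
  eq : R.map (shiftZ 1) * zU V W - zU V W * R = 0
  trace : R.trace = 1
  det : R.det = 0
  const : R.map PowerSeries.constantCoeff = !![1, 0; 0, 0]

/-- The coefficient of `λ^{-m} μ^{-n}` in `tr (R(λ) R(μ)) - 1`. -/
def pairCoeff (R : Matrix (Fin 2) (Fin 2) (PowerSeries (Ser U))) (m n : ℕ) : Ser U :=
  (R.map (PowerSeries.coeff m) * R.map (PowerSeries.coeff n)).trace -
    if m = 0 ∧ n = 0 then 1 else 0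

/-- `∑_{i,j ≥ 0} Ω_{i,j} λ^{-i-2} μ^{-j-2} = (tr (R(λ) R(μ)) - 1) / (λ - μ)^2`.  With `s = λ⁻¹`
and `t = μ⁻¹` this is `(s - t)^2 ∑ Ω_{i,j} s^i t^j = tr (R R) - 1`, stated for the coefficient of
`s^m t^n`. -/
def IsTwoPoint (R : Matrix (Fin 2) (Fin 2) (PowerSeries (Ser U))) (Ω : ℕ → ℕ → Ser U) : Prop :=
  ∀ m n : ℕ, pairCoeff R m n =
    (if 2 ≤ m then Ω (m - 2) n else 0) -
      (if 1 ≤ m ∧ 1 ≤ n then 2 * Ω (m - 1) (n - 1) else 0) +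
      (if 2 ≤ n then Ω m (n - 2) else 0)

/-- `τ` is the tau-function of the solution `(V, W)` of the Toda lattice hierarchy. -/
structure IsTauFunction (τ : FormalExp U) (V W : Ser U) : Prop where
  toda : IsTodaSolution V W
  /-- `ε² ∂² log τ / ∂t_i ∂t_j = Ω_{i,j}` and `ε ∂/∂t_i log (τ(x + ε) / τ(x)) = S_i`, where `S_i` is
  the coefficient of `λ^{-i-2}` in `Λ(γ(λ))` and `γ` is the lower left entry of `R`. -/
  resolvent : ∃ (R : Matrix (Fin 2) (Fin 2) (PowerSeries (Ser U))) (Ω : ℕ → ℕ → Ser U),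
    IsBasicResolvent V W R ∧ IsTwoPoint R Ω ∧
    (∀ i j, MvPowerSeries.C (eps U ^ 2) * Ser.d i (Ser.d j τ.log) = Ω i j) ∧
    ∀ i, MvPowerSeries.C (eps U) * Ser.d i (τ.shift 1 / τ).log =
      PowerSeries.coeff (i + 2) (shiftZ 1 (R 1 0))
  /-- `τ(x + ε) τ(x - ε) / τ(x)² = W(x)`. -/
  ratio : τ.ratio.HasValue W

/-- The change of variables `p_{i+1} = (i + 1) t_i`: it turns a series in `p` into one in `t`. -/
def toTodaTimes (f : Ser U) : Ser U :=
  MvPowerSeries.rescale (fun i : ℕ => ((i : Coef U) + 1)) f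

/-! ## The dessin free energy -/

/-- The connected correlator `⟨τ_{μ_1} ⋯ τ_{μ_m}⟩(u, v, ε)`, the sum of
`N_{k,l}(μ) u^k v^l ε^{2g-2}` over `g ≥ 0` and `k, l ≥ 1` with `2g + k + l = |μ| - m + 2`. -/
def correlator {m : ℕ} (u v : Hol U) (μ : Fin m → ℕ) : Coef U :=
  ∑ᶠ s : {s : ℕ × ℕ × ℕ // 1 ≤ s.2.1 ∧ 1 ≤ s.2.2 ∧ 2 * s.1 + s.2.1 + s.2.2 + m = (∑ j, μ j) + 2},
    HahnSeries.single (2 * (s.1.1 : ℤ) - 2)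
      ((dessinCount s.1.2.1 s.1.2.2 μ : ℂ) • (u ^ s.1.2.1 * v ^ s.1.2.2))

/-- The dessin free energy
`∑_{m ≥ 1} ∑_{μ_1, …, μ_m ≥ 1} ⟨τ_{μ_1} ⋯ τ_{μ_m}⟩(u, v, ε) p_{μ_1} ⋯ p_{μ_m} / m!`.  The
coefficient of a monomial `n` of degree `m ≥ 1` collects the tuples `μ_j = ν_j + 1` whose monomial
is `n`. -/
def dessinFreeEnergy (u v : Hol U) : Ser U := fun n =>
  if n.degree = 0 then 0
  else ((n.degree.factorial : ℂ)⁻¹) •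
    ∑ᶠ ν : {ν : Fin n.degree → ℕ // ∑ j, Finsupp.single (ν j) 1 = n},
      correlator u v fun j => ν.1 j + 1

end Operations

/-! ## The corrected dessin partition function -/

/-- The set of `x` such that neither `x` nor `x + a` lies on the half-line `(-∞, 0]`; the principal
logarithms of `x` and `x + a` are holomorphic there. -/
def dom (a : ℂ) : Opens ℂ where
  carrier := {x | x ∈ Complex.slitPlane ∧ x + a ∈ Complex.slitPlane}
  is_open' := Complex.isOpen_slitPlane.inter
    (Complex.isOpen_slitPlane.preimage (continuous_id.add continuous_const))

variable (a : ℂ)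

/-- The function `x`. -/
def xFun : Hol (dom a) := Hol.ofFun (fun x => x) differentiableOn_id

/-- The constant function `c`. -/
def constFun (c : ℂ) : Hol (dom a) := algebraMap ℂ (Hol (dom a)) c

/-- The function `log x`. -/
def logX : Hol (dom a) :=
  Hol.ofFun (fun x => Complex.log x) (differentiableOn_id.clog fun _ hx => hx.1)

/-- The function `log (x + a)`. -/
def logXa : Hol (dom a) :=
  Hol.ofFun (fun x => Complex.log (x + a))
    ((differentiableOn_id.add_const a).clog fun _ hx => hx.2)

/-- The function `1 / x`. -/
def invX : Hol (dom a) :=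
  Hol.ofFun (fun x => x⁻¹) (differentiableOn_id.inv fun _ hx => Complex.slitPlane_ne_zero hx.1)

/-- The function `1 / (x + a)`. -/
def invXa : Hol (dom a) :=
  Hol.ofFun (fun x => (x + a)⁻¹)
    ((differentiableOn_id.add_const a).inv fun _ hx => Complex.slitPlane_ne_zero hx.2)

/-- The coefficient of `ε^{-2}` in the correction term:
`(x²/2) log x + ((x+a)²/2) log (x+a) - (a²/2) log a - (3/2) x (x+a)`. -/
def correctionZero : Hol (dom a) :=
  (1 / 2 : ℂ) • (xFun a ^ 2 * logX a) +
    (1 / 2 : ℂ) • ((xFun a + constFun a a) ^ 2 * logXa a) -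
    constFun a (a ^ 2 / 2 * Complex.log a) -
    (3 / 2 : ℂ) • (xFun a * (xFun a + constFun a a))

/-- The coefficient of `ε^0` in the correction term:
`-(1/12) (log x + log (x+a) - log a) + ζ'(-1)`. -/
def correctionOne : Hol (dom a) :=
  -((1 / 12 : ℂ) • (logX a + logXa a - constFun a (Complex.log a))) +
    constFun a (deriv riemannZeta (-1))

/-- The coefficient of `ε^{2g-2}`, `g ≥ 2`, in the correction term:
`B_{2g} / (4g(g-1)) (x^{2-2g} + (x+a)^{2-2g} - a^{2-2g})`. -/
def correctionHigher (g : ℕ) : Hol (dom a) :=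
  ((bernoulli (2 * g) : ℂ) / (4 * (g : ℂ) * ((g : ℂ) - 1))) •
    (invX a ^ (2 * g - 2) + invXa a ^ (2 * g - 2) - constFun a (a⁻¹ ^ (2 * g - 2)))

/-- The logarithm of the correction factor. -/
def correction : Coef (dom a) :=
  HahnSeries.single (-2) (correctionZero a) + HahnSeries.single 0 (correctionOne a) +
    HahnSeries.ofPowerSeries ℤ (Hol (dom a)) (PowerSeries.mk fun n =>
      if Even n ∧ 2 ≤ n then correctionHigher a (n / 2 + 1) else 0)

/-- The corrected dessin partition function `Z(x, p; a; ε)`: the product of the correction factor and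
of the dessin partition function `Z_dessins(u, v, p; ε) = exp F_dessins(u, v, p; ε)` at `u = x`,
`v = x + a`. -/
def correctedZ : FormalExp (dom a) :=
  FormalExp.exp (MvPowerSeries.C (correction a)) *
    FormalExp.exp (dessinFreeEnergy (xFun a) (xFun a + constFun a a))

/-- `V(x, p; ε) = ε (Λ - 1) ∂ log Z / ∂p_1`. -/
def dessinV : Ser (dom a) :=
  MvPowerSeries.C (eps (dom a)) *
    (Ser.shift 1 (Ser.d 0 (correctedZ a).log) - Ser.d 0 (correctedZ a).log)

end DessinToda

end

/-!
The dessin partition function is a tau-function of the Toda lattice because, at the lattice points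
`x = n ε`, it is a matrix integral, and matrix integrals are governed by orthogonal polynomials.

*From dessins to a matrix integral.* The free energy is the generating series of the pairs of
permutations that generate a transitive group (`coeff_dessinFreeEnergy`): the automorphism weights
turn isomorphism classes into labelled structures, the labels of the poles cancel `m!`, and the
exponent of `ε` is fixed by the Riemann–Hurwitz relation (`exists_genus`). By the exponential
formula (`mvExp_transSeries`), its exponential counts all pairs of permutations, that is, all
factorizations `f = w b`, with weight `U` for each cycle of `w` and `V` for each cycle of `b`. For
`U = n` and `V = n + a / ε` the weighted number of factorizations of `f` is the average of the
product of the power sums belonging to the cycles of `f` over the Laguerre ensemble of `n` points,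
that is, the average against the squared Vandermonde determinant and the weight
`y ^ (a / ε) exp (- y / ε)`. This Wick formula (`laguerreAvg_cycProd`) holds because both sides
satisfy the same recursion: removing a point from a factorization on one side, the Virasoro
constraints on the other. All integrals are linear functionals given by their moments
`∏ (a + i ε)`, so no analysis is involved.

*Orthogonal polynomials.* Insert the times into the weight. The average of the squared Vandermonde
determinant is `n!` times the product of the norms of the first `n` orthogonal polynomials. Hence
the exponential of the free energy at `x = n ε` is such a product, divided by its value at time `0`
(`prod_orthNorm_timeFun`). The differences in `n` and the derivatives in the times of its logarithm
are therefore expressed by matrix elements of multiplication by powers of the variable in the basis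
of orthogonal polynomials. In particular `V` and `W` are the coefficients of the three term
recurrence, and the powers of the Lax operator evaluate to these matrix elements
(`serEval_laxCoeff`). The deformation of the orthogonal polynomials gives the derivatives, and the
Christoffel–Darboux formula gives the two-point functions (`orthTwo_second_difference`).

*From lattice points to functions of `x`.* All coefficients are polynomials in `x` over the Laurent
series in `ε`, and a polynomial identity that holds at `x = n ε` for all large `n` holds
identically (`ser_ext`). This proves the Toda equations (`serD_polyLax`), the equations of the
basic matrix resolvent and its two-point functions (`polyR_eq`, `polyR_det`,
`polyPair_eq_twoPoint`) over polynomials. Substituting the function `x`, which intertwines the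
shift `x ↦ x + ε` of polynomials with the formal Taylor shift (`shift_holHom`), carries them over
to holomorphic coefficients, where the polynomial series becomes the dessin free energy
(`dessinFreeEnergy_eq`).

*Correction and uniqueness.* The correction factor does not depend on the times and drops out
except in `W`, where its second difference `log x + log (x + a)` supplies the initial value
`x (x + a)` (`shift_correction`); this amounts to the identity
`(B - X B') (exp X + exp (-X) - 2) = X ^ 2` for the Bernoulli series `B = X / (exp X - 1)`.
Uniqueness holds since the Toda equations express the derivatives of `V` and `W`, hence their
coefficients of degree `N + 1`, through their coefficients of degree at most `N`
(`eq_of_isTodaSolution`).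
-/


noncomputable section

namespace DessinToda

/-! ### Blocks of an equivalence relation on a finite type -/

section Blocks

open Finset Equiv Classical

variable {E E' : Type*} [Fintype E] [Fintype E'] {R : Type*} [CommRing R]

/-- The equivalence class of `x`, as a finite set. -/
def blk (r : Setoid E) (x : E) : Finset E := {y | r x y}

/-- The set of equivalence classes. -/
def blks (r : Setoid E) : Finset (Finset E) := univ.image (blk r)

/-- The product over the equivalence classes of a weight that depends on their size. -/
def blkProd (r : Setoid E) (q : ℕ → R) : R := ∏ s ∈ blks r, q s.card

/-- The equivalence classes other than that of `x`. -/
def restBlks (r : Setoid E) (x : E) : Finset (Finset E) := (blks r).erase (blk r x)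

/-- A set of sets with one of them left out.  As a definition it fixes one decidability instance, so
that it can be rewritten in contexts with another one. -/
def eraseBlk (A : Finset (Finset E)) (s : Finset E) : Finset (Finset E) := A.erase s

/-- The equivalence classes other than those of `x` and `y`. -/
def restBlks₂ (r : Setoid E) (x y : E) : Finset (Finset E) := eraseBlk (restBlks r x) (blk r y)

/-- `r'` is obtained from `r` by uniting the classes of `x` and `y`. -/
def IsMerge (r r' : Setoid E) (x y : E) : Prop :=
  ∀ a b, r' a b ↔ r a b ∨ ((r x a ∨ r y a) ∧ (r x b ∨ r y b))

theorem mem_blk {r : Setoid E} {x y : E} : y ∈ blk r x ↔ r x y := by simp [blk]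

theorem self_mem_blk (r : Setoid E) (x : E) : x ∈ blk r x := mem_blk.2 (r.refl x)

theorem blk_eq_iff {r : Setoid E} {x y : E} : blk r x = blk r y ↔ r x y := by
  constructor
  · intro h
    exact mem_blk.1 (h ▸ self_mem_blk r y)
  · intro h
    ext z
    rw [mem_blk, mem_blk]
    exact ⟨fun h' => r.trans (r.symm h) h', fun h' => r.trans h h'⟩

theorem blk_mem_blks (r : Setoid E) (x : E) : blk r x ∈ blks r := mem_image_of_mem _ (mem_univ x)

theorem mem_blks {r : Setoid E} {s : Finset E} : s ∈ blks r ↔ ∃ x, blk r x = s := by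
  simp [blks]

theorem mem_restBlks {r : Setoid E} {x : E} {s : Finset E} :
    s ∈ restBlks r x ↔ s ≠ blk r x ∧ s ∈ blks r := mem_erase

omit [Fintype E] in
theorem eraseBlk_eq [DecidableEq (Finset E)] (A : Finset (Finset E)) (s : Finset E) :
    eraseBlk A s = A.erase s := by
  ext t
  simp [eraseBlk]

theorem card_blks (r : Setoid E) : (blks r).card = Nat.card (Quotient r) := by
  rw [← Fintype.card_coe, ← Nat.card_eq_fintype_card]
  refine (Nat.card_congr (Equiv.ofBijective
    (Quotient.lift (fun x => (⟨blk r x, blk_mem_blks r x⟩ : blks r))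
      fun x y h => Subtype.ext (blk_eq_iff.2 h)) ⟨?_, ?_⟩)).symm
  · rintro ⟨x⟩ ⟨y⟩ h
    exact Quotient.sound (blk_eq_iff.1 (Subtype.ext_iff.1 h))
  · rintro ⟨s, hs⟩
    obtain ⟨x, -, rfl⟩ := mem_image.1 hs
    exact ⟨Quotient.mk _ x, rfl⟩

theorem blkProd_const (r : Setoid E) (t : R) :
    blkProd r (fun _ => t) = t ^ Nat.card (Quotient r) := by
  rw [blkProd, prod_const, card_blks]

theorem blkProd_erase (r : Setoid E) (x : E) (q : ℕ → R) :
    blkProd r q = q (blk r x).card * ∏ s ∈ restBlks r x, q s.card :=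
  (mul_prod_erase _ _ (blk_mem_blks r x)).symm

theorem map_blkProd {R' : Type*} [CommRing R'] (φ : R →+* R') (r : Setoid E) (q : ℕ → R) :
    φ (blkProd r q) = blkProd r (fun n => φ (q n)) := by simp [blkProd]

theorem card_blk_pos (r : Setoid E) (x : E) : 0 < (blk r x).card :=
  card_pos.2 ⟨x, self_mem_blk r x⟩

theorem sum_card_blks (r : Setoid E) : ∑ s ∈ blks r, s.card = Fintype.card E := by
  rw [← card_univ, card_eq_sum_card_fiberwise (f := blk r) (t := blks r)
    (fun x _ => blk_mem_blks r x)]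
  refine sum_congr rfl fun s hs => ?_
  obtain ⟨x, -, rfl⟩ := mem_image.1 hs
  congr 1
  ext y
  simp [mem_blk, blk_eq_iff, r.comm']

theorem blkProd_equiv {r : Setoid E} {r' : Setoid E'} (e : E ≃ E')
    (h : ∀ a b, r' (e a) (e b) ↔ r a b) (q : ℕ → R) : blkProd r' q = blkProd r q := by
  have hb : ∀ x, blk r' (e x) = (blk r x).map e.toEmbedding := by
    intro x
    ext z
    obtain ⟨y, rfl⟩ := e.surjective z
    simp [mem_blk, h]
  have : blks r' = (blks r).image (fun s => s.map e.toEmbedding) := by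
    ext s
    simp only [blks, mem_image, mem_univ, true_and]
    constructor
    · rintro ⟨z, rfl⟩
      obtain ⟨y, rfl⟩ := e.surjective z
      exact ⟨_, ⟨y, rfl⟩, (hb y).symm⟩
    · rintro ⟨_, ⟨y, rfl⟩, rfl⟩
      exact ⟨e y, hb y⟩
  rw [blkProd, this, prod_image (fun s _ t _ hst => map_injective _ hst)]
  simp [blkProd]

section Merge

variable {r r' : Setoid E} {x y : E}

theorem IsMerge.blk_left (hm : IsMerge r r' x y) : blk r' x = blk r x ∪ blk r y := by
  ext z
  simp only [mem_blk, mem_union, hm x z, r.refl x, true_or, true_and]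
  tauto

theorem disjoint_blk (hxy : ¬ r x y) : Disjoint (blk r x) (blk r y) := by
  rw [Finset.disjoint_left]
  intro z hx hy
  exact hxy (r.trans (mem_blk.1 hx) (r.symm (mem_blk.1 hy)))

theorem IsMerge.card_blk_left (hm : IsMerge r r' x y) (hxy : ¬ r x y) :
    (blk r' x).card = (blk r x).card + (blk r y).card := by
  rw [hm.blk_left, card_union_of_disjoint (disjoint_blk hxy)]

theorem IsMerge.blk_of_not (hm : IsMerge r r' x y) {z : E} (hx : ¬ r x z) (hy : ¬ r y z) :
    blk r' z = blk r z := by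
  ext w
  simp [mem_blk, hm z w, hx, hy]

/-- The classes that are not involved in the merging stay the same. -/
theorem IsMerge.erase_eq (hm : IsMerge r r' x y) :
    restBlks r' x = restBlks₂ r x y := by
  ext s
  simp only [restBlks₂, eraseBlk, restBlks, mem_erase, blks, mem_image, mem_univ, true_and]
  constructor
  · rintro ⟨hs, z, rfl⟩
    have hz : ¬ r' x z := fun h => hs (blk_eq_iff.2 (r'.symm h))
    rw [hm x z] at hz
    simp only [r.refl x, true_or, true_and, not_or] at hz
    rw [hm.blk_of_not hz.2.1 hz.2.2]
    exact ⟨fun h => hz.2.2 (r.symm (blk_eq_iff.1 h)), fun h => hz.2.1 (r.symm (blk_eq_iff.1 h)),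
      z, rfl⟩
  · rintro ⟨hy, hx, z, rfl⟩
    have hx' : ¬ r x z := fun h => hx (blk_eq_iff.2 (r.symm h))
    have hy' : ¬ r y z := fun h => hy (blk_eq_iff.2 (r.symm h))
    refine ⟨fun h => ?_, z, hm.blk_of_not hx' hy'⟩
    have h1 : x ∈ blk r z := h ▸ self_mem_blk r' x
    exact hx' (r.symm (mem_blk.1 h1))

theorem blkProd_erase₂ (hxy : ¬ r x y) (q : ℕ → R) :
    blkProd r q = q (blk r x).card * q (blk r y).card *
      ∏ s ∈ restBlks₂ r x y, q s.card := by
  rw [blkProd_erase r x, restBlks₂, eraseBlk, mul_assoc,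
    mul_prod_erase (restBlks r x) (fun s : Finset E => q s.card)
    (mem_erase.2 ⟨fun h => hxy (r.symm (blk_eq_iff.1 h)), blk_mem_blks r y⟩)]

/-- Uniting two classes of sizes `k` and `l` replaces the weights `q k` and `q l` by `q (k + l)`. -/
theorem IsMerge.blkProd (hm : IsMerge r r' x y) (hxy : ¬ r x y) (q : ℕ → R) :
    blkProd r' q * (q (blk r x).card * q (blk r y).card) =
      blkProd r q * q ((blk r x).card + (blk r y).card) := by
  rw [blkProd_erase r' x, hm.erase_eq, hm.card_blk_left hxy, blkProd_erase₂ hxy]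
  ring

theorem IsMerge.card_quotient (hm : IsMerge r r' x y) (hxy : ¬ r x y) :
    Nat.card (Quotient r') + 1 = Nat.card (Quotient r) := by
  rw [← card_blks, ← card_blks, ← card_erase_add_one (blk_mem_blks r' x),
    ← card_erase_add_one (blk_mem_blks r x)]
  change (restBlks r' x).card + 1 + 1 = (restBlks r x).card + 1
  rw [hm.erase_eq, restBlks₂, eraseBlk, card_erase_add_one]
  exact mem_erase.2 ⟨fun h => hxy (r.symm (blk_eq_iff.1 h)), blk_mem_blks r y⟩

end Merge

end Blocks

/-! ### Cycles of permutations and transpositions -/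

section Cycles

open Equiv Finset

variable {E E' : Type*}

/-- The partition of a type into the cycles of a permutation. -/
abbrev cycSetoid (f : Perm E) : Setoid E := Perm.SameCycle.setoid f

theorem cycSetoid_apply (f : Perm E) (a b : E) : cycSetoid f a b ↔ f.SameCycle a b := Iff.rfl

theorem cycSetoid_inv (f : Perm E) : cycSetoid f⁻¹ = cycSetoid f := by
  ext a b
  exact Perm.sameCycle_inv

/-- The cycles are the classes of the finest equivalence relation that relates `x` and `f x`. -/
theorem sameCycle_le {f : Perm E} {r : Setoid E} (h : ∀ x, r x (f x)) {a b : E}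
    (hab : f.SameCycle a b) : r a b := by
  obtain ⟨n, rfl⟩ := hab
  have hp : ∀ (n : ℕ) x, r x ((f ^ n) x) := by
    intro n
    induction n with
    | zero => intro x; simp
    | succ n ih =>
      intro x
      rw [pow_succ', Perm.mul_apply]
      exact r.trans (ih x) (h _)
  obtain ⟨n, rfl | rfl⟩ := n.eq_nat_or_neg
  · exact_mod_cast hp n a
  · have := hp n ((f ^ (-(n : ℤ))) a)
    rw [← Perm.mul_apply, ← zpow_natCast, ← zpow_add] at this
    simp only [add_neg_cancel, zpow_zero, Perm.coe_one, id_eq] at this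
    exact r.symm this

theorem cycSetoid_equiv (e : E ≃ E') (f : Perm E) (a b : E) :
    cycSetoid (e.permCongr f) (e a) (e b) ↔ cycSetoid f a b := by
  have h : ∀ (n : ℤ), ((e.permCongr f) ^ n) (e a) = e ((f ^ n) a) := by
    intro n
    have : (e.permCongr f) ^ n = e.permCongr (f ^ n) := (map_zpow e.permCongrHom f n).symm
    rw [this]
    simp
  constructor
  · rintro ⟨n, hn⟩
    exact ⟨n, e.injective (by rw [← h, hn])⟩
  · rintro ⟨n, hn⟩
    exact ⟨n, by rw [h, hn]⟩

variable [Fintype E] [DecidableEq E]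

/-- If `x` and `y` lie on different cycles of `f`, then they lie on the same cycle of
`f * swap x y`. -/
theorem sameCycle_mul_swap {f : Perm E} {x y : E} (hxy : ¬ f.SameCycle x y) :
    (f * swap x y).SameCycle x y := by
  set g := f * swap x y with hg
  -- The orbit of `y` under `g` follows the orbit of `x` under `f` until that returns to `x`.
  by_contra hcon
  have hgz : ∀ z, z ≠ x → z ≠ y → g z = f z := fun z h1 h2 => by
    simp [hg, swap_apply_of_ne_of_ne h1 h2]
  have key : ∀ n : ℕ, g.SameCycle y ((f ^ (n + 1)) x) := by
    intro n
    induction n with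
    | zero =>
      have : g y = (f ^ (0 + 1)) x := by simp [hg]
      rw [← this]
      exact Perm.sameCycle_apply_right.2 (Perm.SameCycle.refl _ _)
    | succ n ih =>
      set z := (f ^ (n + 1)) x with hz
      have hzx : z ≠ x := fun h => hcon (h ▸ ih).symm
      have hzy : z ≠ y := fun h => hxy ⟨(n + 1 : ℕ), by rw [zpow_natCast, ← hz, h]⟩
      have : (f ^ (n + 1 + 1)) x = g z := by
        rw [hgz z hzx hzy, pow_succ', Perm.mul_apply]
      rw [this]
      exact Perm.sameCycle_apply_right.2 ih
  have h1 := key (orderOf f - 1)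
  rw [Nat.sub_add_cancel (orderOf_pos f), pow_orderOf_eq_one] at h1
  exact hcon h1.symm

/-- Multiplication by a transposition of two points on different cycles unites these cycles. -/
theorem isMerge_mul_swap {f : Perm E} {x y : E} (hxy : ¬ f.SameCycle x y) :
    IsMerge (cycSetoid f) (cycSetoid (f * swap x y)) x y := by
  have hs := sameCycle_mul_swap hxy
  set g := f * swap x y with hg
  have hgz : ∀ z, z ≠ x → z ≠ y → g z = f z := fun z h1 h2 => by
    simp [hg, swap_apply_of_ne_of_ne h1 h2]
  have hgx : g x = f y := by simp [hg]
  have hgy : g y = f x := by simp [hg]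
  have hle : ∀ a b, f.SameCycle a b → g.SameCycle a b := by
    intro a b hab
    refine sameCycle_le (r := cycSetoid g) (fun z => ?_) hab
    change g.SameCycle z (f z)
    by_cases h1 : z = x
    · rw [h1, ← hgy]
      exact Perm.sameCycle_apply_right.2 hs
    by_cases h2 : z = y
    · rw [h2, ← hgx]
      exact Perm.sameCycle_apply_right.2 hs.symm
    rw [← hgz z h1 h2]
    exact Perm.sameCycle_apply_right.2 (Perm.SameCycle.refl _ _)
  intro a b
  constructor
  · intro hab
    -- The relation that merges the two cycles of `f` relates `z` to `g z`, hence contains the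
    -- cycles of `g`.
    let r : Setoid E :=
      { r := fun a b => f.SameCycle a b ∨
          ((f.SameCycle x a ∨ f.SameCycle y a) ∧ (f.SameCycle x b ∨ f.SameCycle y b))
        iseqv :=
          { refl := fun a => Or.inl (Perm.SameCycle.refl _ _)
            symm := by
              rintro a b (h | ⟨h1, h2⟩)
              · exact Or.inl h.symm
              · exact Or.inr ⟨h2, h1⟩
            trans := by
              rintro a b c (h | ⟨h1, h2⟩) (h' | ⟨h1', h2'⟩)
              · exact Or.inl (h.trans h')
              · exact Or.inr ⟨h1'.imp (fun t => t.trans h.symm) (fun t => t.trans h.symm), h2'⟩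
              · exact Or.inr ⟨h1, h2.imp (fun t => t.trans h') (fun t => t.trans h')⟩
              · exact Or.inr ⟨h1, h2'⟩ } }
    refine sameCycle_le (r := r) (fun z => ?_) hab
    change f.SameCycle z (g z) ∨
      ((f.SameCycle x z ∨ f.SameCycle y z) ∧ (f.SameCycle x (g z) ∨ f.SameCycle y (g z)))
    by_cases h1 : z = x
    · subst h1
      rw [hgx]
      exact Or.inr ⟨Or.inl (Perm.SameCycle.refl _ _),
        Or.inr (Perm.sameCycle_apply_right.2 (Perm.SameCycle.refl _ _))⟩
    by_cases h2 : z = y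
    · subst h2
      rw [hgy]
      exact Or.inr ⟨Or.inr (Perm.SameCycle.refl _ _),
        Or.inl (Perm.sameCycle_apply_right.2 (Perm.SameCycle.refl _ _))⟩
    rw [hgz z h1 h2]
    exact Or.inl (Perm.sameCycle_apply_right.2 (Perm.SameCycle.refl _ _))
  · have hx : ∀ c, (f.SameCycle x c ∨ f.SameCycle y c) → g.SameCycle x c := by
      rintro c (h | h)
      · exact hle _ _ h
      · exact hs.trans (hle _ _ h)
    rintro (h | ⟨h1, h2⟩)
    · exact hle _ _ h
    · exact (hx a h1).symm.trans (hx b h2)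

end Cycles

/-! ### Removing a point from a permutation -/

section RemovePoint

open Equiv Finset

variable {E : Type*} [Fintype E] {R : Type*} [CommRing R]

/-- The number of cycles. -/
abbrev cycCount {E : Type*} (f : Perm E) : ℕ := Nat.card (Quotient (cycSetoid f))

/-- The product of the weights `q (length)` over the cycles. -/
abbrev cycProd (f : Perm E) (q : ℕ → R) : R := blkProd (cycSetoid f) q

theorem cycCount_inv {E : Type*} (f : Perm E) : cycCount f⁻¹ = cycCount f := by
  rw [cycCount, cycSetoid_inv]

theorem optionCongr_mul {E : Type*} (f g : Perm E) :
    (optionCongr (f * g) : Perm (Option E)) = optionCongr f * optionCongr g := by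
  ext1 x
  cases x <;> simp [Perm.mul_def]

theorem optionCongr_inv {E : Type*} (f : Perm E) :
    (optionCongr f⁻¹ : Perm (Option E)) = (optionCongr f)⁻¹ := by
  rw [eq_inv_iff_mul_eq_one, ← optionCongr_mul]
  simp

theorem sameCycle_optionCongr_some {E : Type*} {f : Perm E} {a b : E} :
    Perm.SameCycle (optionCongr f) (some a) (some b) ↔ f.SameCycle a b := by
  have h : ∀ n : ℤ, ((optionCongr f : Perm (Option E)) ^ n) (some a) = some ((f ^ n) a) := by
    intro n
    let φ : Perm E →* Perm (Option E) := MonoidHom.mk' (fun f => optionCongr f) optionCongr_mul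
    have : (optionCongr f : Perm (Option E)) ^ n = optionCongr (f ^ n) := (map_zpow φ f n).symm
    rw [this]
    rfl
  simp [Perm.SameCycle, h]

theorem sameCycle_of_fixed {E : Type*} {f : Perm E} {a b : E} (ha : f a = a) :
    f.SameCycle a b ↔ a = b := by
  constructor
  · intro h
    exact h.eq_of_left ha
  · rintro rfl
    exact Perm.SameCycle.refl _ _

theorem blk_of_fixed {f : Perm E} {a : E} (ha : f a = a) : blk (cycSetoid f) a = {a} := by
  ext b
  rw [mem_blk, mem_singleton, cycSetoid_apply, sameCycle_of_fixed ha, eq_comm]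

theorem blk_optionCongr_some (f : Perm E) (a : E) :
    blk (cycSetoid (optionCongr f)) (some a) =
      (blk (cycSetoid f) a).map Function.Embedding.some := by
  ext b
  rw [mem_blk, cycSetoid_apply]
  cases b with
  | none =>
    simp only [mem_map, Function.Embedding.some_apply, reduceCtorEq, and_false, exists_false,
      iff_false]
    intro h
    have := (sameCycle_of_fixed (f := optionCongr f) (a := none) (by simp)).1 h.symm
    simp at this
  | some b => simp [sameCycle_optionCongr_some, mem_blk, cycSetoid_apply]

/-- Adding a fixed point adds a cycle of length `1`. -/
theorem cycProd_optionCongr (f : Perm E) (q : ℕ → R) :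
    cycProd (optionCongr f) q = q 1 * cycProd f q := by
  classical
  have hb : blks (cycSetoid (optionCongr f)) =
      insert {none} ((blks (cycSetoid f)).image (fun s => s.map Function.Embedding.some)) := by
    ext s
    simp only [blks, mem_image, mem_univ, true_and, mem_insert]
    constructor
    · rintro ⟨x, rfl⟩
      cases x with
      | none => exact Or.inl (blk_of_fixed (by simp))
      | some x => exact Or.inr ⟨_, ⟨x, rfl⟩, (blk_optionCongr_some f x).symm⟩
    · rintro (rfl | ⟨_, ⟨x, rfl⟩, rfl⟩)
      · exact ⟨none, blk_of_fixed (by simp)⟩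
      · exact ⟨some x, blk_optionCongr_some f x⟩
  rw [cycProd, blkProd]
  have hb' : ∏ s ∈ blks (cycSetoid (optionCongr f)), q s.card = ∏ s ∈ insert {none}
      ((blks (cycSetoid f)).image (fun s => s.map Function.Embedding.some)), q s.card := by
    rw [hb]
  rw [hb', prod_insert, prod_image (fun s _ t _ hst => map_injective _ hst)]
  · simp [cycProd, blkProd]
  · simp only [mem_image, not_exists, not_and]
    intro s _ h
    have : none ∈ s.map Function.Embedding.some := h ▸ mem_singleton_self _
    simp at this

/-- A relation between cycle products yields one between the numbers of cycles, by taking every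
weight equal to `2`. -/
theorem cycCount_eq_iff_const {E' : Type*} [Fintype E'] {f : Perm E} {g : Perm E'} {n : ℕ}
    (h : cycProd f (fun _ => (2 : ℤ)) = 2 ^ n * cycProd g (fun _ => (2 : ℤ))) :
    cycCount f = n + cycCount g := by
  rw [cycProd, cycProd, blkProd_const, blkProd_const, ← pow_add] at h
  exact_mod_cast Int.pow_right_injective (by norm_num) h

theorem cycCount_optionCongr (f : Perm E) : cycCount (optionCongr f) = cycCount f + 1 := by
  rw [add_comm]
  exact cycCount_eq_iff_const (by rw [cycProd_optionCongr, pow_one])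

variable [DecidableEq E]

omit [Fintype E] in
theorem swap_mul_optionCongr_removeNone (f : Perm (Option E)) :
    swap none (f none) * optionCongr (removeNone f) = f :=
  Perm.decomposeOption.symm_apply_apply f

theorem isMerge_optionCongr_mul_swap {g : Perm E} {j : Option E} (hj : j ≠ none) :
    IsMerge (cycSetoid (optionCongr g)) (cycSetoid (optionCongr g * swap none j)) none j ∧
      ¬ Perm.SameCycle (optionCongr g) none j := by
  have : ¬ Perm.SameCycle (optionCongr g) none j := by
    rw [sameCycle_of_fixed (f := optionCongr g) (by simp)]
    exact fun h => hj h.symm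
  exact ⟨isMerge_mul_swap this, this⟩

theorem cycCount_optionCongr_mul_swap (g : Perm E) (j : Option E) :
    cycCount (optionCongr g * swap none j) = cycCount g + if j = none then 1 else 0 := by
  by_cases hj : j = none
  · subst hj
    rw [swap_self, ← Perm.one_def, mul_one, cycCount_optionCongr, if_pos rfl]
  · obtain ⟨h1, h2⟩ := isMerge_optionCongr_mul_swap (g := g) hj
    have := h1.card_quotient h2
    have h3 := cycCount_optionCongr g
    simp only [cycCount, hj, if_false] at *
    omega

theorem cycCount_swap_mul_optionCongr (g : Perm E) (i : Option E) :
    cycCount (swap none i * optionCongr g) = cycCount g + if i = none then 1 else 0 := by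
  rw [← cycCount_inv, mul_inv_rev, swap_inv, ← optionCongr_inv, cycCount_optionCongr_mul_swap,
    cycCount_inv]

/-- Removing a point that is not fixed shortens its cycle by one. -/
theorem cycProd_removeNone [IsDomain R] {q : ℕ → R} (hq : q 1 ≠ 0) (f : Perm (Option E))
    (hf : f none ≠ none) :
    cycProd f q * q ((blk (cycSetoid f) none).card - 1) =
      cycProd (removeNone f) q * q (blk (cycSetoid f) none).card := by
  set g := removeNone f with hg
  have hfg := swap_mul_optionCongr_removeNone f
  have hinv : f⁻¹ = optionCongr g⁻¹ * swap none (f none) := by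
    rw [← hfg, mul_inv_rev, swap_inv, optionCongr_inv, hfg]
  obtain ⟨hm, hn⟩ := isMerge_optionCongr_mul_swap (g := g⁻¹) hf
  rw [← hinv, cycSetoid_inv] at hm
  have h1 : (blk (cycSetoid (optionCongr g⁻¹)) none).card = 1 := by
    rw [blk_of_fixed (by simp), card_singleton]
  have h2 := hm.card_blk_left hn
  have h3 := hm.blkProd hn q
  have h4 := cycProd_optionCongr g⁻¹ q
  rw [cycProd, cycProd, cycSetoid_inv] at h4
  rw [← h2, h1, h4] at h3
  rw [h1] at h2
  have h5 : (blk (cycSetoid f) none).card - 1 =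
      (blk (cycSetoid (optionCongr g⁻¹)) (f none)).card := by omega
  rw [h5]
  refine mul_left_cancel₀ hq ?_
  linear_combination h3

theorem cycProd_removeNone_of_fixed (q : ℕ → R) (f : Perm (Option E)) (hf : f none = none) :
    cycProd f q = q 1 * cycProd (removeNone f) q := by
  rw [← cycProd_optionCongr]
  congr 2
  conv_lhs => rw [← swap_mul_optionCongr_removeNone f, hf, swap_self, ← Perm.one_def, one_mul]

/-- The permutation of `E` obtained from a permutation `f` of `Option E` by cutting `none` out of
its cycle and crossing the arcs that start at `j` and end at `none`. -/
def cutAt (f : Perm (Option E)) (j : Option E) : Perm E := removeNone (f * swap none j)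

omit [Fintype E] in
theorem cutAt_spec (f : Perm (Option E)) (j : Option E) :
    optionCongr (cutAt f j) * swap none j = swap none (f j) * f := by
  have h := swap_mul_optionCongr_removeNone (f * swap none j)
  have h0 : (f * swap none j) none = f j := by simp
  rw [h0] at h
  rw [cutAt, ← mul_left_inj (swap none j), mul_assoc, swap_mul_self, mul_one,
    ← mul_right_inj (swap none (f j)), h, mul_assoc, ← mul_assoc, swap_mul_self, one_mul]

/-- Joining: if `j` lies on another cycle than `none`, then `cutAt f j` unites the cycle of `j` with
what is left of the cycle of `none`.  The identity is multiplied by the weights of the two cycles,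
so that it involves no division. -/
theorem cycProd_cutAt_of_not_sameCycle [IsDomain R] {q : ℕ → R} (hq : ∀ n, 0 < n → q n ≠ 0)
    (f : Perm (Option E)) {j : Option E} (hj : ¬ f.SameCycle none j) :
    cycProd (cutAt f j) q *
        (q (blk (cycSetoid f) none).card * q (blk (cycSetoid f) j).card) =
      cycProd f q * q ((blk (cycSetoid f) none).card - 1 + (blk (cycSetoid f) j).card) := by
  have hm := isMerge_mul_swap hj
  have h1 := hm.blkProd hj q
  have h2 := hm.card_blk_left hj
  have hk := card_blk_pos (cycSetoid f) none
  have hl := card_blk_pos (cycSetoid f) j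
  have h3 := cycProd_removeNone (hq 1 one_pos) (f * swap none j) (fun h => hj (by
    have : f j = none := by simpa using h
    rw [← this]
    exact Perm.sameCycle_apply_left.2 (Perm.SameCycle.refl _ _)))
  rw [h2] at h3
  have h4 : (blk (cycSetoid f) none).card + (blk (cycSetoid f) j).card - 1 =
    (blk (cycSetoid f) none).card - 1 + (blk (cycSetoid f) j).card := by omega
  rw [h4] at h3
  refine mul_left_cancel₀ (hq ((blk (cycSetoid f) none).card + (blk (cycSetoid f) j).card)
    (by omega)) ?_
  rw [cutAt]
  rw [cycProd] at *
  linear_combination (-(q (blk (cycSetoid f) none).card * q (blk (cycSetoid f) j).card)) * h3 +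
    q ((blk (cycSetoid f) none).card - 1 + (blk (cycSetoid f) j).card) * h1

/-- The cycle of `x`, listed. -/
theorem card_blk_eq_minimalPeriod (f : Perm E) (x : E) :
    (blk (cycSetoid f) x).card = Function.minimalPeriod f x ∧
      blk (cycSetoid f) x = (range (Function.minimalPeriod f x)).image (fun r => (f ^ r) x) := by
  have hpos : 0 < Function.minimalPeriod f x := by
    refine Function.minimalPeriod_pos_of_mem_periodicPts ?_
    exact ⟨orderOf f, orderOf_pos f, by
      rw [Function.IsPeriodicPt, ← Perm.coe_pow, pow_orderOf_eq_one]; rfl⟩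
  have h2 : blk (cycSetoid f) x =
      (range (Function.minimalPeriod f x)).image (fun r => (f ^ r) x) := by
    ext y
    rw [mem_blk, cycSetoid_apply, mem_image]
    constructor
    · intro h
      obtain ⟨n, rfl⟩ := h.exists_nat_pow_eq
      refine ⟨n % Function.minimalPeriod f x, mem_range.2 (Nat.mod_lt _ hpos), ?_⟩
      rw [Perm.coe_pow, Perm.coe_pow, Function.iterate_mod_minimalPeriod_eq]
    · rintro ⟨r, -, rfl⟩
      exact ⟨r, by simp⟩
  refine ⟨?_, h2⟩
  rw [h2, card_image_of_injOn, card_range]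
  intro a ha b hb hab
  simp only [Perm.coe_pow] at hab
  exact Function.iterate_injOn_Iio_minimalPeriod (by simpa using ha) (by simpa using hb) hab

/-- Multiplication by a transposition of `x` and `f ^ r x` cuts an orbit of size `r` out of the
cycle of `x`. -/
theorem blk_mul_swap_pow (f : Perm E) (x : E) {r : ℕ} (h0 : 0 < r)
    (hr : r < (blk (cycSetoid f) x).card) :
    (blk (cycSetoid (f * swap x ((f ^ r) x))) ((f ^ r) x)).card = r ∧
      ¬ (f * swap x ((f ^ r) x)).SameCycle x ((f ^ r) x) := by
  rw [(card_blk_eq_minimalPeriod f x).1] at hr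
  have hinj : ∀ a b, a < Function.minimalPeriod f x → b < Function.minimalPeriod f x →
      (f ^ a) x = (f ^ b) x → a = b := by
    intro a b ha hb hab
    simp only [Perm.coe_pow] at hab
    exact Function.iterate_injOn_Iio_minimalPeriod ha hb hab
  set y := (f ^ r) x with hy
  set g := f * swap x y with hg
  have hgy : g y = (f ^ 1) x := by simp [hg]
  have hgs : ∀ s, 0 < s → s < r → g ((f ^ s) x) = (f ^ (s + 1)) x := by
    intro s hs hsr
    have h1 : (f ^ s) x ≠ x := fun h => by
      have := hinj s 0 (by omega) (by omega) (by simpa using h)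
      omega
    have h2 : (f ^ s) x ≠ y := fun h => by
      have := hinj s r (by omega) (by omega) h
      omega
    rw [hg, Perm.mul_apply, swap_apply_of_ne_of_ne h1 h2, pow_succ', Perm.mul_apply]
  -- The orbit of `y = f ^ r x` under `g` consists of `f x, …, f ^ r x`.
  have hreach : ∀ s, s < r → g.SameCycle y ((f ^ (s + 1)) x) := by
    intro s
    induction s with
    | zero =>
      intro _
      rw [zero_add, ← hgy]
      exact Perm.sameCycle_apply_right.2 (Perm.SameCycle.refl _ _)
    | succ s ih =>
      intro hs
      rw [← hgs (s + 1) (by omega) (by omega)]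
      exact Perm.sameCycle_apply_right.2 (ih (by omega))
  have hclosed : ∀ n : ℕ, ∃ s, 0 < s ∧ s ≤ r ∧ (g ^ n) y = (f ^ s) x := by
    intro n
    induction n with
    | zero => exact ⟨r, h0, le_rfl, by simp [hy]⟩
    | succ n ih =>
      obtain ⟨s, h1, h2, h3⟩ := ih
      rw [pow_succ', Perm.mul_apply, h3]
      rcases h2.lt_or_eq with h | rfl
      · exact ⟨s + 1, by omega, by omega, hgs s h1 h⟩
      · exact ⟨1, by omega, by omega, hgy⟩
  have hmem : ∀ z, g.SameCycle y z ↔ ∃ s, 0 < s ∧ s ≤ r ∧ z = (f ^ s) x := by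
    intro z
    constructor
    · intro h
      obtain ⟨n, rfl⟩ := h.exists_nat_pow_eq
      exact hclosed n
    · rintro ⟨s, h1, h2, rfl⟩
      obtain ⟨s, rfl⟩ : ∃ t, s = t + 1 := ⟨s - 1, by omega⟩
      exact hreach s (by omega)
  constructor
  · have : blk (cycSetoid g) y = (Ioc 0 r).image (fun s => (f ^ s) x) := by
      ext z
      rw [mem_blk, cycSetoid_apply, hmem, mem_image]
      constructor
      · rintro ⟨s, h1, h2, rfl⟩
        exact ⟨s, mem_Ioc.2 ⟨h1, h2⟩, rfl⟩
      · rintro ⟨s, h1, rfl⟩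
        exact ⟨s, (mem_Ioc.1 h1).1, (mem_Ioc.1 h1).2, rfl⟩
    rw [this, card_image_of_injOn, Nat.card_Ioc, Nat.sub_zero]
    intro a ha b hb hab
    simp only [coe_Ioc, Set.mem_Ioc] at ha hb
    exact hinj a b (by omega) (by omega) hab
  · intro h
    obtain ⟨s, h1, h2, h3⟩ := (hmem x).1 h.symm
    have := hinj 0 s (by omega) (by omega) (by simpa using h3)
    omega

/-- Cutting: if `j = f ^ r none`, then `cutAt f j` splits the cycle of `none` into one of length `r`
and one of length `k - 1 - r`, where `k` is the length of the cycle of `none`; a part of length `0`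
is absent. -/
theorem cycProd_cutAt_pow [IsDomain R] {q : ℕ → R} (hq : ∀ n, 0 < n → q n ≠ 0)
    (f : Perm (Option E)) {r : ℕ} (h0 : 0 < r) (hr : r < (blk (cycSetoid f) none).card) :
    cycProd (cutAt f ((f ^ r) none)) q * q (blk (cycSetoid f) none).card =
      cycProd f q * (q r * if r + 1 = (blk (cycSetoid f) none).card then 1
        else q ((blk (cycSetoid f) none).card - 1 - r)) := by
  obtain ⟨h1, h2⟩ := blk_mul_swap_pow f none h0 hr
  set j := (f ^ r) none with hj
  set f1 := f * swap none j with hf1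
  have hff : f = f1 * swap none j := by rw [hf1, mul_assoc, swap_mul_self, mul_one]
  have hm := isMerge_mul_swap h2
  rw [← hff] at hm
  have h3 := hm.card_blk_left h2
  have h4 := hm.blkProd h2 q
  rw [← h3, h1] at h4
  rw [h1] at h3
  rw [cutAt, ← hf1]
  split_ifs with hk
  -- `r = k - 1`: nothing is left next to `none`, which is a fixed point of `f1`.
  · have h5 : (blk (cycSetoid f1) none).card = 1 := by omega
    have h6 : f1 none = none := by
      have : f1 none ∈ blk (cycSetoid f1) none :=
        mem_blk.2 (Perm.sameCycle_apply_right.2 (Perm.SameCycle.refl _ _))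
      obtain ⟨z, hz⟩ := card_eq_one.1 h5
      have h7 := self_mem_blk (cycSetoid f1) none
      rw [hz, mem_singleton] at this h7
      rw [this, ← h7]
    have h7 := cycProd_removeNone_of_fixed q f1 h6
    rw [h5] at h4
    refine mul_left_cancel₀ (hq 1 one_pos) ?_
    rw [cycProd] at *
    linear_combination -h4 - q (blk (cycSetoid f) none).card * h7
  · have h5 : f1 none ≠ none := by
      intro h
      have := blk_of_fixed h
      rw [this, card_singleton] at h3
      omega
    have h6 := cycProd_removeNone (hq 1 one_pos) f1 h5
    have h7 : (blk (cycSetoid f) none).card - 1 - r = (blk (cycSetoid f1) none).card - 1 := by omega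
    rw [h7]
    refine mul_left_cancel₀ (hq _ (card_blk_pos (cycSetoid f1) none)) ?_
    rw [cycProd] at *
    linear_combination (-q ((blk (cycSetoid f1) none).card - 1)) * h4 -
      q (blk (cycSetoid f) none).card * h6

end RemovePoint

/-! ### Factorization of cycle products at a distinguished point -/

section CutProducts

open Equiv Finset

variable {E : Type*} [Fintype E] {R : Type*} [CommRing R]

/-- The product of the weights over the cycles that do not contain the point `none`. -/
def restProd (f : Perm (Option E)) (q : ℕ → R) : R :=
  ∏ s ∈ restBlks (cycSetoid f) none, q s.card

theorem cycProd_eq_mul_restProd (f : Perm (Option E)) (q : ℕ → R) :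
    cycProd f q = q (blk (cycSetoid f) none).card * restProd f q :=
  blkProd_erase (cycSetoid f) none q

/-- An identity between products of weights holds in every ring as soon as it holds for
independent variables. -/
theorem eval₂Hom_X_eq (q : ℕ → R) (n : ℕ) :
    MvPolynomial.eval₂Hom (Int.castRingHom R) q (MvPolynomial.X n) = q n :=
  MvPolynomial.eval₂Hom_X' _ _ _

variable [DecidableEq E]

/-- The case `j = none`: the point `none` is removed from its cycle. -/
theorem cycProd_cutAt_none (f : Perm (Option E)) (q : ℕ → R) :
    cycProd (cutAt f none) q = restProd f q *
      if (blk (cycSetoid f) none).card = 1 then 1 else q ((blk (cycSetoid f) none).card - 1) := by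
  suffices h : cycProd (cutAt f none) (fun n => (MvPolynomial.X n : MvPolynomial ℕ ℤ)) =
      restProd f (fun n => (MvPolynomial.X n : MvPolynomial ℕ ℤ)) *
      if (blk (cycSetoid f) none).card = 1 then 1 else
        MvPolynomial.X ((blk (cycSetoid f) none).card - 1) by
    have h' := congrArg (MvPolynomial.eval₂Hom (Int.castRingHom R) q) h
    rw [map_mul, apply_ite (MvPolynomial.eval₂Hom (Int.castRingHom R) q), map_one,
      eval₂Hom_X_eq, map_blkProd, restProd, map_prod] at h'
    simp only [eval₂Hom_X_eq] at h'
    exact h'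
  set q : ℕ → MvPolynomial ℕ ℤ := fun n => MvPolynomial.X n
  have hc : cutAt f none = removeNone f := by
    rw [cutAt, swap_self, ← Perm.one_def, mul_one]
  rw [hc]
  refine mul_left_cancel₀ (MvPolynomial.X_ne_zero (blk (cycSetoid f) none).card) ?_
  change q _ * _ = q _ * _
  by_cases h1 : f none = none
  · have h2 : (blk (cycSetoid f) none).card = 1 := by rw [blk_of_fixed h1, card_singleton]
    have h3 := cycProd_removeNone_of_fixed q f h1
    rw [cycProd_eq_mul_restProd, h2] at h3
    rw [h2, if_pos rfl, mul_one, h3]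
  · have h2 : (blk (cycSetoid f) none).card ≠ 1 := by
      intro h
      obtain ⟨z, hz⟩ := card_eq_one.1 h
      have h6 : f none ∈ blk (cycSetoid f) none :=
        mem_blk.2 (Perm.sameCycle_apply_right.2 (Perm.SameCycle.refl _ _))
      have h7 := self_mem_blk (cycSetoid f) none
      rw [hz, mem_singleton] at h6 h7
      exact h1 (h6.trans h7.symm)
    have h3 := cycProd_removeNone (MvPolynomial.X_ne_zero (R := ℤ) 1) f h1
    rw [cycProd_eq_mul_restProd f] at h3
    rw [if_neg h2]
    change q _ * _ * q _ = _ * q _ at h3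
    rw [← mul_assoc, h3, mul_comm]

/-- The cutting rule in division-free form, for weights in any ring. -/
theorem cycProd_cutAt_pow_eq (f : Perm (Option E)) (q : ℕ → R) {r : ℕ}
    (hr : r < (blk (cycSetoid f) none).card) :
    cycProd (cutAt f ((f ^ r) none)) q = restProd f q * ((if r = 0 then 1 else q r) *
      if r + 1 = (blk (cycSetoid f) none).card then 1
        else q ((blk (cycSetoid f) none).card - 1 - r)) := by
  rcases Nat.eq_zero_or_pos r with rfl | h0
  · simp only [pow_zero, Perm.coe_one, id_eq, cycProd_cutAt_none, if_true, one_mul, zero_add,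
      Nat.sub_zero, eq_comm]
  suffices h : cycProd (cutAt f ((f ^ r) none))
        (fun n => (MvPolynomial.X n : MvPolynomial ℕ ℤ)) =
      restProd f (fun n => (MvPolynomial.X n : MvPolynomial ℕ ℤ)) * (MvPolynomial.X r *
      if r + 1 = (blk (cycSetoid f) none).card then 1 else
        MvPolynomial.X ((blk (cycSetoid f) none).card - 1 - r)) by
    have h' := congrArg (MvPolynomial.eval₂Hom (Int.castRingHom R) q) h
    rw [map_mul, map_mul, apply_ite (MvPolynomial.eval₂Hom (Int.castRingHom R) q), map_one,
      eval₂Hom_X_eq, map_blkProd, restProd, map_prod] at h'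
    simp only [eval₂Hom_X_eq] at h'
    rw [if_neg h0.ne']
    exact h'
  refine mul_left_cancel₀ (MvPolynomial.X_ne_zero (blk (cycSetoid f) none).card) ?_
  rw [mul_comm, cycProd_cutAt_pow (fun n _ => MvPolynomial.X_ne_zero n) f h0 hr,
    cycProd_eq_mul_restProd f, mul_assoc]

/-- The joining rule in division-free form, for weights in any ring. -/
theorem cycProd_cutAt_of_not_mem (f : Perm (Option E)) (q : ℕ → R) {j : Option E}
    (hj : ¬ f.SameCycle none j) :
    cycProd (cutAt f j) q = q ((blk (cycSetoid f) j).card + (blk (cycSetoid f) none).card - 1) *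
      ∏ s ∈ restBlks₂ (cycSetoid f) none j,
        q s.card := by
  have h4 : (blk (cycSetoid f) j).card + (blk (cycSetoid f) none).card - 1 =
    (blk (cycSetoid f) none).card - 1 + (blk (cycSetoid f) j).card := by
    have hk := card_blk_pos (cycSetoid f) none
    omega
  rw [h4]
  suffices h : cycProd (cutAt f j) (fun n => (MvPolynomial.X n : MvPolynomial ℕ ℤ)) =
      MvPolynomial.X ((blk (cycSetoid f) none).card - 1 + (blk (cycSetoid f) j).card) *
      ∏ s ∈ restBlks₂ (cycSetoid f) none j,
        (MvPolynomial.X s.card : MvPolynomial ℕ ℤ) by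
    have h' := congrArg (MvPolynomial.eval₂Hom (Int.castRingHom R) q) h
    rw [map_mul, eval₂Hom_X_eq, map_blkProd, map_prod] at h'
    simp only [eval₂Hom_X_eq] at h'
    exact h'
  refine mul_left_cancel₀ (mul_ne_zero (MvPolynomial.X_ne_zero (blk (cycSetoid f) none).card)
    (MvPolynomial.X_ne_zero (blk (cycSetoid f) j).card)) ?_
  have h1 := cycProd_cutAt_of_not_sameCycle
    (q := fun n => (MvPolynomial.X n : MvPolynomial ℕ ℤ))
    (fun n _ => MvPolynomial.X_ne_zero n) f hj
  rw [cycProd, cycProd, blkProd_erase₂ (r := cycSetoid f) hj] at h1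
  rw [cycProd, mul_comm, h1]
  ring

/-- A sum over the points of the cycle of `none`, in cyclic order. -/
theorem sum_blk_none {A : Type*} [AddCommMonoid A] (f : Perm (Option E)) (F : Option E → A) :
    ∑ j ∈ blk (cycSetoid f) none, F j =
      ∑ r ∈ range (blk (cycSetoid f) none).card, F ((f ^ r) none) := by
  obtain ⟨h1, h2⟩ := card_blk_eq_minimalPeriod f none
  rw [h1, h2, sum_image]
  intro a ha b hb hab
  simp only [Perm.coe_pow] at hab
  exact Function.iterate_injOn_Iio_minimalPeriod (by simpa using ha) (by simpa using hb) hab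

theorem pow_none_eq_none_iff (f : Perm (Option E)) {r : ℕ}
    (hr : r < (blk (cycSetoid f) none).card) :
    ((f ^ r) none = none ↔ r = 0) ∧
      (f ((f ^ r) none) = none ↔ r + 1 = (blk (cycSetoid f) none).card) := by
  rw [(card_blk_eq_minimalPeriod f none).1] at *
  have key : ∀ n : ℕ, (f ^ n) none = none ↔ Function.minimalPeriod f none ∣ n := by
    intro n
    rw [← Function.isPeriodicPt_iff_minimalPeriod_dvd, Function.IsPeriodicPt, Function.IsFixedPt,
      Perm.coe_pow]
  rw [← Perm.mul_apply, ← pow_succ', key, key]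
  constructor
  · constructor
    · intro h
      by_contra h0
      exact absurd (Nat.le_of_dvd (Nat.pos_of_ne_zero h0) h) (by omega)
    · rintro rfl
      exact dvd_zero _
  · constructor
    · intro h
      exact le_antisymm (by omega) (Nat.le_of_dvd (by omega) h)
    · intro h
      rw [h]

/-- A sum over the points outside of the cycle of `none`, cycle by cycle. -/
theorem sum_compl_blk_none {A : Type*} [AddCommMonoid A] (f : Perm (Option E))
    (F : Finset (Option E) → A) :
    ∑ j ∈ (blk (cycSetoid f) none)ᶜ, F (blk (cycSetoid f) j) =
      ∑ s ∈ restBlks (cycSetoid f) none, s.card • F s := by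
  have hm : ∀ j ∈ (blk (cycSetoid f) none)ᶜ,
      blk (cycSetoid f) j ∈ restBlks (cycSetoid f) none := by
    intro j hj
    rw [mem_compl, mem_blk] at hj
    exact mem_restBlks.2 ⟨fun h => hj ((cycSetoid f).symm (blk_eq_iff.1 h)), blk_mem_blks _ _⟩
  classical
  rw [← sum_fiberwise_of_maps_to hm]
  refine sum_congr rfl fun s hs => ?_
  obtain ⟨h1, h2⟩ := mem_restBlks.1 hs
  obtain ⟨x, rfl⟩ := mem_blks.1 h2
  have : {j ∈ (blk (cycSetoid f) none)ᶜ | blk (cycSetoid f) j = blk (cycSetoid f) x} =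
      blk (cycSetoid f) x := by
    ext y
    rw [mem_filter, blk_eq_iff, mem_compl, mem_blk, mem_blk]
    constructor
    · rintro ⟨-, h⟩
      exact (cycSetoid f).symm h
    · intro h
      exact ⟨fun h' => h1 (blk_eq_iff.2 ((cycSetoid f).trans h ((cycSetoid f).symm h'))),
        (cycSetoid f).symm h⟩
  rw [sum_congr rfl (fun j hj => by rw [(mem_filter.1 hj).2]), sum_const, this]

end CutProducts

/-! ### Sums over factorizations of a permutation -/

section Factorizations

open Equiv Finset

variable {E : Type*} [Fintype E] [DecidableEq E] {R : Type*} [CommRing R]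

/-- The sum of `U ^ (cycles of w) * V ^ (cycles of b)` over the factorizations `f = w * b`. -/
def factorSum (U V : R) (f : Perm E) : R := ∑ w : Perm E, U ^ cycCount w * V ^ cycCount (w⁻¹ * f)

/-- Removing the point `none` from a factorization `f = w * b`.  The summand of `j` collects the
factorizations with `b j = none`; the point is then a fixed point of `w` when `f j = none`, and of
`b` when `j = none`. -/
theorem factorSum_option (U V : R) (f : Perm (Option E)) :
    factorSum U V f = ∑ j : Option E, (if f j = none then U else 1) *
      (if j = none then V else 1) * factorSum U V (cutAt f j) := by
  rw [factorSum, ← Perm.decomposeOption.symm.sum_comp, Fintype.sum_prod_type,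
    ← Equiv.sum_comp f]
  refine sum_congr rfl fun j _ => ?_
  rw [factorSum, mul_sum]
  refine sum_congr rfl fun w _ => ?_
  have h1 : Perm.decomposeOption.symm (f j, w) = swap none (f j) * optionCongr w := rfl
  have h2 : (swap none (f j) * optionCongr w)⁻¹ * f =
      optionCongr (w⁻¹ * cutAt f j) * swap none j := by
    rw [mul_inv_rev, swap_inv, mul_assoc, ← cutAt_spec, optionCongr_mul, optionCongr_inv,
      mul_assoc]
  rw [h1, h2, cycCount_swap_mul_optionCongr, cycCount_optionCongr_mul_swap, pow_add, pow_add]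
  split_ifs <;> simp only [pow_one, pow_zero, one_mul, mul_one] <;> ring

end Factorizations

/-! ### Moments of the Laguerre ensemble -/

section Moments

open Finset MvPolynomial

variable {R : Type*} [CommRing R]

/-- The functional on polynomials in `n` variables that integrates every variable separately against
the functional with moments `m`. -/
def multiMoment (m : ℕ → R) (n : ℕ) : MvPolynomial (Fin n) R →ₗ[R] R :=
  (basisMonomials (Fin n) R).constr R fun β => ∏ i, m (β i)

theorem multiMoment_monomial (m : ℕ → R) (n : ℕ) (β : Fin n →₀ ℕ) (c : R) :
    multiMoment m n (monomial β c) = c * ∏ i, m (β i) := by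
  have : monomial β c = c • basisMonomials (Fin n) R β := by
    rw [coe_basisMonomials, smul_monomial, smul_eq_mul, mul_one]
  rw [this, map_smul, multiMoment, Module.Basis.constr_basis, smul_eq_mul]

/-- The moments `∏_{i = 1}^{j} (a + i e)` of the Laguerre weight `x ^ (a / e) exp (- x / e)`. -/
def laguerreMoment (a e : R) (j : ℕ) : R := ∏ i ∈ range j, (a + (i + 1) * e)

theorem laguerreMoment_succ (a e : R) (j : ℕ) :
    laguerreMoment a e (j + 1) = (a + (j + 1) * e) * laguerreMoment a e j := by
  rw [laguerreMoment, prod_range_succ, mul_comm]; rfl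

variable (a e : R) (n : ℕ)

/-- Integration by parts in one variable. -/
theorem multiMoment_X_pow (s : Fin n) (k : ℕ) (Q : MvPolynomial (Fin n) R) :
    multiMoment (laguerreMoment a e) n (X s ^ (k + 1) * Q) =
      multiMoment (laguerreMoment a e) n
        (C (a + (k + 1) * e) * (X s ^ k * Q) + C e * (X s ^ (k + 1) * pderiv s Q)) := by
  induction Q using MvPolynomial.induction_on' with
  | add p q hp hq =>
    have : C (a + (k + 1) * e) * (X s ^ k * (p + q)) +
        C e * (X s ^ (k + 1) * pderiv s (p + q)) =
        (C (a + (k + 1) * e) * (X s ^ k * p) + C e * (X s ^ (k + 1) * pderiv s p)) +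
        (C (a + (k + 1) * e) * (X s ^ k * q) + C e * (X s ^ (k + 1) * pderiv s q)) := by
      rw [map_add (pderiv s)]; ring
    rw [mul_add, this, map_add, map_add, hp, hq]
  | monomial β c =>
    have key : ∀ l : ℕ, ∏ i, laguerreMoment a e ((Finsupp.single s l + β) i) =
        laguerreMoment a e (l + β s) * ∏ i ∈ univ.erase s, laguerreMoment a e (β i) := by
      intro l
      rw [← mul_prod_erase _ _ (mem_univ s)]
      congr 1
      · simp
      · refine prod_congr rfl fun i hi => ?_
        simp [Finsupp.single_eq_of_ne (mem_erase.1 hi).1]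
    have hX : ∀ l (β' : Fin n →₀ ℕ) (c' : R),
        (X s : MvPolynomial (Fin n) R) ^ l * monomial β' c' =
        monomial (Finsupp.single s l + β') c' := by
      intro l β' c'
      rw [X_pow_eq_monomial, monomial_mul, one_mul]
    have hp : (X s : MvPolynomial (Fin n) R) ^ (k + 1) * pderiv s (monomial β c) =
        monomial (Finsupp.single s k + β) (c * β s) := by
      rw [pderiv_monomial, hX]
      rcases Nat.eq_zero_or_pos (β s) with h0 | h0
      · simp [h0]
      · congr 2
        ext i
        by_cases hi : i = s
        · subst hi
          simp
          omega
        · simp [Finsupp.single_eq_of_ne hi]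
    rw [hp, hX, hX, C_mul_monomial, C_mul_monomial, map_add, multiMoment_monomial,
      multiMoment_monomial, multiMoment_monomial, key, key]
    rw [show k + 1 + β s = (k + β s) + 1 by ring, laguerreMoment_succ]
    push_cast
    ring

/-- The vector field `∑ x_s ^ (k + 1) ∂_s`. -/
def powField (k : ℕ) : Derivation R (MvPolynomial (Fin n) R) (MvPolynomial (Fin n) R) :=
  mkDerivation R fun s => X s ^ (k + 1)

theorem powField_eq_sum (k : ℕ) (Q : MvPolynomial (Fin n) R) :
    powField (R := R) n k Q = ∑ s, X s ^ (k + 1) * pderiv s Q := by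
  have hsum : ∀ (D : Fin n → Derivation R (MvPolynomial (Fin n) R) (MvPolynomial (Fin n) R)) Q,
      (∑ s, D s) Q = ∑ s, D s Q := fun D Q =>
    map_sum (⟨⟨fun d => d Q, rfl⟩, fun _ _ => rfl⟩ :
      Derivation R (MvPolynomial (Fin n) R) (MvPolynomial (Fin n) R) →+ _) D univ
  have : powField (R := R) n k = ∑ s, (X s : MvPolynomial (Fin n) R) ^ (k + 1) • pderiv s := by
    refine derivation_ext fun i => ?_
    rw [powField, mkDerivation_X, hsum]
    simp only [Derivation.smul_apply, pderiv_X, smul_eq_mul, Pi.single_apply]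
    simp
  rw [this, hsum]
  rfl

/-- The Vandermonde determinant. -/
def vdm : MvPolynomial (Fin n) R := ∏ i, ∏ j ∈ Ioi i, (X j - X i)

/-- The logarithmic derivative of the squared Vandermonde determinant along the vector field
`∑ x_s ^ (k + 1) ∂_s`. -/
theorem powField_vdm_sq (k : ℕ) :
    powField (R := R) n k (vdm n ^ 2) = (∑ r ∈ range (k + 1), psum (Fin n) R r *
      psum (Fin n) R (k - r) - ((k : MvPolynomial (Fin n) R) + 1) * psum (Fin n) R k) *
        vdm n ^ 2 := by
  -- `H i j` is the quotient `(X i ^ (k + 1) - X j ^ (k + 1)) / (X i - X j)`.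
  set H : Fin n → Fin n → MvPolynomial (Fin n) R :=
    fun i j => ∑ r ∈ range (k + 1), X i ^ r * X j ^ (k - r) with hH
  have hsymm : ∀ i j, H i j = H j i := by
    intro i j
    simp only [hH]
    rw [← sum_range_reflect]
    refine sum_congr rfl fun r hr => ?_
    have : r ≤ k := by simpa [Nat.lt_succ_iff] using hr
    rw [mul_comm, show k - (k + 1 - 1 - r) = r by omega, show k + 1 - 1 - r = k - r by omega]
  have hdiag : ∀ i, H i i = ((k : MvPolynomial (Fin n) R) + 1) * X i ^ k := by
    intro i
    simp only [hH]
    rw [sum_congr rfl (g := fun _ => X i ^ k) (fun r hr => by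
      rw [← pow_add]; congr 1; have := mem_range.1 hr; omega)]
    simp
  have hX : ∀ i j, powField (R := R) n k (X j - X i) = (X j - X i) * H i j := by
    intro i j
    rw [map_sub, powField, mkDerivation_X, mkDerivation_X, hsymm i j, mul_comm]
    have := (Commute.all (X j : MvPolynomial (Fin n) R) (X i)).geom_sum₂_mul (k + 1)
    simp only [Nat.add_sub_cancel] at this
    rw [← this]
  have hD : ∀ (s : Finset (Fin n × Fin n)) , powField (R := R) n k
      (∏ p ∈ s, (X p.2 - X p.1)) = (∏ p ∈ s, (X p.2 - X p.1)) * ∑ p ∈ s, H p.1 p.2 := by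
    classical
    intro s
    induction s using Finset.induction_on with
    | empty => simp
    | insert p s hp ih =>
      rw [prod_insert hp, sum_insert hp, Derivation.leibniz, ih, hX, smul_eq_mul, smul_eq_mul]
      ring
  have hv2 : vdm (R := R) n =
      ∏ p ∈ (univ : Finset (Fin n × Fin n)).filter (fun p => p.1 < p.2), (X p.2 - X p.1) := by
    rw [prod_filter, ← univ_product_univ, prod_product, vdm]
    refine prod_congr rfl fun i _ => ?_
    rw [← prod_filter]
    refine prod_congr ?_ fun _ _ => rfl
    ext j
    simp
  have hsum : 2 * ∑ p ∈ (univ : Finset (Fin n × Fin n)).filter (fun p => p.1 < p.2), H p.1 p.2 =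
      ∑ r ∈ range (k + 1), psum (Fin n) R r * psum (Fin n) R (k - r) -
        ((k : MvPolynomial (Fin n) R) + 1) * psum (Fin n) R k := by
    have h1 : ∑ i, ∑ j, H i j = ∑ r ∈ range (k + 1), psum (Fin n) R r * psum (Fin n) R (k - r) := by
      simp only [hH, psum, sum_mul_sum]
      rw [sum_congr rfl (fun i _ => sum_comm), sum_comm]
    have h2 : ∑ i, ∑ j, H i j = 2 * ∑ p ∈ (univ : Finset (Fin n × Fin n)).filter
        (fun p => p.1 < p.2), H p.1 p.2 + ∑ i, H i i := by
      have hlt : ∑ p ∈ (univ : Finset (Fin n × Fin n)).filter (fun p => p.2 < p.1), H p.1 p.2 =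
          ∑ p ∈ (univ : Finset (Fin n × Fin n)).filter (fun p => p.1 < p.2), H p.1 p.2 := by
        refine sum_nbij' Prod.swap Prod.swap ?_ ?_ ?_ ?_ ?_ <;> simp [hsymm]
      have hd : ∑ i, H i i = ∑ i, ∑ j, if i = j then H i j else 0 := by simp
      rw [two_mul]
      nth_rewrite 2 [← hlt]
      rw [sum_filter, sum_filter, ← univ_product_univ, sum_product, sum_product, hd,
        ← sum_add_distrib, ← sum_add_distrib]
      refine sum_congr rfl fun i _ => ?_
      rw [← sum_add_distrib, ← sum_add_distrib]
      refine sum_congr rfl fun j _ => ?_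
      rcases lt_trichotomy i j with h | h | h
      · simp [h, h.ne, h.not_gt]
      · simp [h]
      · simp [h, h.ne', h.not_gt]
    rw [← h1, h2]
    simp only [hdiag, psum, mul_sum]
    ring
  rw [← hsum, pow_two, Derivation.leibniz, hv2, hD, smul_eq_mul]
  ring

/-- The Virasoro constraint: the effect of the change of variables along `∑ x_s ^ (k + 1) ∂_s` on
averages against the squared Vandermonde determinant. -/
theorem multiMoment_psum_succ (k : ℕ) (P : MvPolynomial (Fin n) R) :
    multiMoment (laguerreMoment a e) n (psum (Fin n) R (k + 1) * P * vdm n ^ 2) =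
      multiMoment (laguerreMoment a e) n ((C a * psum (Fin n) R k +
        C e * ∑ r ∈ range (k + 1), psum (Fin n) R r * psum (Fin n) R (k - r)) * P * vdm n ^ 2) +
      e * multiMoment (laguerreMoment a e) n (powField n k P * vdm n ^ 2) := by
  have h1 : psum (Fin n) R (k + 1) * P * vdm n ^ 2 = ∑ s, X s ^ (k + 1) * (P * vdm n ^ 2) := by
    rw [mul_assoc, psum, sum_mul]
  rw [h1, map_sum, sum_congr rfl (fun s _ => multiMoment_X_pow a e n s k (P * vdm n ^ 2)),
    ← map_sum, ← smul_eq_mul e, ← map_smul, ← map_add]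
  congr 1
  rw [sum_add_distrib, ← mul_sum, ← mul_sum, ← sum_mul, ← powField_eq_sum, Derivation.leibniz,
    powField_vdm_sq, smul_eq_mul, smul_eq_mul, smul_eq_C_mul]
  change C (a + (k + 1) * e) * (psum (Fin n) R k * _) + _ = _
  simp only [map_add, map_mul, map_natCast, map_one]
  ring

theorem powField_psum (k l : ℕ) :
    powField n k (psum (Fin n) R l) = l * psum (Fin n) R (l + k) := by
  rw [psum, map_sum, psum, mul_sum]
  refine sum_congr rfl fun s _ => ?_
  rw [Derivation.leibniz_pow, powField, mkDerivation_X, nsmul_eq_mul, smul_eq_mul]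
  rcases Nat.eq_zero_or_pos l with rfl | h
  · simp
  · rw [← pow_add]
    congr 2
    omega

theorem powField_prod_psum {ι : Type*} [DecidableEq ι] (k : ℕ) (s : Finset ι) (l : ι → ℕ) :
    powField n k (∏ i ∈ s, psum (Fin n) R (l i)) =
      ∑ i ∈ s, l i • (psum (Fin n) R (l i + k) * ∏ j ∈ s.erase i, psum (Fin n) R (l j)) := by
  induction s using Finset.induction_on with
  | empty => simp
  | insert i s hi ih =>
    rw [prod_insert hi, sum_insert hi, Derivation.leibniz, ih, powField_psum, erase_insert hi,
      smul_eq_mul, smul_eq_mul, mul_sum, add_comm]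
    congr 1
    · rw [nsmul_eq_mul]; ring
    · refine sum_congr rfl fun j hj => ?_
      have hij : i ≠ j := fun h => hi (h ▸ hj)
      rw [erase_insert_of_ne hij, prod_insert (fun h => hi (mem_of_mem_erase h)),
        nsmul_eq_mul, nsmul_eq_mul]
      ring

end Moments

/-! ### The Wick formula for the Laguerre ensemble -/

section Wick

open Equiv Finset MvPolynomial

theorem cycCount_equiv {E E' : Type*} (e : E ≃ E') (f : Perm E) :
    cycCount (e.permCongr f) = cycCount f :=
  (Nat.card_congr (Quotient.congr e fun a b => (cycSetoid_equiv e f a b).symm)).symm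

theorem cycProd_equiv {E E' : Type*} [Fintype E] [Fintype E'] {R : Type*} [CommRing R]
    (e : E ≃ E') (f : Perm E) (q : ℕ → R) : cycProd (e.permCongr f) q = cycProd f q :=
  blkProd_equiv e (cycSetoid_equiv e f) q

theorem factorSum_equiv {E E' : Type*} [Fintype E] [Fintype E'] [DecidableEq E] [DecidableEq E']
    {R : Type*} [CommRing R] (e : E ≃ E') (U V : R) (f : Perm E) :
    factorSum U V (e.permCongr f) = factorSum U V f := by
  rw [factorSum, ← e.permCongr.sum_comp, factorSum]
  refine sum_congr rfl fun w _ => ?_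
  have : (e.permCongr w)⁻¹ * e.permCongr f = e.permCongr (w⁻¹ * f) := by
    change (e.permCongrHom w)⁻¹ * e.permCongrHom f = e.permCongrHom (w⁻¹ * f)
    rw [map_mul, map_inv]
  rw [this, cycCount_equiv, cycCount_equiv]

variable {K : Type*} [Field K] (a e : K) (n : ℕ)

/-- The average of `Q` against the squared Vandermonde determinant, unnormalized. -/
def laguerreAvg (Q : MvPolynomial (Fin n) K) : K :=
  multiMoment (laguerreMoment a e) n (Q * vdm n ^ 2)

theorem laguerreAvg_sum {ι : Type*} (s : Finset ι) (c : ι → K)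
    (Q : ι → MvPolynomial (Fin n) K) :
    laguerreAvg a e n (∑ i ∈ s, C (c i) * Q i) = ∑ i ∈ s, c i * laguerreAvg a e n (Q i) := by
  rw [laguerreAvg, sum_mul, map_sum]
  refine sum_congr rfl fun i _ => ?_
  rw [mul_assoc, ← smul_eq_C_mul, map_smul, smul_eq_mul, laguerreAvg]

variable {a e}

/-- The recursion for products of power sums that mirrors `factorSum_option`: the arcs at the points
of the cycle of `none` come from the Vandermonde determinant, the others from the derivatives of the
remaining power sums. -/
theorem laguerreAvg_cycProd_option {E : Type*} [Fintype E] [DecidableEq E] (he : e ≠ 0)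
    (f : Perm (Option E)) :
    laguerreAvg a e n (cycProd f (psum (Fin n) K)) = e * ∑ j : Option E,
      ((if f j = none then (n : K) else 1) * (if j = none then (n + a / e : K) else 1)) *
        laguerreAvg a e n (cycProd (cutAt f j) (psum (Fin n) K)) := by
  set q := psum (Fin n) K with hq
  obtain ⟨k, hk⟩ : ∃ k, (blk (cycSetoid f) none).card = k + 1 :=
    ⟨_, (Nat.sub_add_cancel (card_blk_pos (cycSetoid f) none)).symm⟩
  have hq0 : q 0 = C (n : K) := by simp [hq, psum_zero]
  set P := restProd f q with hP
  -- The points of the cycle of `none`.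
  have hown : ∑ j ∈ blk (cycSetoid f) none,
      C ((if f j = none then (n : K) else 1) * (if j = none then (n + a / e : K) else 1)) *
        cycProd (cutAt f j) q =
      (C (a / e) * q k + ∑ r ∈ range (k + 1), q r * q (k - r)) * P := by
    rw [sum_blk_none, hk]
    have h1 : ∀ r ∈ range (k + 1), C ((if f ((f ^ r) none) = none then (n : K) else 1) *
        (if (f ^ r) none = none then (n + a / e : K) else 1)) * cycProd (cutAt f ((f ^ r) none)) q =
        ((if r = 0 then C (a / e) * q k else 0) + q r * q (k - r)) * P := by
      intro r hr
      have hr' : r < (blk (cycSetoid f) none).card := by rw [hk]; exact mem_range.1 hr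
      obtain ⟨h2, h3⟩ := pow_none_eq_none_iff f hr'
      rw [cycProd_cutAt_pow_eq f q hr', ← hP]
      simp only [h2, h3, hk, Nat.add_right_cancel_iff, Nat.add_sub_cancel]
      by_cases h0 : r = 0
      · subst h0
        by_cases h4 : 0 = k
        · subst h4
          simp only [if_true, Nat.sub_zero, hq0, map_mul, map_add]
          ring
        · simp only [h4, if_true, if_false, Nat.sub_zero, hq0, one_mul, map_add]
          ring
      · by_cases h4 : r = k
        · subst h4
          simp only [h0, if_true, if_false, Nat.sub_self, hq0, mul_one]
          ring
        · simp only [h0, h4, if_false, mul_one, C_1]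
          ring
    rw [sum_congr rfl h1, ← sum_mul, sum_add_distrib, sum_ite_eq' (range (k + 1)) 0]
    simp
  -- The other points.
  have hother : ∑ j ∈ (blk (cycSetoid f) none)ᶜ,
      C ((if f j = none then (n : K) else 1) * (if j = none then (n + a / e : K) else 1)) *
        cycProd (cutAt f j) q = powField n k P := by
    have h1 : ∀ j ∈ (blk (cycSetoid f) none)ᶜ,
        C ((if f j = none then (n : K) else 1) * (if j = none then (n + a / e : K) else 1)) *
          cycProd (cutAt f j) q =
        q ((blk (cycSetoid f) j).card + k) * ∏ s ∈ restBlks₂ (cycSetoid f) none j, q s.card := by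
      intro j hj
      rw [mem_compl, mem_blk] at hj
      have h2 : j ≠ none := by
        rintro rfl
        exact hj (Perm.SameCycle.refl _ _)
      have h3 : f j ≠ none := fun h => hj (by
        change f.SameCycle none j
        rw [← h]
        exact Perm.sameCycle_apply_left.2 (Perm.SameCycle.refl _ _))
      rw [if_neg h2, if_neg h3, mul_one, C_1, one_mul, cycProd_cutAt_of_not_mem f q hj, hk]
      rfl
    rw [sum_congr rfl h1, hP, restProd, hq, powField_prod_psum]
    refine (sum_compl_blk_none f (fun s => q (s.card + k) *
      ∏ t ∈ eraseBlk (restBlks (cycSetoid f) none) s, q t.card)).trans ?_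
    refine sum_congr rfl fun s _ => ?_
    rw [eraseBlk_eq]
  have htot : laguerreAvg a e n (cycProd f q) =
      laguerreAvg a e n (C e * ((C (a / e) * q k + ∑ r ∈ range (k + 1), q r * q (k - r)) * P +
        powField n k P)) := by
    rw [cycProd_eq_mul_restProd, hk, laguerreAvg, hq, multiMoment_psum_succ, ← smul_eq_mul e,
      ← map_smul, ← map_add, laguerreAvg, smul_eq_C_mul]
    congr 1
    have : (C a : MvPolynomial (Fin n) K) = C e * C (a / e) := by
      rw [← C_mul, mul_div_cancel₀ _ he]
    rw [this]
    ring
  rw [htot, ← hown, ← hother, sum_add_sum_compl, ← laguerreAvg_sum, laguerreAvg, laguerreAvg,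
    mul_assoc, ← smul_eq_C_mul, map_smul, smul_eq_mul]

/-- The Wick formula: averages of products of power sums are sums over factorizations. -/
theorem laguerreAvg_cycProd (he : e ≠ 0) (E : Type) [Fintype E] [DecidableEq E] (f : Perm E) :
    laguerreAvg a e n (cycProd f (psum (Fin n) K)) =
      e ^ Fintype.card E * factorSum (n : K) (n + a / e) f * laguerreAvg a e n 1 := by
  let P : ∀ (E : Type) [Fintype E], Prop := fun E _ => ∀ (_ : DecidableEq E) (f : Perm E),
    laguerreAvg a e n (cycProd f (psum (Fin n) K)) =
      e ^ Fintype.card E * factorSum (n : K) (n + a / e) f * laguerreAvg a e n 1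
  refine Fintype.induction_empty_option (P := P) ?_ ?_ ?_ E _ f
  · intro α β _ ε ih dβ f
    let _ : Fintype α := Fintype.ofEquiv β ε.symm
    let _ : DecidableEq α := ε.decidableEq
    have h := ih inferInstance (ε.symm.permCongr f)
    rw [cycProd_equiv, factorSum_equiv] at h
    rwa [← Fintype.card_congr ε]
  · intro _ f
    have h1 : cycProd f (psum (Fin n) K) = 1 := by
      have : blks (cycSetoid f) = ∅ := by
        ext s
        simp [mem_blks]
      rw [cycProd, blkProd, this, prod_empty]
    have h2 : factorSum (n : K) (n + a / e) f = 1 := by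
      rw [factorSum, univ_unique, sum_singleton]
      simp [cycCount]
    rw [h1, h2]
    simp
  · intro α _ ih d f
    let _ : DecidableEq α := Classical.decEq α
    obtain rfl : d = Option.instDecidableEq := Subsingleton.elim _ _
    rw [laguerreAvg_cycProd_option n he, factorSum_option, Fintype.card_option, pow_succ,
      mul_sum, mul_sum, sum_mul]
    refine sum_congr rfl fun j _ => ?_
    rw [ih]
    ring

end Wick

/-! ### Decomposition of pairs of permutations into transitive ones -/

section Orbits

open Equiv Finset

variable {E E' : Type*}

/-- The orbits of the group generated by two permutations. -/
def orb (w b : Perm E) : Setoid E := MulAction.orbitRel (Subgroup.closure {w, b}) E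

/-- The group generated by `w` and `b` is transitive. -/
abbrev IsTrans (w b : Perm E) : Prop :=
  MulAction.IsPretransitive (Subgroup.closure {w, b}) E

theorem orb_left (w b : Perm E) (x : E) : orb w b x (w x) := by
  refine (orb w b).symm ?_
  exact ⟨⟨w, Subgroup.subset_closure (by simp)⟩, rfl⟩

theorem orb_right (w b : Perm E) (x : E) : orb w b x (b x) := by
  refine (orb w b).symm ?_
  exact ⟨⟨b, Subgroup.subset_closure (by simp)⟩, rfl⟩

/-- The orbits are the classes of the finest equivalence relation preserved by both permutations. -/
theorem orb_le {w b : Perm E} {r : Setoid E} (hw : ∀ x, r x (w x)) (hb : ∀ x, r x (b x)) {x y : E}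
    (h : orb w b x y) : r x y := by
  obtain ⟨⟨g, hg⟩, rfl⟩ := h
  change r (g y) y
  revert y
  induction hg using Subgroup.closure_induction with
  | mem g hg =>
    intro y
    rcases hg with rfl | rfl
    · exact r.symm (hw y)
    · exact r.symm (hb y)
  | one => exact r.refl _
  | mul g g' _ _ h h' => exact r.trans h h'
  | inv g _ h =>
    intro y
    have := h (y := g⁻¹ y)
    rw [← Perm.mul_apply, mul_inv_cancel, Perm.one_apply] at this
    exact r.symm this

theorem isTrans_iff {w b : Perm E} : IsTrans w b ↔ ∀ x y, orb w b x y := by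
  constructor
  · intro h x y
    obtain ⟨g, hg⟩ := h.exists_smul_eq y x
    exact ⟨g, hg⟩
  · intro h
    exact ⟨fun x y => (h y x)⟩

theorem orb_equiv (e : E ≃ E') (w b : Perm E) (x y : E) :
    orb (e.permCongr w) (e.permCongr b) (e x) (e y) ↔ orb w b x y := by
  constructor
  · intro h
    have := orb_le (r := Setoid.comap e.symm (orb w b)) (fun z => ?_) (fun z => ?_) h
    · simpa [Setoid.comap_rel] using this
    · simpa [Setoid.comap_rel] using orb_left w b (e.symm z)
    · simpa [Setoid.comap_rel] using orb_right w b (e.symm z)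
  · intro h
    have := orb_le (r := Setoid.comap e (orb (e.permCongr w) (e.permCongr b)))
      (fun z => ?_) (fun z => ?_) h
    · exact this
    · simpa [Setoid.comap_rel] using orb_left (e.permCongr w) (e.permCongr b) (e z)
    · simpa [Setoid.comap_rel] using orb_right (e.permCongr w) (e.permCongr b) (e z)

theorem isTrans_equiv (e : E ≃ E') (w b : Perm E) :
    IsTrans (e.permCongr w) (e.permCongr b) ↔ IsTrans w b := by
  rw [isTrans_iff, isTrans_iff]
  constructor
  · intro h x y
    exact (orb_equiv e w b x y).1 (h _ _)
  · intro h x y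
    obtain ⟨x, rfl⟩ := e.surjective x
    obtain ⟨y, rfl⟩ := e.surjective y
    exact (orb_equiv e w b x y).2 (h x y)

end Orbits

section Sums

open Equiv Finset Classical

variable {E E' : Type*} [Fintype E] [Fintype E'] {R : Type*} [CommRing R]

/-- The weight of a pair of permutations: `U` for every cycle of `w`, `V` for every cycle of `b`,
and `q k` for every cycle of length `k` of `w * b`. -/
def pairWeight (U V : R) (q : ℕ → R) (w b : Perm E) : R :=
  U ^ cycCount w * V ^ cycCount b * cycProd (w * b) q

variable (E) in
/-- The sum of the weights of all pairs of permutations of `E`. -/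
def pairSum (U V : R) (q : ℕ → R) : R := ∑ x : Perm E × Perm E, pairWeight U V q x.1 x.2

variable (E) in
/-- The sum of the weights of the pairs of permutations that generate a transitive group. -/
def transSum (U V : R) (q : ℕ → R) : R :=
  ∑ x : Perm E × Perm E, if IsTrans x.1 x.2 then pairWeight U V q x.1 x.2 else 0

theorem pairWeight_equiv (e : E ≃ E') (U V : R) (q : ℕ → R) (w b : Perm E) :
    pairWeight U V q (e.permCongr w) (e.permCongr b) = pairWeight U V q w b := by
  have : e.permCongr w * e.permCongr b = e.permCongr (w * b) := (map_mul e.permCongrHom w b).symm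
  rw [pairWeight, this, cycCount_equiv, cycCount_equiv, cycProd_equiv, pairWeight]

theorem pairSum_equiv (e : E ≃ E') (U V : R) (q : ℕ → R) : pairSum E U V q = pairSum E' U V q := by
  rw [pairSum, pairSum, ← (e.permCongr.prodCongr e.permCongr).sum_comp]
  exact sum_congr rfl fun x _ => (pairWeight_equiv e U V q x.1 x.2).symm

theorem transSum_equiv (e : E ≃ E') (U V : R) (q : ℕ → R) :
    transSum E U V q = transSum E' U V q := by
  rw [transSum, transSum, ← (e.permCongr.prodCongr e.permCongr).sum_comp]
  refine sum_congr rfl fun x _ => ?_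
  simp only [prodCongr_apply, Prod.map, pairWeight_equiv, isTrans_equiv]

/-- The cycles of a permutation that acts on two disjoint sets. -/
theorem cycProd_sumCongr (f : Perm E) (g : Perm E') (q : ℕ → R) :
    cycProd (Perm.sumCongr f g) q = cycProd f q * cycProd g q := by
  have hpow : ∀ (n : ℤ), (Perm.sumCongr f g) ^ n = Perm.sumCongr (f ^ n) (g ^ n) := fun n =>
    (map_zpow (Perm.sumCongrHom E E') (f, g) n).symm
  have hl : ∀ x, blk (cycSetoid (Perm.sumCongr f g)) (Sum.inl x) =
      (blk (cycSetoid f) x).map Function.Embedding.inl := by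
    intro x
    ext y
    cases y <;> simp [mem_blk, cycSetoid_apply, Perm.SameCycle, hpow]
  have hr : ∀ x, blk (cycSetoid (Perm.sumCongr f g)) (Sum.inr x) =
      (blk (cycSetoid g) x).map Function.Embedding.inr := by
    intro x
    ext y
    cases y <;> simp [mem_blk, cycSetoid_apply, Perm.SameCycle, hpow]
  have hb : blks (cycSetoid (Perm.sumCongr f g)) =
      (blks (cycSetoid f)).image (fun s => s.map Function.Embedding.inl) ∪
      (blks (cycSetoid g)).image (fun s => s.map Function.Embedding.inr) := by
    ext s
    simp only [mem_blks, mem_union, mem_image, Sum.exists, hl, hr]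
    simp
  have hd : Disjoint ((blks (cycSetoid f)).image
      (fun s => s.map (Function.Embedding.inl : E ↪ E ⊕ E')))
      ((blks (cycSetoid g)).image (fun s => s.map (Function.Embedding.inr : E' ↪ E ⊕ E'))) := by
    rw [Finset.disjoint_left]
    intro s h1 h2
    obtain ⟨t, ht, rfl⟩ := mem_image.1 h1
    obtain ⟨t', -, h⟩ := mem_image.1 h2
    obtain ⟨x, rfl⟩ := mem_blks.1 ht
    have : Sum.inl x ∈ (blk (cycSetoid f) x).map (Function.Embedding.inl : E ↪ E ⊕ E') := by
      simp [self_mem_blk]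
    rw [← h] at this
    simp at this
  rw [cycProd, blkProd, hb, prod_union hd, prod_image (fun s _ t _ hst => map_injective _ hst),
    prod_image (fun s _ t _ hst => map_injective _ hst)]
  simp [cycProd, blkProd]

theorem cycProd_subtypeCongr {p : E → Prop} (f : Perm {x // p x}) (g : Perm {x // ¬ p x})
    (q : ℕ → R) : cycProd (Perm.subtypeCongr f g) q = cycProd f q * cycProd g q := by
  rw [← cycProd_sumCongr]
  exact cycProd_equiv (sumCompl p) (Perm.sumCongr f g) q

theorem cycCount_subtypeCongr {p : E → Prop} (f : Perm {x // p x}) (g : Perm {x // ¬ p x}) :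
    cycCount (Perm.subtypeCongr f g) = cycCount f + cycCount g := by
  have := cycProd_subtypeCongr f g (fun _ => (2 : ℤ))
  simp only [cycProd, blkProd_const, ← pow_add] at this
  exact_mod_cast Int.pow_right_injective (by norm_num) this

omit [Fintype E] in
theorem subtypeCongr_mul {p : E → Prop} (f f' : Perm {x // p x}) (g g' : Perm {x // ¬ p x}) :
    Perm.subtypeCongr f g * Perm.subtypeCongr f' g' = Perm.subtypeCongr (f * f') (g * g') :=
  (map_mul (Perm.subtypeCongrHom p) (f, g) (f', g')).symm

theorem pairWeight_subtypeCongr {p : E → Prop} (U V : R) (q : ℕ → R) (w b : Perm {x // p x})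
    (w' b' : Perm {x // ¬ p x}) :
    pairWeight U V q (Perm.subtypeCongr w w') (Perm.subtypeCongr b b') =
      pairWeight U V q w b * pairWeight U V q w' b' := by
  rw [pairWeight, subtypeCongr_mul, cycProd_subtypeCongr, cycCount_subtypeCongr,
    cycCount_subtypeCongr, pairWeight, pairWeight]
  ring

omit [Fintype E] in
theorem orb_subtypeCongr {p : E → Prop} (w b : Perm {x // p x}) (w' b' : Perm {x // ¬ p x})
    {x : E} (hx : p x) (y : E) :
    orb (Perm.subtypeCongr w w') (Perm.subtypeCongr b b') x y ↔
      ∃ hy : p y, orb w b ⟨x, hx⟩ ⟨y, hy⟩ := by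
  have hpres : ∀ (f : Perm {x // p x}) (g : Perm {x // ¬ p x}) (z : E),
      p (Perm.subtypeCongr f g z) ↔ p z := by
    intro f g z
    by_cases hz : p z
    · simp [Perm.subtypeCongr.left_apply _ _ hz, hz, (f ⟨z, hz⟩).2]
    · simp [Perm.subtypeCongr.right_apply _ _ hz, hz, (g ⟨z, hz⟩).2]
  constructor
  · intro h
    -- Two points are related if both lie in `p` and in the same orbit of the first pair, or if both
    -- lie outside of `p`.
    let r : Setoid E :=
      { r := fun y z => (p y ↔ p z) ∧ ∀ (hy : p y) (hz : p z), orb w b ⟨y, hy⟩ ⟨z, hz⟩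
        iseqv :=
          { refl := fun y => ⟨Iff.rfl, fun _ _ => (orb w b).refl _⟩
            symm := fun h => ⟨h.1.symm, fun hy hz => (orb w b).symm (h.2 hz hy)⟩
            trans := fun h h' => ⟨h.1.trans h'.1, fun hy hz =>
              (orb w b).trans (h.2 hy (h.1.1 hy)) (h'.2 _ hz)⟩ } }
    have hr : r x y := by
      refine orb_le (r := r) (fun z => ⟨(hpres _ _ z).symm, fun hz hz' => ?_⟩)
        (fun z => ⟨(hpres _ _ z).symm, fun hz hz' => ?_⟩) h
      · have := orb_left w b ⟨z, hz⟩
        convert this using 1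
        exact Subtype.ext (Perm.subtypeCongr.left_apply _ _ hz)
      · have := orb_right w b ⟨z, hz⟩
        convert this using 1
        exact Subtype.ext (Perm.subtypeCongr.left_apply _ _ hz)
    exact ⟨hr.1.1 hx, hr.2 hx _⟩
  · rintro ⟨hy, h⟩
    have := orb_le (r := Setoid.comap Subtype.val
      (orb (Perm.subtypeCongr w w') (Perm.subtypeCongr b b'))) (fun z => ?_) (fun z => ?_) h
    · exact this
    · have h1 := orb_left (Perm.subtypeCongr w w') (Perm.subtypeCongr b b') z.1
      rwa [Perm.subtypeCongr.left_apply _ _ z.2] at h1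
    · have h1 := orb_right (Perm.subtypeCongr w w') (Perm.subtypeCongr b b') z.1
      rwa [Perm.subtypeCongr.left_apply _ _ z.2] at h1

omit [Fintype E] in
theorem exists_subtypeCongr {p : E → Prop} (w : Perm E) (hw : ∀ x, p (w x) ↔ p x) :
    ∃ (f : Perm {x // p x}) (g : Perm {x // ¬ p x}), Perm.subtypeCongr f g = w := by
  refine ⟨w.subtypePerm hw, w.subtypePerm (fun x => not_congr (hw x)), ?_⟩
  ext x
  by_cases hx : p x
  · rw [Perm.subtypeCongr.left_apply _ _ hx, Perm.subtypePerm_apply]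
  · rw [Perm.subtypeCongr.right_apply _ _ hx, Perm.subtypePerm_apply]

/-- The pairs for which the orbit of `x` is a given set: they consist of a transitive pair on this
set and an arbitrary pair on its complement. -/
theorem sum_orbit_eq (U V : R) (q : ℕ → R) {x : E} {p : E → Prop} (hx : p x) :
    ∑ y : Perm E × Perm E with ∀ z, orb y.1 y.2 x z ↔ p z, pairWeight U V q y.1 y.2 =
      transSum {y // p y} U V q * pairSum {y // ¬ p y} U V q := by
  rw [transSum, pairSum, ← sum_filter, sum_mul_sum, ← sum_product']
  symm
  refine sum_bij (fun z _ => (Perm.subtypeCongr z.1.1 z.2.1, Perm.subtypeCongr z.1.2 z.2.2))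
    ?_ ?_ ?_ ?_
  · rintro ⟨⟨w, b⟩, ⟨w', b'⟩⟩ h
    simp only [mem_product, mem_filter, mem_univ, true_and, and_true] at h ⊢
    intro y
    rw [orb_subtypeCongr w b w' b' hx]
    exact ⟨fun h => h.1, fun h' => ⟨h', isTrans_iff.1 h _ _⟩⟩
  · rintro ⟨⟨w, b⟩, ⟨w', b'⟩⟩ _ ⟨⟨v, c⟩, ⟨v', c'⟩⟩ _ h
    have h1 := Perm.subtypeCongrHom_injective p
      (a₁ := (w, w')) (a₂ := (v, v')) (congrArg Prod.fst h)
    have h2 := Perm.subtypeCongrHom_injective p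
      (a₁ := (b, b')) (a₂ := (c, c')) (congrArg Prod.snd h)
    simp only [Prod.mk.injEq] at h1 h2 ⊢
    exact ⟨⟨h1.1, h2.1⟩, h1.2, h2.2⟩
  · rintro ⟨w, b⟩ h
    simp only [mem_filter, mem_univ, true_and] at h
    have hmem : ∀ y, p y ↔ orb w b x y := fun y => (h y).symm
    obtain ⟨w1, w2, rfl⟩ := exists_subtypeCongr (p := p) w (fun y => by
      rw [hmem, hmem]
      exact ⟨fun t => (orb w b).trans t ((orb w b).symm (orb_left w b y)),
        fun t => (orb w b).trans t (orb_left w b y)⟩)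
    obtain ⟨b1, b2, rfl⟩ := exists_subtypeCongr (p := p) b (fun y => by
      rw [hmem, hmem]
      exact ⟨fun t => (orb _ b).trans t ((orb _ b).symm (orb_right _ b y)),
        fun t => (orb _ b).trans t (orb_right _ b y)⟩)
    refine ⟨⟨⟨w1, b1⟩, ⟨w2, b2⟩⟩, ?_, rfl⟩
    simp only [mem_product, mem_filter, mem_univ, true_and, and_true]
    rw [isTrans_iff]
    intro y z
    have hy := (orb_subtypeCongr w1 b1 w2 b2 hx y).1 ((hmem y).1 y.2)
    have hz := (orb_subtypeCongr w1 b1 w2 b2 hx z).1 ((hmem z).1 z.2)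
    exact (orb w1 b1).trans ((orb w1 b1).symm hy.2) hz.2
  · rintro ⟨⟨w, b⟩, ⟨w', b'⟩⟩ _
    exact (pairWeight_subtypeCongr U V q w b w' b').symm

/-- The exponential formula: a pair of permutations of `d + 1` points consists of a transitive pair
on the orbit of the first point and an arbitrary pair on the complement. -/
theorem pairSum_succ (U V : R) (q : ℕ → R) (d : ℕ) :
    pairSum (Fin (d + 1)) U V q = ∑ k ∈ range (d + 1),
      (d.choose k : R) * (transSum (Fin (k + 1)) U V q * pairSum (Fin (d - k)) U V q) := by
  -- Split the sum by the orbit `S` of the point `0`.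
  have hS : ∀ S : Finset (Fin (d + 1)), (0 : Fin (d + 1)) ∈ S →
      ∑ y : Perm (Fin (d + 1)) × Perm (Fin (d + 1)) with blk (orb y.1 y.2) 0 = S,
        pairWeight U V q y.1 y.2 =
      transSum (Fin S.card) U V q * pairSum (Fin (d + 1 - S.card)) U V q := by
    intro S h0
    have h := sum_orbit_eq U V q (p := fun y => y ∈ S) h0
    have hT := fun (i : Fintype {y // y ∈ S}) => @transSum_equiv _ _ i _ R _ S.equivFin U V q
    have e : {y // y ∉ S} ≃ Fin (d + 1 - S.card) := Fintype.equivFinOfCardEq (by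
      rw [Fintype.card_subtype_compl, Fintype.card_coe, Fintype.card_fin])
    have hA := fun (i : Fintype {y // y ∉ S}) => @pairSum_equiv _ _ i _ R _ e U V q
    rw [hT, hA] at h
    rw [← h]
    refine sum_congr ?_ fun _ _ => rfl
    ext y
    simp only [mem_filter, mem_univ, true_and, Finset.ext_iff, mem_blk]
  have h1 : pairSum (Fin (d + 1)) U V q = ∑ S : Finset (Fin (d + 1)) with (0 : Fin (d + 1)) ∈ S,
      transSum (Fin S.card) U V q * pairSum (Fin (d + 1 - S.card)) U V q := by
    rw [pairSum, ← sum_fiberwise_of_maps_to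
      (t := univ.filter fun S : Finset (Fin (d + 1)) => (0 : Fin (d + 1)) ∈ S)
      (g := fun y : Perm (Fin (d + 1)) × Perm (Fin (d + 1)) => blk (orb y.1 y.2) 0)
      (fun y _ => by simp [self_mem_blk])]
    refine sum_congr rfl fun S h0 => ?_
    rw [← hS S (mem_filter.1 h0).2]
    refine sum_congr ?_ fun _ _ => rfl
    ext y
    simp only [mem_filter, mem_univ, true_and]
  -- A set `S` that contains `0` is `0` together with a set `S.erase 0` of other points.
  have h2 : ∑ S : Finset (Fin (d + 1)) with (0 : Fin (d + 1)) ∈ S,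
      transSum (Fin S.card) U V q * pairSum (Fin (d + 1 - S.card)) U V q =
      ∑ S ∈ ((univ : Finset (Fin (d + 1))).erase 0).powerset,
        transSum (Fin (S.card + 1)) U V q * pairSum (Fin (d - S.card)) U V q := by
    refine sum_bij' (fun S _ => S.erase 0) (fun S _ => insert 0 S) ?_ ?_ ?_ ?_ ?_
    · intro S _
      exact mem_powerset.2 (erase_subset_erase _ (subset_univ _))
    · intro S _
      simp
    · intro S hS
      exact insert_erase (mem_filter.1 hS).2
    · intro S hS
      refine erase_insert fun h => ?_
      have := mem_powerset.1 hS h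
      simp at this
    · intro S hS
      have h3 := card_erase_add_one (mem_filter.1 hS).2
      rw [← h3, Nat.add_sub_add_right]
  rw [h1, h2, sum_powerset_apply_card (fun k =>
    transSum (Fin (k + 1)) U V q * pairSum (Fin (d - k)) U V q)]
  rw [card_erase_of_mem (mem_univ _), card_univ, Fintype.card_fin, Nat.add_sub_cancel]
  exact sum_congr rfl fun k _ => nsmul_eq_mul _ _

end Sums

/-! ### Exponentials of power series and derivations -/

section Exponential

open Finset MvPowerSeries

variable {R : Type*} [CommRing R] [Algebra ℂ R]

/-- The exponential of a power series without constant term. -/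
abbrev mvExp (h : MvPowerSeries ℕ R) : MvPowerSeries ℕ R := PowerSeries.subst h (PowerSeries.exp ℂ)

/-- The partial sums of the exponential series. -/
def expSum (h : MvPowerSeries ℕ R) (N : ℕ) : MvPowerSeries ℕ R :=
  ∑ k ∈ range N, ((k.factorial : ℂ)⁻¹) • h ^ k

theorem coeff_complex_smul (c : ℂ) (f : MvPowerSeries ℕ R) (ν : ℕ →₀ ℕ) :
    coeff ν (c • f) = c • coeff ν f := rfl

theorem coeff_mvExp {h : MvPowerSeries ℕ R} (h0 : constantCoeff h = 0) (ν : ℕ →₀ ℕ) {N : ℕ}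
    (hN : ν.degree < N) : coeff ν (mvExp h) = coeff ν (expSum h N) := by
  rw [mvExp, PowerSeries.coeff_subst (PowerSeries.HasSubst.of_constantCoeff_zero h0),
    finsum_eq_sum_of_support_subset (s := range N)]
  · rw [expSum, map_sum]
    refine sum_congr rfl fun k _ => ?_
    rw [PowerSeries.coeff_exp, coeff_complex_smul]
    simp
  · intro k hk
    by_contra hkN
    refine hk ?_
    simp only [coe_range, Set.mem_Iio, not_lt] at hkN
    change _ • coeff ν (h ^ k) = 0
    rw [coeff_eq_zero_of_constantCoeff_nilpotent (m := 1) (by simpa using h0) (by omega), smul_zero]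

theorem constantCoeff_mvExp {h : MvPowerSeries ℕ R} (h0 : constantCoeff h = 0) :
    constantCoeff (mvExp h) = 1 := by
  rw [← coeff_zero_eq_constantCoeff_apply, coeff_mvExp h0 0 (N := 1) (by simp), expSum]
  simp

omit [Algebra ℂ R] in
/-- Multiplication respects agreement in low degrees. -/
theorem coeff_mul_congr {f f' g g' : MvPowerSeries ℕ R} {ν : ℕ →₀ ℕ}
    (hf : ∀ i ≤ ν, coeff i f = coeff i f') (hg : ∀ i ≤ ν, coeff i g = coeff i g') :
    coeff ν (f * g) = coeff ν (f' * g') := by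
  classical
  rw [coeff_mul, coeff_mul]
  refine sum_congr rfl fun p hp => ?_
  have := mem_antidiagonal.1 hp
  rw [hf p.1 (this ▸ le_self_add), hg p.2 (this ▸ le_add_self)]

/-- The chain rule for a derivation that lowers degrees at most by one. -/
theorem deriv_mvExp (D : Derivation ℂ (MvPowerSeries ℕ R) (MvPowerSeries ℕ R))
    (hD : ∀ (N : ℕ) (f : MvPowerSeries ℕ R), (∀ ν : ℕ →₀ ℕ, ν.degree < N + 1 → coeff ν f = 0) →
      ∀ ν : ℕ →₀ ℕ, ν.degree < N → coeff ν (D f) = 0)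
    {h : MvPowerSeries ℕ R} (h0 : constantCoeff h = 0) : D (mvExp h) = mvExp h * D h := by
  have hS : ∀ N, D (expSum h (N + 1)) = expSum h N * D h := by
    intro N
    rw [expSum, map_sum, sum_range_succ', expSum, sum_mul]
    simp only [Derivation.map_smul, Derivation.leibniz_pow, pow_zero, Derivation.map_one_eq_zero,
      smul_zero, add_zero, Nat.add_sub_cancel]
    refine sum_congr rfl fun k _ => ?_
    have hk : ((k + 1 : ℕ) : ℂ) ≠ 0 := by exact_mod_cast k.succ_ne_zero
    rw [smul_eq_mul, ← Nat.cast_smul_eq_nsmul ℂ, smul_smul, Nat.factorial_succ, smul_mul_assoc]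
    congr 1
    push_cast at hk ⊢
    field_simp
  ext ν
  have h1 : coeff ν (D (mvExp h - expSum h (ν.degree + 1 + 1))) = 0 :=
    hD (ν.degree + 1) _ (fun i hi => by
      rw [map_sub, coeff_mvExp h0 i hi, sub_self]) ν (Nat.lt_succ_self _)
  rw [map_sub, map_sub, sub_eq_zero, hS] at h1
  rw [h1]
  refine coeff_mul_congr (fun i hi => ?_) fun _ _ => rfl
  rw [coeff_mvExp h0 i]
  exact Nat.lt_succ_of_le (Finsupp.degree_mono hi)

theorem pderiv_mvExp (i : ℕ) {h : MvPowerSeries ℕ R} (h0 : constantCoeff h = 0) :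
    pderiv R i (mvExp h) = mvExp h * pderiv R i h := by
  refine deriv_mvExp ((pderiv R i).restrictScalars ℂ) (fun N f hf ν hν => ?_) h0
  change coeff ν (pderiv R i f) = 0
  rw [coeff_pderiv, hf _ (by simpa using hν), zero_mul]

/-- The weight of a monomial, where the variable of index `i` has weight `i + 1`. -/
def wt : (ℕ →₀ ℕ) →+ ℕ := Finsupp.weight fun i => i + 1

theorem wt_single (i n : ℕ) : wt (Finsupp.single i n) = n * (i + 1) := by
  simp [wt, Finsupp.weight_single]

theorem wt_apply (ν : ℕ →₀ ℕ) : wt ν = ν.sum fun i n => n * (i + 1) := by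
  simp [wt, Finsupp.weight_apply]

theorem wt_eq_zero {ν : ℕ →₀ ℕ} (h : wt ν = 0) : ν = 0 := by
  ext i
  rw [wt_apply, Finsupp.sum] at h
  by_contra hi
  have := (Finset.sum_eq_zero_iff.1 h) i (Finsupp.mem_support_iff.2 hi)
  simp at this
  exact hi this

/-- The Euler derivation of the grading by weight. -/
def euler : Derivation ℂ (MvPowerSeries ℕ R) (MvPowerSeries ℕ R) where
  toFun f := fun ν => (wt ν : R) * coeff ν f
  map_add' f g := by
    ext ν
    change (wt ν : R) * coeff ν (f + g) = (wt ν : R) * coeff ν f + (wt ν : R) * coeff ν g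
    rw [map_add, mul_add]
  map_smul' c f := by
    ext ν
    change (wt ν : R) * coeff ν (c • f) = c • ((wt ν : R) * coeff ν f)
    rw [coeff_complex_smul, mul_smul_comm]
  map_one_eq_zero' := by
    classical
    ext ν
    change (wt ν : R) * coeff ν 1 = 0
    rw [coeff_one]
    split_ifs with h <;> simp [h]
  leibniz' f g := by
    classical
    ext ν
    let E : MvPowerSeries ℕ R → MvPowerSeries ℕ R := fun f ν => (wt ν : R) * coeff ν f
    change (wt ν : R) * coeff ν (f * g) = coeff ν (f * E g) + coeff ν (g * E f)
    rw [mul_comm g, coeff_mul, coeff_mul, coeff_mul, mul_sum, ← sum_add_distrib]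
    refine sum_congr rfl fun p hp => ?_
    change (wt ν : R) * _ = coeff p.1 f * ((wt p.2 : R) * coeff p.2 g) +
      ((wt p.1 : R) * coeff p.1 f) * coeff p.2 g
    rw [← mem_antidiagonal.1 hp, map_add]
    push_cast
    ring

theorem coeff_euler (f : MvPowerSeries ℕ R) (ν : ℕ →₀ ℕ) :
    coeff ν (euler f) = (wt ν : R) * coeff ν f := rfl

theorem euler_mvExp {h : MvPowerSeries ℕ R} (h0 : constantCoeff h = 0) :
    euler (mvExp h) = mvExp h * euler h := by
  refine deriv_mvExp euler (fun N f hf ν hν => ?_) h0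
  rw [coeff_euler, hf _ (by omega), mul_zero]

theorem natCast_mul_cancel {n : ℕ} (hn : n ≠ 0) {x y : R} (h : (n : R) * x = n * y) : x = y := by
  have hn' : (n : ℂ) ≠ 0 := by exact_mod_cast hn
  have h1 : ∀ z : R, (n : ℂ)⁻¹ • ((n : R) * z) = z := by
    intro z
    rw [← nsmul_eq_mul, ← Nat.cast_smul_eq_nsmul ℂ, smul_smul, inv_mul_cancel₀ hn', one_smul]
  rw [← h1 x, h, h1]

/-- A power series is determined by its constant term and its logarithmic Euler derivative. -/
theorem eq_of_euler_eq {X Y H : MvPowerSeries ℕ R} (hX : euler X = X * H) (hY : euler Y = Y * H)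
    (h0 : constantCoeff X = constantCoeff Y) (hH : constantCoeff H = 0) : X = Y := by
  classical
  have key : ∀ d (ν : ℕ →₀ ℕ), wt ν = d → coeff ν X = coeff ν Y := by
    intro d
    induction d using Nat.strong_induction_on with
    | _ d ih =>
      intro ν hν
      rcases Nat.eq_zero_or_pos d with rfl | hd
      · rw [wt_eq_zero hν]
        exact h0
      · have h1 := congrArg (coeff ν) hX
        have h2 := congrArg (coeff ν) hY
        rw [coeff_euler, coeff_mul] at h1 h2
        refine natCast_mul_cancel (n := wt ν) (by omega) ?_
        rw [h1, h2]
        refine sum_congr rfl fun p hp => ?_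
        by_cases hp2 : p.2 = 0
        · rw [hp2, coeff_zero_eq_constantCoeff_apply, hH, mul_zero, mul_zero]
        · have h3 : wt p.1 + wt p.2 = d := by
            rw [← map_add, mem_antidiagonal.1 hp, hν]
          have h4 : wt p.2 ≠ 0 := fun h => hp2 (wt_eq_zero h)
          rw [ih (wt p.1) (by omega) p.1 rfl]
  ext ν
  exact key _ ν rfl

theorem constantCoeff_euler (h : MvPowerSeries ℕ R) : constantCoeff (euler h) = 0 := by
  rw [← coeff_zero_eq_constantCoeff_apply, coeff_euler]
  simp

theorem mvExp_add {f g : MvPowerSeries ℕ R} (hf : constantCoeff f = 0)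
    (hg : constantCoeff g = 0) : mvExp (f + g) = mvExp f * mvExp g := by
  have hfg : constantCoeff (f + g) = 0 := by rw [map_add, hf, hg, add_zero]
  refine eq_of_euler_eq (euler_mvExp hfg) (H := euler (f + g)) ?_ ?_ (constantCoeff_euler _)
  · rw [Derivation.leibniz, euler_mvExp hf, euler_mvExp hg, map_add, smul_eq_mul, smul_eq_mul]
    ring
  · rw [constantCoeff_mvExp hfg, map_mul, constantCoeff_mvExp hf, constantCoeff_mvExp hg, mul_one]

/-- A series with Euler derivative `Z * euler F` is the exponential of `F`. -/
theorem eq_mvExp_of_euler {Z F : MvPowerSeries ℕ R} (hF : constantCoeff F = 0)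
    (hZ : constantCoeff Z = 1) (h : euler Z = Z * euler F) : mvExp F = Z :=
  eq_of_euler_eq (euler_mvExp hF) h (by rw [constantCoeff_mvExp hF, hZ]) (constantCoeff_euler _)

theorem map_mvExp {S : Type*} [CommRing S] [Algebra ℂ S] (φ : R →ₐ[ℂ] S) {h : MvPowerSeries ℕ R}
    (h0 : constantCoeff h = 0) :
    map (φ : R →+* S) (mvExp h) = mvExp (map (φ : R →+* S) h) := by
  have h0' : constantCoeff (map (φ : R →+* S) h) = 0 := by rw [constantCoeff_map, h0, map_zero]
  ext ν
  rw [coeff_map, coeff_mvExp h0 ν (Nat.lt_succ_self _), coeff_mvExp h0' ν (Nat.lt_succ_self _),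
    expSum, expSum, map_sum, map_sum, map_sum]
  refine sum_congr rfl fun k _ => ?_
  rw [coeff_complex_smul, coeff_complex_smul, ← map_pow, coeff_map]
  exact map_smul φ _ _

theorem rescale_mvExp (c : ℕ → R) {h : MvPowerSeries ℕ R} (h0 : constantCoeff h = 0) :
    rescale c (mvExp h) = mvExp (rescale c h) := by
  have h0' : constantCoeff (rescale c h) = 0 := by
    rw [← coeff_zero_eq_constantCoeff_apply, coeff_rescale, coeff_zero_eq_constantCoeff_apply, h0,
      mul_zero]
  ext ν
  rw [coeff_rescale, coeff_mvExp h0 ν (Nat.lt_succ_self _),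
    coeff_mvExp h0' ν (Nat.lt_succ_self _), expSum, expSum, map_sum, map_sum, mul_sum]
  refine sum_congr rfl fun k _ => ?_
  rw [coeff_complex_smul, coeff_complex_smul, ← map_pow, coeff_rescale,
    mul_smul_comm]

end Exponential

/-! ### Generating series of pairs of permutations -/

section GeneratingSeries

open Equiv Finset MvPowerSeries Classical

variable {R : Type*} [CommRing R] [Algebra ℂ R]

/-- The cycle type of a permutation as a monomial: the variable of index `i` for every cycle of
length `i + 1`. -/
def cycMon {E : Type*} [Fintype E] (f : Perm E) : ℕ →₀ ℕ :=
  ∑ s ∈ blks (cycSetoid f), Finsupp.single (s.card - 1) 1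

theorem card_pos_of_mem_blks {E : Type*} [Fintype E] {r : Setoid E} {s : Finset E}
    (hs : s ∈ blks r) : 0 < s.card := by
  obtain ⟨x, rfl⟩ := mem_blks.1 hs
  exact card_blk_pos r x

theorem wt_cycMon {E : Type*} [Fintype E] (f : Perm E) : wt (cycMon f) = Fintype.card E := by
  rw [cycMon, map_sum, ← sum_card_blks (cycSetoid f)]
  refine sum_congr rfl fun s hs => ?_
  rw [wt_single, one_mul, Nat.sub_add_cancel (card_pos_of_mem_blks hs)]

omit [Algebra ℂ R] in
theorem cycProd_X {E : Type*} [Fintype E] (f : Perm E) :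
    cycProd f (fun k => (X (k - 1) : MvPowerSeries ℕ R)) = monomial (cycMon f) 1 := by
  rw [cycProd, blkProd, cycMon]
  induction blks (cycSetoid f) using Finset.induction_on with
  | empty => simp
  | insert s t hs ih =>
    rw [prod_insert hs, sum_insert hs, ih, X, monomial_mul_monomial, one_mul]

/-- The coefficient of `ν` in the sum of the weights of the pairs of permutations that satisfy a
condition `P`. -/
def typeSum {E : Type*} [Fintype E] (P : Perm E → Perm E → Prop) (U V : R) (ν : ℕ →₀ ℕ) : R :=
  ∑ x : Perm E × Perm E,
    if P x.1 x.2 ∧ cycMon (x.1 * x.2) = ν then U ^ cycCount x.1 * V ^ cycCount x.2 else 0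

/-- All pairs of permutations of `d` points. -/
abbrev allPairs (d : ℕ) : Perm (Fin d) → Perm (Fin d) → Prop := fun _ _ => True

/-- The pairs of permutations of `d` points that generate a transitive group. -/
abbrev transPairs (d : ℕ) : Perm (Fin d) → Perm (Fin d) → Prop := fun w b => IsTrans w b

omit [Algebra ℂ R] in
theorem typeSum_eq_zero {d : ℕ} {P : Perm (Fin d) → Perm (Fin d) → Prop} (U V : R)
    {ν : ℕ →₀ ℕ} (h : wt ν ≠ d) : typeSum P U V ν = 0 := by
  refine sum_eq_zero fun x _ => if_neg ?_
  rintro ⟨-, hx⟩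
  refine h ?_
  rw [← hx, wt_cycMon, Fintype.card_fin]

omit [Algebra ℂ R] in
theorem coeff_pairWeight {d : ℕ} (U V : R) (w b : Perm (Fin d)) (ν : ℕ →₀ ℕ) :
    coeff ν (pairWeight (C U) (C V) (fun k => (X (k - 1) : MvPowerSeries ℕ R)) w b) =
      if cycMon (w * b) = ν then U ^ cycCount w * V ^ cycCount b else 0 := by
  rw [pairWeight, cycProd_X, ← map_pow, ← map_pow, ← map_mul, coeff_C_mul, coeff_monomial]
  simp only [eq_comm, mul_ite, mul_one, mul_zero]

omit [Algebra ℂ R] in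
theorem coeff_pairSum (U V : R) (d : ℕ) (ν : ℕ →₀ ℕ) :
    coeff ν (pairSum (Fin d) (C U) (C V) (fun k => (X (k - 1) : MvPowerSeries ℕ R))) =
      typeSum (allPairs d) U V ν := by
  rw [pairSum, map_sum, typeSum]
  refine sum_congr rfl fun x _ => ?_
  rw [coeff_pairWeight]
  simp

omit [Algebra ℂ R] in
theorem coeff_transSum (U V : R) (d : ℕ) (ν : ℕ →₀ ℕ) :
    coeff ν (transSum (Fin d) (C U) (C V) (fun k => (X (k - 1) : MvPowerSeries ℕ R))) =
      typeSum (transPairs d) U V ν := by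
  rw [transSum, map_sum, typeSum]
  refine sum_congr rfl fun x _ => ?_
  rw [apply_ite (coeff ν), coeff_pairWeight, map_zero, ite_and]

/-- The exponential generating series of all pairs of permutations. -/
def pairSeries (U V : R) : MvPowerSeries ℕ R := fun ν =>
  (((wt ν).factorial : ℂ)⁻¹) • typeSum (allPairs (wt ν)) U V ν

/-- The exponential generating series of the pairs of permutations that generate a transitive
group. -/
def transSeries (U V : R) : MvPowerSeries ℕ R := fun ν =>
  if ν = 0 then 0 else
    (((wt ν).factorial : ℂ)⁻¹) • typeSum (transPairs (wt ν)) U V ν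

theorem coeff_pairSeries (U V : R) (ν : ℕ →₀ ℕ) : coeff ν (pairSeries U V) =
    (((wt ν).factorial : ℂ)⁻¹) • typeSum (allPairs (wt ν)) U V ν := rfl

theorem coeff_transSeries (U V : R) (ν : ℕ →₀ ℕ) : coeff ν (transSeries U V) =
    if ν = 0 then 0 else
      (((wt ν).factorial : ℂ)⁻¹) • typeSum (transPairs (wt ν)) U V ν := rfl

theorem constantCoeff_transSeries (U V : R) : constantCoeff (transSeries U V) = 0 := by
  rw [← coeff_zero_eq_constantCoeff_apply, coeff_transSeries, if_pos rfl]

theorem constantCoeff_pairSeries (U V : R) : constantCoeff (pairSeries U V) = 1 := by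
  rw [← coeff_zero_eq_constantCoeff_apply, coeff_pairSeries]
  have h : ∀ (d : ℕ) (_ : d = 0), typeSum (allPairs d) U V 0 = 1 := by
    rintro d rfl
    have _ : Unique (Perm (Fin 0) × Perm (Fin 0)) := uniqueOfSubsingleton (1, 1)
    have h1 : ∀ f : Perm (Fin 0), cycMon f = 0 := fun f => wt_eq_zero (by rw [wt_cycMon]; simp)
    rw [typeSum, Fintype.sum_unique, if_pos ⟨trivial, h1 _⟩]
    simp [cycCount]
  rw [h _ (map_zero wt)]
  simp

/-- The exponential formula, as a differential equation for the series of all pairs. -/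
theorem euler_pairSeries (U V : R) :
    euler (pairSeries U V) = pairSeries U V * euler (transSeries U V) := by
  ext ν
  rw [coeff_euler, mul_comm (pairSeries U V), coeff_mul]
  rcases Nat.eq_zero_or_pos (wt ν) with h0 | h0
  · rw [h0, Nat.cast_zero, zero_mul]
    symm
    refine sum_eq_zero fun p hp => ?_
    have h1 : wt p.1 + wt p.2 = 0 := by rw [← map_add, mem_antidiagonal.1 hp, h0]
    rw [coeff_euler, show wt p.1 = 0 by omega]
    simp
  obtain ⟨d, hd⟩ : ∃ d, wt ν = d + 1 := ⟨wt ν - 1, by omega⟩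
  have h := congrArg (coeff ν) (pairSum_succ (C U) (C V)
    (fun k => (X (k - 1) : MvPowerSeries ℕ R)) d)
  rw [coeff_pairSum, map_sum] at h
  have h2 : ∀ k ∈ range (d + 1), coeff ν ((d.choose k : MvPowerSeries ℕ R) *
      (transSum (Fin (k + 1)) (C U) (C V) (fun k => (X (k - 1) : MvPowerSeries ℕ R)) *
        pairSum (Fin (d - k)) (C U) (C V) (fun k => (X (k - 1) : MvPowerSeries ℕ R)))) =
      ∑ p ∈ antidiagonal ν, (d.choose k : R) * (typeSum (transPairs (k + 1)) U V p.1 *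
        typeSum (allPairs (d - k)) U V p.2) := by
    intro k _
    rw [← map_natCast (C (σ := ℕ) (R := R)), coeff_C_mul, coeff_mul, mul_sum]
    refine sum_congr rfl fun p _ => ?_
    rw [coeff_transSum, coeff_pairSum]
  rw [sum_congr rfl h2, sum_comm] at h
  rw [coeff_pairSeries, hd, h, mul_smul_comm, mul_sum, smul_sum]
  refine sum_congr rfl fun p hp => ?_
  have h1 : wt p.1 + wt p.2 = d + 1 := by rw [← map_add, mem_antidiagonal.1 hp, hd]
  rw [coeff_euler, coeff_transSeries, coeff_pairSeries]
  by_cases hp0 : p.1 = 0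
  · rw [hp0, map_zero, Nat.cast_zero, zero_mul, zero_mul, sum_eq_zero, mul_zero, smul_zero]
    intro k _
    rw [typeSum_eq_zero U V (by rw [map_zero]; omega), zero_mul, mul_zero]
  · have hw : wt p.1 ≠ 0 := fun h => hp0 (wt_eq_zero h)
    obtain ⟨k, hk⟩ : ∃ k, wt p.1 = k + 1 := ⟨wt p.1 - 1, by omega⟩
    have hk2 : wt p.2 = d - k := by omega
    rw [if_neg hp0, sum_eq_single k, hk, hk2]
    -- The weight `k + 1` of the Euler derivation turns `d.choose k / (d + 1)!` into the product of
    -- `(k + 1) / (k + 1)!` and `1 / (d - k)!`, up to the factor `d + 1` on the left.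
    · rw [← nsmul_eq_mul, ← nsmul_eq_mul, ← nsmul_eq_mul, ← Nat.cast_smul_eq_nsmul ℂ,
        ← Nat.cast_smul_eq_nsmul ℂ, ← Nat.cast_smul_eq_nsmul ℂ, smul_mul_assoc, smul_mul_smul_comm,
        smul_smul, smul_smul, smul_smul]
      congr 1
      have hkd : k ≤ d := by omega
      have hc : ((d.choose k : ℂ)) * (k.factorial * (d - k).factorial) = d.factorial := by
        rw [← Nat.choose_mul_factorial_mul_factorial hkd]
        push_cast
        ring
      have e1 : (k.factorial : ℂ) ≠ 0 := by exact_mod_cast k.factorial_ne_zero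
      have e2 : ((d - k).factorial : ℂ) ≠ 0 := by exact_mod_cast (d - k).factorial_ne_zero
      have e3 : (d.factorial : ℂ) ≠ 0 := by exact_mod_cast d.factorial_ne_zero
      have e4 : ((d : ℂ) + 1) ≠ 0 := by exact_mod_cast d.succ_ne_zero
      have e5 : ((k : ℂ) + 1) ≠ 0 := by exact_mod_cast k.succ_ne_zero
      rw [Nat.factorial_succ, Nat.factorial_succ]
      push_cast
      rw [← hc] at e3 ⊢
      have e6 : (d.choose k : ℂ) ≠ 0 := left_ne_zero_of_mul e3
      field_simp
    · intro j _ hj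
      rw [typeSum_eq_zero U V (by omega), zero_mul, mul_zero]
    · intro hk3
      exact absurd (mem_range.2 (by omega)) hk3

/-- All pairs of permutations are counted by the exponential of the series of transitive pairs. -/
theorem mvExp_transSeries (U V : R) : mvExp (transSeries U V) = pairSeries U V :=
  eq_mvExp_of_euler (constantCoeff_transSeries U V) (constantCoeff_pairSeries U V)
    (euler_pairSeries U V)

end GeneratingSeries

/-! ### The number of permutations of a given cycle type -/

section CycleType

open Equiv Finset Classical

variable {E : Type*} [Fintype E]

theorem blk_of_not_fixed (f : Perm E) {x : E} (hx : f x ≠ x) :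
    blk (cycSetoid f) x = (f.cycleOf x).support := by
  ext y
  rw [mem_blk, cycSetoid_apply, Perm.mem_support_cycleOf_iff]
  exact ⟨fun h => ⟨h, Perm.mem_support.2 hx⟩, fun h => h.1⟩

theorem blks_eq_union (f : Perm E) :
    blks (cycSetoid f) = f.cycleFactorsFinset.image Perm.support ∪
      ({x | f x = x} : Finset E).image fun x => {x} := by
  ext s
  simp only [mem_blks, mem_union, mem_image, mem_filter, mem_univ, true_and]
  constructor
  · rintro ⟨x, rfl⟩
    by_cases hx : f x = x
    · exact Or.inr ⟨x, hx, (blk_of_fixed hx).symm⟩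
    · exact Or.inl ⟨f.cycleOf x,
        Perm.cycleOf_mem_cycleFactorsFinset_iff.2 (Perm.mem_support.2 hx),
        (blk_of_not_fixed f hx).symm⟩
  · rintro (⟨c, hc, rfl⟩ | ⟨x, hx, rfl⟩)
    · obtain ⟨x, hx⟩ := (Perm.mem_cycleFactorsFinset_iff.1 hc).1.nonempty_support
      have h1 : c = f.cycleOf x := Perm.cycle_is_cycleOf hx hc
      refine ⟨x, ?_⟩
      rw [blk_of_not_fixed, ← h1]
      rw [h1] at hx
      exact Perm.mem_support.1 (Perm.support_cycleOf_le f x hx)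
    · exact ⟨x, blk_of_fixed hx⟩

theorem cycMon_apply (f : Perm E) (i : ℕ) :
    cycMon f i = #{s ∈ blks (cycSetoid f) | s.card = i + 1} := by
  rw [cycMon, Finsupp.finsetSum_apply, card_filter]
  refine sum_congr rfl fun s hs => ?_
  have := card_pos_of_mem_blks hs
  rw [Finsupp.single_apply]
  refine if_congr ?_ rfl rfl
  omega

theorem cycMon_apply_of_pos (f : Perm E) {i : ℕ} (hi : 0 < i) :
    cycMon f i = f.cycleType.count (i + 1) := by
  rw [cycMon_apply, blks_eq_union, filter_union, Perm.cycleType_def, Multiset.count_map]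
  have h2 : {s ∈ ({x | f x = x} : Finset E).image (fun x => ({x} : Finset E)) |
      s.card = i + 1} = ∅ := by
    refine filter_eq_empty_iff.2 fun s hs => ?_
    obtain ⟨x, -, rfl⟩ := mem_image.1 hs
    rw [card_singleton]
    omega
  rw [h2, union_empty, filter_image, card_image_of_injOn]
  · rw [Finset.card, filter_val]
    congr 1
    exact Multiset.filter_congr fun c _ => ⟨fun h => h.symm, fun h => h.symm⟩
  · intro c hc c' hc' h
    have hc1 := (mem_filter.1 hc).1
    have hc2 := (mem_filter.1 hc').1
    obtain ⟨x, hx⟩ := (Perm.mem_cycleFactorsFinset_iff.1 hc1).1.nonempty_support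
    rw [Perm.cycle_is_cycleOf hx hc1, Perm.cycle_is_cycleOf (h ▸ hx) hc2]

/-- The multiset of cycle lengths greater than `1` that is encoded by a monomial. -/
def longCycles (ν : ℕ →₀ ℕ) : Multiset ℕ :=
  ∑ i ∈ ν.support.erase 0, Multiset.replicate (ν i) (i + 1)

theorem count_longCycles (ν : ℕ →₀ ℕ) (n : ℕ) :
    (longCycles ν).count n = if 2 ≤ n then ν (n - 1) else 0 := by
  rw [longCycles, Multiset.count_sum']
  simp only [Multiset.count_replicate]
  split_ifs with h
  · by_cases hn : ν (n - 1) = 0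
    · rw [hn]
      refine sum_eq_zero fun i hi => ?_
      split_ifs with h'
      · subst h'
        simpa using hn
      · rfl
    · rw [sum_eq_single (n - 1)]
      · rw [if_pos (by omega)]
      · intro i _ hi
        rw [if_neg (by omega)]
      · intro h'
        exact absurd (mem_erase.2 ⟨by omega, Finsupp.mem_support_iff.2 hn⟩) h'
  · refine sum_eq_zero fun i hi => ?_
    have := (mem_erase.1 hi).1
    rw [if_neg (by omega)]

theorem sum_longCycles (ν : ℕ →₀ ℕ) : (longCycles ν).sum + ν 0 = wt ν := by
  have h : (longCycles ν).sum = ∑ i ∈ ν.support.erase 0, ν i * (i + 1) := by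
    rw [longCycles, Multiset.sum_sum]
    simp
  rw [h, wt_apply, Finsupp.sum]
  by_cases h0 : 0 ∈ ν.support
  · rw [← sum_erase_add _ _ h0]
    simp
  · rw [erase_eq_of_notMem h0]
    rw [Finsupp.notMem_support_iff.1 h0, add_zero]

/-- Mathlib's cycle type leaves out the fixed points; their number is determined by the weight. -/
theorem cycMon_eq_iff (f : Perm E) {ν : ℕ →₀ ℕ} (hν : wt ν = Fintype.card E) :
    cycMon f = ν ↔ f.cycleType = longCycles ν := by
  have h1 : ∀ n, f.cycleType.count n = if 2 ≤ n then cycMon f (n - 1) else 0 := by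
    intro n
    split_ifs with h
    · rw [cycMon_apply_of_pos f (by omega), Nat.sub_add_cancel (by omega)]
    · exact Multiset.count_eq_zero.2 fun hn => h (Perm.two_le_of_mem_cycleType hn)
  constructor
  · rintro rfl
    ext n
    rw [h1, count_longCycles]
  · intro h
    have h2 : ∀ i, 0 < i → cycMon f i = ν i := by
      intro i hi
      rw [cycMon_apply_of_pos f hi, h, count_longCycles, if_pos (by omega), Nat.add_sub_cancel]
    have h3 : longCycles (cycMon f) = longCycles ν := by
      ext n
      rw [count_longCycles, count_longCycles]
      split_ifs with hn
      · exact h2 _ (by omega)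
      · rfl
    have h4 := sum_longCycles (cycMon f)
    have h5 := sum_longCycles ν
    rw [h3, wt_cycMon] at h4
    ext i
    rcases Nat.eq_zero_or_pos i with rfl | hi
    · omega
    · exact h2 i hi

/-- The number of permutations with `ν i` cycles of length `i + 1` for every `i`. -/
theorem card_cycMon_mul (ν : ℕ →₀ ℕ) (hν : wt ν = Fintype.card E) :
    #{f : Perm E | cycMon f = ν} * ν.prod (fun i n => (i + 1) ^ n * n.factorial) =
      (Fintype.card E).factorial := by
  have h := Perm.card_of_cycleType_mul_eq E (longCycles ν)
  have h1 := sum_longCycles ν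
  rw [if_pos ⟨by omega, fun a ha => by
    by_contra h'
    have := Multiset.count_pos.2 ha
    rw [count_longCycles, if_neg h'] at this
    omega⟩] at h
  rw [← h]
  congr 1
  · congr 1
    ext f
    simp only [mem_filter, mem_univ, true_and]
    exact cycMon_eq_iff f hν
  · have h2 : Fintype.card E - (longCycles ν).sum = ν 0 := by omega
    have h3 : (longCycles ν).prod = ∏ i ∈ ν.support.erase 0, (i + 1) ^ ν i := by
      rw [longCycles, Multiset.prod_sum]
      simp
    have h4 : ∏ n ∈ (longCycles ν).toFinset, ((longCycles ν).count n).factorial =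
        ∏ i ∈ ν.support.erase 0, (ν i).factorial := by
      refine prod_bij' (fun n _ => n - 1) (fun i _ => i + 1) ?_ ?_ ?_ ?_ ?_
      · intro n hn
        have := Multiset.count_pos.2 (Multiset.mem_toFinset.1 hn)
        rw [count_longCycles] at this
        split_ifs at this with h'
        · exact mem_erase.2 ⟨by omega, Finsupp.mem_support_iff.2 (by omega)⟩
        · omega
      · intro i hi
        obtain ⟨hi0, hi1⟩ := mem_erase.1 hi
        rw [Multiset.mem_toFinset, ← Multiset.count_pos, count_longCycles, if_pos (by omega),
          Nat.add_sub_cancel]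
        exact Nat.pos_of_ne_zero (Finsupp.mem_support_iff.1 hi1)
      · intro n hn
        have := Multiset.count_pos.2 (Multiset.mem_toFinset.1 hn)
        rw [count_longCycles] at this
        split_ifs at this with h'
        · omega
        · omega
      · intro i _
        simp
      · intro n hn
        have := Multiset.count_pos.2 (Multiset.mem_toFinset.1 hn)
        rw [count_longCycles] at this ⊢
        split_ifs at this ⊢ with h'
        · rfl
        · omega
    rw [h2, h3, h4, mul_assoc, ← prod_mul_distrib, Finsupp.prod]
    by_cases h0 : 0 ∈ ν.support
    · rw [← mul_prod_erase _ _ h0]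
      simp
    · rw [erase_eq_of_notMem h0, Finsupp.notMem_support_iff.1 h0]
      simp

end CycleType

/-! ### The series of all pairs as an average over the Laguerre ensemble -/

section PairSeries

open Equiv Finset Classical MvPolynomial

theorem cycProd_eq_prod {E : Type*} [Fintype E] {R : Type*} [CommRing R] (f : Perm E)
    (q : ℕ → R) : cycProd f q = (cycMon f).prod fun i n => q (i + 1) ^ n := by
  rw [cycProd, blkProd, cycMon, ← Finsupp.prod_finsetSum_index (fun i => pow_zero _)
    (fun a m n => pow_add _ _ _)]
  refine prod_congr rfl fun s hs => ?_
  rw [Finsupp.prod_single_index (h := fun i n => q (i + 1) ^ n) (pow_zero _), pow_one,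
    Nat.sub_add_cancel (card_pos_of_mem_blks hs)]

/-- The sum over all pairs `(w, b)`, sorted by the product `f = w * b`. -/
theorem typeSum_true {E : Type*} [Fintype E] {R : Type*} [CommRing R] (U V : R) (ν : ℕ →₀ ℕ) :
    typeSum (fun _ _ : Perm E => True) U V ν =
      ∑ f : Perm E with cycMon f = ν, factorSum U V f := by
  rw [typeSum, Fintype.sum_prod_type, sum_filter]
  simp only [true_and]
  have h1 : ∀ w : Perm E, ∑ b : Perm E,
      (if cycMon (w * b) = ν then U ^ cycCount w * V ^ cycCount b else 0) =
      ∑ f : Perm E, if cycMon f = ν then U ^ cycCount w * V ^ cycCount (w⁻¹ * f) else 0 := by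
    intro w
    exact Fintype.sum_equiv (Equiv.mulLeft w) _ _ fun b => by simp
  refine (sum_congr rfl fun w _ => h1 w).trans ?_
  rw [sum_comm]
  refine sum_congr rfl fun f _ => ?_
  split_ifs
  · rw [factorSum]
  · simp

variable {K : Type*} [Field K] [CharZero K] [Algebra ℂ K] {a e : K} (n : ℕ)

omit [CharZero K] [Algebra ℂ K] in
theorem typeSum_true_mul (he : e ≠ 0) {E : Type} [Fintype E] (ν : ℕ →₀ ℕ)
    (hν : wt ν = Fintype.card E) :
    typeSum (fun _ _ : Perm E => True) (n : K) (n + a / e) ν *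
      (e ^ wt ν * ν.prod (fun i m => ((i + 1 : K)) ^ m * m.factorial) * laguerreAvg a e n 1) =
    (wt ν).factorial * laguerreAvg a e n (ν.prod fun i m => psum (Fin n) K (i + 1) ^ m) := by
  set c := ν.prod fun i m => psum (Fin n) K (i + 1) ^ m with hc
  have h1 : ∀ f : Perm E, cycMon f = ν →
      e ^ wt ν * laguerreAvg a e n 1 * factorSum (n : K) (n + a / e) f = laguerreAvg a e n c := by
    intro f hf
    have := laguerreAvg_cycProd (a := a) n he E f
    rw [cycProd_eq_prod, hf, ← hν] at this
    rw [hc, this]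
    ring
  have h2 : e ^ wt ν * laguerreAvg a e n 1 *
      typeSum (fun _ _ : Perm E => True) (n : K) (n + a / e) ν =
      #{f : Perm E | cycMon f = ν} * laguerreAvg a e n c := by
    rw [typeSum_true, mul_sum, sum_congr rfl (g := fun _ => laguerreAvg a e n c), sum_const,
      nsmul_eq_mul]
    intro f hf
    rw [← h1 f (mem_filter.1 hf).2]
  have h3 := congrArg (Nat.cast (R := K)) (card_cycMon_mul (E := E) ν hν)
  rw [← hν, Nat.cast_mul] at h3
  have h4 : ((ν.prod (fun i m => (i + 1) ^ m * m.factorial) : ℕ) : K) =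
      ν.prod (fun i m => ((i + 1 : K)) ^ m * m.factorial) := by
    simp [Finsupp.prod]
  rw [h4] at h3
  linear_combination ν.prod (fun i m => ((i + 1 : K)) ^ m * m.factorial) * h2 +
    laguerreAvg a e n c * h3

/-- The coefficients of the series of all pairs, at `U = n` and `V = n + a / e`, are averages of
products of power sums over the Laguerre ensemble of `n` points. -/
theorem coeff_pairSeries_mul (he : e ≠ 0) (ν : ℕ →₀ ℕ) :
    MvPowerSeries.coeff ν (pairSeries (n : K) (n + a / e)) *
      (e ^ wt ν * ν.prod (fun i m => ((i + 1 : K)) ^ m * m.factorial) * laguerreAvg a e n 1) =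
    laguerreAvg a e n (ν.prod fun i m => psum (Fin n) K (i + 1) ^ m) := by
  have h5 : ((wt ν).factorial : K) ≠ 0 := by exact_mod_cast (wt ν).factorial_ne_zero
  have h := typeSum_true_mul (a := a) n he (E := Fin (wt ν)) ν (by simp)
  rw [coeff_pairSeries, Algebra.smul_def, map_inv₀, map_natCast]
  refine mul_left_cancel₀ h5 ?_
  rw [mul_assoc, mul_inv_cancel_left₀ h5]
  exact h

end PairSeries

/-! ### The genus of a pair of permutations -/

section Genus

open Equiv Finset Classical

variable {E : Type*} [Fintype E]

/-- Multiplication by a transposition of two points on the same cycle splits this cycle. -/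
theorem not_sameCycle_mul_swap {f : Perm E} {x y : E} (hne : x ≠ y) (h : f.SameCycle x y) :
    ¬ (f * swap x y).SameCycle x y := by
  obtain ⟨n, hn, hy⟩ := h.exists_pow_eq_of_mem_support (f := f) (x := x) (y := y) (by
    rw [Perm.mem_support]
    intro hx
    exact hne ((sameCycle_of_fixed hx).1 h))
  have hx : f x ≠ x := fun hx => hne ((sameCycle_of_fixed hx).1 h)
  have h0 : 0 < n := by
    rcases Nat.eq_zero_or_pos n with rfl | h0
    · exact absurd hy hne
    · exact h0
  rw [← hy]
  exact (blk_mul_swap_pow f x h0 (by rwa [blk_of_not_fixed f hx])).2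

/-- The number of orbits of the group generated by two permutations. -/
def orbCount (w b : Perm E) : ℕ := Nat.card (Quotient (orb w b))

theorem orbCount_le_of_le {w b w' b' : Perm E} (h : orb w b ≤ orb w' b') :
    orbCount w' b' ≤ orbCount w b :=
  Nat.card_le_card_of_surjective (Quotient.map' id h) (by
    rintro ⟨x⟩
    exact ⟨⟦x⟧, rfl⟩)

/-- Multiplication by a transposition lowers the number of orbits by at most one: the orbits of
`(w, b)` are covered by those of `(w, b * swap x y)` and one further orbit. -/
theorem orbCount_le_mul_swap (w b : Perm E) (x y : E) :
    orbCount w b ≤ orbCount w (b * swap x y) + 1 := by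
  -- The map `g` identifies the orbit of `y` with the orbit of `x`.
  let q : E → Quotient (orb w b) := fun z => ⟦z⟧
  let g : E → Quotient (orb w b) := fun z => if q z = q y then q x else q z
  have hq : ∀ z z', orb w b z z' → q z = q z' := fun z z' h => Quotient.sound h
  have hg : ∀ z z', orb w b z z' → g z = g z' := fun z z' h => by
    simp only [g, hq z z' h]
  have hxy : g x = g y := by
    simp only [g, if_true]
    split_ifs <;> rfl
  have h1 : ∀ z z', orb w (b * swap x y) z z' → g z = g z' := by
    intro z z' h
    refine orb_le (r := Setoid.ker g) (fun z => hg _ _ (orb_left w b z)) (fun z => ?_) h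
    change g z = g ((b * swap x y) z)
    rw [Perm.mul_apply]
    have h2 := hg _ _ (orb_right w b (swap x y z))
    rw [← h2]
    by_cases hx : z = x
    · rw [hx, swap_apply_left, hxy]
    · by_cases hy : z = y
      · rw [hy, swap_apply_right, hxy]
      · rw [swap_apply_of_ne_of_ne hx hy]
  let G : Option (Quotient (orb w (b * swap x y))) → Quotient (orb w b) := fun o =>
    o.elim (q y) (Quotient.lift g h1)
  have hG : Function.Surjective G := by
    rintro ⟨z⟩
    by_cases hz : q z = q y
    · exact ⟨none, hz.symm⟩
    · exact ⟨some ⟦z⟧, if_neg hz⟩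
  have := Nat.card_le_card_of_surjective G hG
  rwa [Nat.card_eq_fintype_card (α := Option _), Fintype.card_option,
    ← Nat.card_eq_fintype_card] at this

omit [Fintype E] in
theorem orb_one (w : Perm E) : orb w 1 = cycSetoid w := by
  ext x y
  constructor
  · exact orb_le (r := cycSetoid w)
      (fun z => Perm.sameCycle_apply_right.2 (Perm.SameCycle.refl _ _))
      (fun z => (cycSetoid w).refl z)
  · exact sameCycle_le (r := orb w 1) (orb_left w 1)

omit [Fintype E] in
theorem orb_mul (w b : Perm E) {x y : E} (h : (w * b).SameCycle x y) : orb w b x y :=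
  sameCycle_le (r := orb w b)
    (fun z => (orb w b).trans (orb_right w b z) (orb_left w b (b z))) h

omit [Fintype E] in
theorem orb_mul_swap_le {w b : Perm E} {x y : E} (hxy : orb w b x y) :
    orb w (b * swap x y) ≤ orb w b := by
  intro z z' h
  refine orb_le (r := orb w b) (orb_left w b) (fun z => ?_) h
  rw [Perm.mul_apply]
  refine (orb w b).trans ?_ (orb_right w b _)
  by_cases hx : z = x
  · rw [hx, swap_apply_left]
    exact hxy
  · by_cases hy : z = y
    · rw [hy, swap_apply_right]
      exact (orb w b).symm hxy
    · rw [swap_apply_of_ne_of_ne hx hy]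

theorem cycCount_one : cycCount (1 : Perm E) = Fintype.card E := by
  rw [← Nat.card_eq_fintype_card]
  refine Nat.card_congr
    (Equiv.ofBijective (Quotient.lift id fun x y h => ?_) ⟨?_, fun x => ⟨⟦x⟧, rfl⟩⟩)
  · exact Perm.sameCycle_one.1 h
  · rintro ⟨x⟩ ⟨y⟩ h
    exact congrArg _ h

/-- **Riemann–Hurwitz** for a pair of permutations: the Euler characteristic of the surface is
twice the number of its components minus twice its genus. -/
theorem exists_genus (w b : Perm E) : ∃ g, 2 * g + cycCount w + cycCount b + cycCount (w * b) =
    Fintype.card E + 2 * orbCount w b := by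
  have hle : ∀ f : Perm E, cycCount f ≤ Fintype.card E := fun f => by
    rw [← Nat.card_eq_fintype_card]
    exact Nat.card_le_card_of_surjective (Quotient.mk _) Quotient.mk_surjective
  induction hd : Fintype.card E - cycCount b using Nat.strong_induction_on generalizing b with
  | _ d ih =>
    by_cases hb : b = 1
    · subst hb
      refine ⟨0, ?_⟩
      rw [mul_one, cycCount_one, orbCount, orb_one]
      change _ = _ + 2 * cycCount w
      ring
    obtain ⟨x, hx⟩ : ∃ x, b x ≠ x := by
      by_contra h
      push Not at h
      exact hb (Equiv.ext h)
    set y := b x with hy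
    have hsame : b.SameCycle x y := Perm.sameCycle_apply_right.2 (Perm.SameCycle.refl _ _)
    -- `b` is obtained from `c`, which has one cycle more, by uniting two cycles.
    set c := b * swap x y with hc
    have hcxy : ¬ c.SameCycle x y := not_sameCycle_mul_swap (Ne.symm hx) hsame
    have hbc : b = c * swap x y := by rw [hc, mul_assoc, swap_mul_self, mul_one]
    have h1 : cycCount b + 1 = cycCount c := by
      have := (isMerge_mul_swap hcxy).card_quotient hcxy
      rwa [← hbc] at this
    obtain ⟨g, hg⟩ := ih (Fintype.card E - cycCount c) (by have := hle c; omega) c rfl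
    have hcb : orb w c ≤ orb w b := orb_mul_swap_le (orb_right w b x)
    have hwb : w * b = w * c * swap x y := by rw [mul_assoc, ← hbc]
    by_cases hwc : (w * c).SameCycle x y
    -- `x` and `y` lie on the same cycle of `w * c`, which splits; the orbits do not change.
    · have hs := not_sameCycle_mul_swap (Ne.symm hx) hwc
      have h2 : cycCount (w * c) + 1 = cycCount (w * b) := by
        have := (isMerge_mul_swap hs).card_quotient hs
        rwa [mul_assoc (w * c), swap_mul_self, mul_one, ← hwb] at this
      have h3 : orbCount w b ≤ orbCount w c := orbCount_le_of_le hcb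
      have h4 : orbCount w c ≤ orbCount w b := orbCount_le_of_le (by
        rw [hbc]
        exact orb_mul_swap_le (orb_mul w c hwc))
      exact ⟨g, by omega⟩
    -- Two cycles of `w * c` are united.  If their orbits were different, two components are joined;
    -- otherwise the genus goes up by one.
    · have h2 : cycCount (w * b) + 1 = cycCount (w * c) := by
        have := (isMerge_mul_swap hwc).card_quotient hwc
        rwa [← hwb] at this
      have h3 := orbCount_le_mul_swap w c x y
      rw [← hbc] at h3
      have h4 : orbCount w b ≤ orbCount w c := orbCount_le_of_le hcb
      rcases Nat.lt_or_ge (orbCount w b) (orbCount w c) with h | h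
      · exact ⟨g, by omega⟩
      · exact ⟨g + 1, by omega⟩

/-- The genus of a dessin: the numbers of its white vertices, black vertices and poles. -/
theorem exists_genus_of_isTrans [Nonempty E] {w b : Perm E} (h : IsTrans w b) :
    ∃ g, 2 * g + cycCount w + cycCount b + cycCount (w * b) = Fintype.card E + 2 := by
  obtain ⟨g, hg⟩ := exists_genus w b
  have h1 : orbCount w b = 1 := by
    rw [orbCount, Nat.card_eq_one_iff_exists]
    obtain ⟨x⟩ := ‹Nonempty E›
    refine ⟨⟦x⟧, ?_⟩
    rintro ⟨y⟩
    exact Quotient.sound (isTrans_iff.1 h y x)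
  exact ⟨g, by omega⟩

theorem cycCount_pos [Nonempty E] (f : Perm E) : 0 < cycCount f := by
  obtain ⟨x⟩ := ‹Nonempty E›
  have : Nonempty (Quotient (cycSetoid f)) := ⟨⟦x⟧⟩
  exact Nat.card_pos

end Genus

/-! ### Labelled poles -/

section Labels

open Equiv Finset Classical

variable {E : Type*} [Fintype E] {m : ℕ}

/-- `p` labels the cycles of `f` such that the cycle with label `j` has length `μ j`. -/
def IsLabel (f : Perm E) (μ : Fin m → ℕ) (p : E → Fin m) : Prop :=
  (∀ x y, p x = p y ↔ f.SameCycle x y) ∧ ∀ j, Nat.card {x // p x = j} = μ j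

omit [Fintype E] in
theorem IsLabel.surjective {f : Perm E} {μ : Fin m → ℕ} {p : E → Fin m} (h : IsLabel f μ p)
    (hμ : ∀ j, 0 < μ j) : Function.Surjective p := by
  intro j
  have h1 := hμ j
  rw [← h.2 j] at h1
  obtain ⟨⟨x, hx⟩⟩ := (Nat.card_pos_iff.1 h1).1
  exact ⟨x, hx⟩

/-- The pole orders are the lengths of the cycles. -/
theorem IsLabel.cycMon_eq {f : Perm E} {μ : Fin m → ℕ} {p : E → Fin m} (h : IsLabel f μ p)
    (hμ : ∀ j, 0 < μ j) : cycMon f = ∑ j, Finsupp.single (μ j - 1) 1 := by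
  have h1 : ∀ x, blk (cycSetoid f) x = ({y | p y = p x} : Finset E) := by
    intro x
    ext y
    rw [mem_blk, mem_filter, cycSetoid_apply, ← h.1, eq_comm]
    simp
  have h2 : ∀ j, ({y | p y = j} : Finset E).card = μ j := by
    intro j
    rw [← h.2 j, Nat.card_eq_fintype_card, Fintype.card_subtype]
  rw [cycMon]
  symm
  refine sum_bij (fun j _ => ({y | p y = j} : Finset E)) ?_ ?_ ?_ ?_
  · intro j _
    obtain ⟨x, rfl⟩ := h.surjective hμ j
    exact mem_blks.2 ⟨x, h1 x⟩
  · intro j _ j' _ hj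
    obtain ⟨x, rfl⟩ := h.surjective hμ j
    have : x ∈ ({y | p y = p x} : Finset E) := by simp
    rw [hj] at this
    simpa using this
  · intro s hs
    obtain ⟨x, rfl⟩ := mem_blks.1 hs
    exact ⟨p x, mem_univ _, (h1 x).symm⟩
  · intro j _
    rw [h2]

theorem degree_cycMon (f : Perm E) : (cycMon f).degree = cycCount f := by
  rw [cycMon, map_sum]
  simp only [Finsupp.degree_single, sum_const, smul_eq_mul, mul_one]
  exact card_blks _

/-- The tuples of pole orders, diminished by one, whose monomial is `n`. -/
abbrev Tuples (n : ℕ →₀ ℕ) : Type := {ν : Fin n.degree → ℕ // ∑ j, Finsupp.single (ν j) 1 = n}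

instance finite_tuples (n : ℕ →₀ ℕ) : Finite (Tuples n) := by
  have h : ∀ (ν : Tuples n) j, ν.1 j ∈ n.support := by
    intro ν j
    rw [Finsupp.mem_support_iff]
    have := DFunLike.congr_fun ν.2 (ν.1 j)
    rw [← this, Finsupp.finsetSum_apply]
    refine (lt_of_lt_of_le Nat.zero_lt_one ?_).ne'
    refine le_trans ?_ (single_le_sum (f := fun i => Finsupp.single (ν.1 i) 1 (ν.1 j))
      (fun _ _ => Nat.zero_le _) (mem_univ j))
    simp
  refine Finite.of_injective (β := Fin n.degree → n.support) (fun ν j => ⟨ν.1 j, h ν j⟩) ?_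
  intro ν ν' hν
  ext j
  exact congrArg Subtype.val (congrFun hν j)

instance fintypeTuples (n : ℕ →₀ ℕ) : Fintype (Tuples n) := Fintype.ofFinite _

theorem sum_tuples {n : ℕ →₀ ℕ} (ν : Tuples n) : ∑ j, (ν.1 j + 1) = wt n := by
  conv_rhs => rw [← ν.2, map_sum]
  simp [wt_single]

/-- There are `m!` ways of labelling the `m` cycles of a permutation. -/
theorem sum_card_isLabel (f : Perm E) (n : ℕ →₀ ℕ) :
    ∑ ν : Tuples n, Nat.card {p // IsLabel f (fun j => ν.1 j + 1) p} =
      if cycMon f = n then n.degree.factorial else 0 := by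
  split_ifs with hf
  · rw [← Nat.card_sigma]
    have hQ : Fintype.card (Quotient (cycSetoid f)) = n.degree := by
      rw [← hf, degree_cycMon, ← Nat.card_eq_fintype_card]
    have hc : Nat.card (Quotient (cycSetoid f) ≃ Fin n.degree) = n.degree.factorial := by
      rw [Nat.card_eq_fintype_card, Fintype.card_equiv (Fintype.equivFinOfCardEq hQ), hQ]
    rw [← hc]
    have hb : ∀ x : (Σ ν : Tuples n, {p // IsLabel f (fun j => ν.1 j + 1) p}),
        Function.Bijective
          (Quotient.lift (s := cycSetoid f) x.2.1 fun a b h => (x.2.2.1 a b).2 h) := by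
      rintro ⟨ν, p, hp⟩
      constructor
      · rintro ⟨a⟩ ⟨b⟩ h
        exact Quotient.sound ((hp.1 a b).1 h)
      · intro j
        obtain ⟨x, hx⟩ := hp.surjective (fun j => Nat.succ_pos _) j
        exact ⟨⟦x⟧, hx⟩
    -- A tuple of orders together with a labelling is a bijection of the cycles with the labels.
    refine Nat.card_congr (Equiv.ofBijective (fun x => Equiv.ofBijective _ (hb x)) ⟨?_, ?_⟩)
    · rintro ⟨ν, p, hp⟩ ⟨ν', p', hp'⟩ h
      have h1 : p = p' := by
        ext x
        exact congrArg Fin.val (DFunLike.congr_fun h (⟦x⟧ : Quotient (cycSetoid f)))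
      subst h1
      have h2 : ν = ν' := by
        ext j
        exact Nat.succ_injective ((hp.2 j).symm.trans (hp'.2 j))
      subst h2
      rfl
    · intro e
      have h1 : ∀ x y : E, e ⟦x⟧ = e ⟦y⟧ ↔ f.SameCycle x y := by
        intro x y
        rw [e.apply_eq_iff_eq]
        exact Quotient.eq (r := cycSetoid f)
      have h2 : ∀ j, 0 < Nat.card {x : E // e ⟦x⟧ = j} := by
        intro j
        obtain ⟨⟨x⟩, hx⟩ := e.surjective j
        have : Nonempty {x : E // e ⟦x⟧ = j} := ⟨⟨x, hx⟩⟩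
        exact Nat.card_pos
      have h3 : IsLabel f (fun j => Nat.card {x : E // e ⟦x⟧ = j} - 1 + 1) fun x => e ⟦x⟧ :=
        ⟨h1, fun j => (Nat.sub_add_cancel (h2 j)).symm⟩
      have h4 := h3.cycMon_eq fun j => Nat.succ_pos _
      simp only [Nat.add_sub_cancel] at h4
      refine ⟨⟨⟨fun j => Nat.card {x : E // e ⟦x⟧ = j} - 1, h4 ▸ hf⟩, _, h3⟩, ?_⟩
      ext ⟨x⟩
      rfl
  · refine sum_eq_zero fun ν _ => ?_
    have : IsEmpty {p // IsLabel f (fun j => ν.1 j + 1) p} := by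
      refine ⟨fun p => hf ?_⟩
      rw [p.2.cycMon_eq fun j => Nat.succ_pos _]
      simpa using ν.2
    exact Nat.card_of_isEmpty

end Labels

/-! ### Weighted counts of dessins as numbers of pairs of permutations -/

section Counts

open Equiv Finset Classical

variable {m k l : ℕ} {μ : Fin m → ℕ}

theorem Dessin.ext' {Γ Γ' : Dessin k l μ} (h1 : Γ.white = Γ'.white) (h2 : Γ.black = Γ'.black)
    (h3 : Γ.pole = Γ'.pole) : Γ = Γ' := by
  cases Γ
  cases Γ'
  simp only at h1 h2 h3
  subst h1 h2 h3
  rfl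

/-- The relabelling of the edges of a dessin by a permutation. -/
def Dessin.conj (e : Perm (Fin (∑ j, μ j))) (Γ : Dessin k l μ) : Dessin k l μ where
  white := e.permCongr Γ.white
  black := e.permCongr Γ.black
  pole := fun x => Γ.pole (e.symm x)
  connected := (isTrans_equiv e Γ.white Γ.black).2 Γ.connected
  card_white := (cycCount_equiv e Γ.white).trans Γ.card_white
  card_black := (cycCount_equiv e Γ.black).trans Γ.card_black
  pole_eq_iff := fun x y => by
    rw [Γ.pole_eq_iff, ← cycSetoid_apply, ← cycSetoid_equiv e, e.apply_symm_apply,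
      e.apply_symm_apply, ← Equiv.permCongr_mul, cycSetoid_apply]
  pole_order := fun j => by
    rw [← Γ.pole_order j]
    exact Nat.card_congr (e.symm.subtypeEquiv fun x => Iff.rfl)

/-- The action of the permutations of the edges on the dessins. -/
instance Dessin.mulAction : MulAction (Perm (Fin (∑ j, μ j))) (Dessin k l μ) where
  smul := Dessin.conj
  one_smul _ := Dessin.ext' rfl rfl rfl
  mul_smul _ _ _ := Dessin.ext' rfl rfl rfl

/-- The isomorphisms of dessins are the permutations that carry one to the other. -/
theorem Dessin.smul_eq_iff (e : Perm (Fin (∑ j, μ j))) (Γ Γ' : Dessin k l μ) :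
    e • Γ = Γ' ↔ Dessin.IsIso Γ Γ' e := by
  constructor
  · rintro rfl
    refine ⟨?_, ?_, fun x => ?_⟩
    · ext x
      exact congrArg (fun y => ((e (Γ.white y) : Fin _) : ℕ)) (e.symm_apply_apply x).symm
    · ext x
      exact congrArg (fun y => ((e (Γ.black y) : Fin _) : ℕ)) (e.symm_apply_apply x).symm
    · exact congrArg Γ.pole (e.symm_apply_apply x)
  · rintro ⟨h1, h2, h3⟩
    refine Dessin.ext' ?_ ?_ ?_
    · change e.permCongr Γ.white = _
      rw [Equiv.permCongr_eq_mul, h1, mul_inv_cancel_right]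
    · change e.permCongr Γ.black = _
      rw [Equiv.permCongr_eq_mul, h2, mul_inv_cancel_right]
    · funext x
      change Γ.pole (e.symm x) = _
      rw [← h3, e.apply_symm_apply]

instance Dessin.finite : Finite (Dessin k l μ) := by
  refine Finite.of_injective (β := Perm (Fin (∑ j, μ j)) × Perm (Fin (∑ j, μ j)) ×
    (Fin (∑ j, μ j) → Fin m)) (fun Γ => (Γ.white, Γ.black, Γ.pole)) ?_
  intro Γ Γ' h
  simp only [Prod.mk.injEq] at h
  exact Dessin.ext' h.1 h.2.1 h.2.2

/-- The weighted number of orbits of a finite group action, the weight of an orbit being the inverse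
of the order of a stabilizer. -/
theorem finsum_inv_card_stabilizer {G D : Type*} [Group G] [MulAction G D] [Finite G] [Finite D]
    (s : Setoid D) (hs : s = MulAction.orbitRel G D) :
    ∑ᶠ q : Quotient s, 1 / (Nat.card (MulAction.stabilizer G q.out) : ℚ) =
      Nat.card D / Nat.card G := by
  subst hs
  have := Fintype.ofFinite G
  have := Fintype.ofFinite D
  have hG : (Fintype.card G : ℚ) ≠ 0 := by exact_mod_cast Fintype.card_ne_zero
  rw [finsum_eq_sum_of_fintype, Nat.card_eq_fintype_card, Nat.card_eq_fintype_card,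
    MulAction.card_eq_sum_card_group_div_card_stabilizer G D, Nat.cast_sum, sum_div]
  refine sum_congr rfl fun q _ => ?_
  have h1 : (Fintype.card (MulAction.stabilizer G q.out) : ℚ) ≠ 0 := by
    exact_mod_cast Fintype.card_ne_zero
  rw [Nat.cast_div (by
    rw [← Nat.card_eq_fintype_card, ← Nat.card_eq_fintype_card]
    exact Subgroup.card_subgroup_dvd_card _) h1, Nat.card_eq_fintype_card]
  field_simp

/-- The weighted number of isomorphism classes of dessins is the number of dessins on a given set of
edges, divided by the number of its permutations. -/
theorem dessinCount_eq (k l : ℕ) (μ : Fin m → ℕ) :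
    dessinCount k l μ = Nat.card (Dessin k l μ) / ((∑ j, μ j).factorial : ℚ) := by
  have hs : Dessin.isoSetoid k l μ =
      MulAction.orbitRel (Perm (Fin (∑ j, μ j))) (Dessin k l μ) := by
    ext Γ Γ'
    refine Iff.trans ?_ (MulAction.orbitRel (Perm (Fin (∑ j, μ j))) (Dessin k l μ)).comm'
    exact exists_congr fun e => (Dessin.smul_eq_iff e Γ Γ').symm
  have h := finsum_inv_card_stabilizer _ hs
  rw [Nat.card_eq_fintype_card (α := Perm _), Fintype.card_perm, Fintype.card_fin] at h
  rw [← h, dessinCount]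
  refine finsum_congr fun q => ?_
  congr 2
  exact Nat.card_congr (Equiv.subtypeEquivRight fun e => (Dessin.smul_eq_iff e _ _).symm)

/-- The number of pairs of permutations of `E` with labelled poles, of type `(k, l, μ)`. -/
def pairCount (E : Type*) [Fintype E] (k l : ℕ) (μ : Fin m → ℕ) : ℕ :=
  ∑ x : Perm E × Perm E, if IsTrans x.1 x.2 ∧ cycCount x.1 = k ∧ cycCount x.2 = l then
    Nat.card {p // IsLabel (x.1 * x.2) μ p} else 0

theorem pairCount_eq (E : Type*) [Fintype E] (k l : ℕ) (μ : Fin m → ℕ) :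
    pairCount E k l μ = Nat.card {x : (Perm E × Perm E) × (E → Fin m) //
      (IsTrans x.1.1 x.1.2 ∧ cycCount x.1.1 = k ∧ cycCount x.1.2 = l) ∧
        IsLabel (x.1.1 * x.1.2) μ x.2} := by
  rw [Nat.card_congr (Equiv.subtypeProdEquivSigmaSubtype fun (a : Perm E × Perm E) b =>
      (IsTrans a.1 a.2 ∧ cycCount a.1 = k ∧ cycCount a.2 = l) ∧ IsLabel (a.1 * a.2) μ b),
    Nat.card_sigma, pairCount]
  refine sum_congr rfl fun x _ => ?_
  split_ifs with h
  · simp only [h, true_and, and_self]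
  · simp only [h, false_and]
    simp

theorem card_dessin (k l : ℕ) (μ : Fin m → ℕ) :
    Nat.card (Dessin k l μ) = pairCount (Fin (∑ j, μ j)) k l μ := by
  rw [pairCount_eq]
  exact Nat.card_congr
    { toFun := fun Γ => ⟨((Γ.white, Γ.black), Γ.pole),
        ⟨Γ.connected, Γ.card_white, Γ.card_black⟩, Γ.pole_eq_iff, Γ.pole_order⟩
      invFun := fun x => ⟨x.1.1.1, x.1.1.2, x.1.2, x.2.1.1, x.2.1.2.1, x.2.1.2.2, x.2.2.1, x.2.2.2⟩
      left_inv := fun Γ => rfl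
      right_inv := fun x => rfl }

/-- The sum over all pairs of permutations with labelled poles of a function of the numbers of their
cycles. -/
def labelSum (E : Type*) [Fintype E] {M : Type*} [AddCommMonoid M] (μ : Fin m → ℕ)
    (G : ℕ → ℕ → M) : M :=
  ∑ x : Perm E × Perm E, if IsTrans x.1 x.2 then
    Nat.card {p // IsLabel (x.1 * x.2) μ p} • G (cycCount x.1) (cycCount x.2) else 0

/-- The sum over the transitive pairs of permutations with pole orders given by the monomial `n`
of a function of the numbers of their cycles. -/
def transPairSum (E : Type*) [Fintype E] {M : Type*} [AddCommMonoid M] (n : ℕ →₀ ℕ)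
    (G : ℕ → ℕ → M) : M :=
  ∑ x : Perm E × Perm E, if IsTrans x.1 x.2 ∧ cycMon (x.1 * x.2) = n then
    G (cycCount x.1) (cycCount x.2) else 0

/-- Summing over the tuples of pole orders removes the labels. -/
theorem sum_labelSum (E : Type*) [Fintype E] {M : Type*} [AddCommMonoid M] (n : ℕ →₀ ℕ)
    (G : ℕ → ℕ → M) : ∑ ν : Tuples n, labelSum E (fun j => ν.1 j + 1) G =
      n.degree.factorial • transPairSum E n G := by
  simp only [labelSum]
  rw [sum_comm, transPairSum, smul_sum]
  refine sum_congr rfl fun x _ => ?_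
  by_cases h : IsTrans x.1 x.2
  · simp only [h, if_true, true_and]
    rw [← sum_smul, sum_card_isLabel]
    split_ifs <;> simp
  · simp [h]

/-- The possible genera and numbers of white and black vertices. -/
abbrev Genera (m d : ℕ) : Type :=
  {s : ℕ × ℕ × ℕ // 1 ≤ s.2.1 ∧ 1 ≤ s.2.2 ∧ 2 * s.1 + s.2.1 + s.2.2 + m = d + 2}

instance finite_genera (m d : ℕ) : Finite (Genera m d) := by
  refine Finite.of_injective (β := Fin (d + 3) × Fin (d + 3) × Fin (d + 3))
    (fun s => (⟨s.1.1, by have := s.2; omega⟩, ⟨s.1.2.1, by have := s.2; omega⟩,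
      ⟨s.1.2.2, by have := s.2; omega⟩)) ?_
  rintro ⟨⟨g, k, l⟩, hs⟩ ⟨⟨g', k', l'⟩, hs'⟩ h
  simpa using h

instance fintypeGenera (m d : ℕ) : Fintype (Genera m d) := Fintype.ofFinite _

/-- The numbers of cycles of a transitive pair satisfy the Riemann–Hurwitz relation, so a sum over
pairs is a sum over the possible genera and numbers of vertices. -/
theorem labelSum_eq (E : Type*) [Fintype E] [Nonempty E] {M : Type*} [AddCommMonoid M]
    (μ : Fin m → ℕ) (hμ : ∀ j, 0 < μ j) (G : ℕ → ℕ → M) :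
    labelSum E μ G = ∑ s : Genera m (Fintype.card E),
      pairCount E s.1.2.1 s.1.2.2 μ • G s.1.2.1 s.1.2.2 := by
  simp only [pairCount, sum_smul]
  rw [sum_comm, labelSum]
  refine sum_congr rfl fun x _ => ?_
  by_cases h : IsTrans x.1 x.2 ∧ Nat.card {p // IsLabel (x.1 * x.2) μ p} ≠ 0
  · obtain ⟨h, h'⟩ := h
    obtain ⟨⟨p, hp⟩⟩ := (Nat.card_ne_zero.1 h').1
    obtain ⟨g, hg⟩ := exists_genus_of_isTrans h
    have hm : cycCount (x.1 * x.2) = m := by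
      rw [← degree_cycMon, hp.cycMon_eq hμ, map_sum]
      simp
    rw [hm] at hg
    rw [if_pos h,
      sum_eq_single ⟨(g, cycCount x.1, cycCount x.2), cycCount_pos _, cycCount_pos _, hg⟩]
    · simp [h]
    · rintro ⟨⟨g', k', l'⟩, hs'⟩ _ hne
      rw [if_neg, zero_smul]
      rintro ⟨-, h1, h2⟩
      simp only at h1 h2
      subst h1 h2
      refine hne (Subtype.ext ?_)
      have : g' = g := by
        have := hs'.2.2
        simp only at this
        omega
      exact congrArg (fun i => (i, cycCount x.1, cycCount x.2)) this
    · intro h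
      exact absurd (mem_univ _) h
  · rw [sum_eq_zero, ite_eq_right_iff]
    · intro h1
      have : Nat.card {p // IsLabel (x.1 * x.2) μ p} = 0 := by
        by_contra h2
        exact h ⟨h1, h2⟩
      rw [this, zero_smul]
    · intro s _
      split_ifs with h1
      · have : Nat.card {p // IsLabel (x.1 * x.2) μ p} = 0 := by
          by_contra h2
          exact h ⟨h1.1, h2⟩
        rw [this, zero_smul]
      · rw [zero_smul]

variable {U : Opens ℂ}

/-- The contribution of a pair of permutations of `d` points with `m` poles, `k` white vertices and
`l` black vertices. -/
def pairTerm (u v : Hol U) (m d k l : ℕ) : Coef U :=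
  HahnSeries.single ((d : ℤ) - m - k - l) (u ^ k * v ^ l)

theorem single_smul {R : Type*} [CommRing R] [Algebra ℂ R] (c : ℂ) (i : ℤ) (x : R) :
    c • HahnSeries.single i x = HahnSeries.single i (c • x) := by
  ext j
  rw [HahnSeries.coeff_smul]
  by_cases h : j = i
  · rw [h, HahnSeries.coeff_single_same, HahnSeries.coeff_single_same]
  · rw [HahnSeries.coeff_single_of_ne h, HahnSeries.coeff_single_of_ne h, smul_zero]

/-- The correlator as a sum over pairs of permutations.  The exponent `2 g - 2` of `ε` equals
`d - m - k - l` by the Riemann–Hurwitz relation. -/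
theorem correlator_eq (u v : Hol U) (μ : Fin m → ℕ) (hμ : ∀ j, 0 < μ j) {d : ℕ} (hd : 0 < d)
    (hd' : ∑ j, μ j = d) : correlator u v μ =
      ((d.factorial : ℂ)⁻¹) • labelSum (Fin d) μ (pairTerm u v m d) := by
  subst hd'
  have : Nonempty (Fin (∑ j, μ j)) := ⟨⟨0, hd⟩⟩
  have h := labelSum_eq (Fin (∑ j, μ j)) μ hμ (pairTerm u v m (∑ j, μ j))
  rw [Fintype.card_fin] at h
  rw [h, smul_sum, correlator]
  refine (finsum_eq_sum_of_fintype (α := Genera m (∑ j, μ j)) _).trans ?_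
  refine sum_congr rfl fun s _ => ?_
  rw [dessinCount_eq, card_dessin, pairTerm, ← Nat.cast_smul_eq_nsmul ℂ, smul_smul,
    single_smul]
  have h2 := s.2.2.2
  congr 2
  · omega
  · push_cast
    rw [div_eq_inv_mul]

/-- The free energy as a sum over transitive pairs of permutations. -/
theorem coeff_dessinFreeEnergy (u v : Hol U) {n : ℕ →₀ ℕ} (hn : n ≠ 0) :
    MvPowerSeries.coeff n (dessinFreeEnergy u v) = (((wt n).factorial : ℂ)⁻¹) •
      transPairSum (Fin (wt n)) n (pairTerm u v n.degree (wt n)) := by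
  change (if n.degree = 0 then 0 else _) = _
  have hm : n.degree ≠ 0 := fun h => hn ((Finsupp.degree_eq_zero_iff n).1 h)
  have hw : 0 < wt n := Nat.pos_of_ne_zero fun h => hn (wt_eq_zero h)
  rw [if_neg hm]
  have h1 : (∑ᶠ ν : {ν : Fin n.degree → ℕ // ∑ j, Finsupp.single (ν j) 1 = n},
      correlator u v fun j => ν.1 j + 1) =
      (((wt n).factorial : ℂ)⁻¹) • (n.degree.factorial •
        transPairSum (Fin (wt n)) n (pairTerm u v n.degree (wt n))) := by
    rw [← sum_labelSum, smul_sum]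
    refine (finsum_eq_sum_of_fintype (α := Tuples n) _).trans ?_
    refine sum_congr rfl fun ν _ => ?_
    exact correlator_eq u v _ (fun j => Nat.succ_pos _) hw (sum_tuples ν)
  have hf : (n.degree.factorial : ℂ) ≠ 0 := by exact_mod_cast n.degree.factorial_ne_zero
  rw [h1, ← Nat.cast_smul_eq_nsmul ℂ, smul_comm _ (n.degree.factorial : ℂ), smul_smul,
    inv_mul_cancel₀ hf, one_smul]

end Counts

/-! ### Orthogonal polynomials -/

section OrthogonalPolynomials

open Finset Polynomial TensorProduct

variable {A : Type*} [CommRing A] (L : A[X] →ₗ[A] A)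

/-- The monic orthogonal polynomials of a moment functional, by Gram–Schmidt orthogonalization of
the powers of `X`.  They are orthogonal as long as the norms of those of smaller degree are units;
`Ring.inverse` is `0` on other elements. -/
def orthPoly (n : ℕ) : A[X] :=
  X ^ n - ∑ j : Fin n, (L (X ^ n * orthPoly j) * Ring.inverse (L (orthPoly j * orthPoly j))) •
    orthPoly j
termination_by n
decreasing_by all_goals exact j.2

/-- The square norms of the orthogonal polynomials. -/
def orthNorm (n : ℕ) : A := L (orthPoly L n * orthPoly L n)

/-- The inverse square norms of the orthogonal polynomials. -/
def orthInv (n : ℕ) : A := Ring.inverse (orthNorm L n)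

theorem orthPoly_eq (n : ℕ) : orthPoly L n =
    X ^ n - ∑ j ∈ range n, (L (X ^ n * orthPoly L j) * orthInv L j) • orthPoly L j := by
  rw [orthPoly, sum_range (fun j => (L (X ^ n * orthPoly L j) * orthInv L j) • orthPoly L j)]
  rfl

theorem degree_orthPoly_sub (n : ℕ) : (orthPoly L n - X ^ n).degree < (n : WithBot ℕ) := by
  induction n using Nat.strong_induction_on with
  | _ n ih =>
    rw [orthPoly_eq, sub_sub_cancel_left, degree_neg]
    refine (degree_sum_le _ _).trans_lt
      ((Finset.sup_lt_iff (WithBot.bot_lt_coe n)).2 fun j hj => ?_)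
    have hj := mem_range.1 hj
    refine (degree_smul_le _ _).trans_lt ?_
    have h1 : orthPoly L j = (orthPoly L j - X ^ j) + X ^ j := by ring
    rw [h1]
    refine (degree_add_le _ _).trans_lt (max_lt ((ih j hj).trans ?_) ?_)
    · exact Nat.cast_lt.2 hj
    · exact (degree_X_pow_le j).trans_lt (Nat.cast_lt.2 hj)

theorem degree_sub_smul_orthPoly {f : A[X]} {n : ℕ} (hf : f.degree < ((n + 1 : ℕ) : WithBot ℕ)) :
    (f - f.coeff n • orthPoly L n).degree < (n : WithBot ℕ) := by
  have h1 : f - f.coeff n • orthPoly L n =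
      (f - C (f.coeff n) * X ^ n) - f.coeff n • (orthPoly L n - X ^ n) := by
    rw [smul_sub, smul_eq_C_mul, smul_eq_C_mul]
    ring
  rw [h1]
  refine (degree_sub_le _ _).trans_lt (max_lt ?_
    ((degree_smul_le _ _).trans_lt (degree_orthPoly_sub L n)))
  rw [degree_lt_iff_coeff_zero] at hf ⊢
  intro m hm
  rw [coeff_sub, coeff_C_mul, coeff_X_pow]
  rcases hm.eq_or_lt with h | h
  · subst h
    simp
  · rw [hf m h, if_neg h.ne', mul_zero, sub_zero]

theorem degree_orthPoly_lt (n : ℕ) : (orthPoly L n).degree < ((n + 1 : ℕ) : WithBot ℕ) := by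
  have h1 : orthPoly L n = (orthPoly L n - X ^ n) + X ^ n := by ring
  rw [h1]
  refine (degree_add_le _ _).trans_lt (max_lt ((degree_orthPoly_sub L n).trans ?_) ?_)
  · exact_mod_cast Nat.lt_succ_self n
  · exact (degree_X_pow_le n).trans_lt (by exact_mod_cast Nat.lt_succ_self n)

theorem coeff_orthPoly_self (n : ℕ) : (orthPoly L n).coeff n = 1 := by
  have h := coeff_eq_zero_of_degree_lt (degree_orthPoly_sub L n)
  rw [coeff_sub, coeff_X_pow, if_pos rfl, sub_eq_zero] at h
  exact h

variable {L}

theorem orthNorm_mul_orthInv {n : ℕ} (h : IsUnit (orthNorm L n)) :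
    orthNorm L n * orthInv L n = 1 := Ring.mul_inverse_cancel _ h

theorem orthPoly_orthogonal {n : ℕ} (hu : ∀ j < n, IsUnit (orthNorm L j)) :
    ∀ i < n, L (orthPoly L i * orthPoly L n) = 0 := by
  induction n using Nat.strong_induction_on with
  | _ n ih =>
    intro i hi
    have h0 : ∀ j < n, j ≠ i → L (orthPoly L i * orthPoly L j) = 0 := by
      intro j hj hji
      rcases lt_or_gt_of_ne hji with h | h
      · rw [mul_comm]
        exact ih i hi (fun k hk => hu k (by omega)) j h
      · exact ih j hj (fun k hk => hu k (by omega)) i h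
    rw [orthPoly_eq L n, mul_sub, mul_sum, map_sub, map_sum, sum_eq_single i]
    · rw [mul_smul_comm, map_smul, smul_eq_mul, mul_assoc, mul_comm (orthInv L i)]
      change _ - _ * (orthNorm L i * _) = 0
      rw [orthNorm_mul_orthInv (hu i hi), mul_one, mul_comm (orthPoly L i), sub_self]
    · intro j hj hji
      rw [mul_smul_comm, map_smul, h0 j (mem_range.1 hj) hji, smul_zero]
    · intro h
      exact absurd (mem_range.2 hi) h

theorem map_mul_orthPoly_eq_zero {n : ℕ} (hu : ∀ j < n, IsUnit (orthNorm L j)) {f : A[X]}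
    (hf : f.degree < (n : WithBot ℕ)) : L (f * orthPoly L n) = 0 := by
  have key : ∀ k ≤ n, ∀ f : A[X], f.degree < (k : WithBot ℕ) → L (f * orthPoly L n) = 0 := by
    intro k
    induction k with
    | zero =>
      intro _ f hf
      rw [Nat.cast_zero, Nat.WithBot.lt_zero_iff, degree_eq_bot] at hf
      rw [hf, zero_mul, map_zero]
    | succ k ih =>
      intro hk f hf
      have h1 := ih (by omega) _ (degree_sub_smul_orthPoly L hf)
      rw [sub_mul, map_sub, smul_mul_assoc, map_smul, orthPoly_orthogonal hu k (by omega),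
        smul_zero, sub_zero] at h1
      exact h1
  exact key n le_rfl f hf

/-- The polynomials of degree less than `n` pair non-degenerately with the first `n` orthogonal
polynomials. -/
theorem eq_zero_of_orthogonal {n : ℕ} (hu : ∀ j < n, IsUnit (orthNorm L j)) {f : A[X]}
    (hf : f.degree < (n : WithBot ℕ)) (h : ∀ j < n, L (f * orthPoly L j) = 0) : f = 0 := by
  induction n with
  | zero =>
    rwa [Nat.cast_zero, Nat.WithBot.lt_zero_iff, degree_eq_bot] at hf
  | succ n ih =>
    have h1 := map_mul_orthPoly_eq_zero (fun j hj => hu j (by omega))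
      (degree_sub_smul_orthPoly L hf)
    rw [sub_mul, map_sub, h n (Nat.lt_succ_self n), zero_sub, neg_eq_zero, smul_mul_assoc, map_smul,
      smul_eq_mul] at h1
    change f.coeff n * orthNorm L n = 0 at h1
    have h2 : f.coeff n = 0 := by
      rwa [(hu n (Nat.lt_succ_self n)).mul_left_eq_zero] at h1
    have h3 := degree_sub_smul_orthPoly L hf
    rw [h2, zero_smul, sub_zero] at h3
    exact ih (fun j hj => hu j (by omega)) h3 fun j hj => h j (by omega)

variable (L)

/-- The matrix elements of multiplication by `X ^ k`. -/
def orthMat (k p q : ℕ) : A := L (X ^ k * (orthPoly L p * orthPoly L q))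

/-- The diagonal coefficients of the three term recurrence. -/
def orthV (n : ℕ) : A := orthMat L 1 n n * orthInv L n

/-- The subdiagonal coefficients of the three term recurrence. -/
def orthW : ℕ → A
  | 0 => 0
  | n + 1 => orthNorm L (n + 1) * orthInv L n

theorem orthMat_comm (k p q : ℕ) : orthMat L k p q = orthMat L k q p := by
  rw [orthMat, orthMat, mul_comm (orthPoly L p)]

variable {L}

theorem orthMat_one_succ {n : ℕ} (hu : ∀ j ≤ n, IsUnit (orthNorm L j)) :
    orthMat L 1 (n + 1) n = orthNorm L (n + 1) := by
  have h1 : (X * orthPoly L n - orthPoly L (n + 1)).degree < ((n + 1 : ℕ) : WithBot ℕ) := by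
    rw [degree_lt_iff_coeff_zero]
    intro m hm
    have h2 := degree_orthPoly_lt L n
    have h3 := degree_orthPoly_lt L (n + 1)
    rw [degree_lt_iff_coeff_zero] at h2 h3
    rcases hm.eq_or_lt with h | h
    · rw [← h, coeff_sub, coeff_X_mul, coeff_orthPoly_self, coeff_orthPoly_self, sub_self]
    · obtain ⟨m, rfl⟩ : ∃ i, m = i + 1 := ⟨m - 1, by omega⟩
      rw [coeff_sub, coeff_X_mul, h2 _ (by omega), h3 _ (by omega), sub_self]
  have h2 := map_mul_orthPoly_eq_zero (fun j hj => hu j (by omega)) h1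
  rw [sub_mul, map_sub, sub_eq_zero] at h2
  rw [orthMat, orthNorm, ← h2]
  congr 1
  ring

theorem orthMat_one_eq_zero {n j : ℕ} (hu : ∀ j < n, IsUnit (orthNorm L j)) (hj : j + 1 < n) :
    orthMat L 1 n j = 0 := by
  have h1 : (X * orthPoly L j).degree < (n : WithBot ℕ) := by
    rw [degree_lt_iff_coeff_zero]
    intro m hm
    have h2 := degree_orthPoly_lt L j
    rw [degree_lt_iff_coeff_zero] at h2
    obtain ⟨m, rfl⟩ : ∃ i, m = i + 1 := ⟨m - 1, by omega⟩
    rw [coeff_X_mul, h2 _ (by omega)]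
  have h2 := map_mul_orthPoly_eq_zero hu h1
  rw [orthMat, ← h2]
  congr 1
  ring

/-- The three term recurrence.  For `n = 0` the last term vanishes since `orthW L 0 = 0`. -/
theorem X_mul_orthPoly {n : ℕ} (hu : ∀ j ≤ n, IsUnit (orthNorm L j)) :
    X * orthPoly L n =
      orthPoly L (n + 1) + orthV L n • orthPoly L n + orthW L n • orthPoly L (n - 1) := by
  rw [← sub_eq_zero]
  refine eq_zero_of_orthogonal (n := n + 1) (fun j hj => hu j (by omega)) ?_ ?_
  · have h2 := degree_orthPoly_lt L n
    have h3 := degree_orthPoly_lt L (n + 1)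
    have h4 := degree_orthPoly_lt L (n - 1)
    rw [degree_lt_iff_coeff_zero] at h2 h3 h4 ⊢
    intro m hm
    obtain ⟨m, rfl⟩ : ∃ i, m = i + 1 := ⟨m - 1, by omega⟩
    rw [coeff_sub, coeff_add, coeff_add, coeff_X_mul, coeff_smul, coeff_smul, h2 (m + 1) (by omega),
      h4 (m + 1) (by omega), smul_zero, smul_zero, add_zero, add_zero]
    rcases hm.eq_or_lt with h | h
    · obtain rfl : n = m := by omega
      rw [coeff_orthPoly_self, coeff_orthPoly_self, sub_self]
    · rw [h2 m (by omega), h3 (m + 1) (by omega), sub_self]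
  · intro j hj
    have h1 : L (X * orthPoly L n * orthPoly L j) = orthMat L 1 n j := by
      rw [orthMat, pow_one, mul_assoc]
    have h2 : L (orthPoly L (n + 1) * orthPoly L j) = 0 := by
      rw [mul_comm]
      exact orthPoly_orthogonal (fun k hk => hu k (by omega)) j hj
    rw [sub_mul, map_sub, add_mul, add_mul, map_add, map_add, smul_mul_assoc, smul_mul_assoc,
      map_smul, map_smul, h1, h2, zero_add, smul_eq_mul, smul_eq_mul]
    rcases (Nat.lt_succ_iff.1 hj).eq_or_lt with h | h
    · subst h
      have h3 : orthW L j * L (orthPoly L (j - 1) * orthPoly L j) = 0 := by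
        cases j with
        | zero => rw [orthW, zero_mul]
        | succ j =>
          rw [Nat.add_sub_cancel, orthPoly_orthogonal (fun k hk => hu k (by omega)) j
            (Nat.lt_succ_self j), mul_zero]
      rw [h3, add_zero, orthV, mul_assoc, mul_comm (orthInv L j)]
      change _ - _ * (orthNorm L j * _) = 0
      rw [orthNorm_mul_orthInv (hu j le_rfl), mul_one, sub_self]
    · rw [mul_comm (orthPoly L n), orthPoly_orthogonal (fun k hk => hu k (by omega)) j h, mul_zero,
        zero_add]
      obtain ⟨i, rfl⟩ : ∃ i, n = i + 1 := ⟨n - 1, by omega⟩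
      rw [Nat.add_sub_cancel]
      rcases (Nat.lt_succ_iff.1 h).eq_or_lt with h' | h'
      · subst h'
        rw [orthMat_one_succ fun k hk => hu k (by omega), orthW, mul_assoc, mul_comm (orthInv L j)]
        change _ - _ * (orthNorm L j * _) = 0
        rw [orthNorm_mul_orthInv (hu j (by omega)), mul_one, sub_self]
      · rw [orthMat_one_eq_zero (fun k hk => hu k (by omega)) (by omega), mul_comm (orthPoly L i),
          orthPoly_orthogonal (fun k hk => hu k (by omega)) j h', mul_zero, sub_self]

section AllUnits

variable (hu : ∀ j, IsUnit (orthNorm L j))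
include hu

theorem orthMat_zero (p q : ℕ) : orthMat L 0 p q = if p = q then orthNorm L p else 0 := by
  rw [orthMat, pow_zero, one_mul]
  split_ifs with h
  · rw [h, orthNorm]
  · rcases lt_or_gt_of_ne h with h | h
    · exact orthPoly_orthogonal (fun k _ => hu k) p h
    · rw [mul_comm]
      exact orthPoly_orthogonal (fun k _ => hu k) q h

theorem orthMat_succ (k p q : ℕ) : orthMat L (k + 1) p q =
    orthMat L k (p + 1) q + orthV L p * orthMat L k p q + orthW L p * orthMat L k (p - 1) q := by
  have h1 : X ^ (k + 1) * (orthPoly L p * orthPoly L q) =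
      X ^ k * ((X * orthPoly L p) * orthPoly L q) := by ring
  rw [orthMat, h1, X_mul_orthPoly fun j _ => hu j, add_mul, add_mul, mul_add, mul_add, map_add,
    map_add, smul_mul_assoc, smul_mul_assoc, mul_smul_comm, mul_smul_comm, map_smul, map_smul]
  rfl

theorem orthW_succ_mul (n : ℕ) : orthInv L (n + 1) * orthW L (n + 1) = orthInv L n := by
  rw [orthW, ← mul_assoc, mul_comm (orthInv L _), orthNorm_mul_orthInv (hu _), one_mul]

end AllUnits

variable (L)

/-- The two-point functions of the ensemble of `n` points, in terms of matrix elements: the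
difference `∑_p c^{i+j}_{pp} / h_p - ∑_{p,q} c^i_{pq} c^j_{pq} / (h_p h_q)` over `p, q < n`, where
the double sum is written as twice the sum over `q < p` plus the diagonal, as it suits the induction
on `n`. -/
def orthTwo (i j n : ℕ) : A :=
  ∑ p ∈ range n, (orthMat L (i + j) p p * orthInv L p -
    (2 * ∑ q ∈ range p, orthMat L i p q * orthMat L j p q * (orthInv L p * orthInv L q) +
      orthMat L i p p * orthMat L j p p * (orthInv L p * orthInv L p)))

theorem orthTwo_succ (i j n : ℕ) : orthTwo L i j (n + 1) = orthTwo L i j n +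
    (orthMat L (i + j) n n * orthInv L n -
    (2 * ∑ q ∈ range n, orthMat L i n q * orthMat L j n q * (orthInv L n * orthInv L q) +
      orthMat L i n n * orthMat L j n n * (orthInv L n * orthInv L n))) :=
  sum_range_succ _ _

theorem sum_symmetric (f : ℕ → ℕ → A) (hf : ∀ p q, f p q = f q p) (n : ℕ) :
    ∑ p ∈ range n, (2 * ∑ q ∈ range p, f p q + f p p) =
      ∑ p ∈ range n, ∑ q ∈ range n, f p q := by
  induction n with
  | zero => simp
  | succ n ih =>
    rw [sum_range_succ, ih, sum_range_succ]
    simp only [sum_range_succ, sum_add_distrib]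
    rw [sum_congr rfl fun p _ => hf p n]
    ring

theorem orthTwo_comm (i j n : ℕ) : orthTwo L i j n = orthTwo L j i n := by
  rw [orthTwo, orthTwo, add_comm i j]
  refine sum_congr rfl fun p _ => ?_
  simp only [mul_comm (orthMat L i p _) (orthMat L j p _)]

/-- The functional of two variables. -/
def twoFunctional : A[X] ⊗[A] A[X] →ₗ[A] A := LinearMap.mul' A A ∘ₗ TensorProduct.map L L

theorem twoFunctional_tmul (f g : A[X]) : twoFunctional L (f ⊗ₜ g) = L f * L g := by
  simp [twoFunctional]

/-- The Christoffel–Darboux kernel. -/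
def cdKernel (n : ℕ) : A[X] ⊗[A] A[X] :=
  ∑ p ∈ range n, orthInv L p • (orthPoly L p ⊗ₜ[A] orthPoly L p)

/-- The square of the kernel integrates to the double sum in the two-point functions. -/
theorem twoFunctional_cdKernel_sq (i j n : ℕ) :
    twoFunctional L (((X ^ i) ⊗ₜ[A] (X ^ j)) * cdKernel L n ^ 2) =
      ∑ p ∈ range n, orthMat L (i + j) p p * orthInv L p - orthTwo L i j n := by
  rw [orthTwo, sum_sub_distrib, sub_sub_cancel,
    sum_symmetric (fun p q => orthMat L i p q * orthMat L j p q * (orthInv L p * orthInv L q)),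
    cdKernel, sq, sum_mul_sum, mul_sum, map_sum]
  · refine sum_congr rfl fun p _ => ?_
    rw [mul_sum, map_sum]
    refine sum_congr rfl fun q _ => ?_
    rw [smul_mul_smul_comm, mul_smul_comm, map_smul, Algebra.TensorProduct.tmul_mul_tmul,
      Algebra.TensorProduct.tmul_mul_tmul, twoFunctional_tmul, smul_eq_mul, mul_comm]
    rfl
  · intro p q
    rw [orthMat_comm L i, orthMat_comm L j, mul_comm (orthInv L p)]

variable {L}

section AllUnits

variable (hu : ∀ j, IsUnit (orthNorm L j))
include hu

/-- The **Christoffel–Darboux** formula. -/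
theorem mul_cdKernel (n : ℕ) : (X ⊗ₜ[A] 1 - 1 ⊗ₜ[A] X : A[X] ⊗[A] A[X]) * cdKernel L (n + 1) =
    orthInv L n • (orthPoly L (n + 1) ⊗ₜ[A] orthPoly L n -
      orthPoly L n ⊗ₜ[A] orthPoly L (n + 1)) := by
  have h1 : ∀ p, (X ⊗ₜ[A] 1 - 1 ⊗ₜ[A] X : A[X] ⊗[A] A[X]) * (orthPoly L p ⊗ₜ orthPoly L p) =
      (orthPoly L (p + 1) ⊗ₜ orthPoly L p - orthPoly L p ⊗ₜ orthPoly L (p + 1)) +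
      orthW L p • (orthPoly L (p - 1) ⊗ₜ orthPoly L p - orthPoly L p ⊗ₜ orthPoly L (p - 1)) := by
    intro p
    rw [sub_mul, Algebra.TensorProduct.tmul_mul_tmul, Algebra.TensorProduct.tmul_mul_tmul, one_mul,
      X_mul_orthPoly fun j _ => hu j]
    simp only [TensorProduct.add_tmul, TensorProduct.tmul_add, ← TensorProduct.smul_tmul',
      TensorProduct.tmul_smul, smul_sub]
    abel
  induction n with
  | zero =>
    rw [cdKernel, sum_range_one, mul_smul_comm, h1, orthW, zero_smul, add_zero]
  | succ n ih =>
    rw [cdKernel, sum_range_succ, mul_add, ← cdKernel, ih, mul_smul_comm, h1, smul_add, smul_smul,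
      orthW_succ_mul hu, Nat.add_sub_cancel]
    simp only [smul_sub]
    abel

/-- The generating function of the two-point functions is, up to the factor `(x - y) ^ 2`, given by
the matrix elements between two consecutive orthogonal polynomials. -/
theorem orthTwo_second_difference (i j n : ℕ) :
    orthTwo L (i + 2) j (n + 1) - 2 * orthTwo L (i + 1) (j + 1) (n + 1) +
      orthTwo L i (j + 2) (n + 1) = orthInv L n ^ 2 *
    (2 * orthMat L i (n + 1) n * orthMat L j (n + 1) n -
      orthMat L i (n + 1) (n + 1) * orthMat L j n n -
      orthMat L i n n * orthMat L j (n + 1) (n + 1)) := by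
  -- Apply the functional to the square of the Christoffel–Darboux formula times `x ^ i y ^ j`.
  have h1 := congrArg (fun z => twoFunctional L (((X ^ i) ⊗ₜ[A] (X ^ j)) * z ^ 2))
    (mul_cdKernel hu n)
  have h2 : ((X ^ i) ⊗ₜ[A] (X ^ j) : A[X] ⊗[A] A[X]) *
      ((X ⊗ₜ[A] 1 - 1 ⊗ₜ[A] X : A[X] ⊗[A] A[X]) * cdKernel L (n + 1)) ^ 2 =
      ((X ^ (i + 2)) ⊗ₜ[A] (X ^ j)) * cdKernel L (n + 1) ^ 2 -
      (2 : A) • (((X ^ (i + 1)) ⊗ₜ[A] (X ^ (j + 1))) * cdKernel L (n + 1) ^ 2) +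
      ((X ^ i) ⊗ₜ[A] (X ^ (j + 2))) * cdKernel L (n + 1) ^ 2 := by
    have h3 : ∀ k l : ℕ, ((X ^ k) ⊗ₜ[A] (X ^ l) : A[X] ⊗[A] A[X]) =
        (X ⊗ₜ 1) ^ k * (1 ⊗ₜ X) ^ l := by
      intro k l
      rw [Algebra.TensorProduct.tmul_pow, Algebra.TensorProduct.tmul_pow,
        Algebra.TensorProduct.tmul_mul_tmul, one_pow, one_pow, mul_one, one_mul]
    simp only [h3, two_smul]
    ring
  have h4 : ((X ^ i) ⊗ₜ[A] (X ^ j) : A[X] ⊗[A] A[X]) * (orthInv L n •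
      (orthPoly L (n + 1) ⊗ₜ[A] orthPoly L n -
      orthPoly L n ⊗ₜ[A] orthPoly L (n + 1))) ^ 2 =
      (orthInv L n ^ 2) •
      ((X ^ i * (orthPoly L (n + 1) * orthPoly L (n + 1))) ⊗ₜ
          (X ^ j * (orthPoly L n * orthPoly L n)) -
        (2 : A) • ((X ^ i * (orthPoly L (n + 1) * orthPoly L n)) ⊗ₜ
          (X ^ j * (orthPoly L (n + 1) * orthPoly L n))) +
        (X ^ i * (orthPoly L n * orthPoly L n)) ⊗ₜ
          (X ^ j * (orthPoly L (n + 1) * orthPoly L (n + 1)))) := by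
    rw [_root_.smul_pow, mul_smul_comm]
    congr 1
    rw [mul_comm (orthPoly L (n + 1)) (orthPoly L n)]
    simp only [← Algebra.TensorProduct.tmul_mul_tmul, two_smul, sq]
    have h5 : (orthPoly L n * orthPoly L (n + 1)) ⊗ₜ[A] (orthPoly L n * orthPoly L (n + 1)) =
        (orthPoly L (n + 1) ⊗ₜ[A] orthPoly L n) * (orthPoly L n ⊗ₜ[A] orthPoly L (n + 1)) := by
      rw [Algebra.TensorProduct.tmul_mul_tmul, mul_comm (orthPoly L n)]
    have h6 : ∀ f g : A[X], f ⊗ₜ[A] g = (f ⊗ₜ 1) * (1 ⊗ₜ g) := fun f g => by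
      rw [Algebra.TensorProduct.tmul_mul_tmul, one_mul, mul_one]
    rw [h6 (orthPoly L (n + 1)) (orthPoly L n), h6 (orthPoly L n) (orthPoly L (n + 1)),
      h6 (orthPoly L n) (orthPoly L n), h6 (orthPoly L (n + 1)) (orthPoly L (n + 1))]
    ring
  rw [h2, h4] at h1
  simp only [map_add, map_sub, map_smul, twoFunctional_tmul, twoFunctional_cdKernel_sq,
    smul_eq_mul] at h1
  rw [show i + 1 + (j + 1) = i + 2 + j by ring, show i + (j + 2) = i + 2 + j by ring] at h1
  simp only [orthMat]
  linear_combination -h1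

theorem orthTwo_zero (i n : ℕ) : orthTwo L i 0 n = 0 := by
  refine sum_eq_zero fun p _ => ?_
  rw [sum_eq_zero, orthMat_zero hu, if_pos rfl, add_zero]
  · linear_combination (-orthMat L i p p * orthInv L p) * orthNorm_mul_orthInv (hu p)
  · intro q hq
    rw [orthMat_zero hu p q, if_neg (mem_range.1 hq).ne', mul_zero, zero_mul]

theorem orthTwo_one (i n : ℕ) :
    orthTwo L i 1 (n + 1) = orthMat L i (n + 1) n * orthInv L n := by
  induction n with
  | zero =>
    rw [orthTwo_succ, orthTwo, range_zero, sum_empty, sum_empty, orthMat_succ hu]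
    rw [orthW, orthV]
    ring
  | succ n ih =>
    rw [orthTwo_succ, ih, sum_range_succ, sum_eq_zero, orthMat_one_succ fun j _ => hu j,
      orthMat_succ hu, Nat.add_sub_cancel, orthMat_comm L i n]
    · have h1 := orthNorm_mul_orthInv (hu (n + 1))
      have h2 := orthW_succ_mul hu n
      rw [orthV]
      linear_combination (orthMat L i (n + 1) n) * h2 -
        2 * orthMat L i (n + 1) n * orthInv L n * h1
    · intro q hq
      rw [orthMat_one_eq_zero (fun j _ => hu j) (by have := mem_range.1 hq; omega), mul_zero,
        zero_mul]

end AllUnits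

end OrthogonalPolynomials

/-! ### Deformations of orthogonal polynomials -/

section Deformation

open Finset Polynomial

variable {R A : Type*} [CommRing R] [CommRing A] [Algebra R A]

/-- The action of a derivation on the coefficients of a polynomial. -/
def coeffD (D : Derivation R A A) (f : A[X]) : A[X] :=
  ∑ k ∈ range (f.natDegree + 1), monomial k (D (f.coeff k))

theorem coeff_coeffD (D : Derivation R A A) (f : A[X]) (k : ℕ) :
    (coeffD D f).coeff k = D (f.coeff k) := by
  rw [coeffD, finsetSum_coeff]
  simp only [coeff_monomial]
  rw [sum_ite_eq' (range (f.natDegree + 1)) k]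
  split_ifs with h
  · rfl
  · rw [coeff_eq_zero_of_natDegree_lt (by simpa using h), map_zero]

theorem coeffD_mul (D : Derivation R A A) (f g : A[X]) :
    coeffD D (f * g) = f * coeffD D g + coeffD D f * g := by
  ext k
  rw [coeff_add, coeff_coeffD, coeff_mul, coeff_mul, coeff_mul, map_sum, ← sum_add_distrib]
  refine sum_congr rfl fun p _ => ?_
  rw [Derivation.leibniz, coeff_coeffD, coeff_coeffD, smul_eq_mul, smul_eq_mul,
    mul_comm (g.coeff _)]

theorem coeffD_X_pow (D : Derivation R A A) (n : ℕ) : coeffD D (X ^ n) = 0 := by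
  ext k
  rw [coeff_coeffD, coeff_X_pow, coeff_zero]
  split_ifs <;> simp

variable {L : A[X] →ₗ[A] A} {D : ℕ → Derivation R A A}

theorem degree_coeffD_orthPoly (D : Derivation R A A) (n : ℕ) :
    (coeffD D (orthPoly L n)).degree < (n : WithBot ℕ) := by
  have h := degree_orthPoly_lt L n
  rw [degree_lt_iff_coeff_zero] at h ⊢
  intro m hm
  rw [coeff_coeffD]
  rcases hm.eq_or_lt with h' | h'
  · rw [← h', coeff_orthPoly_self, Derivation.map_one_eq_zero]
  · rw [h m (by omega), map_zero]

variable (hD : ∀ i f, D i (L f) = L (X ^ (i + 1) * f) + L (coeffD (D i) f))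
  (hu : ∀ j, IsUnit (orthNorm L j))
include hD hu

theorem deriv_orthNorm (i n : ℕ) : D i (orthNorm L n) = orthMat L (i + 1) n n := by
  have h := map_mul_orthPoly_eq_zero (fun j _ => hu j) (degree_coeffD_orthPoly (L := L) (D i) n)
  rw [orthNorm, hD, coeffD_mul, map_add, mul_comm (orthPoly L n) (coeffD _ _), h, add_zero,
    add_zero]
  rfl

theorem map_coeffD_orthPoly_mul (i : ℕ) {p q : ℕ} (hq : q < p) :
    L (coeffD (D i) (orthPoly L p) * orthPoly L q) = -orthMat L (i + 1) p q := by
  have h1 := congrArg (D i) (orthPoly_orthogonal (L := L) (n := p) (fun j _ => hu j) q hq)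
  have h2 : L (coeffD (D i) (orthPoly L q) * orthPoly L p) = 0 :=
    map_mul_orthPoly_eq_zero (fun j _ => hu j)
      ((degree_coeffD_orthPoly (D i) q).trans (Nat.cast_lt.2 hq))
  rw [mul_comm, hD, coeffD_mul, map_add, map_zero, mul_comm (orthPoly L p) (coeffD _ _), h2,
    zero_add] at h1
  rw [orthMat]
  linear_combination h1

/-- The deformation of the orthogonal polynomials under the times, for a functional whose derivative
with respect to the time of index `i` inserts `X ^ (i + 1)`. -/
theorem coeffD_orthPoly (i p : ℕ) : coeffD (D i) (orthPoly L p) =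
    -∑ q ∈ range p, (orthMat L (i + 1) p q * orthInv L q) • orthPoly L q := by
  rw [← sub_eq_zero, sub_neg_eq_add]
  refine eq_zero_of_orthogonal (n := p) (fun j _ => hu j) ?_ ?_
  · refine (degree_add_le _ _).trans_lt (max_lt (degree_coeffD_orthPoly _ _) ?_)
    refine (degree_sum_le _ _).trans_lt
      ((Finset.sup_lt_iff (WithBot.bot_lt_coe p)).2 fun j hj => ?_)
    refine (degree_smul_le _ _).trans_lt ((degree_orthPoly_lt L j).trans_le ?_)
    exact Nat.cast_le.2 (mem_range.1 hj)
  · intro j hj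
    rw [add_mul, map_add, map_coeffD_orthPoly_mul hD hu i hj, sum_mul, map_sum, sum_eq_single j]
    · rw [smul_mul_assoc, map_smul, smul_eq_mul]
      change _ + _ * orthNorm L j = 0
      linear_combination (orthMat L (i + 1) p j) * orthNorm_mul_orthInv (hu j)
    · intro q _ hqj
      rw [smul_mul_assoc, map_smul]
      have h := orthMat_zero hu q j
      rw [orthMat, pow_zero, one_mul, if_neg hqj] at h
      rw [h, smul_zero]
    · intro h
      exact absurd (mem_range.2 hj) h

theorem deriv_orthMat_self (i k p : ℕ) : D i (orthMat L k p p) = orthMat L (i + 1 + k) p p -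
    2 * ∑ q ∈ range p, orthMat L (i + 1) p q * orthMat L k p q * orthInv L q := by
  rw [orthMat, hD, coeffD_mul, coeffD_X_pow, zero_mul, add_zero, coeffD_mul,
    mul_comm (coeffD (D i) (orthPoly L p)), ← two_mul, coeffD_orthPoly hD hu, mul_sum,
    ← mul_assoc, ← pow_add, sub_eq_add_neg]
  congr 1
  rw [mul_neg, mul_neg, mul_neg, map_neg, ← mul_sum, mul_left_comm, mul_sum, mul_sum,
    ← C_ofNat, ← smul_eq_C_mul, map_smul, map_sum, smul_eq_mul]
  congr 2
  refine sum_congr rfl fun q _ => ?_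
  rw [mul_smul_comm, mul_smul_comm, map_smul, smul_eq_mul, ← orthMat]
  ring

theorem deriv_orthInv (i p : ℕ) :
    D i (orthInv L p) = -(orthMat L (i + 1) p p * (orthInv L p * orthInv L p)) := by
  have h1 := orthNorm_mul_orthInv (hu p)
  have h2 := congrArg (D i) h1
  rw [Derivation.leibniz, Derivation.map_one_eq_zero, smul_eq_mul, smul_eq_mul,
    deriv_orthNorm hD hu] at h2
  linear_combination orthInv L p * h2 - D i (orthInv L p) * h1

/-- The second logarithmic derivatives of the product of the norms. -/
theorem deriv_sum_orthMat (i j n : ℕ) :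
    D i (∑ p ∈ range n, orthMat L (j + 1) p p * orthInv L p) = orthTwo L (i + 1) (j + 1) n := by
  rw [map_sum, orthTwo]
  refine sum_congr rfl fun p _ => ?_
  rw [Derivation.leibniz, deriv_orthInv hD hu, deriv_orthMat_self hD hu, smul_eq_mul, smul_eq_mul]
  have hs : orthInv L p * ∑ q ∈ range p, orthMat L (i + 1) p q * orthMat L (j + 1) p q *
      orthInv L q = ∑ q ∈ range p, orthMat L (i + 1) p q * orthMat L (j + 1) p q *
        (orthInv L p * orthInv L q) := by
    rw [mul_sum]
    exact sum_congr rfl fun q _ => by ring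
  linear_combination (-2) * hs

end Deformation

/-! ### The average of the squared Vandermonde determinant -/

section Vandermonde

open Finset Polynomial

variable {A : Type*} [CommRing A] (m : ℕ → A)

/-- The functional on polynomials with moments `m`. -/
def momentFun : A[X] →ₗ[A] A := Polynomial.lsum fun k => LinearMap.toSpanSingleton A A (m k)

theorem momentFun_eq_sum {f : A[X]} {N : ℕ} (h : f.natDegree < N) :
    momentFun m f = ∑ k ∈ range N, f.coeff k * m k := by
  rw [momentFun, Polynomial.lsum_apply, Polynomial.sum_over_range' f _ N h]
  · rfl
  · intro k
    exact map_zero _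

theorem momentFun_X_pow (k : ℕ) : momentFun m (X ^ k) = m k := by
  rw [momentFun_eq_sum m (N := k + 1) (Nat.lt_succ_of_le (natDegree_X_pow_le k)),
    sum_range_succ, sum_eq_zero, coeff_X_pow, if_pos rfl]
  · ring
  · intro j hj
    rw [coeff_X_pow, if_neg (mem_range.1 hj).ne, zero_mul]

/-- The integral of a product of polynomials in one variable each. -/
theorem multiMoment_prod_aeval {n : ℕ} (f : Fin n → A[X]) :
    multiMoment m n (∏ i, aeval (MvPolynomial.X i) (f i)) = ∏ i, momentFun m (f i) := by
  set N := (univ.sup fun i => (f i).natDegree) + 1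
  have hN : ∀ i, (f i).natDegree < N := fun i =>
    Nat.lt_succ_of_le (le_sup (f := fun i => (f i).natDegree) (mem_univ i))
  have h1 : ∀ i, aeval (MvPolynomial.X i : MvPolynomial (Fin n) A) (f i) =
      ∑ k ∈ range N, MvPolynomial.C ((f i).coeff k) * MvPolynomial.X i ^ k := by
    intro i
    rw [aeval_eq_sum_range' (hN i)]
    simp only [MvPolynomial.smul_eq_C_mul]
  simp only [h1, momentFun_eq_sum m (hN _)]
  rw [prod_univ_sum, prod_univ_sum, map_sum]
  refine sum_congr rfl fun κ _ => ?_
  have h2 : ∏ i, (MvPolynomial.C ((f i).coeff (κ i)) * MvPolynomial.X i ^ κ i) =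
      MvPolynomial.monomial (Finsupp.equivFunOnFinite.symm κ) (∏ i, (f i).coeff (κ i)) := by
    rw [MvPolynomial.monomial_eq, Finsupp.prod_fintype _ _ fun i => pow_zero _, prod_mul_distrib,
      map_prod]
    rfl
  rw [h2, multiMoment_monomial, prod_mul_distrib]
  rfl

theorem natDegree_orthPoly [Nontrivial A] (L : A[X] →ₗ[A] A) (n : ℕ) :
    (orthPoly L n).natDegree = n := by
  refine natDegree_eq_of_le_of_coeff_ne_zero ?_ ?_
  · rw [natDegree_le_iff_coeff_eq_zero]
    intro k hk
    have h := degree_orthPoly_lt L n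
    rw [degree_lt_iff_coeff_zero] at h
    exact h k (by omega)
  · rw [coeff_orthPoly_self]
    exact one_ne_zero

theorem monic_orthPoly [Nontrivial A] (L : A[X] →ₗ[A] A) (n : ℕ) : (orthPoly L n).Monic := by
  rw [Monic, leadingCoeff, natDegree_orthPoly, coeff_orthPoly_self]

/-- The Vandermonde determinant in terms of monic orthogonal polynomials. -/
theorem vdm_eq_sum [Nontrivial A] (L : A[X] →ₗ[A] A) (n : ℕ) :
    (vdm n : MvPolynomial (Fin n) A) = ∑ σ : Equiv.Perm (Fin n),
      ((Equiv.Perm.sign σ : ℤ) : MvPolynomial (Fin n) A) *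
        ∏ i, aeval (MvPolynomial.X i) (orthPoly L (σ i)) := by
  rw [vdm, ← Matrix.det_vandermonde, Matrix.det_eval_matrixOfPolynomials_eq_det_vandermonde _
    (fun j : Fin n => (orthPoly L j).map (MvPolynomial.C (σ := Fin n))),
    ← Matrix.det_transpose, Matrix.det_apply']
  · refine sum_congr rfl fun σ _ => ?_
    congr 1
    refine prod_congr rfl fun i _ => ?_
    rw [Matrix.transpose_apply, Matrix.of_apply, eval_map, aeval_def]
    rfl
  · intro j
    rw [(monic_orthPoly L j).natDegree_map, natDegree_orthPoly]
  · intro j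
    exact (monic_orthPoly L j).map _

/-- The average of the squared Vandermonde determinant is, up to `n!`, the product of the norms. -/
theorem multiMoment_vdm_sq [Nontrivial A] {L : A[X] →ₗ[A] A} (hm : L = momentFun m)
    (hu : ∀ j, IsUnit (orthNorm L j)) (n : ℕ) :
    multiMoment m n (vdm n ^ 2) = n.factorial * ∏ p ∈ range n, orthNorm L p := by
  rw [sq, vdm_eq_sum L, sum_mul_sum, map_sum]
  have h : ∀ σ τ : Equiv.Perm (Fin n), multiMoment m n
      (((Equiv.Perm.sign σ : ℤ) : MvPolynomial (Fin n) A) *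
        (∏ i, aeval (MvPolynomial.X i) (orthPoly L (σ i))) *
      (((Equiv.Perm.sign τ : ℤ) : MvPolynomial (Fin n) A) *
        ∏ i, aeval (MvPolynomial.X i) (orthPoly L (τ i)))) =
      if τ = σ then ∏ p ∈ range n, orthNorm L p else 0 := by
    intro σ τ
    rw [mul_mul_mul_comm, ← prod_mul_distrib, ← Int.cast_mul, ← zsmul_eq_mul, map_zsmul]
    simp only [← map_mul]
    rw [multiMoment_prod_aeval, ← hm]
    have h1 : ∀ p q, L (orthPoly L p * orthPoly L q) = if p = q then orthNorm L p else 0 := by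
      intro p q
      rw [← orthMat_zero hu, orthMat, pow_zero, one_mul]
    simp only [h1]
    split_ifs with hστ
    · subst hστ
      simp only [if_true]
      rw [Int.units_coe_mul_self, one_smul, Equiv.prod_comp τ (fun i : Fin n => orthNorm L i),
        Fin.prod_univ_eq_prod_range]
    · obtain ⟨i, hi⟩ : ∃ i, τ i ≠ σ i := by
        by_contra hcon
        push Not at hcon
        exact hστ (Equiv.ext hcon)
      rw [prod_eq_zero (mem_univ i), smul_zero]
      rw [if_neg]
      exact fun h => hi (Fin.ext h.symm)
  simp only [map_sum, h]
  simp only [sum_ite_eq', mem_univ, if_true, sum_const, card_univ, Fintype.card_perm,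
    Fintype.card_fin, nsmul_eq_mul]

end Vandermonde

/-! ### The norms of the Laguerre polynomials -/

section Laguerre

open Finset Polynomial

theorem momentFun_monomial {A : Type*} [CommRing A] (m : ℕ → A) (k : ℕ) (c : A) :
    momentFun m (monomial k c) = c * m k := by
  rw [momentFun, Polynomial.lsum_apply, Polynomial.sum_monomial_index _ _ (by simp)]
  rfl

theorem map_mul_orthPoly_eq_coeff {A : Type*} [CommRing A] {L : A[X] →ₗ[A] A} {n : ℕ}
    (hu : ∀ j < n, IsUnit (orthNorm L j)) {f : A[X]} (hf : f.degree < ((n + 1 : ℕ) : WithBot ℕ)) :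
    L (f * orthPoly L n) = f.coeff n * orthNorm L n := by
  have h1 := map_mul_orthPoly_eq_zero hu (degree_sub_smul_orthPoly L hf)
  rw [sub_mul, map_sub, smul_mul_assoc, map_smul, smul_eq_mul, sub_eq_zero] at h1
  exact h1

variable {K : Type*} [Field K] [CharZero K] {a e : K}

/-- The functional of the Laguerre weight. -/
abbrev laguerreFun (a e : K) : K[X] →ₗ[K] K := momentFun (laguerreMoment a e)

omit [CharZero K] in
/-- Integration by parts. -/
theorem laguerreFun_X_mul (f : K[X]) : laguerreFun a e (X * f) =
    (a + e) * laguerreFun a e f + e * laguerreFun a e (X * derivative f) := by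
  induction f using Polynomial.induction_on' with
  | add f g hf hg =>
    rw [mul_add, map_add, hf, hg, map_add, map_add, mul_add, mul_add, map_add]
    ring
  | monomial k c =>
    have h1 : X * derivative (monomial k c) = monomial k (c * k) := by
      ext j
      cases j with
      | zero =>
        rw [mul_coeff_zero, coeff_X_zero, zero_mul, coeff_monomial]
        split_ifs with h
        · simp [h]
        · rfl
      | succ j =>
        rw [coeff_X_mul, coeff_derivative, coeff_monomial, coeff_monomial]
        split_ifs with h
        · rw [h]
          push_cast
          ring
        · simp
    rw [h1, X_mul_monomial, momentFun_monomial, momentFun_monomial, momentFun_monomial,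
      laguerreMoment_succ]
    ring

omit [CharZero K] in
/-- `x d/dx - n` annihilates the leading term of the orthogonal polynomial of degree `n`. -/
theorem degree_euler_sub (L : K[X] →ₗ[K] K) (n : ℕ) :
    (X * derivative (orthPoly L n) - (n : K) • orthPoly L n).degree < (n : WithBot ℕ) := by
  have h := degree_orthPoly_lt L n
  rw [degree_lt_iff_coeff_zero] at h ⊢
  intro k hk
  rw [coeff_sub, coeff_smul, smul_eq_mul]
  cases k with
  | zero =>
    obtain rfl : n = 0 := by omega
    simp
  | succ k =>
    rw [coeff_X_mul, coeff_derivative]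
    rcases hk.eq_or_lt with h' | h'
    · rw [h']
      push_cast
      ring
    · rw [h (k + 1) (by omega)]
      ring

omit [CharZero K] in
theorem orthV_laguerre {n : ℕ} (hu : ∀ j ≤ n, IsUnit (orthNorm (laguerreFun a e) j)) :
    orthV (laguerreFun a e) n = a + e + 2 * n * e := by
  have h1 := map_mul_orthPoly_eq_zero (fun j hj => hu j hj.le)
    (degree_euler_sub (laguerreFun a e) n)
  rw [sub_mul, map_sub, smul_mul_assoc, map_smul, sub_eq_zero, smul_eq_mul] at h1
  change _ = _ * orthNorm _ _ at h1
  have h2 : orthMat (laguerreFun a e) 1 n n =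
      (a + e + 2 * n * e) * orthNorm (laguerreFun a e) n := by
    have h3 : X * derivative (orthPoly (laguerreFun a e) n * orthPoly (laguerreFun a e) n) =
        X * derivative (orthPoly (laguerreFun a e) n) * orthPoly (laguerreFun a e) n +
        X * derivative (orthPoly (laguerreFun a e) n) * orthPoly (laguerreFun a e) n := by
      rw [derivative_mul]
      ring
    rw [orthMat, pow_one, laguerreFun_X_mul, h3, map_add, h1, orthNorm]
    ring
  rw [orthV, h2, mul_assoc, orthNorm_mul_orthInv (hu n le_rfl), mul_one]

omit [CharZero K] in
/-- The subleading coefficient, from the sum of the diagonal recurrence coefficients. -/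
theorem coeff_orthPoly_laguerre {n : ℕ} (hu : ∀ j ≤ n, IsUnit (orthNorm (laguerreFun a e) j)) :
    (orthPoly (laguerreFun a e) (n + 1)).coeff n = -((n + 1) * (a + (n + 1) * e)) := by
  have key : ∀ n : ℕ, (∀ j ≤ n, IsUnit (orthNorm (laguerreFun a e) j)) →
      (X * orthPoly (laguerreFun a e) n).coeff n =
        (orthPoly (laguerreFun a e) (n + 1)).coeff n + (a + e + 2 * n * e) := by
    intro n hu
    rw [X_mul_orthPoly hu, coeff_add, coeff_add, coeff_smul, coeff_smul, coeff_orthPoly_self,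
      orthV_laguerre hu, smul_eq_mul, smul_eq_mul, mul_one]
    have h : orthW (laguerreFun a e) n * (orthPoly (laguerreFun a e) (n - 1)).coeff n = 0 := by
      cases n with
      | zero => rw [orthW, zero_mul]
      | succ n =>
        have h := degree_orthPoly_lt (laguerreFun a e) n
        rw [degree_lt_iff_coeff_zero] at h
        rw [Nat.add_sub_cancel, h _ le_rfl, mul_zero]
    rw [h, add_zero]
  induction n with
  | zero =>
    have h := key 0 hu
    rw [mul_coeff_zero, coeff_X_zero, zero_mul] at h
    linear_combination -h
  | succ n ih =>
    have h := key (n + 1) hu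
    rw [coeff_X_mul, ih fun j hj => hu j (by omega)] at h
    push_cast at h ⊢
    linear_combination -h

omit [CharZero K] in
/-- The subdiagonal recurrence coefficients `n e (a + n e)` of the Laguerre weight. -/
theorem orthNorm_laguerre_succ {n : ℕ} (hu : ∀ j ≤ n, IsUnit (orthNorm (laguerreFun a e) j)) :
    orthNorm (laguerreFun a e) (n + 1) =
      (n + 1) * e * (a + (n + 1) * e) * orthNorm (laguerreFun a e) n := by
  have hu' : ∀ j < n + 1, IsUnit (orthNorm (laguerreFun a e) j) := fun j hj => hu j (by omega)
  have h1 := orthMat_one_succ hu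
  have h2 := orthPoly_orthogonal hu' n (Nat.lt_succ_self n)
  have h3 : X * derivative (orthPoly (laguerreFun a e) (n + 1) * orthPoly (laguerreFun a e) n) =
      X * derivative (orthPoly (laguerreFun a e) (n + 1)) * orthPoly (laguerreFun a e) n +
      X * derivative (orthPoly (laguerreFun a e) n) * orthPoly (laguerreFun a e) (n + 1) := by
    rw [derivative_mul]
    ring
  have h4 : laguerreFun a e
      (X * derivative (orthPoly (laguerreFun a e) n) * orthPoly (laguerreFun a e) (n + 1)) = 0 := by
    refine map_mul_orthPoly_eq_zero hu' ?_
    have h5 : X * derivative (orthPoly (laguerreFun a e) n) =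
        (X * derivative (orthPoly (laguerreFun a e) n) - (n : K) • orthPoly (laguerreFun a e) n) +
          (n : K) • orthPoly (laguerreFun a e) n := by ring
    rw [h5]
    refine (degree_add_le _ _).trans_lt (max_lt ((degree_euler_sub _ n).trans ?_)
      ((degree_smul_le _ _).trans_lt (degree_orthPoly_lt _ n)))
    exact Nat.cast_lt.2 (Nat.lt_succ_self n)
  have h6 := map_mul_orthPoly_eq_coeff (fun j hj => hu j hj.le)
    (degree_euler_sub (laguerreFun a e) (n + 1))
  rw [coeff_sub, coeff_smul, sub_mul, map_sub, smul_mul_assoc, map_smul, mul_comm (orthPoly _ _),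
    h2, smul_zero, sub_zero, coeff_orthPoly_laguerre hu] at h6
  have h7 : (X * derivative (orthPoly (laguerreFun a e) (n + 1))).coeff n =
      n * (orthPoly (laguerreFun a e) (n + 1)).coeff n := by
    cases n with
    | zero => simp
    | succ n =>
      rw [coeff_X_mul, coeff_derivative, mul_comm]
      push_cast
      ring
  rw [h7, coeff_orthPoly_laguerre hu] at h6
  rw [← h1, orthMat, pow_one, laguerreFun_X_mul, h3, map_add, h4, h6,
    mul_comm (orthPoly (laguerreFun a e) (n + 1)), h2]
  simp only [smul_eq_mul]
  push_cast
  ring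

theorem orthNorm_laguerre_ne_zero (he : e ≠ 0) (ha : ∀ n : ℕ, a + (n + 1) * e ≠ 0) (n : ℕ) :
    orthNorm (laguerreFun a e) n ≠ 0 := by
  induction n using Nat.strong_induction_on with
  | _ n ih =>
    cases n with
    | zero =>
      rw [orthNorm, orthPoly_eq, range_zero, sum_empty, sub_zero, pow_zero, mul_one,
        ← pow_zero X, momentFun_X_pow, laguerreMoment, range_zero, prod_empty]
      exact one_ne_zero
    | succ n =>
      rw [orthNorm_laguerre_succ fun j hj => (ih j (by omega)).isUnit]
      exact mul_ne_zero (mul_ne_zero (mul_ne_zero (Nat.cast_add_one_ne_zero n) he) (ha n))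
        (ih n (Nat.lt_succ_self n))

end Laguerre

/-! ### Change of the coefficient ring -/

section Naturality

open Finset Polynomial

variable {A B : Type*} [CommRing A] [CommRing B] (φ : A →+* B)

theorem map_ringInverse [IsLocalHom φ] (x : A) : φ (Ring.inverse x) = Ring.inverse (φ x) := by
  by_cases h : IsUnit x
  · obtain ⟨u, rfl⟩ := h
    rw [Ring.inverse_unit]
    exact (Ring.inverse_unit (Units.map (φ : A →* B) u)).symm
  · rw [Ring.inverse_non_unit _ h, map_zero,
      Ring.inverse_non_unit _ fun h' => h (isUnit_of_map_unit φ x h')]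

theorem map_momentFun (m : ℕ → A) (f : A[X]) :
    φ (momentFun m f) = momentFun (fun k => φ (m k)) (f.map φ) := by
  rw [momentFun_eq_sum m (Nat.lt_succ_self f.natDegree),
    momentFun_eq_sum _ (Nat.lt_succ_of_le natDegree_map_le), map_sum]
  simp

variable {L : A[X] →ₗ[A] A} {L' : B[X] →ₗ[B] B}

theorem map_orthPoly [IsLocalHom φ] (h : ∀ f, φ (L f) = L' (f.map φ)) (n : ℕ) :
    (orthPoly L n).map φ = orthPoly L' n := by
  induction n using Nat.strong_induction_on with
  | _ n ih =>
    rw [orthPoly_eq, orthPoly_eq, Polynomial.map_sub, Polynomial.map_sum, Polynomial.map_pow, map_X]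
    congr 1
    refine sum_congr rfl fun j hj => ?_
    have hj := ih j (mem_range.1 hj)
    rw [Polynomial.map_smul, map_mul, h, Polynomial.map_mul, Polynomial.map_pow, map_X, hj, orthInv,
      map_ringInverse, orthNorm, h, Polynomial.map_mul, hj]
    rfl

theorem map_orthNorm [IsLocalHom φ] (h : ∀ f, φ (L f) = L' (f.map φ)) (n : ℕ) :
    φ (orthNorm L n) = orthNorm L' n := by
  rw [orthNorm, h, Polynomial.map_mul, map_orthPoly φ h, orthNorm]

theorem map_orthInv [IsLocalHom φ] (h : ∀ f, φ (L f) = L' (f.map φ)) (n : ℕ) :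
    φ (orthInv L n) = orthInv L' n := by
  rw [orthInv, map_ringInverse, map_orthNorm φ h, orthInv]

theorem map_orthMat [IsLocalHom φ] (h : ∀ f, φ (L f) = L' (f.map φ)) (k p q : ℕ) :
    φ (orthMat L k p q) = orthMat L' k p q := by
  rw [orthMat, h, Polynomial.map_mul, Polynomial.map_mul, map_orthPoly φ h, map_orthPoly φ h,
    Polynomial.map_pow, map_X, orthMat]

theorem map_orthV [IsLocalHom φ] (h : ∀ f, φ (L f) = L' (f.map φ)) (n : ℕ) :
    φ (orthV L n) = orthV L' n := by
  rw [orthV, map_mul, map_orthMat φ h, map_orthInv φ h, orthV]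

end Naturality

/-! ### The Laguerre weight with times -/

section Times

open Finset MvPowerSeries

/-- The generating series of transitive pairs, as a function of the times: the variable of index `i`
is replaced by `e ^ i (i + 1) t_i`. -/
def timeSeries {R : Type*} [CommRing R] [Algebra ℂ R] (U V e : R) : MvPowerSeries ℕ R :=
  rescale (fun i : ℕ => e ^ i * ((i : R) + 1)) (transSeries U V)

theorem constantCoeff_timeSeries {R : Type*} [CommRing R] [Algebra ℂ R] (U V e : R) :
    constantCoeff (timeSeries U V e) = 0 := by
  rw [timeSeries, ← coeff_zero_eq_constantCoeff_apply, coeff_rescale,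
    coeff_zero_eq_constantCoeff_apply, constantCoeff_transSeries, mul_zero]

variable {K : Type*} [Field K] [CharZero K] {a e : K}

/-- The factorial of a monomial. -/
def multiFactorial (ν : ℕ →₀ ℕ) : ℕ := ν.prod fun _ n => n.factorial

theorem multiFactorial_add_single (ν : ℕ →₀ ℕ) (i : ℕ) :
    multiFactorial (ν + Finsupp.single i 1) = (ν i + 1) * multiFactorial ν := by
  classical
  have h1 : ν.support ⊆ insert i ν.support := subset_insert _ _
  have h2 : (ν + Finsupp.single i 1).support ⊆ insert i ν.support := by
    refine Finsupp.support_add.trans (union_subset h1 ?_)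
    refine Finsupp.support_single_subset.trans ?_
    simp
  rw [multiFactorial, multiFactorial, Finsupp.prod_of_support_subset _ h1 _ (by simp),
    Finsupp.prod_of_support_subset _ h2 _ (by simp), ← mul_prod_erase _ _ (mem_insert_self i _),
    ← mul_prod_erase (insert i ν.support) (fun x => (ν x).factorial) (mem_insert_self i _),
    ← mul_assoc]
  congr 1
  · rw [Finsupp.add_apply, Finsupp.single_eq_same, Nat.factorial_succ]
  · refine prod_congr rfl fun j hj => ?_
    rw [Finsupp.add_apply, Finsupp.single_eq_of_ne (ne_of_mem_erase hj), add_zero]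

theorem multiFactorial_ne_zero (ν : ℕ →₀ ℕ) : multiFactorial ν ≠ 0 :=
  prod_ne_zero_iff.2 fun _ _ => Nat.factorial_ne_zero _

/-- The moments of the weight `x ^ (a / e) exp (- x / e + e⁻¹ ∑ t_i x ^ (i + 1))`. -/
def timeMoment (a e : K) (k : ℕ) : MvPowerSeries ℕ K := fun ν =>
  (e ^ ν.degree * multiFactorial ν)⁻¹ * laguerreMoment a e (k + wt ν)

omit [CharZero K] in
theorem coeff_timeMoment (k : ℕ) (ν : ℕ →₀ ℕ) : coeff ν (timeMoment a e k) =
    (e ^ ν.degree * multiFactorial ν)⁻¹ * laguerreMoment a e (k + wt ν) := rfl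

omit [CharZero K] in
theorem constantCoeff_timeMoment (k : ℕ) :
    constantCoeff (timeMoment a e k) = laguerreMoment a e k := by
  rw [← coeff_zero_eq_constantCoeff_apply, coeff_timeMoment]
  simp [multiFactorial]

/-- The derivation `e ∂/∂t_i`. -/
def epsD (e : K) (i : ℕ) : Derivation K (MvPowerSeries ℕ K) (MvPowerSeries ℕ K) :=
  e • pderiv K i

omit [CharZero K] in
theorem coeff_epsD (i : ℕ) (f : MvPowerSeries ℕ K) (ν : ℕ →₀ ℕ) :
    coeff ν (epsD e i f) = e * (coeff (ν + Finsupp.single i 1) f * (ν i + 1)) := by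
  rw [epsD, Derivation.smul_apply, coeff_smul, coeff_pderiv]

theorem epsD_timeMoment (he : e ≠ 0) (i k : ℕ) :
    epsD e i (timeMoment a e k) = timeMoment a e (k + (i + 1)) := by
  ext ν
  have h1 : (multiFactorial ν : K) ≠ 0 := by exact_mod_cast multiFactorial_ne_zero ν
  have h2 : ((ν i : K) + 1) ≠ 0 := Nat.cast_add_one_ne_zero _
  rw [coeff_epsD, coeff_timeMoment, coeff_timeMoment, multiFactorial_add_single, map_add, map_add,
    wt_single, Finsupp.degree_single, one_mul]
  rw [show k + (wt ν + (i + 1)) = k + (i + 1) + wt ν by ring]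
  push_cast
  field_simp
  ring

omit [CharZero K] in
theorem epsD_momentFun {m : ℕ → MvPowerSeries ℕ K}
    (hm : ∀ i k, epsD e i (m k) = m (k + (i + 1))) (i : ℕ) (f : Polynomial (MvPowerSeries ℕ K)) :
    epsD e i (momentFun m f) = momentFun m (Polynomial.X ^ (i + 1) * f) +
      momentFun m (coeffD (epsD e i) f) := by
  induction f using Polynomial.induction_on' with
  | add f g hf hg =>
    have h : coeffD (epsD e i) (f + g) = coeffD (epsD e i) f + coeffD (epsD e i) g := by
      ext1 k
      rw [Polynomial.coeff_add, coeff_coeffD, coeff_coeffD, coeff_coeffD, Polynomial.coeff_add,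
        map_add]
    rw [map_add, map_add, hf, hg, h, mul_add, map_add, map_add]
    ring
  | monomial k c =>
    have h : coeffD (epsD e i) (Polynomial.monomial k c) =
        Polynomial.monomial k (epsD e i c) := by
      ext1 j
      rw [coeff_coeffD, Polynomial.coeff_monomial, Polynomial.coeff_monomial]
      split_ifs <;> simp
    rw [h, Polynomial.X_pow_mul_monomial, momentFun_monomial, momentFun_monomial,
      momentFun_monomial, Derivation.leibniz, hm, smul_eq_mul, smul_eq_mul]
    ring

omit [CharZero K] in
/-- The derivative with respect to the time of index `i` inserts the power sum of degree `i + 1`. -/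
theorem epsD_multiMoment {m : ℕ → MvPowerSeries ℕ K}
    (hm : ∀ i k, epsD e i (m k) = m (k + (i + 1))) (i n : ℕ) (Q : MvPolynomial (Fin n) K) :
    epsD e i (multiMoment m n (MvPolynomial.map C Q)) =
      multiMoment m n (MvPolynomial.map C (MvPolynomial.psum (Fin n) K (i + 1) * Q)) := by
  classical
  induction Q using MvPolynomial.induction_on' with
  | add P Q hP hQ =>
    rw [map_add, map_add, map_add, hP, hQ, mul_add, map_add, map_add]
  | monomial β c =>
    have hD : epsD e i (C c) = 0 := by
      ext ν
      rw [coeff_epsD, coeff_C, if_neg, zero_mul, mul_zero, map_zero]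
      intro h
      have := DFunLike.congr_fun h i
      simp at this
    have h1 : MvPolynomial.psum (Fin n) K (i + 1) * MvPolynomial.monomial β c =
        ∑ s, MvPolynomial.monomial (β + Finsupp.single s (i + 1)) c := by
      rw [MvPolynomial.psum, sum_mul]
      refine sum_congr rfl fun s _ => ?_
      rw [MvPolynomial.X_pow_eq_monomial, MvPolynomial.monomial_mul, one_mul, add_comm]
    rw [h1, map_sum, map_sum, MvPolynomial.map_monomial, multiMoment_monomial, Derivation.leibniz,
      hD, smul_zero, add_zero]
    simp only [MvPolynomial.map_monomial, multiMoment_monomial, smul_eq_mul]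
    rw [← mul_sum]
    congr 1
    have h2 : ∀ S : Finset (Fin n), epsD e i (∏ s ∈ S, m (β s)) =
        ∑ s ∈ S, ∏ t ∈ S, m ((β + Finsupp.single s (i + 1)) t) := by
      intro S
      induction S using Finset.induction_on with
      | empty => simp
      | insert s S hs ih =>
        rw [prod_insert hs, Derivation.leibniz, ih, sum_insert hs, hm, smul_eq_mul, smul_eq_mul,
          prod_insert hs, mul_sum, add_comm]
        congr 1
        · rw [mul_comm, Finsupp.add_apply, Finsupp.single_eq_same]
          congr 1
          refine prod_congr rfl fun t ht => ?_
          rw [Finsupp.add_apply, Finsupp.single_eq_of_ne (ne_of_mem_of_not_mem ht hs), add_zero]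
        · refine sum_congr rfl fun t ht => ?_
          rw [prod_insert hs, Finsupp.add_apply,
            Finsupp.single_eq_of_ne (ne_of_mem_of_not_mem ht hs).symm, add_zero]
    exact h2 univ

/-- The coefficients of an average with times are averages with power sums inserted. -/
theorem coeff_multiMoment (he : e ≠ 0) (n : ℕ) (ν : ℕ →₀ ℕ) (Q : MvPolynomial (Fin n) K) :
    coeff ν (multiMoment (timeMoment a e) n (MvPolynomial.map C Q)) *
      (e ^ ν.degree * multiFactorial ν) =
    multiMoment (laguerreMoment a e) n
      ((ν.prod fun i k => MvPolynomial.psum (Fin n) K (i + 1) ^ k) * Q) := by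
  induction hd : ν.degree generalizing ν Q with
  | zero =>
    have h0 : ν = 0 := (Finsupp.degree_eq_zero_iff ν).1 hd
    subst h0
    rw [coeff_zero_eq_constantCoeff_apply]
    simp only [multiFactorial, Finsupp.prod_zero_index, pow_zero, Nat.cast_one, mul_one, one_mul]
    induction Q using MvPolynomial.induction_on' with
    | add P Q hP hQ => rw [map_add, map_add, map_add, hP, hQ, map_add]
    | monomial β c =>
      rw [MvPolynomial.map_monomial, multiMoment_monomial, multiMoment_monomial, map_mul,
        constantCoeff_C, map_prod]
      simp only [constantCoeff_timeMoment]
  | succ d ih =>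
    obtain ⟨i, hi⟩ : ∃ i, ν i ≠ 0 := by
      by_contra h
      push Not at h
      have : ν = 0 := Finsupp.ext h
      rw [this, map_zero] at hd
      omega
    obtain ⟨κ, rfl⟩ : ∃ κ, ν = κ + Finsupp.single i 1 := by
      refine ⟨ν - Finsupp.single i 1, (tsub_add_cancel_of_le ?_).symm⟩
      rw [Finsupp.single_le_iff]
      omega
    rw [map_add, Finsupp.degree_single] at hd
    have h := ih κ (MvPolynomial.psum (Fin n) K (i + 1) * Q) (by omega)
    rw [← epsD_multiMoment (fun i k => epsD_timeMoment he i k), coeff_epsD] at h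
    rw [multiFactorial_add_single, Finsupp.prod_add_index' (fun i => pow_zero _)
      (fun i m n => pow_add _ m n), Finsupp.prod_single_index
        (h := fun i k => MvPolynomial.psum (Fin n) K (i + 1) ^ k) (pow_zero _), pow_one, mul_assoc,
      ← h]
    push_cast
    ring

/-- The functional of the Laguerre weight with times. -/
abbrev timeFun (a e : K) : Polynomial (MvPowerSeries ℕ K) →ₗ[MvPowerSeries ℕ K] MvPowerSeries ℕ K :=
  momentFun (timeMoment a e)

/-- A power series is a unit as soon as its constant term is one. -/
instance isLocalHom_constantCoeff :
    IsLocalHom (constantCoeff : MvPowerSeries ℕ K →+* K) :=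
  ⟨fun _ h => isUnit_iff_constantCoeff.2 h⟩

omit [CharZero K] in
theorem constantCoeff_timeFun (f : Polynomial (MvPowerSeries ℕ K)) :
    constantCoeff (timeFun a e f) = laguerreFun a e (f.map constantCoeff) := by
  rw [map_momentFun]
  simp only [constantCoeff_timeMoment]

theorem isUnit_orthNorm_timeFun (he : e ≠ 0) (ha : ∀ n : ℕ, a + (n + 1) * e ≠ 0) (n : ℕ) :
    IsUnit (orthNorm (timeFun a e) n) := by
  rw [isUnit_iff_constantCoeff, map_orthNorm (L := timeFun a e) constantCoeff constantCoeff_timeFun]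
  exact (orthNorm_laguerre_ne_zero he ha n).isUnit

variable [Algebra ℂ K]

/-- The product of the norms of the first `n` orthogonal polynomials is, up to its value at time
`0`, the generating series of pairs of permutations at `U = n` and `V = n + a / e`. -/
theorem prod_orthNorm_timeFun (he : e ≠ 0) (ha : ∀ n : ℕ, a + (n + 1) * e ≠ 0) (n : ℕ) :
    ∏ p ∈ range n, orthNorm (timeFun a e) p =
      C (∏ p ∈ range n, orthNorm (laguerreFun a e) p) *
        mvExp (timeSeries (n : K) (n + a / e) e) := by
  have hn : (n.factorial : K) ≠ 0 := by exact_mod_cast n.factorial_ne_zero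
  have hvdm : (vdm n : MvPolynomial (Fin n) (MvPowerSeries ℕ K)) ^ 2 =
      MvPolynomial.map C (vdm n ^ 2) := by
    rw [map_pow, vdm, vdm, map_prod]
    simp
  have hT := multiMoment_vdm_sq (timeMoment a e) rfl (isUnit_orthNorm_timeFun he ha) n
  have hL := multiMoment_vdm_sq (laguerreMoment a e) rfl
    (fun j => (orthNorm_laguerre_ne_zero he ha j).isUnit) n
  have h1 : laguerreAvg a e n 1 = n.factorial * ∏ p ∈ range n, orthNorm (laguerreFun a e) p := by
    rw [laguerreAvg, one_mul, hL]
  rw [timeSeries, ← rescale_mvExp _ (constantCoeff_transSeries _ _), mvExp_transSeries]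
  ext ν
  have h2 := coeff_multiMoment (a := a) he n ν (vdm n ^ 2)
  rw [← hvdm, hT] at h2
  change _ = laguerreAvg a e n _ at h2
  rw [← coeff_pairSeries_mul n he, h1] at h2
  have h3 : (n.factorial : MvPowerSeries ℕ K) = C (n.factorial : K) := (map_natCast C _).symm
  have hw : e ^ wt ν = e ^ ν.degree * ν.prod fun i k => (e ^ i) ^ k := by
    rw [wt_apply, Finsupp.degree_apply, Finsupp.sum, Finsupp.prod, ← prod_pow_eq_pow_sum,
      ← prod_pow_eq_pow_sum, ← prod_mul_distrib]
    refine prod_congr rfl fun i _ => ?_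
    rw [← pow_mul, ← pow_add]
    congr 1
    ring
  have hp : (ν.prod fun i m => ((i + 1 : K)) ^ m * m.factorial) =
      (ν.prod fun i m => ((i + 1 : K)) ^ m) * multiFactorial ν := by
    rw [multiFactorial, Finsupp.prod, Finsupp.prod, Finsupp.prod, prod_mul_distrib]
    push_cast
    rfl
  have hm : (multiFactorial ν : K) ≠ 0 := by exact_mod_cast multiFactorial_ne_zero ν
  have hd : e ^ ν.degree ≠ 0 := pow_ne_zero _ he
  rw [h3, coeff_C_mul, hw, hp] at h2
  rw [coeff_C_mul, coeff_rescale]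
  simp only [mul_pow]
  rw [Finsupp.prod_mul]
  refine mul_left_cancel₀ (mul_ne_zero (mul_ne_zero hn hd) hm) ?_
  linear_combination h2

end Times

/-! ### The Toda lattice over polynomials in `x` -/

section PolynomialToda

open Finset
open scoped Polynomial

variable {K : Type*} [Field K] [Algebra ℂ K] (a e : K)

/-- The shift `x ↦ x + k e` of polynomials. -/
def polyShift (k : ℤ) : K[X] →ₐ[ℂ] K[X] :=
  (Polynomial.aeval (Polynomial.X + Polynomial.C ((k : K) * e)) : K[X] →ₐ[K] K[X]).restrictScalars ℂ

/-- The evaluation of polynomials at the lattice point `x = n e`. -/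
def polyEval (n : ℤ) : K[X] →ₐ[ℂ] K :=
  (Polynomial.aeval ((n : K) * e) : K[X] →ₐ[K] K).restrictScalars ℂ

theorem polyShift_C (k : ℤ) (c : K) : polyShift e k (Polynomial.C c) = Polynomial.C c :=
  Polynomial.aeval_C _ c

theorem polyShift_X (k : ℤ) :
    polyShift e k Polynomial.X = Polynomial.X + Polynomial.C ((k : K) * e) :=
  Polynomial.aeval_X _

theorem polyEval_C (n : ℤ) (c : K) : polyEval e n (Polynomial.C c) = c := Polynomial.aeval_C _ c

theorem polyEval_X (n : ℤ) : polyEval e n Polynomial.X = n * e := Polynomial.aeval_X _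

theorem polyEval_polyShift (n k : ℤ) (f : K[X]) :
    polyEval e n (polyShift e k f) = polyEval e (n + k) f := by
  induction f using Polynomial.induction_on' with
  | add f g hf hg => rw [map_add, map_add, map_add, hf, hg]
  | monomial j c =>
    rw [← Polynomial.C_mul_X_pow_eq_monomial]
    simp only [map_mul, map_pow, map_add, polyShift_C, polyShift_X, polyEval_C, polyEval_X]
    push_cast
    ring

theorem polyShift_polyShift (j k : ℤ) (f : K[X]) :
    polyShift e j (polyShift e k f) = polyShift e (j + k) f := by
  induction f using Polynomial.induction_on' with
  | add f g hf hg => rw [map_add, map_add, map_add, hf, hg]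
  | monomial j c =>
    rw [← Polynomial.C_mul_X_pow_eq_monomial]
    simp only [map_mul, map_pow, map_add, polyShift_C, polyShift_X]
    push_cast
    simp only [map_add, add_mul]
    ring

theorem polyShift_zero (f : K[X]) : polyShift e 0 f = f := by
  induction f using Polynomial.induction_on' with
  | add f g hf hg => rw [map_add, hf, hg]
  | monomial j c =>
    rw [← Polynomial.C_mul_X_pow_eq_monomial]
    simp [polyShift_C, polyShift_X]

/-- The shift on the coefficients of a power series. -/
def serShift (k : ℤ) : MvPowerSeries ℕ K[X] →+* MvPowerSeries ℕ K[X] :=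
  MvPowerSeries.map (polyShift e k : K[X] →+* K[X])

/-- The evaluation of the coefficients of a power series at a lattice point. -/
def serEval (n : ℤ) : MvPowerSeries ℕ K[X] →+* MvPowerSeries ℕ K :=
  MvPowerSeries.map (polyEval e n : K[X] →+* K)

theorem coeff_serShift (k : ℤ) (f : MvPowerSeries ℕ K[X]) (ν : ℕ →₀ ℕ) :
    MvPowerSeries.coeff ν (serShift e k f) = polyShift e k (MvPowerSeries.coeff ν f) :=
  MvPowerSeries.coeff_map _ _ _

theorem coeff_serEval (n : ℤ) (f : MvPowerSeries ℕ K[X]) (ν : ℕ →₀ ℕ) :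
    MvPowerSeries.coeff ν (serEval e n f) = polyEval e n (MvPowerSeries.coeff ν f) :=
  MvPowerSeries.coeff_map _ _ _

theorem serEval_serShift (n k : ℤ) (f : MvPowerSeries ℕ K[X]) :
    serEval e n (serShift e k f) = serEval e (n + k) f := by
  ext ν
  rw [coeff_serEval, coeff_serShift, polyEval_polyShift, coeff_serEval]

theorem serShift_serShift (j k : ℤ) (f : MvPowerSeries ℕ K[X]) :
    serShift e j (serShift e k f) = serShift e (j + k) f := by
  ext1 ν
  rw [coeff_serShift, coeff_serShift, polyShift_polyShift, coeff_serShift]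

theorem serShift_zero (f : MvPowerSeries ℕ K[X]) : serShift e 0 f = f := by
  ext1 ν
  rw [coeff_serShift, polyShift_zero]

variable {e} in
/-- A polynomial identity holds as soon as it holds at almost all lattice points. -/
theorem poly_ext [CharZero K] (he : e ≠ 0) (N : ℕ) {f g : K[X]}
    (h : ∀ n : ℕ, N ≤ n → polyEval e n f = polyEval e n g) : f = g := by
  refine Polynomial.eq_of_infinite_eval_eq f g ?_
  refine Set.Infinite.mono (s := (fun n : ℕ => (n : K) * e) '' Set.Ici N) ?_ ?_
  · rintro _ ⟨n, hn, rfl⟩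
    have := h n hn
    rw [polyEval, AlgHom.restrictScalars_apply, AlgHom.restrictScalars_apply,
      Polynomial.coe_aeval_eq_eval]
      at this
    simpa using this
  · refine (Set.Ici_infinite N).image fun m _ n _ hmn => ?_
    exact_mod_cast mul_right_cancel₀ he hmn

variable {e} in
/-- An identity of power series holds as soon as it holds at almost all lattice points. -/
theorem ser_ext [CharZero K] (he : e ≠ 0) (N : ℕ) {f g : MvPowerSeries ℕ K[X]}
    (h : ∀ n : ℕ, N ≤ n → serEval e n f = serEval e n g) : f = g := by
  ext1 ν
  refine poly_ext he N fun n hn => ?_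
  rw [← coeff_serEval, ← coeff_serEval, h n hn]

/-- The derivation `e ∂/∂t_i`. -/
def serD (i : ℕ) (f : MvPowerSeries ℕ K[X]) : MvPowerSeries ℕ K[X] :=
  MvPowerSeries.C (Polynomial.C e) * MvPowerSeries.pderiv K[X] i f

omit [Algebra ℂ K] in
theorem coeff_serD (i : ℕ) (f : MvPowerSeries ℕ K[X]) (ν : ℕ →₀ ℕ) :
    MvPowerSeries.coeff ν (serD e i f) =
    Polynomial.C e * (MvPowerSeries.coeff (ν + Finsupp.single i 1) f * (ν i + 1)) := by
  rw [serD, MvPowerSeries.coeff_C_mul, MvPowerSeries.coeff_pderiv]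

theorem serEval_serD (n : ℤ) (i : ℕ) (f : MvPowerSeries ℕ K[X]) :
    serEval e n (serD e i f) = epsD e i (serEval e n f) := by
  ext ν
  rw [coeff_serEval, coeff_serD, coeff_epsD, coeff_serEval]
  simp [polyEval_C]

theorem serShift_serD (k : ℤ) (i : ℕ) (f : MvPowerSeries ℕ K[X]) :
    serShift e k (serD e i f) = serD e i (serShift e k f) := by
  ext1 ν
  rw [coeff_serShift, coeff_serD, coeff_serD, coeff_serShift]
  simp [polyShift_C]

omit [Algebra ℂ K] in
theorem serD_add (i : ℕ) (f g : MvPowerSeries ℕ K[X]) :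
    serD e i (f + g) = serD e i f + serD e i g := by
  rw [serD, map_add, mul_add, serD, serD]

omit [Algebra ℂ K] in
theorem serD_sub (i : ℕ) (f g : MvPowerSeries ℕ K[X]) :
    serD e i (f - g) = serD e i f - serD e i g := by
  rw [serD, map_sub, mul_sub, serD, serD]

theorem map_typeSum {R S : Type*} [CommRing R] [CommRing S] (φ : R →+* S) {E : Type*} [Fintype E]
    (P : Equiv.Perm E → Equiv.Perm E → Prop) (U V : R) (ν : ℕ →₀ ℕ) :
    φ (typeSum P U V ν) = typeSum P (φ U) (φ V) ν := by
  rw [typeSum, map_sum, typeSum]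
  refine sum_congr rfl fun x _ => ?_
  split_ifs <;> simp

theorem map_transSeries {R S : Type*} [CommRing R] [CommRing S] [Algebra ℂ R] [Algebra ℂ S]
    (φ : R →ₐ[ℂ] S) (U V : R) :
    MvPowerSeries.map (φ : R →+* S) (transSeries U V) = transSeries (φ U) (φ V) := by
  ext ν
  rw [MvPowerSeries.coeff_map, coeff_transSeries, coeff_transSeries]
  split_ifs
  · simp
  · change φ _ = _
    rw [map_smul]
    congr 1
    exact map_typeSum (φ : R →+* S) _ U V ν


end PolynomialToda

/-! ### The solution at the lattice points -/

section LatticePoints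

open Finset
open scoped Polynomial

variable {K : Type*} [Field K] [CharZero K] [Algebra ℂ K] {a e : K}

/-- The logarithm of the tau-function without its correction factor, as a series in the times: the
generating series of transitive pairs at `U = x / e` and `V = (x + a) / e`. -/
def tauLog (a e : K) : MvPowerSeries ℕ K[X] :=
  timeSeries (Polynomial.C e⁻¹ * Polynomial.X)
    (Polynomial.C e⁻¹ * (Polynomial.X + Polynomial.C a)) (Polynomial.C e)

/-- The second difference of `tauLog`. -/
def tauDiff (a e : K) : MvPowerSeries ℕ K[X] :=
  serShift e 1 (tauLog a e) + serShift e (-1) (tauLog a e) - 2 * tauLog a e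

/-- The coefficient `V` of the Lax operator. -/
def polyV (a e : K) : MvPowerSeries ℕ K[X] :=
  serShift e 1 (serD e 0 (tauLog a e)) - serD e 0 (tauLog a e)

/-- The coefficient `W` of the Lax operator. -/
def polyW (a e : K) : MvPowerSeries ℕ K[X] :=
  MvPowerSeries.C (Polynomial.X * (Polynomial.X + Polynomial.C a)) * mvExp (tauDiff a e)

omit [CharZero K] in
theorem constantCoeff_tauLog : MvPowerSeries.constantCoeff (tauLog a e) = 0 :=
  constantCoeff_timeSeries _ _ _

omit [CharZero K] in
theorem constantCoeff_serShift (k : ℤ) (f : MvPowerSeries ℕ K[X]) :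
    MvPowerSeries.constantCoeff (serShift e k f) =
      polyShift e k (MvPowerSeries.constantCoeff f) := by
  rw [← MvPowerSeries.coeff_zero_eq_constantCoeff_apply, coeff_serShift,
    MvPowerSeries.coeff_zero_eq_constantCoeff_apply]

omit [CharZero K] in
theorem constantCoeff_tauDiff : MvPowerSeries.constantCoeff (tauDiff a e) = 0 := by
  rw [tauDiff, map_sub, map_add, map_mul, constantCoeff_serShift, constantCoeff_serShift,
    constantCoeff_tauLog]
  simp

omit [CharZero K] in
theorem serEval_tauLog (he : e ≠ 0) (n : ℕ) :
    serEval e n (tauLog a e) = timeSeries (n : K) (n + a / e) e := by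
  have h := map_transSeries (polyEval e n) (Polynomial.C e⁻¹ * Polynomial.X)
    (Polynomial.C e⁻¹ * (Polynomial.X + Polynomial.C a))
  have h1 : polyEval e n (Polynomial.C e⁻¹ * Polynomial.X) = (n : K) := by
    rw [map_mul, polyEval_C, polyEval_X]
    push_cast
    field_simp
  have h2 : polyEval e n (Polynomial.C e⁻¹ * (Polynomial.X + Polynomial.C a)) = n + a / e := by
    rw [map_mul, map_add, polyEval_C, polyEval_X, polyEval_C]
    push_cast
    field_simp
  rw [h1, h2] at h
  ext ν
  rw [coeff_serEval, tauLog, timeSeries, timeSeries, MvPowerSeries.coeff_rescale,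
    MvPowerSeries.coeff_rescale, ← h, MvPowerSeries.coeff_map, map_mul, Finsupp.prod, map_prod]
  congr 1
  refine prod_congr rfl fun i _ => ?_
  simp [polyEval_C]

omit [CharZero K] in
theorem constantCoeff_serEval_tauLog (he : e ≠ 0) (n : ℕ) :
    MvPowerSeries.constantCoeff (serEval e n (tauLog a e)) = 0 := by
  rw [serEval_tauLog he, constantCoeff_timeSeries]

omit [CharZero K] [Algebra ℂ K] in
theorem epsD_C (i : ℕ) (c : K) : epsD e i (MvPowerSeries.C c) = 0 := by
  have h : MvPowerSeries.C c = c • (1 : MvPowerSeries ℕ K) := by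
    rw [MvPowerSeries.smul_eq_C_mul, mul_one]
  rw [h, Derivation.map_smul, Derivation.map_one_eq_zero, smul_zero]

omit [CharZero K] in
theorem epsD_mvExp (i : ℕ) {h : MvPowerSeries ℕ K} (h0 : MvPowerSeries.constantCoeff h = 0) :
    epsD e i (mvExp h) = mvExp h * epsD e i h := by
  rw [epsD, Derivation.smul_apply, Derivation.smul_apply, pderiv_mvExp i h0, mul_smul_comm]

omit [Algebra ℂ K] in
theorem deriv_functional_timeFun (he : e ≠ 0) (i : ℕ) (f : Polynomial (MvPowerSeries ℕ K)) :
    epsD e i (timeFun a e f) = timeFun a e (Polynomial.X ^ (i + 1) * f) +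
      timeFun a e (coeffD (epsD e i) f) :=
  epsD_momentFun (fun i k => epsD_timeMoment he i k) i f

/-- The logarithmic derivative of a product of units. -/
theorem deriv_prod_eq {R A : Type*} [CommRing R] [CommRing A] [Algebra R A] (D : Derivation R A A)
    {h g : ℕ → A} (hg : ∀ p, h p * g p = 1) (n : ℕ) :
    D (∏ p ∈ range n, h p) = (∏ p ∈ range n, h p) * ∑ p ∈ range n, D (h p) * g p := by
  induction n with
  | zero => simp
  | succ n ih =>
    rw [prod_range_succ, sum_range_succ, Derivation.leibniz, ih, smul_eq_mul, smul_eq_mul]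
    linear_combination -(∏ p ∈ range n, h p) * D (h n) * hg n

/-- The first derivatives of the tau-function at the lattice point `x = n e`. -/
theorem epsD_serEval_tauLog (he : e ≠ 0) (ha : ∀ n : ℕ, a + (n + 1) * e ≠ 0) (i n : ℕ) :
    epsD e i (serEval e n (tauLog a e)) =
      ∑ p ∈ range n, orthMat (timeFun a e) (i + 1) p p * orthInv (timeFun a e) p := by
  have hu := isUnit_orthNorm_timeFun (a := a) he ha
  have h1 := prod_orthNorm_timeFun (a := a) he ha n
  have h2 := deriv_prod_eq (epsD e i) (fun p => orthNorm_mul_orthInv (hu p)) n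
  have h3 : IsUnit (∏ p ∈ range n, orthNorm (timeFun a e) p) :=
    IsUnit.prod_iff.2 fun p _ => hu p
  refine h3.mul_left_cancel ?_
  simp only [deriv_orthNorm (deriv_functional_timeFun he) hu] at h2
  rw [← h2, h1, Derivation.leibniz, epsD_C, epsD_mvExp i (constantCoeff_timeSeries _ _ _),
    serEval_tauLog he]
  simp only [smul_eq_mul]
  ring

/-- The second derivatives of the tau-function at the lattice points are the two-point functions. -/
theorem serEval_serD_serD_tauLog (he : e ≠ 0) (ha : ∀ n : ℕ, a + (n + 1) * e ≠ 0) (i j n : ℕ) :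
    serEval e n (serD e i (serD e j (tauLog a e))) = orthTwo (timeFun a e) (i + 1) (j + 1) n := by
  have hu := isUnit_orthNorm_timeFun (a := a) he ha
  rw [serEval_serD, serEval_serD, epsD_serEval_tauLog he ha,
    deriv_sum_orthMat (deriv_functional_timeFun he) hu]

theorem serEval_diff_serD_tauLog (he : e ≠ 0) (ha : ∀ n : ℕ, a + (n + 1) * e ≠ 0) (i n : ℕ) :
    serEval e n (serShift e 1 (serD e i (tauLog a e)) - serD e i (tauLog a e)) =
      orthMat (timeFun a e) (i + 1) n n * orthInv (timeFun a e) n := by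
  have h := epsD_serEval_tauLog he ha i (n + 1)
  push_cast at h
  rw [map_sub, serEval_serShift, serEval_serD, serEval_serD, h, epsD_serEval_tauLog he ha,
    sum_range_succ]
  ring

/-- At the lattice points, `V` is the diagonal coefficient of the three term recurrence. -/
theorem serEval_polyV (he : e ≠ 0) (ha : ∀ n : ℕ, a + (n + 1) * e ≠ 0) (n : ℕ) :
    serEval e n (polyV a e) = orthV (timeFun a e) n :=
  serEval_diff_serD_tauLog he ha 0 n

omit [CharZero K] in
theorem isUnit_mvExp {h : MvPowerSeries ℕ K} (h0 : MvPowerSeries.constantCoeff h = 0) :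
    IsUnit (mvExp h) := by
  rw [MvPowerSeries.isUnit_iff_constantCoeff, constantCoeff_mvExp h0]
  exact isUnit_one

/-- At the lattice points, `W` is the subdiagonal coefficient of the three term recurrence. -/
theorem serEval_polyW (he : e ≠ 0) (ha : ∀ n : ℕ, a + (n + 1) * e ≠ 0) (n : ℕ) :
    serEval e (n + 1) (polyW a e) = orthW (timeFun a e) (n + 1) := by
  have hu := isUnit_orthNorm_timeFun (a := a) he ha
  have hl : ∀ j, orthNorm (laguerreFun a e) j ≠ 0 := orthNorm_laguerre_ne_zero he ha
  have hF : ∀ m : ℕ, MvPowerSeries.constantCoeff (serEval e m (tauLog a e)) = 0 :=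
    constantCoeff_serEval_tauLog he
  -- The ratio of the products of norms at the lattice points `m + 1` and `m`.
  have hN : ∀ m : ℕ, MvPowerSeries.C (orthNorm (laguerreFun a e) m) *
      mvExp (serEval e (m + 1 : ℕ) (tauLog a e)) =
      mvExp (serEval e m (tauLog a e)) * orthNorm (timeFun a e) m := by
    intro m
    have h := prod_orthNorm_timeFun (a := a) he ha (m + 1)
    rw [prod_range_succ, prod_range_succ, prod_orthNorm_timeFun he ha m, ← serEval_tauLog he,
      ← serEval_tauLog he, map_mul] at h
    have hP : IsUnit (MvPowerSeries.C (∏ p ∈ range m, orthNorm (laguerreFun a e) p) :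
        MvPowerSeries ℕ K) := (prod_ne_zero_iff.2 fun p _ => hl p).isUnit.map _
    refine hP.mul_left_cancel ?_
    linear_combination -h
  have hq := orthNorm_laguerre_succ (n := n) (a := a) fun j _ => (hl j).isUnit
  set f0 := serEval e n (tauLog a e)
  set f1 := serEval e (n + 1 : ℕ) (tauLog a e)
  set f2 := serEval e (n + 1 + 1 : ℕ) (tauLog a e)
  have hd : serEval e (n + 1) (tauDiff a e) = f2 + f0 - 2 * f1 := by
    rw [tauDiff, map_sub, map_add, map_mul, map_ofNat, serEval_serShift, serEval_serShift]
    push_cast [f0, f1, f2]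
    rw [show (n : ℤ) + 1 + -1 = n by ring]
  have hd0 : MvPowerSeries.constantCoeff (f2 + f0 - 2 * f1) = 0 := by
    rw [map_sub, map_add, map_mul, hF, hF, hF]
    simp
  have hx : mvExp (f2 + f0 - 2 * f1) * mvExp f1 ^ 2 = mvExp f2 * mvExp f0 := by
    have h11 : MvPowerSeries.constantCoeff (f1 + f1) = 0 := by rw [map_add, hF, add_zero]
    rw [sq, ← mvExp_add (hF _) (hF _), ← mvExp_add hd0 h11, ← mvExp_add (hF _) (hF _)]
    congr 1
    ring
  have hW : serEval e (n + 1) (polyW a e) =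
      MvPowerSeries.C ((n + 1) * e * (a + (n + 1) * e)) * mvExp (f2 + f0 - 2 * f1) := by
    have hm := map_mvExp (polyEval e (n + 1)) (constantCoeff_tauDiff (a := a) (e := e))
    change serEval e (n + 1) _ = mvExp (serEval e (n + 1) _) at hm
    rw [polyW, map_mul, hm, hd]
    congr 1
    rw [serEval, MvPowerSeries.map_C]
    congr 1
    change polyEval e (n + 1) _ = _
    rw [map_mul, map_add, polyEval_C, polyEval_X]
    push_cast
    ring
  rw [hW]
  change _ = orthNorm (timeFun a e) (n + 1) * orthInv (timeFun a e) n
  have hi := orthNorm_mul_orthInv (hu n)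
  have e0 := hN n
  have e1 := hN (n + 1)
  rw [hq, map_mul] at e1
  have u0 : IsUnit (mvExp f0) := isUnit_mvExp (hF _)
  have u1 : IsUnit (mvExp f1) := isUnit_mvExp (hF _)
  refine ((u0.mul u1).mul (hu n)).mul_left_cancel ?_
  set Q := (MvPowerSeries.C ((n + 1) * e * (a + (n + 1) * e)) : MvPowerSeries ℕ K)
  set k0 := (MvPowerSeries.C (orthNorm (laguerreFun a e) n) : MvPowerSeries ℕ K)
  set y := mvExp (f2 + f0 - 2 * f1)
  set h0 := orthNorm (timeFun a e) n
  set h1 := orthNorm (timeFun a e) (n + 1)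
  linear_combination (-(Q * y * mvExp f1)) * e0 + (Q * k0) * hx + mvExp f0 * e1 -
    mvExp f0 * mvExp f1 * h1 * hi

end LatticePoints

/-! ### Powers of the Lax operator -/

section LaxCoefficients

open Finset
open scoped Polynomial

variable {K : Type*} [Field K] [Algebra ℂ K]

/-- The coefficient of `Λ ^ j` in `(Λ + V + W Λ⁻¹) ^ k`. -/
def laxCoeff (e : K) (V W : MvPowerSeries ℕ K[X]) : ℕ → ℤ → MvPowerSeries ℕ K[X]
  | 0, j => if j = 0 then 1 else 0
  | k + 1, j => serShift e 1 (laxCoeff e V W k (j - 1)) + V * laxCoeff e V W k j +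
      W * serShift e (-1) (laxCoeff e V W k (j + 1))

variable (e : K) (V W : MvPowerSeries ℕ K[X])

theorem laxCoeff_zero (j : ℤ) : laxCoeff e V W 0 j = if j = 0 then 1 else 0 := rfl

theorem laxCoeff_succ (k : ℕ) (j : ℤ) : laxCoeff e V W (k + 1) j =
    serShift e 1 (laxCoeff e V W k (j - 1)) + V * laxCoeff e V W k j +
      W * serShift e (-1) (laxCoeff e V W k (j + 1)) := rfl

/-- The coefficients of `L ^ (k + 1) = L ^ k L`, while the definition reads `L ^ (k + 1) = L L ^ k`.
-/
theorem laxCoeff_succ' (k : ℕ) (j : ℤ) : laxCoeff e V W (k + 1) j =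
    laxCoeff e V W k (j - 1) + laxCoeff e V W k j * serShift e j V +
      laxCoeff e V W k (j + 1) * serShift e (j + 1) W := by
  induction k generalizing j with
  | zero =>
    rw [laxCoeff_succ]
    simp only [laxCoeff_zero]
    split_ifs <;> first | (exfalso; omega) | skip
    all_goals simp_all [serShift_zero]
  | succ k ih =>
    rw [laxCoeff_succ e V W k (j - 1), laxCoeff_succ e V W k j, laxCoeff_succ e V W k (j + 1),
      laxCoeff_succ e V W (k + 1) j, ih (j - 1), ih j, ih (j + 1)]
    simp only [map_add, map_mul, serShift_serShift]
    rw [show (1 : ℤ) + (j - 1) = j by ring, show (1 : ℤ) + (j - 1 + 1) = j + 1 by ring,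
      show (-1 : ℤ) + (j + 1) = j by ring, show (-1 : ℤ) + (j + 1 + 1) = j + 1 by ring,
      show j - 1 + 1 = j by ring, show j + 1 - 1 = j by ring]
    ring

variable {e} [CharZero K] {a : K}

/-- At the lattice point `x = n e`, the powers of the Lax operator are the matrix elements of
multiplication by powers of the variable.  The recurrence for `L ^ k` visits the lattice points down
to `n - k`, which have to be non-negative. -/
theorem serEval_laxCoeff (he : e ≠ 0) (ha : ∀ n : ℕ, a + (n + 1) * e ≠ 0) {k n : ℕ} (hk : k ≤ n)
    (m : ℕ) : serEval e n (laxCoeff e (polyV a e) (polyW a e) k (m - n)) =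
      orthMat (timeFun a e) k n m * orthInv (timeFun a e) m := by
  have hu := isUnit_orthNorm_timeFun (a := a) he ha
  induction k generalizing n m with
  | zero =>
    rw [laxCoeff_zero, orthMat_zero hu]
    by_cases h : n = m
    · subst h
      simp [orthNorm_mul_orthInv (hu n)]
    · rw [if_neg (by omega), if_neg h, map_zero, zero_mul]
  | succ k ih =>
    obtain ⟨n, rfl⟩ : ∃ n', n = n' + 1 := ⟨n - 1, by omega⟩
    rw [laxCoeff_succ, map_add, map_add, map_mul, map_mul, serEval_serShift, serEval_serShift,
      serEval_polyV he ha, orthMat_succ hu]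
    have h1 := ih (n := n + 1 + 1) (by omega) m
    have h2 := ih (n := n + 1) (by omega) m
    have h3 := ih (n := n) (by omega) m
    have hw := serEval_polyW (a := a) he ha n
    push_cast at h1 h2 h3 hw ⊢
    rw [show (m : ℤ) - (n + 1) - 1 = m - (n + 1 + 1) by ring, h1, h2, hw,
      show (n : ℤ) + 1 + -1 = n by ring, show (m : ℤ) - (n + 1) + 1 = m - n by ring, h3]
    ring

end LaxCoefficients

/-! ### Identities between the coefficients and the tau-function -/

section TauIdentities

open Finset
open scoped Polynomial

variable {K : Type*} [Field K] [CharZero K] [Algebra ℂ K] {a e : K}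

/-- The coefficients of the powers of the Lax operator of the dessin solution. -/
abbrev dessinLax (a e : K) (k : ℕ) (j : ℤ) : MvPowerSeries ℕ K[X] :=
  laxCoeff e (polyV a e) (polyW a e) k j

theorem serEval_dessinLax_neg (he : e ≠ 0) (ha : ∀ n : ℕ, a + (n + 1) * e ≠ 0) {k n : ℕ}
    (hk : k ≤ n + 1) : serEval e (n + 1) (dessinLax a e k (-1)) =
      orthMat (timeFun a e) k (n + 1) n * orthInv (timeFun a e) n := by
  have h := serEval_laxCoeff he ha hk n
  push_cast at h
  rwa [show (n : ℤ) - (n + 1) = -1 by ring] at h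

theorem serEval_dessinLax_zero (he : e ≠ 0) (ha : ∀ n : ℕ, a + (n + 1) * e ≠ 0) {k n : ℕ}
    (hk : k ≤ n) : serEval e n (dessinLax a e k 0) =
      orthMat (timeFun a e) k n n * orthInv (timeFun a e) n := by
  have h := serEval_laxCoeff he ha hk n
  rwa [sub_self] at h

theorem serEval_dessinLax_one (he : e ≠ 0) (ha : ∀ n : ℕ, a + (n + 1) * e ≠ 0) {k n : ℕ}
    (hk : k ≤ n) : serEval e n (dessinLax a e k 1) =
      orthMat (timeFun a e) k n (n + 1) * orthInv (timeFun a e) (n + 1) := by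
  have h := serEval_laxCoeff he ha hk (n + 1)
  push_cast at h
  rwa [show (n : ℤ) + 1 - n = 1 by ring] at h

/-- The variant of `ser_ext` for the lattice points `x = (n + 1) e`. -/
theorem ser_ext_succ (he : e ≠ 0) (N : ℕ) {f g : MvPowerSeries ℕ K[X]}
    (h : ∀ n : ℕ, N ≤ n → serEval e (n + 1) f = serEval e (n + 1) g) : f = g := by
  refine ser_ext he (N + 1) fun n hn => ?_
  obtain ⟨n, rfl⟩ : ∃ n', n = n' + 1 := ⟨n - 1, by omega⟩
  exact_mod_cast h n (by omega)

/-- The mixed derivatives of `tauLog` with one index zero. -/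
theorem serD_serD_zero_tauLog (he : e ≠ 0) (ha : ∀ n : ℕ, a + (n + 1) * e ≠ 0) (i : ℕ) :
    serD e i (serD e 0 (tauLog a e)) = dessinLax a e (i + 1) (-1) := by
  have hu := isUnit_orthNorm_timeFun (a := a) he ha
  refine ser_ext_succ he i fun n hn => ?_
  have h := serEval_serD_serD_tauLog he ha i 0 (n + 1)
  push_cast at h
  rw [serEval_dessinLax_neg he ha (by omega), h, orthTwo_one hu]

/-- The first difference of the first derivatives of `tauLog`. -/
theorem diff_serD_tauLog (he : e ≠ 0) (ha : ∀ n : ℕ, a + (n + 1) * e ≠ 0) (i : ℕ) :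
    serShift e 1 (serD e i (tauLog a e)) - serD e i (tauLog a e) = dessinLax a e (i + 1) 0 := by
  refine ser_ext he (i + 1) fun n hn => ?_
  rw [serEval_diff_serD_tauLog he ha, serEval_dessinLax_zero he ha hn]

/-- The symmetry of the powers of the Lax operator. -/
theorem dessinLax_neg_one (he : e ≠ 0) (ha : ∀ n : ℕ, a + (n + 1) * e ≠ 0) (k : ℕ) :
    dessinLax a e k (-1) = polyW a e * serShift e (-1) (dessinLax a e k 1) := by
  have hu := isUnit_orthNorm_timeFun (a := a) he ha
  refine ser_ext_succ he k fun n hn => ?_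
  rw [serEval_dessinLax_neg he ha (by omega), map_mul, serEval_polyW he ha, serEval_serShift,
    show (n : ℤ) + 1 + -1 = n by ring, serEval_dessinLax_one he ha hn, orthMat_comm,
    ← orthW_succ_mul hu]
  ring

/-- The two-point functions, with indices shifted by one and extended by zero. -/
def twoPoint (a e : K) : ℕ → ℕ → MvPowerSeries ℕ K[X]
  | i + 1, j + 1 => serD e i (serD e j (tauLog a e))
  | _, _ => 0

theorem serEval_twoPoint (he : e ≠ 0) (ha : ∀ n : ℕ, a + (n + 1) * e ≠ 0) (i j n : ℕ) :
    serEval e n (twoPoint a e i j) = orthTwo (timeFun a e) i j n := by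
  have hu := isUnit_orthNorm_timeFun (a := a) he ha
  match i, j with
  | i + 1, j + 1 => exact serEval_serD_serD_tauLog he ha i j n
  | 0, j => rw [orthTwo_comm, orthTwo_zero hu]; simp [twoPoint]
  | i + 1, 0 => rw [orthTwo_zero hu]; simp [twoPoint]

/-- The two-point functions in terms of the powers of the Lax operator. -/
theorem twoPoint_second_difference (he : e ≠ 0) (ha : ∀ n : ℕ, a + (n + 1) * e ≠ 0) (i j : ℕ) :
    twoPoint a e (i + 2) j - 2 * twoPoint a e (i + 1) (j + 1) + twoPoint a e i (j + 2) =
      2 * dessinLax a e i (-1) * dessinLax a e j (-1) - polyW a e *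
        (dessinLax a e i 0 * serShift e (-1) (dessinLax a e j 0) +
          serShift e (-1) (dessinLax a e i 0) * dessinLax a e j 0) := by
  have hu := isUnit_orthNorm_timeFun (a := a) he ha
  refine ser_ext_succ he (i + j) fun n hn => ?_
  have h0 : ∀ k ≤ i + j, serEval e (n + 1) (dessinLax a e k 0) =
      orthMat (timeFun a e) k (n + 1) (n + 1) * orthInv (timeFun a e) (n + 1) := by
    intro k hk
    have h := serEval_dessinLax_zero (a := a) he ha (k := k) (n := n + 1) (by omega)
    exact_mod_cast h
  have h2 : ∀ k l, serEval e (n + 1) (twoPoint a e k l) = orthTwo (timeFun a e) k l (n + 1) := by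
    intro k l
    have h := serEval_twoPoint (a := a) he ha k l (n + 1)
    exact_mod_cast h
  simp only [map_sub, map_add, map_mul, map_ofNat, serEval_serShift]
  rw [show (n : ℤ) + 1 + -1 = n by ring, serEval_dessinLax_neg he ha (by omega),
    serEval_dessinLax_neg he ha (by omega), h0 i (by omega), h0 j (by omega), h2, h2, h2,
    serEval_dessinLax_zero he ha (by omega), serEval_dessinLax_zero he ha (by omega),
    serEval_polyW he ha, orthTwo_second_difference hu]
  have hw := orthW_succ_mul hu n
  set L := timeFun a e
  linear_combination (orthInv L n * (-(orthMat L i (n + 1) (n + 1) * orthMat L j n n) -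
    orthMat L i n n * orthMat L j (n + 1) (n + 1))) * -hw

end TauIdentities

/-! ### The Toda equations and the matrix resolvent over polynomials in `x` -/

section PolynomialResolvent

open Finset
open scoped Polynomial

variable {K : Type*} [Field K] [CharZero K] [Algebra ℂ K] {a e : K}

/-- The initial data, from the recurrence coefficients of the Laguerre weight. -/
theorem constantCoeff_polyV (he : e ≠ 0) (ha : ∀ n : ℕ, a + (n + 1) * e ≠ 0) :
    MvPowerSeries.constantCoeff (polyV a e) =
      2 * Polynomial.X + Polynomial.C a + Polynomial.C e := by
  refine poly_ext he 0 fun n _ => ?_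
  have h := congrArg MvPowerSeries.constantCoeff (serEval_polyV (a := a) he ha n)
  rw [map_orthV (L := timeFun a e) MvPowerSeries.constantCoeff constantCoeff_timeFun,
    orthV_laguerre fun j _ => (orthNorm_laguerre_ne_zero he ha j).isUnit,
    ← MvPowerSeries.coeff_zero_eq_constantCoeff_apply, coeff_serEval,
    MvPowerSeries.coeff_zero_eq_constantCoeff_apply] at h
  rw [h]
  simp only [map_add, map_mul, map_ofNat, polyEval_X, polyEval_C]
  push_cast
  ring

omit [CharZero K] in
theorem constantCoeff_polyW : MvPowerSeries.constantCoeff (polyW a e) =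
    Polynomial.X * (Polynomial.X + Polynomial.C a) := by
  rw [polyW, map_mul, constantCoeff_mvExp constantCoeff_tauDiff, MvPowerSeries.constantCoeff_C,
    mul_one]

omit [CharZero K] [Algebra ℂ K] in
theorem serD_comm (i j : ℕ) (f : MvPowerSeries ℕ K[X]) :
    serD e i (serD e j f) = serD e j (serD e i f) := by
  ext1 ν
  simp only [coeff_serD]
  rw [add_right_comm ν]
  by_cases h : i = j
  · rw [h]
  · simp only [Finsupp.add_apply, Finsupp.single_eq_of_ne h, Finsupp.single_eq_of_ne (Ne.symm h),
      add_zero]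
    ring

/-- The coefficients of the positive part of `L ^ (i + 1)`. -/
def laxPlus (a e : K) (i : ℕ) (j : ℤ) : MvPowerSeries ℕ K[X] :=
  if 0 ≤ j then dessinLax a e (i + 1) j else 0

/-- The coefficients of `L = Λ + V + W Λ⁻¹`. -/
def polyLax (a e : K) (j : ℤ) : MvPowerSeries ℕ K[X] :=
  if j = 1 then 1 else if j = 0 then polyV a e else if j = -1 then polyW a e else 0

omit [CharZero K] [Algebra ℂ K] in
theorem serD_one (i : ℕ) : serD e i (1 : MvPowerSeries ℕ K[X]) = 0 := by
  rw [serD, Derivation.map_one_eq_zero, mul_zero]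

omit [CharZero K] [Algebra ℂ K] in
theorem serD_zero (i : ℕ) : serD e i (0 : MvPowerSeries ℕ K[X]) = 0 := by
  rw [serD, map_zero, mul_zero]

omit [CharZero K] in
theorem serD_polyW (i : ℕ) : serD e i (polyW a e) = polyW a e * serD e i (tauDiff a e) := by
  have h : MvPowerSeries.pderiv K[X] i
      (MvPowerSeries.C (Polynomial.X * (Polynomial.X + Polynomial.C a))) = 0 := by
    rw [← mul_one (MvPowerSeries.C _), ← MvPowerSeries.smul_eq_C_mul, Derivation.map_smul,
      Derivation.map_one_eq_zero, smul_zero]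
  rw [serD, polyW, Derivation.leibniz, h, pderiv_mvExp i constantCoeff_tauDiff, serD, smul_zero,
    add_zero, smul_eq_mul]
  ring

theorem serD_tauDiff (he : e ≠ 0) (ha : ∀ n : ℕ, a + (n + 1) * e ≠ 0) (i : ℕ) :
    serD e i (tauDiff a e) =
      dessinLax a e (i + 1) 0 - serShift e (-1) (dessinLax a e (i + 1) 0) := by
  rw [← diff_serD_tauLog he ha, map_sub, serShift_serShift, tauDiff, two_mul, serD_sub, serD_add,
    serD_add, ← serShift_serD, ← serShift_serD, show (-1 : ℤ) + 1 = 0 by ring, serShift_zero]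
  ring

/-- The Toda lattice hierarchy for the coefficients of every power of `Λ`. -/
theorem serD_polyLax (he : e ≠ 0) (ha : ∀ n : ℕ, a + (n + 1) * e ≠ 0) (i : ℕ) (k : ℤ) :
    serD e i (polyLax a e k) =
      (laxPlus a e i (k - 1) + laxPlus a e i k * serShift e k (polyV a e) +
        laxPlus a e i (k + 1) * serShift e (k + 1) (polyW a e)) -
      (serShift e 1 (laxPlus a e i (k - 1)) + polyV a e * laxPlus a e i k +
        polyW a e * serShift e (-1) (laxPlus a e i (k + 1))) := by
  -- For `k < 0` only `W` contributes; for `k > 0` both sides vanish, as `L ^ (i + 1)` commutes with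
  -- `L`.
  rcases lt_trichotomy k 0 with hk | rfl | hk
  · rcases lt_or_eq_of_le (show k ≤ -1 by omega) with hk' | rfl
    · simp only [laxPlus, polyLax, if_neg (show ¬ 0 ≤ k by omega),
        if_neg (show ¬ 0 ≤ k - 1 by omega), if_neg (show ¬ 0 ≤ k + 1 by omega),
        if_neg (show k ≠ 1 by omega), if_neg (show k ≠ 0 by omega),
        if_neg (show k ≠ -1 by omega), map_zero, serD_zero]
      ring
    · have h : polyLax a e (-1) = polyW a e := by simp [polyLax]
      rw [h, serD_polyW, serD_tauDiff he ha]
      simp only [laxPlus]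
      norm_num [serShift_zero]
      ring
  · have h : polyLax a e 0 = polyV a e := by simp [polyLax]
    have h1 := laxCoeff_succ' e (polyV a e) (polyW a e)
    have h2 : serD e i (polyV a e) = serShift e 1 (dessinLax a e (i + 1) (-1)) -
        dessinLax a e (i + 1) (-1) := by
      rw [← serD_serD_zero_tauLog he ha, polyV, serD_sub, ← serShift_serD]
    have h3 := congrArg (serShift e 1) (dessinLax_neg_one he ha (i + 1))
    rw [map_mul, serShift_serShift, show (1 : ℤ) + -1 = 0 by ring, serShift_zero] at h3
    rw [h, h2, h3, dessinLax_neg_one he ha]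
    simp only [laxPlus]
    norm_num [serShift_zero]
    ring
  · have h0 : serD e i (polyLax a e k) = 0 := by
      rw [polyLax]
      split_ifs <;> first | omega | skip
      · rw [serD_one]
      · rw [serD_zero]
    have h1 := laxCoeff_succ' e (polyV a e) (polyW a e) (i + 1) k
    rw [laxCoeff_succ] at h1
    simp only [laxPlus, if_pos (show 0 ≤ k by omega), if_pos (show 0 ≤ k - 1 by omega),
      if_pos (show 0 ≤ k + 1 by omega)]
    rw [h0]
    linear_combination h1

/-! ### The matrix resolvent, in the variable `z = λ⁻¹` -/

/-- The generating series `∑ z ^ k b_k` of the coefficients `b_k` of `Λ ^ j` in `L ^ k`. -/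
def laxSeries (a e : K) (j : ℤ) : PowerSeries (MvPowerSeries ℕ K[X]) :=
  PowerSeries.mk fun k => dessinLax a e k j

/-- The shift on the coefficients of a power series in `z`. -/
def zShift (e : K) (k : ℤ) :
    PowerSeries (MvPowerSeries ℕ K[X]) →+* PowerSeries (MvPowerSeries ℕ K[X]) :=
  PowerSeries.map (serShift e k)

omit [CharZero K] in
theorem coeff_zShift (k : ℤ) (f : PowerSeries (MvPowerSeries ℕ K[X])) (n : ℕ) :
    PowerSeries.coeff n (zShift e k f) = serShift e k (PowerSeries.coeff n f) :=
  PowerSeries.coeff_map _ _ _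

omit [CharZero K] in
theorem coeff_laxSeries (j : ℤ) (n : ℕ) :
    PowerSeries.coeff n (laxSeries a e j) = dessinLax a e n j := PowerSeries.coeff_mk _ _

omit [CharZero K] in
theorem zShift_one_neg_one (f : PowerSeries (MvPowerSeries ℕ K[X])) :
    zShift e 1 (zShift e (-1) f) = f := by
  ext1 n
  rw [coeff_zShift, coeff_zShift, serShift_serShift, show (1 : ℤ) + -1 = 0 by ring, serShift_zero]

omit [CharZero K] in
theorem zShift_X (k : ℤ) : zShift e k PowerSeries.X = PowerSeries.X := PowerSeries.map_X _

omit [CharZero K] in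
theorem zShift_C (k : ℤ) (f : MvPowerSeries ℕ K[X]) :
    zShift e k (PowerSeries.C f) = PowerSeries.C (serShift e k f) := PowerSeries.map_C _ _

omit [CharZero K] in
/-- The relation `∑ z ^ k L ^ k = 1 + z L ∑ z ^ k L ^ k`, for the coefficient of `Λ ^ j`. -/
theorem laxSeries_left (j : ℤ) : laxSeries a e j = (if j = 0 then 1 else 0) +
    PowerSeries.X * (zShift e 1 (laxSeries a e (j - 1)) +
      PowerSeries.C (polyV a e) * laxSeries a e j +
      PowerSeries.C (polyW a e) * zShift e (-1) (laxSeries a e (j + 1))) := by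
  ext1 n
  cases n with
  | zero =>
    rw [coeff_laxSeries, map_add, PowerSeries.coeff_zero_X_mul, add_zero, dessinLax, laxCoeff_zero]
    split_ifs <;> simp
  | succ n =>
    rw [coeff_laxSeries, map_add, PowerSeries.coeff_succ_X_mul, map_add, map_add,
      PowerSeries.coeff_C_mul, PowerSeries.coeff_C_mul, coeff_zShift, coeff_zShift,
      coeff_laxSeries, coeff_laxSeries, coeff_laxSeries, dessinLax, laxCoeff_succ]
    split_ifs <;> simp [PowerSeries.coeff_one]

omit [CharZero K] in
/-- The relation `∑ z ^ k L ^ k = 1 + z (∑ z ^ k L ^ k) L`, for the coefficient of `Λ ^ j`. -/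
theorem laxSeries_right (j : ℤ) : laxSeries a e j = (if j = 0 then 1 else 0) +
    PowerSeries.X * (laxSeries a e (j - 1) +
      PowerSeries.C (serShift e j (polyV a e)) * laxSeries a e j +
      PowerSeries.C (serShift e (j + 1) (polyW a e)) * laxSeries a e (j + 1)) := by
  ext1 n
  cases n with
  | zero =>
    rw [coeff_laxSeries, map_add, PowerSeries.coeff_zero_X_mul, add_zero, dessinLax, laxCoeff_zero]
    split_ifs <;> simp
  | succ n =>
    rw [coeff_laxSeries, map_add, PowerSeries.coeff_succ_X_mul, map_add, map_add,
      PowerSeries.coeff_C_mul, PowerSeries.coeff_C_mul,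
      coeff_laxSeries, coeff_laxSeries, coeff_laxSeries, dessinLax, laxCoeff_succ']
    split_ifs <;> simp [PowerSeries.coeff_one] <;> ring

theorem laxSeries_neg_one (he : e ≠ 0) (ha : ∀ n : ℕ, a + (n + 1) * e ≠ 0) :
    laxSeries a e (-1) = PowerSeries.C (polyW a e) * zShift e (-1) (laxSeries a e 1) := by
  ext1 n
  rw [PowerSeries.coeff_C_mul, coeff_zShift, coeff_laxSeries, coeff_laxSeries,
    dessinLax_neg_one he ha]

/-- The basic matrix resolvent.  Its entries are the coefficients of `Λ⁻¹` and of `1` in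
`z ∑ z ^ k L ^ k`, the resolvent of `L`. -/
def polyR (a e : K) : Matrix (Fin 2) (Fin 2) (PowerSeries (MvPowerSeries ℕ K[X])) :=
  !![1 + PowerSeries.X * laxSeries a e (-1),
    -(PowerSeries.X * (PowerSeries.C (polyW a e) * laxSeries a e 0));
    PowerSeries.X * zShift e (-1) (laxSeries a e 0), -(PowerSeries.X * laxSeries a e (-1))]

/-- The matrix `λ⁻¹ U(λ)`. -/
def polyU (a e : K) : Matrix (Fin 2) (Fin 2) (PowerSeries (MvPowerSeries ℕ K[X])) :=
  !![PowerSeries.X * PowerSeries.C (polyV a e) - 1,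
    PowerSeries.X * PowerSeries.C (polyW a e); -PowerSeries.X, 0]

theorem polyR_eq (he : e ≠ 0) (ha : ∀ n : ℕ, a + (n + 1) * e ≠ 0) :
    (polyR a e).map (zShift e 1) * polyU a e - polyU a e * polyR a e = 0 := by
  have l0 := laxSeries_left (a := a) (e := e) 0
  have l1 := laxSeries_left (a := a) (e := e) (-1)
  have r1 := congrArg (zShift e 1) (laxSeries_right (a := a) (e := e) (-1))
  have hb := laxSeries_neg_one he ha
  norm_num at l0 l1 r1
  simp only [zShift_X, zShift_C, serShift_serShift] at r1
  norm_num [serShift_zero] at r1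
  ext1 i j
  fin_cases i <;> fin_cases j <;>
    simp only [polyR, polyU, Matrix.sub_apply, Matrix.mul_apply, Fin.sum_univ_two,
      Matrix.map_apply, Matrix.of_apply, Matrix.cons_val', Matrix.cons_val_zero,
      Matrix.cons_val_one, Matrix.cons_val_fin_one, Fin.zero_eta, Fin.mk_one, Fin.isValue,
      map_add, map_mul, map_neg, map_one, zShift_X, zShift_C, zShift_one_neg_one,
      Matrix.zero_apply]
  · linear_combination PowerSeries.X * (l1 - r1)
  · linear_combination PowerSeries.X * PowerSeries.C (polyW a e) * (hb * PowerSeries.X - l0)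
  · linear_combination PowerSeries.X * (hb * PowerSeries.X - l0)
  · ring

omit [CharZero K] in
theorem polyR_trace : (polyR a e).trace = 1 := by
  rw [polyR, Matrix.trace_fin_two_of]
  ring

omit [CharZero K] in
theorem polyR_const :
    (polyR a e).map PowerSeries.constantCoeff = !![1, 0; 0, 0] := by
  ext1 i j
  fin_cases i <;> fin_cases j <;> simp [polyR]

/-- The coefficients of `tr (R(λ) R(μ)) - 1`. -/
def polyPair (a e : K) (m n : ℕ) : MvPowerSeries ℕ K[X] :=
  ((polyR a e).map (PowerSeries.coeff m) * (polyR a e).map (PowerSeries.coeff n)).trace -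
    if m = 0 ∧ n = 0 then 1 else 0

omit [CharZero K] in
theorem polyPair_eq (m n : ℕ) : polyPair a e m n =
    ∑ i, ∑ j, PowerSeries.coeff m (polyR a e i j) * PowerSeries.coeff n (polyR a e j i) -
      if m = 0 ∧ n = 0 then 1 else 0 := by
  simp only [polyPair, Matrix.trace, Matrix.diag_apply, Matrix.mul_apply, Matrix.map_apply]

omit [CharZero K] in
theorem polyPair_zero_zero : polyPair a e 0 0 = 0 := by
  rw [polyPair_eq]
  simp [Fin.sum_univ_two, polyR]

omit [CharZero K] in
theorem polyPair_zero_succ (n : ℕ) : polyPair a e 0 (n + 1) = dessinLax a e n (-1) := by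
  rw [polyPair_eq]
  simp [Fin.sum_univ_two, polyR, PowerSeries.coeff_succ_X_mul, PowerSeries.coeff_one,
    coeff_laxSeries]

omit [CharZero K] in
theorem polyPair_comm (m n : ℕ) : polyPair a e m n = polyPair a e n m := by
  rw [polyPair, polyPair, Matrix.trace_mul_comm]
  simp only [and_comm]

omit [CharZero K] in
theorem polyPair_succ_succ (m n : ℕ) : polyPair a e (m + 1) (n + 1) =
    2 * dessinLax a e m (-1) * dessinLax a e n (-1) - polyW a e *
      (dessinLax a e m 0 * serShift e (-1) (dessinLax a e n 0) +
        serShift e (-1) (dessinLax a e m 0) * dessinLax a e n 0) := by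
  rw [polyPair_eq]
  simp only [Fin.sum_univ_two, polyR, PowerSeries.coeff_succ_X_mul, PowerSeries.coeff_one,
    coeff_laxSeries, coeff_zShift, PowerSeries.coeff_C_mul, Matrix.of_apply, Matrix.cons_val',
    Matrix.cons_val_zero, Matrix.cons_val_one, Matrix.cons_val_fin_one, map_add, map_neg,
    Nat.add_eq_zero_iff, one_ne_zero, and_false, if_false]
  ring

/-- The mixed second derivatives of `tauLog` are the two-point functions of the resolvent. -/
theorem polyPair_eq_twoPoint (he : e ≠ 0) (ha : ∀ n : ℕ, a + (n + 1) * e ≠ 0) (m n : ℕ) :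
    polyPair a e m n =
      (if 2 ≤ m then serD e (m - 2) (serD e n (tauLog a e)) else 0) -
      (if 1 ≤ m ∧ 1 ≤ n then 2 * serD e (m - 1) (serD e (n - 1) (tauLog a e)) else 0) +
      (if 2 ≤ n then serD e m (serD e (n - 2) (tauLog a e)) else 0) := by
  have h0 : ∀ n, polyPair a e 0 n =
      if 2 ≤ n then serD e 0 (serD e (n - 2) (tauLog a e)) else 0 := by
    intro n
    match n with
    | 0 => simpa using polyPair_zero_zero
    | 1 =>
      rw [polyPair_zero_succ, dessinLax, laxCoeff_zero]
      simp
    | n + 2 =>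
      rw [polyPair_zero_succ, if_pos (by omega), ← serD_serD_zero_tauLog he ha, serD_comm]
      rfl
  match m, n with
  | 0, n => simp [h0]
  | m + 1, 0 =>
    rw [polyPair_comm, h0, serD_comm]
    simp
  | m + 1, n + 1 =>
    have h1 : twoPoint a e m (n + 2) =
        if 2 ≤ m + 1 then serD e (m + 1 - 2) (serD e (n + 1) (tauLog a e)) else 0 := by
      cases m <;> rfl
    have h2 : twoPoint a e (m + 2) n =
        if 2 ≤ n + 1 then serD e (m + 1) (serD e (n + 1 - 2) (tauLog a e)) else 0 := by
      cases n <;> rfl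
    rw [polyPair_succ_succ, ← twoPoint_second_difference he ha, ← h1, ← h2,
      if_pos (⟨by omega, by omega⟩ : 1 ≤ m + 1 ∧ 1 ≤ n + 1)]
    simp only [twoPoint, Nat.add_sub_cancel]
    ring

/-- The series `(s - t) ^ 2 ∑ Ω_{i,j} s ^ i t ^ j` vanishes on the diagonal `s = t`. -/
theorem sum_antidiagonal_second_difference {A : Type*} [CommRing A] (Ω : ℕ → ℕ → A) (N : ℕ) :
    ∑ p ∈ antidiagonal N, ((if 2 ≤ p.1 then Ω (p.1 - 2) p.2 else 0) -
      (if 1 ≤ p.1 ∧ 1 ≤ p.2 then 2 * Ω (p.1 - 1) (p.2 - 1) else 0) +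
      (if 2 ≤ p.2 then Ω p.1 (p.2 - 2) else 0)) = 0 := by
  rw [sum_add_distrib, sum_sub_distrib]
  match N with
  | 0 => simp
  | 1 => simp [Finset.Nat.sum_antidiagonal_succ]
  | N + 2 =>
    have h1 : ∑ p ∈ antidiagonal (N + 2), (if 2 ≤ p.1 then Ω (p.1 - 2) p.2 else 0) =
        ∑ p ∈ antidiagonal N, Ω p.1 p.2 := by
      simp [Finset.Nat.sum_antidiagonal_succ]
    have h2 : ∑ p ∈ antidiagonal (N + 2), (if 2 ≤ p.2 then Ω p.1 (p.2 - 2) else 0) =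
        ∑ p ∈ antidiagonal N, Ω p.1 p.2 := by
      simp [Finset.Nat.sum_antidiagonal_succ']
    have h3 : ∑ p ∈ antidiagonal (N + 2),
        (if 1 ≤ p.1 ∧ 1 ≤ p.2 then 2 * Ω (p.1 - 1) (p.2 - 1) else 0) =
        ∑ p ∈ antidiagonal N, 2 * Ω p.1 p.2 := by
      rw [Finset.Nat.sum_antidiagonal_succ, Finset.Nat.sum_antidiagonal_succ']
      simp
    rw [h1, h2, h3, ← mul_sum]
    ring

/-- The determinant vanishes: on the diagonal `λ = μ` the two-point functions give
`tr (R(λ) R(λ)) = 1`, and `2 det R = (tr R) ^ 2 - tr (R R)`. -/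
theorem polyR_det (he : e ≠ 0) (ha : ∀ n : ℕ, a + (n + 1) * e ≠ 0) : (polyR a e).det = 0 := by
  have hsq : (polyR a e * polyR a e).trace = 1 := by
    ext1 N
    have h := sum_antidiagonal_second_difference
      (fun i j => serD e i (serD e j (tauLog a e))) N
    simp only [← polyPair_eq_twoPoint he ha] at h
    simp only [polyPair_eq] at h
    rw [sum_sub_distrib, sub_eq_zero] at h
    have h1 : ∑ p ∈ antidiagonal N,
        (if p.1 = 0 ∧ p.2 = 0 then (1 : MvPowerSeries ℕ K[X]) else 0) = PowerSeries.coeff N 1 := by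
      rw [PowerSeries.coeff_one]
      cases N with
      | zero => rw [Finset.Nat.antidiagonal_zero, sum_singleton]; simp
      | succ N =>
        rw [if_neg (by omega)]
        refine sum_eq_zero fun p hp => if_neg ?_
        rw [HasAntidiagonal.mem_antidiagonal] at hp
        omega
    rw [h1] at h
    rw [← h, sum_comm]
    simp only [Matrix.trace, Matrix.diag_apply, Matrix.mul_apply, map_sum, PowerSeries.coeff_mul]
    exact sum_congr rfl fun i _ => sum_comm
  have h : 2 * (polyR a e).det = (polyR a e).trace ^ 2 - (polyR a e * polyR a e).trace := by
    rw [Matrix.det_fin_two, Matrix.trace_fin_two, Matrix.trace_fin_two, Matrix.mul_apply,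
      Matrix.mul_apply, Fin.sum_univ_two, Fin.sum_univ_two]
    ring
  have h2 : (2 : PowerSeries (MvPowerSeries ℕ K[X])) ≠ 0 := by
    intro h
    have := congrArg (fun f => Polynomial.eval 0
      (MvPowerSeries.constantCoeff (PowerSeries.constantCoeff f))) h
    simp only [map_ofNat, map_zero, Polynomial.eval_ofNat, Polynomial.eval_zero] at this
    exact two_ne_zero this
  rw [polyR_trace, hsq, one_pow, sub_self] at h
  exact (mul_eq_zero.1 h).resolve_left h2

end PolynomialResolvent

/-! ### Holomorphic functions and the shift -/

section Holomorphic

variable {U : Opens ℂ}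

/-- The derivative of `f` is that of any function on `ℂ` that represents it. -/
theorem Hol.D_apply (f : Hol U) (g : ℂ → ℂ) (h : ∀ y : U, f.1 y = g y) (x : U) :
    (Hol.D f).1 x = deriv g x := by
  refine Filter.EventuallyEq.deriv_eq ?_
  filter_upwards [U.isOpen.mem_nhds x.2] with y hy
  rw [← h ⟨y, hy⟩]
  exact (f.2.choose_spec.2 ⟨y, hy⟩).symm

/-- A holomorphic function on `U` extended to `ℂ`, so that Mathlib's `deriv` applies. -/
theorem Hol.exists_differentiableAt (f : Hol U) :
    ∃ g : ℂ → ℂ, (∀ x : U, DifferentiableAt ℂ g x) ∧ ∀ x : U, f.1 x = g x := by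
  obtain ⟨g, hg, h⟩ := f.2
  exact ⟨g, fun x => (hg x x.2).differentiableAt (U.isOpen.mem_nhds x.2), h⟩

variable (U) in
/-- The derivation `∂/∂x`. -/
def Hol.deriv : Derivation ℂ (Hol U) (Hol U) where
  toFun := Hol.D
  map_add' f f' := by
    obtain ⟨g, hg, h⟩ := f.exists_differentiableAt
    obtain ⟨g', hg', h'⟩ := f'.exists_differentiableAt
    ext x
    change _ = (Hol.D f).1 x + (Hol.D f').1 x
    rw [Hol.D_apply f g h, Hol.D_apply f' g' h', ← deriv_add (hg x) (hg' x)]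
    refine Hol.D_apply _ _ (fun y => ?_) x
    rw [Pi.add_apply, ← h, ← h']
    rfl
  map_smul' c f := by
    obtain ⟨g, hg, h⟩ := f.exists_differentiableAt
    ext x
    change _ = c * (Hol.D f).1 x
    rw [Hol.D_apply f g h, ← deriv_const_mul c (hg x)]
    refine Hol.D_apply _ _ (fun y => ?_) x
    rw [← h]
    rfl
  map_one_eq_zero' := by
    ext x
    change (Hol.D 1).1 x = 0
    rw [Hol.D_apply 1 (fun _ => 1) (fun _ => rfl), deriv_const]
  leibniz' f f' := by
    obtain ⟨g, hg, h⟩ := f.exists_differentiableAt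
    obtain ⟨g', hg', h'⟩ := f'.exists_differentiableAt
    ext x
    change (Hol.D (f * f')).1 x = f.1 x * (Hol.D f').1 x + f'.1 x * (Hol.D f).1 x
    rw [Hol.D_apply f g h, Hol.D_apply f' g' h', h, h', Hol.D_apply (f * f') (g * g') (fun y => ?_),
      deriv_mul (hg x) (hg' x)]
    · ring
    · rw [Pi.mul_apply, ← h, ← h']
      rfl

theorem Hol.deriv_apply (f : Hol U) : Hol.deriv U f = Hol.D f := rfl

theorem Hol.iterate_D_add (j : ℕ) (f g : Hol U) :
    Hol.D^[j] (f + g) = Hol.D^[j] f + Hol.D^[j] g :=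
  iterate_map_add (Hol.deriv U) j f g

theorem Hol.iterate_D_zero (j : ℕ) : Hol.D^[j] (0 : Hol U) = 0 :=
  iterate_map_zero (Hol.deriv U) j

theorem Hol.iterate_D_smul (j : ℕ) (c : ℂ) (f : Hol U) :
    Hol.D^[j] (c • f) = c • Hol.D^[j] f := by
  induction j generalizing f with
  | zero => rfl
  | succ j ih =>
    rw [Function.iterate_succ_apply, ← Hol.deriv_apply, Derivation.map_smul, ih,
      Function.iterate_succ_apply, Hol.deriv_apply]

theorem Coef.coeff_shift (k : ℤ) (f : Coef U) (n : ℤ) : (Coef.shift k f).coeff n =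
    ∑ᶠ j : ℕ, ((k : ℂ) ^ j / (j.factorial : ℂ)) • Hol.D^[j] (f.coeff (n - j)) := rfl

/-- The coefficients of the shift as finite sums. -/
theorem Coef.coeff_shift_eq_sum (k : ℤ) (f : Coef U) (n : ℤ) (N : ℕ)
    (hN : ∀ j, N ≤ j → Hol.D^[j] (f.coeff (n - j)) = 0) : (Coef.shift k f).coeff n =
    ∑ j ∈ Finset.range N, ((k : ℂ) ^ j / (j.factorial : ℂ)) • Hol.D^[j] (f.coeff (n - j)) := by
  rw [Coef.coeff_shift]
  refine finsum_eq_sum_of_support_subset _ fun j hj => ?_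
  rw [Finset.coe_range, Set.mem_Iio]
  by_contra h
  exact hj (by simp only; rw [hN j (by omega), smul_zero])

/-- The sum that defines the shift is finite, since a Laurent series has no terms of low order. -/
theorem Coef.exists_iterate_D_eq_zero (f : Coef U) (n : ℤ) :
    ∃ N : ℕ, ∀ j, N ≤ j → Hol.D^[j] (f.coeff (n - j)) = 0 := by
  refine ⟨(n - f.order + 1).toNat, fun j hj => ?_⟩
  rw [HahnSeries.coeff_eq_zero_of_lt_order (by omega), Hol.iterate_D_zero]

/-- The shift as an additive map. -/
def Coef.shiftHom (k : ℤ) : Coef U →+ Coef U where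
  toFun := Coef.shift k
  map_zero' := by
    ext1
    funext n
    rw [Coef.coeff_shift_eq_sum k 0 n 0 fun j _ => by
      rw [HahnSeries.coeff_zero, Hol.iterate_D_zero]]
    rfl
  map_add' f g := by
    ext1
    funext n
    obtain ⟨N, hN⟩ := f.exists_iterate_D_eq_zero n
    obtain ⟨M, hM⟩ := g.exists_iterate_D_eq_zero n
    have hf : ∀ j, max N M ≤ j → Hol.D^[j] (f.coeff (n - j)) = 0 :=
      fun j hj => hN j ((le_max_left _ _).trans hj)
    have hg : ∀ j, max N M ≤ j → Hol.D^[j] (g.coeff (n - j)) = 0 :=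
      fun j hj => hM j ((le_max_right _ _).trans hj)
    rw [HahnSeries.coeff_add, Coef.coeff_shift_eq_sum k f n _ hf,
      Coef.coeff_shift_eq_sum k g n _ hg,
      Coef.coeff_shift_eq_sum k (f + g) n (max N M), ← Finset.sum_add_distrib]
    · refine Finset.sum_congr rfl fun j _ => ?_
      rw [HahnSeries.coeff_add, Hol.iterate_D_add, smul_add]
    · intro j hj
      rw [HahnSeries.coeff_add, Hol.iterate_D_add, hf j hj, hg j hj, add_zero]

theorem Coef.shift_zero_left (f : Coef U) : Coef.shift 0 f = f := by
  ext1
  funext n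
  rw [Coef.coeff_shift, finsum_eq_single _ 0]
  · simp
  · intro j hj
    simp [hj]

/-- The shift of power series as an additive map. -/
def Ser.shiftHom (k : ℤ) : Ser U →+ Ser U where
  toFun := Ser.shift k
  map_zero' := by
    ext1 n
    exact (Coef.shiftHom k).map_zero
  map_add' f g := by
    ext1 n
    exact (Coef.shiftHom k).map_add _ _

theorem Ser.coeff_shift (k : ℤ) (f : Ser U) (n : ℕ →₀ ℕ) :
    MvPowerSeries.coeff n (Ser.shift k f) = Coef.shift k (MvPowerSeries.coeff n f) := rfl

theorem Ser.shift_zero_left (f : Ser U) : Ser.shift 0 f = f := by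
  ext1 n
  rw [Ser.coeff_shift, Coef.shift_zero_left]

theorem Ser.shift_C (k : ℤ) (c : Coef U) :
    Ser.shift k (MvPowerSeries.C c) = MvPowerSeries.C (Coef.shift k c) := by
  classical
  ext1 n
  rw [Ser.coeff_shift, MvPowerSeries.coeff_C, MvPowerSeries.coeff_C]
  split_ifs
  · rfl
  · exact (Coef.shiftHom k).map_zero

variable (U) in
/-- Laurent series with constant coefficients, as series with coefficients in the holomorphic
functions. -/
def scalarHom : LaurentSeries ℂ →+* Coef U where
  toFun f := f.map (algebraMap ℂ (Hol U))
  map_zero' := by ext1; funext n; simp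
  map_one' := HahnSeries.map_one (algebraMap ℂ (Hol U)).toMonoidWithZeroHom
  map_add' f g := by ext1; funext n; simp
  map_mul' f g := HahnSeries.map_mul (algebraMap ℂ (Hol U) : ℂ →ₙ+* Hol U)

theorem coeff_scalarHom (f : LaurentSeries ℂ) (n : ℤ) :
    (scalarHom U f).coeff n = algebraMap ℂ (Hol U) (f.coeff n) := rfl

theorem scalarHom_single (i : ℤ) (c : ℂ) :
    scalarHom U (HahnSeries.single i c) = HahnSeries.single i (algebraMap ℂ (Hol U) c) := by
  ext1
  funext n
  rw [coeff_scalarHom]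
  by_cases h : n = i
  · rw [h, HahnSeries.coeff_single_same, HahnSeries.coeff_single_same]
  · rw [HahnSeries.coeff_single_of_ne h, HahnSeries.coeff_single_of_ne h, map_zero]

theorem coeff_scalarHom_mul_single (f : LaurentSeries ℂ) (i n : ℤ) (h : Hol U) :
    (scalarHom U f * HahnSeries.single i h).coeff n = f.coeff (n - i) • h := by
  rw [HahnSeries.coeff_mul_single, coeff_scalarHom, Algebra.smul_def]

end Holomorphic

section Substitution

open scoped Polynomial

variable (a : ℂ)

theorem D_xFun : Hol.D (xFun a) = 1 := by
  ext x
  rw [Hol.D_apply (xFun a) (fun y => y) (fun _ => rfl)]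
  exact deriv_id _

theorem D_xFun_pow (m : ℕ) : Hol.D (xFun a ^ m) = (m : ℂ) • xFun a ^ (m - 1) := by
  rw [← Hol.deriv_apply, Derivation.leibniz_pow, Hol.deriv_apply, D_xFun, smul_eq_mul, mul_one,
    Nat.cast_smul_eq_nsmul]

theorem iterate_D_xFun_pow (m j : ℕ) :
    Hol.D^[j] (xFun a ^ m) = (m.descFactorial j : ℂ) • xFun a ^ (m - j) := by
  induction j with
  | zero => simp
  | succ j ih =>
    rw [Function.iterate_succ_apply', ih, ← Hol.deriv_apply, Derivation.map_smul, Hol.deriv_apply,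
      D_xFun_pow, smul_smul, Nat.descFactorial_succ, Nat.sub_sub]
    push_cast
    rw [mul_comm]

/-- The substitution of the function `x` for the variable of a polynomial with coefficients in the
Laurent series in `ε`. -/
def holHom : (LaurentSeries ℂ)[X] →+* Coef (dom a) :=
  Polynomial.eval₂RingHom (scalarHom (dom a)) (HahnSeries.C (xFun a))

theorem holHom_C (c : LaurentSeries ℂ) : holHom a (Polynomial.C c) = scalarHom (dom a) c :=
  Polynomial.eval₂_C _ _

theorem holHom_X : holHom a Polynomial.X = HahnSeries.C (xFun a) := Polynomial.eval₂_X _ _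

theorem algebraMap_laurentSeries {R : Type*} [CommRing R] [Algebra ℂ R] (c : ℂ) :
    algebraMap ℂ (LaurentSeries R) c = HahnSeries.C (algebraMap ℂ R c) := by
  rw [HahnSeries.algebraMap_apply', PowerSeries.algebraMap_apply, HahnSeries.ofPowerSeries_C]

/-- The substitution as a homomorphism of algebras. -/
def holAlgHom : (LaurentSeries ℂ)[X] →ₐ[ℂ] Coef (dom a) :=
  { holHom a with
    commutes' := fun c => by
      change holHom a (algebraMap ℂ (LaurentSeries ℂ)[X] c) = _
      rw [IsScalarTower.algebraMap_apply ℂ (LaurentSeries ℂ) (LaurentSeries ℂ)[X],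
        Polynomial.algebraMap_eq, holHom_C, algebraMap_laurentSeries, algebraMap_laurentSeries]
      exact scalarHom_single 0 c }

/-- The series `ε`. -/
abbrev epsK : LaurentSeries ℂ := HahnSeries.single 1 1

theorem scalarHom_epsK : scalarHom (dom a) epsK = eps (dom a) := by
  rw [scalarHom_single, map_one, eps]

/-- The shift of polynomials is the shift of functions. -/
theorem shift_holHom (k : ℤ) (P : (LaurentSeries ℂ)[X]) :
    Coef.shift k (holHom a P) = holHom a (polyShift epsK k P) := by
  induction P using Polynomial.induction_on' with
  | add f g hf hg =>
    rw [map_add, map_add, map_add, ← hf, ← hg]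
    exact (Coef.shiftHom k).map_add _ _
  | monomial m c =>
    -- The binomial expansion of `(x + k ε) ^ m`, to be compared with the Taylor expansion.
    have hR : holHom a (polyShift epsK k (Polynomial.C c * Polynomial.X ^ m)) =
        ∑ j ∈ Finset.range (m + 1), scalarHom (dom a) c *
          HahnSeries.single (j : ℤ) (((k : ℂ) ^ j * m.choose j) • xFun a ^ (m - j)) := by
      simp only [map_mul, map_pow, map_add, polyShift_C, polyShift_X, holHom_C, holHom_X]
      rw [add_comm, add_pow, Finset.mul_sum]
      refine Finset.sum_congr rfl fun j _ => ?_
      congr 1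
      have h1 : scalarHom (dom a) (k : LaurentSeries ℂ) = HahnSeries.C (k : Hol (dom a)) := by
        rw [map_intCast, map_intCast]
      rw [h1, scalarHom_epsK, eps, HahnSeries.C_apply, HahnSeries.C_apply,
        HahnSeries.single_mul_single, HahnSeries.single_pow, HahnSeries.single_pow,
        HahnSeries.single_mul_single, ← map_natCast (HahnSeries.C (Γ := ℤ)), HahnSeries.C_apply,
        HahnSeries.single_mul_single]
      congr 1
      · simp
      · rw [Algebra.smul_def, map_mul, map_pow, map_intCast, map_natCast]
        ring
    have hL : holHom a (Polynomial.C c * Polynomial.X ^ m) =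
        scalarHom (dom a) c * HahnSeries.single 0 (xFun a ^ m) := by
      rw [map_mul, map_pow, holHom_C, holHom_X, ← map_pow, HahnSeries.C_apply]
    rw [← Polynomial.C_mul_X_pow_eq_monomial, hR, hL]
    ext1
    funext n
    rw [HahnSeries.coeff_sum, Coef.coeff_shift_eq_sum k _ n (m + 1)]
    · refine Finset.sum_congr rfl fun j _ => ?_
      rw [coeff_scalarHom_mul_single, coeff_scalarHom_mul_single, Hol.iterate_D_smul,
        iterate_D_xFun_pow, smul_smul, smul_smul, smul_smul, sub_zero,
        Nat.descFactorial_eq_factorial_mul_choose]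
      congr 1
      have := Nat.cast_ne_zero (R := ℂ).2 j.factorial_ne_zero
      push_cast
      field_simp
    · intro j hj
      rw [coeff_scalarHom_mul_single, Hol.iterate_D_smul, iterate_D_xFun_pow,
        Nat.descFactorial_eq_zero_iff_lt.2 (by omega)]
      simp

end Substitution

/-! ### Difference operators -/

section DifferenceOperators

variable {U : Opens ℂ}

theorem Ser.shift_zero_right (k : ℤ) : Ser.shift k (0 : Ser U) = 0 := (Ser.shiftHom k).map_zero

/-- The coefficients of a product of difference operators. -/
theorem DiffOp.comp_apply (A B : DiffOp U) (k : ℤ) :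
    A.comp B k = A.sum fun i f => f * Ser.shift i (B (k - i)) := by
  rw [DiffOp.comp, Finsupp.sum_apply]
  refine Finsupp.sum_congr fun i _ => ?_
  rw [Finsupp.sum_apply, Finsupp.sum, Finset.sum_eq_single (k - i)]
  · rw [add_sub_cancel, Finsupp.single_eq_same]
  · intro j _ hj
    rw [Finsupp.single_eq_of_ne (by omega)]
  · intro h
    rw [Finsupp.notMem_support_iff.1 h, Ser.shift_zero_right, mul_zero]
    simp

theorem lax_apply (V W : Ser U) (k : ℤ) :
    lax V W k = if k = 1 then 1 else if k = 0 then V else if k = -1 then W else 0 := by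
  rw [lax, Finsupp.add_apply, Finsupp.add_apply, Finsupp.single_apply, Finsupp.single_apply,
    Finsupp.single_apply]
  split_ifs <;> first | omega | simp

/-- The coefficients of `L B`. -/
theorem lax_comp_apply (V W : Ser U) (B : DiffOp U) (k : ℤ) : (lax V W).comp B k =
    Ser.shift 1 (B (k - 1)) + V * B k + W * Ser.shift (-1) (B (k + 1)) := by
  have hs : (lax V W).support ⊆ {1, 0, -1} := by
    intro j hj
    rw [Finsupp.mem_support_iff, lax_apply] at hj
    by_contra h
    simp only [Finset.mem_insert, Finset.mem_singleton, not_or] at h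
    rw [if_neg h.1, if_neg h.2.1, if_neg h.2.2] at hj
    exact hj rfl
  rw [DiffOp.comp_apply, Finsupp.sum_of_support_subset _ hs
      (fun i f => f * Ser.shift i (B (k - i))) fun _ _ => zero_mul _,
    Finset.sum_insert (by simp), Finset.sum_insert (by simp), Finset.sum_singleton]
  simp only [lax_apply]
  norm_num [Ser.shift_zero_left]
  ring

/-- The coefficients of `A L`. -/
theorem comp_lax_apply (V W : Ser U) (hone : ∀ k, Ser.shift k (1 : Ser U) = 1) (A : DiffOp U)
    (k : ℤ) : A.comp (lax V W) k =
    A (k - 1) + A k * Ser.shift k V + A (k + 1) * Ser.shift (k + 1) W := by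
  classical
  have hs : A.support ⊆ A.support ∪ {k - 1, k, k + 1} := Finset.subset_union_left
  rw [DiffOp.comp_apply, Finsupp.sum_of_support_subset _ hs
      (fun i f => f * Ser.shift i (lax V W (k - i))) fun _ _ => zero_mul _,
    ← Finset.sum_subset (Finset.subset_union_right (s₁ := A.support) (s₂ := {k - 1, k, k + 1})),
    Finset.sum_insert (by simp; omega), Finset.sum_insert (by simp), Finset.sum_singleton]
  · simp only [lax_apply]
    norm_num [hone]
    ring
  · intro j _ hj
    simp only [Finset.mem_insert, Finset.mem_singleton, not_or] at hj
    rw [lax_apply, if_neg (by omega), if_neg (by omega), if_neg (by omega), Ser.shift_zero_right,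
      mul_zero]

theorem plus_apply (A : DiffOp U) (k : ℤ) : DiffOp.plus A k = if 0 ≤ k then A k else 0 :=
  Finsupp.filter_apply _ _ _

end DifferenceOperators

/-! ### From polynomials in `x` to holomorphic functions -/

section Transfer

open scoped Polynomial

variable (a : ℂ)

/-- The substitution in the coefficients of power series. -/
def serHom : MvPowerSeries ℕ (LaurentSeries ℂ)[X] →+* Ser (dom a) := MvPowerSeries.map (holHom a)

theorem coeff_serHom (f : MvPowerSeries ℕ (LaurentSeries ℂ)[X]) (n : ℕ →₀ ℕ) :
    MvPowerSeries.coeff n (serHom a f) = holHom a (MvPowerSeries.coeff n f) :=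
  MvPowerSeries.coeff_map _ _ _

theorem serHom_C (P : (LaurentSeries ℂ)[X]) :
    serHom a (MvPowerSeries.C P) = MvPowerSeries.C (holHom a P) := MvPowerSeries.map_C _ _

theorem shift_serHom (k : ℤ) (f : MvPowerSeries ℕ (LaurentSeries ℂ)[X]) :
    Ser.shift k (serHom a f) = serHom a (serShift epsK k f) := by
  ext1 n
  rw [Ser.coeff_shift, coeff_serHom, coeff_serHom, coeff_serShift, shift_holHom]

theorem shift_one (k : ℤ) : Ser.shift k (1 : Ser (dom a)) = 1 := by
  rw [← map_one (serHom a), shift_serHom, map_one]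

theorem Ser.coeff_d {U : Opens ℂ} (i : ℕ) (f : Ser U) (n : ℕ →₀ ℕ) :
    MvPowerSeries.coeff n (Ser.d i f) =
      MvPowerSeries.coeff (n + Finsupp.single i 1) f * (n i + 1) := by
  rw [Ser.d, MvPowerSeries.coeff_pderiv]

theorem holHom_C_epsK : holHom a (Polynomial.C epsK) = eps (dom a) := by
  rw [holHom_C, scalarHom_epsK]

theorem eps_mul_d_serHom (i : ℕ) (f : MvPowerSeries ℕ (LaurentSeries ℂ)[X]) :
    MvPowerSeries.C (eps (dom a)) * Ser.d i (serHom a f) = serHom a (serD epsK i f) := by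
  ext1 n
  rw [MvPowerSeries.coeff_C_mul, Ser.coeff_d, coeff_serHom, coeff_serHom, coeff_serD, map_mul,
    map_mul, holHom_C_epsK, map_add, map_natCast, map_one]

theorem epsInv_mul_eps {U : Opens ℂ} : epsInv U * eps U = 1 := by
  rw [epsInv, eps, HahnSeries.single_mul_single, one_mul]
  rfl

theorem Ser.d_add {U : Opens ℂ} (i : ℕ) (f g : Ser U) : Ser.d i (f + g) = Ser.d i f + Ser.d i g :=
  map_add (MvPowerSeries.pderiv (Coef U) i) f g

theorem Ser.d_C {U : Opens ℂ} (i : ℕ) (c : Coef U) : Ser.d i (MvPowerSeries.C c) = 0 := by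
  rw [Ser.d, ← mul_one (MvPowerSeries.C c), ← MvPowerSeries.smul_eq_C_mul, Derivation.map_smul,
    Derivation.map_one_eq_zero, smul_zero]

theorem Ser.d_C_mul {U : Opens ℂ} (i : ℕ) (c : Coef U) (f : Ser U) :
    Ser.d i (MvPowerSeries.C c * f) = MvPowerSeries.C c * Ser.d i f := by
  rw [← MvPowerSeries.smul_eq_C_mul, ← MvPowerSeries.smul_eq_C_mul]
  exact Derivation.map_smul _ _ _

theorem epsK_ne_zero : (epsK : LaurentSeries ℂ) ≠ 0 :=
  HahnSeries.single_ne_zero one_ne_zero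

instance : CharZero (LaurentSeries ℂ) :=
  charZero_of_injective_algebraMap (algebraMap ℂ (LaurentSeries ℂ)).injective

/-- No moment of the Laguerre weight with parameters `a` and `ε` vanishes, as `ε` is not a constant.
-/
theorem const_add_ne_zero (n : ℕ) :
    (HahnSeries.C a : LaurentSeries ℂ) + (n + 1) * epsK ≠ 0 := by
  intro h
  have h1 := congrArg (fun f : LaurentSeries ℂ => f.coeff 1) h
  have h2 : ((n : LaurentSeries ℂ) + 1) = HahnSeries.C ((n : ℂ) + 1) := by
    rw [map_add, map_natCast, map_one]
  simp only [h2, HahnSeries.coeff_add, HahnSeries.C_apply, HahnSeries.single_mul_single,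
    HahnSeries.coeff_zero] at h1
  rw [HahnSeries.coeff_single_of_ne one_ne_zero, zero_add, zero_add,
    HahnSeries.coeff_single_same, mul_one] at h1
  exact Nat.cast_add_one_ne_zero n h1

/-- The parameter `a` as a Laurent series. -/
abbrev aK : LaurentSeries ℂ := HahnSeries.C a

/-- The coefficients of the powers of the Lax operator of the dessin solution. -/
theorem lax_pow_apply (k : ℕ) (j : ℤ) :
    (lax (serHom a (polyV (aK a) epsK)) (serHom a (polyW (aK a) epsK))).pow k j =
      serHom a (dessinLax (aK a) epsK k j) := by
  induction k generalizing j with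
  | zero =>
    rw [DiffOp.pow, Finsupp.single_apply, dessinLax, laxCoeff_zero]
    simp only [eq_comm (a := (0 : ℤ))]
    split_ifs <;> simp
  | succ k ih =>
    change _ = serHom a (laxCoeff epsK (polyV (aK a) epsK) (polyW (aK a) epsK) (k + 1) j)
    rw [DiffOp.pow, lax_comp_apply, ih, ih, ih, laxCoeff_succ, map_add, map_add, map_mul,
      map_mul, shift_serHom, shift_serHom]

theorem lax_serHom_apply (k : ℤ) :
    lax (serHom a (polyV (aK a) epsK)) (serHom a (polyW (aK a) epsK)) k =
      serHom a (polyLax (aK a) epsK k) := by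
  rw [lax_apply, polyLax]
  split_ifs <;> simp

theorem plus_lax_pow_apply (i : ℕ) (k : ℤ) :
    DiffOp.plus ((lax (serHom a (polyV (aK a) epsK))
      (serHom a (polyW (aK a) epsK))).pow (i + 1)) k = serHom a (laxPlus (aK a) epsK i k) := by
  rw [plus_apply, lax_pow_apply, laxPlus]
  split_ifs <;> simp

/-- The Toda equations are carried over from the series with polynomial coefficients. -/
theorem isTodaSolution_serHom :
    IsTodaSolution (serHom a (polyV (aK a) epsK)) (serHom a (polyW (aK a) epsK)) := by
  intro i k
  have h := congrArg (serHom a) (serD_polyLax epsK_ne_zero (const_add_ne_zero a) i k)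
  rw [← eps_mul_d_serHom, ← lax_serHom_apply] at h
  simp only [map_sub, map_add, map_mul, ← shift_serHom, ← plus_lax_pow_apply] at h
  rw [← comp_lax_apply _ _ (shift_one a), ← lax_comp_apply] at h
  rw [← h, ← mul_assoc, ← map_mul, epsInv_mul_eps, map_one, one_mul]

/-! ### The matrix resolvent and the two-point functions of the dessin solution -/

/-- The substitution in the coefficients of power series in `z = λ⁻¹`. -/
def zHom : PowerSeries (MvPowerSeries ℕ (LaurentSeries ℂ)[X]) →+* PowerSeries (Ser (dom a)) :=
  PowerSeries.map (serHom a)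

theorem coeff_zHom (n : ℕ) (f : PowerSeries (MvPowerSeries ℕ (LaurentSeries ℂ)[X])) :
    PowerSeries.coeff n (zHom a f) = serHom a (PowerSeries.coeff n f) :=
  PowerSeries.coeff_map _ _ _

theorem shiftZ_zHom (k : ℤ) (f : PowerSeries (MvPowerSeries ℕ (LaurentSeries ℂ)[X])) :
    shiftZ k (zHom a f) = zHom a (zShift epsK k f) := by
  ext1 n
  rw [shiftZ, PowerSeries.coeff_mk, coeff_zHom, coeff_zHom, coeff_zShift, shift_serHom]

/-- The basic matrix resolvent of the dessin solution. -/
def dessinR : Matrix (Fin 2) (Fin 2) (PowerSeries (Ser (dom a))) :=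
  (polyR (aK a) epsK).map (zHom a)

set_option synthInstance.maxHeartbeats 200000 in
theorem isBasicResolvent_dessinR :
    IsBasicResolvent (serHom a (polyV (aK a) epsK)) (serHom a (polyW (aK a) epsK)) (dessinR a) where
  eq := by
    have h1 : (dessinR a).map (shiftZ 1) =
        ((polyR (aK a) epsK).map (zShift epsK 1)).map (zHom a) := by
      ext1 i j
      exact shiftZ_zHom a 1 _
    have h2 : zU (serHom a (polyV (aK a) epsK)) (serHom a (polyW (aK a) epsK)) =
        (polyU (aK a) epsK).map (zHom a) := by
      ext1 i j
      fin_cases i <;> fin_cases j <;> simp [zU, polyU, zHom]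
    have h3 := sub_eq_zero.1 (polyR_eq epsK_ne_zero (const_add_ne_zero a))
    rw [h1, h2, dessinR, ← Matrix.map_mul, ← Matrix.map_mul, h3]
    exact sub_self (((polyU (aK a) epsK) * (polyR (aK a) epsK)).map (zHom a))
  trace := by
    have h := congrArg (zHom a) (polyR_trace (a := aK a) (e := epsK))
    rw [Matrix.trace_fin_two, map_add, map_one] at h
    rw [Matrix.trace_fin_two]
    exact h
  det := by
    have h := congrArg (zHom a)
      (sub_eq_zero.1 ((Matrix.det_fin_two _).symm.trans
        (polyR_det epsK_ne_zero (const_add_ne_zero a))))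
    rw [map_mul, map_mul] at h
    refine (Matrix.det_fin_two _).trans ?_
    rw [dessinR, Matrix.map_apply, Matrix.map_apply, Matrix.map_apply, Matrix.map_apply, h,
      sub_self]
  const := by
    ext1 i j
    have h := congrFun (congrFun (polyR_const (a := aK a) (e := epsK)) i) j
    rw [Matrix.map_apply] at h ⊢
    rw [dessinR, Matrix.map_apply, ← PowerSeries.coeff_zero_eq_constantCoeff_apply, coeff_zHom,
      PowerSeries.coeff_zero_eq_constantCoeff_apply, h]
    fin_cases i <;> fin_cases j <;> simp

theorem pairCoeff_dessinR (m n : ℕ) :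
    pairCoeff (dessinR a) m n = serHom a (polyPair (aK a) epsK m n) := by
  rw [polyPair_eq, pairCoeff]
  simp only [dessinR, Matrix.trace, Matrix.diag_apply, Matrix.mul_apply, Matrix.map_apply,
    coeff_zHom, map_sub, map_sum, map_mul]
  congr 1
  split_ifs <;> simp

theorem isTwoPoint_dessinR : IsTwoPoint (dessinR a) fun i j =>
    serHom a (serD epsK i (serD epsK j (tauLog (aK a) epsK))) := by
  intro m n
  rw [pairCoeff_dessinR, polyPair_eq_twoPoint epsK_ne_zero (const_add_ne_zero a), map_add, map_sub]
  congr 1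
  · congr 1
    · split_ifs <;> simp
    · simp only [two_mul]
      split_ifs <;> simp
  · split_ifs <;> simp

end Transfer

/-! ### The dessin free energy as a series over polynomials in `x` -/

section FreeEnergy

open scoped Polynomial

variable {K : Type*} [Field K] [Algebra ℂ K] (a e : K)

/-- The dessin free energy, in the original variables: the generating series of transitive pairs at
`U = x / e` and `V = (x + a) / e`, where the variable of index `i` is rescaled by `e ^ i`. -/
def freeLog : MvPowerSeries ℕ K[X] :=
  MvPowerSeries.rescale (fun i : ℕ => Polynomial.C e ^ i)
    (transSeries (Polynomial.C e⁻¹ * Polynomial.X)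
      (Polynomial.C e⁻¹ * (Polynomial.X + Polynomial.C a)))

/-- The second difference of a series. -/
def secondDiff (F : MvPowerSeries ℕ K[X]) : MvPowerSeries ℕ K[X] :=
  serShift e 1 F + serShift e (-1) F - 2 * F

/-- The coefficient `V` of the Lax operator with tau-function `exp F`. -/
def laxV (F : MvPowerSeries ℕ K[X]) : MvPowerSeries ℕ K[X] :=
  serShift e 1 (serD e 0 F) - serD e 0 F

/-- The coefficient `W` of the Lax operator with tau-function `exp F`, where the correction factor
contributes `x (x + a)`. -/
def laxW (F : MvPowerSeries ℕ K[X]) : MvPowerSeries ℕ K[X] :=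
  MvPowerSeries.C (Polynomial.X * (Polynomial.X + Polynomial.C a)) * mvExp (secondDiff e F)

theorem polyW_eq : polyW a e = laxW a e (tauLog a e) := rfl

/-- The derivation `∂/∂t_i`. -/
def serPderiv (i : ℕ) (f : MvPowerSeries ℕ K[X]) : MvPowerSeries ℕ K[X] :=
  MvPowerSeries.pderiv K[X] i f

omit [Algebra ℂ K] in
theorem coeff_serPderiv (i : ℕ) (f : MvPowerSeries ℕ K[X]) (n : ℕ →₀ ℕ) :
    MvPowerSeries.coeff n (serPderiv i f) =
      MvPowerSeries.coeff (n + Finsupp.single i 1) f * (n i + 1) := by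
  rw [serPderiv, MvPowerSeries.coeff_pderiv]

omit [Algebra ℂ K] in
theorem serD_eq (i : ℕ) (f : MvPowerSeries ℕ K[X]) :
    serD e i f = MvPowerSeries.C (Polynomial.C e) * serPderiv i f := rfl

theorem secondDiff_add (F : MvPowerSeries ℕ K[X]) :
    serShift e 1 F + serShift e (-1) F = secondDiff e F + (F + F) := by
  rw [secondDiff]
  ring

theorem serShift_C_C_mul (k : ℤ) (f : MvPowerSeries ℕ K[X]) :
    serShift e k (MvPowerSeries.C (Polynomial.C e) * f) =
      MvPowerSeries.C (Polynomial.C e) * serShift e k f := by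
  rw [map_mul, serShift, MvPowerSeries.map_C]
  congr 2
  exact polyShift_C _ _ _

/-- The change of variables `p_{i+1} = (i + 1) t_i`. -/
def toTimes : MvPowerSeries ℕ K[X] →+* MvPowerSeries ℕ K[X] :=
  MvPowerSeries.rescale fun i : ℕ => (i : K[X]) + 1

omit [Algebra ℂ K] in
theorem coeff_toTimes (f : MvPowerSeries ℕ K[X]) (n : ℕ →₀ ℕ) :
    MvPowerSeries.coeff n (toTimes f) =
      (n.prod fun i m => ((i : K[X]) + 1) ^ m) * MvPowerSeries.coeff n f :=
  MvPowerSeries.coeff_rescale _ _ _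

theorem constantCoeff_freeLog : MvPowerSeries.constantCoeff (freeLog a e) = 0 := by
  rw [freeLog, ← MvPowerSeries.coeff_zero_eq_constantCoeff_apply, MvPowerSeries.coeff_rescale,
    MvPowerSeries.coeff_zero_eq_constantCoeff_apply, constantCoeff_transSeries, mul_zero]

theorem toTimes_freeLog : toTimes (freeLog a e) = tauLog a e := by
  ext1 n
  rw [coeff_toTimes, freeLog, tauLog, timeSeries, MvPowerSeries.coeff_rescale,
    MvPowerSeries.coeff_rescale, ← mul_assoc, ← Finsupp.prod_mul]
  congr 1
  refine Finsupp.prod_congr fun i _ => ?_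
  rw [mul_comm, mul_pow]

theorem toTimes_serShift (k : ℤ) (f : MvPowerSeries ℕ K[X]) :
    toTimes (serShift e k f) = serShift e k (toTimes f) := by
  ext1 n
  rw [coeff_toTimes, coeff_serShift, coeff_serShift, coeff_toTimes, map_mul, Finsupp.prod,
    map_prod]
  simp

omit [Algebra ℂ K] in
theorem toTimes_serD (f : MvPowerSeries ℕ K[X]) :
    toTimes (serD e 0 f) = serD e 0 (toTimes f) := by
  ext1 n
  have h : ((n + Finsupp.single 0 1).prod fun i m => ((i : K[X]) + 1) ^ m) =
      n.prod fun i m => ((i : K[X]) + 1) ^ m := by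
    rw [Finsupp.prod_add_index' (fun i => pow_zero _) (fun i m n => pow_add _ m n)]
    simp
  rw [coeff_toTimes, coeff_serD, coeff_serD, coeff_toTimes, h]
  ring

theorem constantCoeff_secondDiff {F : MvPowerSeries ℕ K[X]}
    (h : MvPowerSeries.constantCoeff F = 0) :
    MvPowerSeries.constantCoeff (secondDiff e F) = 0 := by
  rw [secondDiff, map_sub, map_add, map_mul, constantCoeff_serShift, constantCoeff_serShift, h]
  simp

theorem toTimes_laxV : toTimes (laxV e (freeLog a e)) = polyV a e := by
  rw [laxV, map_sub, toTimes_serShift, toTimes_serD, toTimes_freeLog, polyV]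

omit [Algebra ℂ K] in
theorem toTimes_C (c : K[X]) : toTimes (MvPowerSeries.C c) = MvPowerSeries.C c := by
  classical
  ext1 n
  rw [coeff_toTimes, MvPowerSeries.coeff_C]
  split_ifs with h
  · rw [h, Finsupp.prod_zero_index, one_mul]
  · rw [mul_zero]

theorem toTimes_secondDiff (F : MvPowerSeries ℕ K[X]) :
    toTimes (secondDiff e F) = secondDiff e (toTimes F) := by
  rw [secondDiff, map_sub, map_add, map_mul, map_ofNat, toTimes_serShift, toTimes_serShift,
    secondDiff]

theorem toTimes_laxW : toTimes (laxW a e (freeLog a e)) = polyW a e := by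
  have h := rescale_mvExp (fun i : ℕ => (i : K[X]) + 1)
    (constantCoeff_secondDiff e (constantCoeff_freeLog a e))
  change toTimes _ = mvExp (toTimes _) at h
  rw [laxW, map_mul toTimes, h, toTimes_C, toTimes_secondDiff, toTimes_freeLog, polyW_eq, laxW]

omit [Algebra ℂ K] in
theorem constantCoeff_toTimes (f : MvPowerSeries ℕ K[X]) :
    MvPowerSeries.constantCoeff (toTimes f) = MvPowerSeries.constantCoeff f := by
  rw [← MvPowerSeries.coeff_zero_eq_constantCoeff_apply, coeff_toTimes, Finsupp.prod_zero_index,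
    one_mul, MvPowerSeries.coeff_zero_eq_constantCoeff_apply]

/-- The power of `ε` attached to a monomial. -/
theorem prod_pow_pow {R : Type*} [CommRing R] (x : R) (n : ℕ →₀ ℕ) :
    ∃ s : ℕ, s + n.degree = wt n ∧ (n.prod fun i m => (x ^ i) ^ m) = x ^ s := by
  refine ⟨n.sum fun i m => i * m, ?_, ?_⟩
  · rw [wt_apply, Finsupp.degree_apply, Finsupp.sum, Finsupp.sum, ← Finset.sum_add_distrib]
    exact Finset.sum_congr rfl fun i _ => by ring
  · rw [Finsupp.prod, Finsupp.sum, ← Finset.prod_pow_eq_pow_sum]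
    exact Finset.prod_congr rfl fun i _ => by rw [pow_mul]

/-- The coefficients of the free energy.  A pair of permutations of `d` points with `m` poles
carries the power `d - m` of `e`, apart from the powers in `U` and `V`. -/
theorem coeff_freeLog {n : ℕ →₀ ℕ} (hn : n ≠ 0) {s : ℕ} (hs : s + n.degree = wt n) :
    MvPowerSeries.coeff n (freeLog a e) = algebraMap ℂ K[X] (((wt n).factorial : ℂ)⁻¹) *
      transPairSum (Fin (wt n)) n fun k l => Polynomial.C e ^ s *
        ((Polynomial.C e⁻¹ * Polynomial.X) ^ k *
          (Polynomial.C e⁻¹ * (Polynomial.X + Polynomial.C a)) ^ l) := by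
  obtain ⟨s', hs', hp⟩ := prod_pow_pow (Polynomial.C e) n
  obtain rfl : s = s' := by omega
  rw [freeLog, MvPowerSeries.coeff_rescale, coeff_transSeries, if_neg hn, hp, Algebra.smul_def,
    mul_left_comm]
  congr 1
  change _ * transPairSum (Fin (wt n)) n (fun k l => (Polynomial.C e⁻¹ * Polynomial.X) ^ k *
    (Polynomial.C e⁻¹ * (Polynomial.X + Polynomial.C a)) ^ l) = _
  rw [transPairSum, transPairSum, Finset.mul_sum]
  refine Finset.sum_congr rfl fun x _ => ?_
  split_ifs
  · rfl
  · rw [mul_zero]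

/-- The series `S_i` of the matrix resolvent are the diagonal coefficients of `L ^ (i + 1)`. -/
theorem coeff_shift_polyR (i : ℕ) :
    PowerSeries.coeff (i + 2) (zShift e 1 (polyR a e 1 0)) = dessinLax a e (i + 1) 0 := by
  rw [coeff_zShift]
  change serShift e 1 (PowerSeries.coeff (i + 1 + 1)
    (PowerSeries.X * zShift e (-1) (laxSeries a e 0))) = _
  rw [PowerSeries.coeff_succ_X_mul, coeff_zShift, coeff_laxSeries, serShift_serShift,
    show (1 : ℤ) + -1 = 0 by ring, serShift_zero]

end FreeEnergy

section DessinSolution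

open scoped Polynomial

variable (a : ℂ)

theorem toTodaTimes_serHom (f : MvPowerSeries ℕ (LaurentSeries ℂ)[X]) :
    toTodaTimes (serHom a f) = serHom a (toTimes f) := by
  ext1 n
  rw [toTodaTimes, MvPowerSeries.coeff_rescale, coeff_serHom, coeff_serHom, coeff_toTimes, map_mul,
    Finsupp.prod, Finsupp.prod, map_prod]
  simp

theorem toTodaTimes_C {U : Opens ℂ} (c : Coef U) :
    toTodaTimes (MvPowerSeries.C c) = MvPowerSeries.C c := by
  classical
  ext1 n
  rw [toTodaTimes, MvPowerSeries.coeff_rescale, MvPowerSeries.coeff_C]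
  split_ifs with h
  · rw [h, Finsupp.prod_zero_index, one_mul]
  · rw [mul_zero]

theorem smul_eq_C_mul {R : Type*} [CommRing R] [Algebra ℂ R] (c : ℂ) (f : LaurentSeries R) :
    c • f = HahnSeries.C (algebraMap ℂ R c) * f := by
  ext1
  funext n
  rw [HahnSeries.C_mul_eq_smul, HahnSeries.coeff_smul, HahnSeries.coeff_smul, algebraMap_smul]

theorem holHom_algebraMap (c : ℂ) :
    holHom a (algebraMap ℂ (LaurentSeries ℂ)[X] c) = HahnSeries.C (algebraMap ℂ _ c) := by
  rw [← algebraMap_laurentSeries]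
  exact (holAlgHom a).commutes c

theorem holHom_inv_mul (P : (LaurentSeries ℂ)[X]) (f : Hol (dom a))
    (h : holHom a P = HahnSeries.C f) :
    holHom a (Polynomial.C epsK⁻¹ * P) = HahnSeries.single (-1) f := by
  rw [map_mul, h, holHom_C]
  have h1 : (epsK⁻¹ : LaurentSeries ℂ) = HahnSeries.single (-1) 1 := by
    refine inv_eq_of_mul_eq_one_left ?_
    rw [HahnSeries.single_mul_single, one_mul]
    rfl
  rw [h1, scalarHom_single, HahnSeries.C_apply, HahnSeries.single_mul_single, map_one, one_mul,
    add_zero]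

theorem holHom_quadratic : holHom a (Polynomial.X * (Polynomial.X + Polynomial.C (aK a))) =
    HahnSeries.C (xFun a * (xFun a + constFun a a)) := by
  rw [map_mul, map_add, holHom_X, holHom_C, map_mul, map_add]
  congr 2
  exact scalarHom_single 0 a

/-- The dessin free energy comes from a series over polynomials in `x`. -/
theorem dessinFreeEnergy_eq :
    dessinFreeEnergy (xFun a) (xFun a + constFun a a) = serHom a (freeLog (aK a) epsK) := by
  ext1 n
  rw [coeff_serHom]
  by_cases hn : n = 0
  · rw [hn]
    change (0 : Coef (dom a)) = holHom a (MvPowerSeries.constantCoeff (freeLog (aK a) epsK))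
    rw [constantCoeff_freeLog, map_zero]
  · obtain ⟨s, hs, -⟩ := prod_pow_pow (1 : ℂ) n
    have hv : holHom a (Polynomial.X + Polynomial.C (aK a)) =
        HahnSeries.C (xFun a + constFun a a) := by
      rw [map_add, holHom_X, holHom_C, map_add]
      congr 1
      exact scalarHom_single 0 a
    rw [coeff_dessinFreeEnergy _ _ hn, coeff_freeLog _ _ hn hs, map_mul, holHom_algebraMap,
      smul_eq_C_mul, transPairSum, transPairSum, map_sum]
    congr 1
    refine Finset.sum_congr rfl fun x _ => ?_
    split_ifs
    · rw [map_mul, map_mul, map_pow, map_pow, map_pow, holHom_inv_mul a _ _ (holHom_X a),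
        holHom_inv_mul a _ _ hv, holHom_C_epsK, eps, HahnSeries.single_pow, HahnSeries.single_pow,
        HahnSeries.single_pow, HahnSeries.single_mul_single, HahnSeries.single_mul_single,
        pairTerm, one_pow, one_mul]
      congr 1
      have hs' : (s : ℤ) + n.degree = wt n := by exact_mod_cast hs
      rw [← hs']
      simp only [nsmul_eq_mul]
      ring_nf
    · rw [map_zero]

theorem d_serHom (i : ℕ) (f : MvPowerSeries ℕ (LaurentSeries ℂ)[X]) :
    Ser.d i (serHom a f) = serHom a (serPderiv i f) := by
  ext1 n
  rw [Ser.coeff_d, coeff_serHom, coeff_serHom, coeff_serPderiv, map_mul, map_add, map_natCast,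
    map_one]

theorem correctedZ_log : (correctedZ a).log =
    MvPowerSeries.C (correction a) + serHom a (freeLog (aK a) epsK) := by
  rw [← dessinFreeEnergy_eq]
  rfl

theorem dessinV_eq : dessinV a = serHom a (laxV epsK (freeLog (aK a) epsK)) := by
  rw [dessinV, correctedZ_log, Ser.d_add, Ser.d_C, zero_add, laxV]
  refine (mul_sub (MvPowerSeries.C (eps (dom a)) : Ser (dom a)) _ _).trans ?_
  rw [map_sub, ← eps_mul_d_serHom]
  congr 1
  rw [d_serHom, shift_serHom, ← holHom_C_epsK, ← serHom_C, serD_eq, serShift_C_C_mul]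
  exact (map_mul (serHom a) _ _).symm

theorem toTodaTimes_dessinV :
    toTodaTimes (dessinV a) = serHom a (polyV (aK a) epsK) := by
  rw [dessinV_eq, toTodaTimes_serHom, toTimes_laxV]

theorem constantCoeff_serHom (f : MvPowerSeries ℕ (LaurentSeries ℂ)[X]) :
    MvPowerSeries.constantCoeff (serHom a f) = holHom a (MvPowerSeries.constantCoeff f) := by
  rw [← MvPowerSeries.coeff_zero_eq_constantCoeff_apply, coeff_serHom,
    MvPowerSeries.coeff_zero_eq_constantCoeff_apply]

theorem constantCoeff_dessinV : MvPowerSeries.constantCoeff (dessinV a) =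
    HahnSeries.C (2 * xFun a + constFun a a) + eps (dom a) := by
  rw [dessinV_eq, constantCoeff_serHom, ← constantCoeff_toTimes, toTimes_laxV,
    constantCoeff_polyV epsK_ne_zero (const_add_ne_zero a), map_add, map_add, map_mul, map_ofNat,
    holHom_X, holHom_C_epsK, holHom_C, map_add, map_mul, map_ofNat]
  congr 2
  exact scalarHom_single 0 a

/-- The series `W` of the dessin solution, in the original variables. -/
def dessinW : Ser (dom a) := serHom a (laxW (aK a) epsK (freeLog (aK a) epsK))

theorem toTodaTimes_dessinW : toTodaTimes (dessinW a) = serHom a (polyW (aK a) epsK) := by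
  rw [dessinW, toTodaTimes_serHom, toTimes_laxW]

theorem constantCoeff_dessinW : MvPowerSeries.constantCoeff (dessinW a) =
    HahnSeries.C (xFun a * (xFun a + constFun a a)) := by
  rw [dessinW, constantCoeff_serHom, ← constantCoeff_toTimes, toTimes_laxW, constantCoeff_polyW,
    holHom_quadratic]

theorem toTodaTimes_correctedZ_log : toTodaTimes (correctedZ a).log =
    MvPowerSeries.C (correction a) + serHom a (tauLog (aK a) epsK) := by
  rw [correctedZ_log, toTodaTimes, map_add, ← toTodaTimes, ← toTodaTimes, toTodaTimes_C,
    toTodaTimes_serHom, toTimes_freeLog]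

theorem add_second_difference {G : Type*} [AddCommGroup G] {x₁ x₂ x y₁ y₂ y l d : G}
    (h : x₁ + x₂ = l + (x + x)) (h' : y₁ + y₂ = d + (y + y)) :
    x₁ + y₁ + (x₂ + y₂) - 2 • (x + y) = l + d := by
  rw [add_add_add_comm, h, h']
  abel

/-- The ratio `τ(x + ε) τ(x - ε) / τ(x) ^ 2` for a tau-function with the correction factor of the
dessin partition function. -/
theorem hasValue_ratio (hc : Coef.shift 1 (correction a) + Coef.shift (-1) (correction a) =
      HahnSeries.C (logX a + logXa a) + (correction a + correction a))
    {F : MvPowerSeries ℕ (LaurentSeries ℂ)[X]} (hF : MvPowerSeries.constantCoeff F = 0) :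
    (FormalExp.exp (MvPowerSeries.C (correction a) + serHom a F)).ratio.HasValue
      (serHom a (laxW (aK a) epsK F)) := by
  have h0 := constantCoeff_secondDiff epsK hF
  refine ⟨logX a + logXa a, 0, serHom a (secondDiff epsK F), map_zero _, ?_, ?_, ?_⟩
  · rw [constantCoeff_serHom, h0, map_zero]
  · have hs : ∀ k, Ser.shift k (MvPowerSeries.C (correction a) + serHom a F) =
        MvPowerSeries.C (Coef.shift k (correction a)) + serHom a (serShift epsK k F) := by
      intro k
      rw [← shift_serHom, ← Ser.shift_C]
      exact (Ser.shiftHom k).map_add _ _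
    change Ser.shift 1 (MvPowerSeries.C (correction a) + serHom a F) +
      Ser.shift (-1) (MvPowerSeries.C (correction a) + serHom a F) -
      2 • (MvPowerSeries.C (correction a) + serHom a F) = _
    rw [hs, hs, map_zero, add_zero]
    refine add_second_difference (G := Ser (dom a)) ?_ ?_
    · rw [← map_add, ← map_add, ← map_add, hc]
    · rw [← map_add, ← map_add, ← map_add, secondDiff_add]
  · have hm := map_mvExp (S := Coef (dom a)) (holAlgHom a) h0
    change serHom a _ = PowerSeries.subst (serHom a _) _ at hm
    have h1 : Hol.exp (logX a + logXa a) = xFun a * (xFun a + constFun a a) := by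
      ext x
      change Complex.exp (Complex.log x + Complex.log (x + a)) = x * (x + a)
      rw [Complex.exp_add, Complex.exp_log (Complex.slitPlane_ne_zero x.2.1),
        Complex.exp_log (Complex.slitPlane_ne_zero x.2.2)]
    have h2 : PowerSeries.subst (0 : PowerSeries (Hol (dom a))) (PowerSeries.exp ℂ) = 1 := by
      rw [PowerSeries.subst_zero_eq_C_constantCoeff]
      simp
    rw [laxW, map_mul (serHom a), hm, serHom_C, h1, h2, map_one, mul_one, holHom_quadratic]

/-- The ratio that defines `W` exists as soon as the second difference of the correction is
`log x + log (x + a)`. -/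
theorem hasValue_ratio_correctedZ
    (hc : Coef.shift 1 (correction a) + Coef.shift (-1) (correction a) =
      HahnSeries.C (logX a + logXa a) + (correction a + correction a)) :
    (correctedZ a).ratio.HasValue (dessinW a) := by
  have h := hasValue_ratio a hc (constantCoeff_freeLog (aK a) epsK)
  rw [← correctedZ_log] at h
  exact h

theorem isTodaSolution_dessin :
    IsTodaSolution (toTodaTimes (dessinV a)) (toTodaTimes (dessinW a)) := by
  rw [toTodaTimes_dessinV, toTodaTimes_dessinW]
  exact isTodaSolution_serHom a

theorem eps_sq_mul_d_d (i j : ℕ) (f : MvPowerSeries ℕ (LaurentSeries ℂ)[X]) :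
    MvPowerSeries.C (eps (dom a) ^ 2) * Ser.d i (Ser.d j (serHom a f)) =
      serHom a (serD epsK i (serD epsK j f)) := by
  rw [← eps_mul_d_serHom, ← eps_mul_d_serHom, Ser.d_C_mul, sq, map_mul, mul_assoc]

theorem isTauFunction_dessin
    (hc : Coef.shift 1 (correction a) + Coef.shift (-1) (correction a) =
      HahnSeries.C (logX a + logXa a) + (correction a + correction a)) :
    IsTauFunction (FormalExp.exp (toTodaTimes (correctedZ a).log))
      (toTodaTimes (dessinV a)) (toTodaTimes (dessinW a)) where
  toda := isTodaSolution_dessin a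
  resolvent := by
    rw [toTodaTimes_dessinV, toTodaTimes_dessinW, toTodaTimes_correctedZ_log]
    refine ⟨dessinR a, _, isBasicResolvent_dessinR a, isTwoPoint_dessinR a, fun i j => ?_,
      fun i => ?_⟩
    · have h : Ser.d j (MvPowerSeries.C (correction a) + serHom a (tauLog (aK a) epsK)) =
          Ser.d j (serHom a (tauLog (aK a) epsK)) := by
        rw [Ser.d_add, Ser.d_C, zero_add]
      refine Eq.trans ?_ (eps_sq_mul_d_d a i j (tauLog (aK a) epsK))
      rw [← h]
      rfl
    · have hs : Ser.shift 1 (MvPowerSeries.C (correction a) + serHom a (tauLog (aK a) epsK)) =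
          MvPowerSeries.C (Coef.shift 1 (correction a)) +
            serHom a (serShift epsK 1 (tauLog (aK a) epsK)) := by
        rw [← shift_serHom, ← Ser.shift_C]
        exact (Ser.shiftHom 1).map_add _ _
      have hd : MvPowerSeries.C (eps (dom a)) * Ser.d i
          (Ser.shift 1 (MvPowerSeries.C (correction a) + serHom a (tauLog (aK a) epsK))) =
          serHom a (serD epsK i (serShift epsK 1 (tauLog (aK a) epsK))) := by
        rw [hs, Ser.d_add, Ser.d_C, zero_add, eps_mul_d_serHom]
      have hd' : MvPowerSeries.C (eps (dom a)) * Ser.d i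
          (MvPowerSeries.C (correction a) + serHom a (tauLog (aK a) epsK)) =
          serHom a (serD epsK i (tauLog (aK a) epsK)) := by
        rw [Ser.d_add, Ser.d_C, zero_add, eps_mul_d_serHom]
      have hR : PowerSeries.coeff (i + 2) (shiftZ 1 (dessinR a 1 0)) =
          serHom a (dessinLax (aK a) epsK (i + 1) 0) := by
        have hz : dessinR a 1 0 = zHom a (polyR (aK a) epsK 1 0) := rfl
        rw [hz, shiftZ_zHom, coeff_zHom, coeff_shift_polyR]
      rw [hR, ← diff_serD_tauLog epsK_ne_zero (const_add_ne_zero a), map_sub, serShift_serD, ← hd,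
        ← hd']
      refine Eq.trans ?_ (mul_sub (MvPowerSeries.C (eps (dom a)) : Ser (dom a)) _ _)
      congr 1
      exact map_sub (MvPowerSeries.pderiv (Coef (dom a)) i) _ _
  ratio := by
    rw [toTodaTimes_dessinW, toTodaTimes_correctedZ_log]
    exact hasValue_ratio a hc constantCoeff_tauLog

end DessinSolution

/-! ### The correction factor -/

section Bernoulli

open PowerSeries

/-- The coefficient of `X ^ q` in `B - X B'`, where `B = X / (exp X - 1)`. -/
def bernoulliDiff (q : ℕ) : ℂ := (1 - q) * (bernoulli q / q.factorial)

/-- The coefficient of `X ^ j` in `exp X + exp (-X) - 2`. -/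
def coshCoeff (j : ℕ) : ℂ := (1 + (-1) ^ j) / j.factorial - if j = 0 then 2 else 0

/-- The identity `(B - X B') (exp X + exp (-X) - 2) = X ^ 2`, for the coefficient of `X ^ N`. -/
theorem sum_bernoulliDiff_mul_coshCoeff (N : ℕ) :
    ∑ p ∈ Finset.HasAntidiagonal.antidiagonal N, bernoulliDiff p.1 * coshCoeff p.2 =
      if N = 2 then 1 else 0 := by
  set B := bernoulliPowerSeries ℂ with hB
  set E := PowerSeries.exp ℂ with hE
  have hB1 : B * (E - 1) = X := bernoulliPowerSeries_mul_exp_sub_one ℂ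
  have hd : B * E + (E - 1) * derivative ℂ B = 1 := by
    have h := congrArg (derivative ℂ) hB1
    rwa [Derivation.leibniz, map_sub, derivative_exp, derivative_X, Derivation.map_one_eq_zero,
      sub_zero, smul_eq_mul, smul_eq_mul] at h
  have hinv : E * evalNegHom E = 1 := exp_mul_exp_neg_eq_one
  have hkey : (B - X * derivative ℂ B) * (E + evalNegHom E - 2) = X ^ 2 := by
    have h : (B - X * derivative ℂ B) * (E - 1) ^ 2 = X ^ 2 * E := by
      linear_combination (E - 1 + X * E) * hB1 - X * (E - 1) * hd
    linear_combination evalNegHom E * h - (B - X * derivative ℂ B) * (E - 2) * hinv + X ^ 2 * hinv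
  have h1 : B - X * derivative ℂ B = PowerSeries.mk bernoulliDiff := by
    ext n
    rw [coeff_mk, bernoulliDiff, map_sub, hB, bernoulliPowerSeries]
    cases n with
    | zero => simp
    | succ n =>
      rw [coeff_succ_X_mul, coeff_derivative, coeff_mk]
      simp
      ring
  have h2 : E + evalNegHom E - 2 = PowerSeries.mk coshCoeff := by
    ext n
    rw [coeff_mk, coshCoeff, map_sub, map_add, evalNegHom, coeff_rescale, hE, coeff_exp,
      show (2 : PowerSeries ℂ) = C (2 : ℂ) from (map_ofNat C 2).symm, coeff_C]
    simp
    ring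
  rw [h1, h2] at hkey
  have h := congrArg (coeff N) hkey
  rw [coeff_mul, coeff_X_pow] at h
  simpa using h

end Bernoulli

section Correction

variable (a : ℂ)

theorem D_constFun (c : ℂ) : Hol.D (constFun a c) = 0 :=
  (Hol.deriv (dom a)).map_algebraMap c

theorem D_xFun_add : Hol.D (xFun a + constFun a a) = 1 := by
  rw [← Hol.deriv_apply, map_add, Hol.deriv_apply, Hol.deriv_apply, D_xFun, D_constFun, add_zero]

theorem xFun_mul_invX : xFun a * invX a = 1 := by
  ext x
  exact mul_inv_cancel₀ (Complex.slitPlane_ne_zero x.2.1)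

theorem xFun_add_mul_invXa : (xFun a + constFun a a) * invXa a = 1 := by
  ext x
  exact mul_inv_cancel₀ (Complex.slitPlane_ne_zero x.2.2)

theorem D_logX : Hol.D (logX a) = invX a := by
  ext x
  rw [Hol.D_apply (logX a) Complex.log fun _ => rfl]
  exact (Complex.hasDerivAt_log x.2.1).deriv

theorem D_logXa : Hol.D (logXa a) = invXa a := by
  ext x
  rw [Hol.D_apply (logXa a) (fun y => Complex.log (y + a)) fun _ => rfl]
  have h := ((hasDerivAt_id (x : ℂ)).add_const a).clog x.2.2
  refine h.deriv.trans ?_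
  rw [one_div]
  rfl

theorem D_invX : Hol.D (invX a) = (-1 : ℂ) • invX a ^ 2 := by
  ext x
  rw [Hol.D_apply (invX a) (fun y => y⁻¹) fun _ => rfl, deriv_inv]
  change _ = -1 * ((x : ℂ)⁻¹ ^ 2)
  rw [inv_pow, neg_one_mul]

theorem D_invXa : Hol.D (invXa a) = (-1 : ℂ) • invXa a ^ 2 := by
  ext x
  rw [Hol.D_apply (invXa a) (fun y => (y + a)⁻¹) fun _ => rfl]
  have h := ((hasDerivAt_id (x : ℂ)).add_const a).fun_inv (Complex.slitPlane_ne_zero x.2.2)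
  refine h.deriv.trans ?_
  change _ = -1 * ((x + a : ℂ)⁻¹ ^ 2)
  rw [inv_pow, neg_div, one_div, neg_one_mul]
  rfl

variable {a} in
/-- The iterated derivatives of a function with derivative `g`, where `g' = - g ^ 2`. -/
theorem iterate_D_of_D_eq {f g : Hol (dom a)} (hf : Hol.D f = g)
    (hg : Hol.D g = (-1 : ℂ) • g ^ 2) (q : ℕ) :
    Hol.D^[q + 1] f = ((-1) ^ q * q.factorial : ℂ) • g ^ (q + 1) := by
  induction q with
  | zero => simp [hf]
  | succ q ih =>
    rw [Function.iterate_succ_apply', ih, ← Hol.deriv_apply, Derivation.map_smul,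
      Derivation.leibniz_pow, Hol.deriv_apply, hg, Nat.factorial_succ, Nat.add_sub_cancel,
      smul_eq_mul, ← Nat.cast_smul_eq_nsmul ℂ, smul_smul, mul_smul_comm, smul_smul, ← pow_add]
    push_cast
    congr 1
    ring

variable {a} in
/-- The second derivatives of the powers of a function such as `g = 1 / x`. -/
theorem D_D_pow {g : Hol (dom a)} (hg : Hol.D g = (-1 : ℂ) • g ^ 2) (k : ℕ) :
    Hol.D^[2] (g ^ k) = ((k : ℂ) * (k + 1)) • g ^ (k + 2) := by
  have h : ∀ k : ℕ, Hol.D (g ^ k) = (-(k : ℂ)) • g ^ (k + 1) := by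
    intro k
    cases k with
    | zero =>
      rw [pow_zero, ← Hol.deriv_apply, Derivation.map_one_eq_zero]
      simp
    | succ k =>
      rw [← Hol.deriv_apply, Derivation.leibniz_pow, Hol.deriv_apply, hg, Nat.add_sub_cancel,
        smul_eq_mul, ← Nat.cast_smul_eq_nsmul ℂ, mul_smul_comm, smul_smul, ← pow_add, mul_neg_one]
  change Hol.D (Hol.D (g ^ k)) = _
  rw [h, ← Hol.deriv_apply, Derivation.map_smul, Hol.deriv_apply, h, smul_smul]
  push_cast
  congr 1
  ring

variable {a} in
/-- The second derivative of `y ^ 2 f`, where `f` plays the part of `log y`. -/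
theorem D_D_sq_mul {y f g : Hol (dom a)} (hy : Hol.D y = 1) (hf : Hol.D f = g) (hyg : y * g = 1) :
    Hol.D^[2] (y ^ 2 * f) = 2 • f + 3 := by
  have h1 : Hol.D (y ^ 2 * f) = 2 * (y * f) + y := by
    rw [← Hol.deriv_apply, Derivation.leibniz, Derivation.leibniz_pow, Hol.deriv_apply,
      Hol.deriv_apply, hy, hf]
    simp only [smul_eq_mul, nsmul_eq_mul]
    linear_combination y * hyg
  change Hol.D (Hol.D (y ^ 2 * f)) = _
  rw [h1, two_mul, ← Hol.deriv_apply, map_add, map_add, Derivation.leibniz, Hol.deriv_apply,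
    Hol.deriv_apply, hy, hf]
  simp only [smul_eq_mul, nsmul_eq_mul]
  linear_combination 2 * hyg

theorem coeff_correction (i : ℤ) : (correction a).coeff i =
    (if i = -2 then correctionZero a else 0) + (if i = 0 then correctionOne a else 0) +
      if i < 0 then 0 else
        if Even i.natAbs ∧ 2 ≤ i.natAbs then correctionHigher a (i.natAbs / 2 + 1) else 0 := by
  rw [correction, HahnSeries.coeff_add, HahnSeries.coeff_add, PowerSeries.coeff_coe,
    PowerSeries.coeff_mk, HahnSeries.coeff_single, HahnSeries.coeff_single]
  split_ifs <;> rfl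

theorem iterate_D_constFun (k : ℕ) (c : ℂ) : Hol.D^[k + 1] (constFun a c) = 0 := by
  rw [Function.iterate_succ_apply, D_constFun, Hol.iterate_D_zero]

theorem Hol.iterate_D_sub {U : Opens ℂ} (j : ℕ) (f g : Hol U) :
    Hol.D^[j] (f - g) = Hol.D^[j] f - Hol.D^[j] g :=
  iterate_map_sub (Hol.deriv U) j f g

theorem Hol.iterate_D_neg {U : Opens ℂ} (j : ℕ) (f : Hol U) :
    Hol.D^[j] (-f) = -Hol.D^[j] f :=
  iterate_map_neg (Hol.deriv U) j f

theorem D_D_correctionZero : Hol.D^[2] (correctionZero a) = logX a + logXa a := by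
  have h1 : Hol.D^[2] (xFun a * (xFun a + constFun a a)) = 2 := by
    have h : Hol.D (xFun a * (xFun a + constFun a a)) = xFun a + (xFun a + constFun a a) := by
      rw [← Hol.deriv_apply, Derivation.leibniz, Hol.deriv_apply, Hol.deriv_apply, D_xFun,
        D_xFun_add, smul_eq_mul, smul_eq_mul, mul_one, mul_one]
    change Hol.D (Hol.D _) = _
    rw [h, ← Hol.deriv_apply, map_add, Hol.deriv_apply, Hol.deriv_apply, D_xFun, D_xFun_add]
    exact one_add_one_eq_two
  rw [correctionZero, Hol.iterate_D_sub, Hol.iterate_D_sub, Hol.iterate_D_add, Hol.iterate_D_smul,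
    Hol.iterate_D_smul, Hol.iterate_D_smul, h1, iterate_D_constFun,
    D_D_sq_mul (D_xFun a) (D_logX a) (xFun_mul_invX a),
    D_D_sq_mul (D_xFun_add a) (D_logXa a) (xFun_add_mul_invXa a)]
  ext x
  change 1 / 2 * (2 • Complex.log x + 3) + 1 / 2 * (2 • Complex.log (x + a) + 3) - 0 - 3 / 2 * 2 =
    Complex.log x + Complex.log (x + a)
  simp only [nsmul_eq_mul]
  push_cast
  ring

/-- The second derivatives of the coefficients of the correction: the correction `c` satisfies
`ε ^ 2 c'' = (B - X B') (log x + log (x + a))` at `X = ε ∂_x`. -/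
theorem D_D_coeff_correction (q : ℕ) : Hol.D^[2] ((correction a).coeff ((q : ℤ) - 2)) =
    bernoulliDiff q • Hol.D^[q] (logX a + logXa a) := by
  rw [coeff_correction]
  match q with
  | 0 =>
    rw [if_pos (by norm_num), if_neg (by norm_num), if_pos (by norm_num), add_zero, add_zero,
      D_D_correctionZero]
    simp [bernoulliDiff]
  | 1 =>
    rw [if_neg (by norm_num), if_neg (by norm_num), if_pos (by norm_num), add_zero, add_zero,
      Hol.iterate_D_zero]
    simp [bernoulliDiff]
  | 2 =>
    rw [if_neg (by norm_num), if_pos (by norm_num), if_neg (by norm_num), if_neg (by norm_num),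
      add_zero, zero_add, correctionOne, Hol.iterate_D_add, Hol.iterate_D_neg, Hol.iterate_D_smul,
      Hol.iterate_D_sub, iterate_D_constFun, iterate_D_constFun, sub_zero, add_zero, ← neg_smul]
    congr 1
    rw [bernoulliDiff, bernoulli_two]
    norm_num
  | n + 3 =>
    rw [if_neg (by omega), if_neg (by omega), if_neg (by omega), zero_add, zero_add]
    have hn : (((n + 3 : ℕ) : ℤ) - 2).natAbs = n + 1 := by omega
    rw [hn]
    by_cases hev : Even (n + 1)
    · obtain ⟨g, hg⟩ := hev
      obtain ⟨g, rfl⟩ : ∃ g', g = g' + 1 := ⟨g - 1, by omega⟩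
      obtain rfl : n = 2 * g + 1 := by omega
      have e1 : (2 * g + 1 + 1) / 2 + 1 = g + 2 := by omega
      rw [if_pos ⟨⟨g + 1, hg⟩, by omega⟩, e1, correctionHigher, Hol.iterate_D_smul,
        Hol.iterate_D_sub, Hol.iterate_D_add, iterate_D_constFun, sub_zero,
        D_D_pow (D_invX a), D_D_pow (D_invXa a), Hol.iterate_D_add,
        iterate_D_of_D_eq (D_logX a) (D_invX a), iterate_D_of_D_eq (D_logXa a) (D_invXa a),
        ← smul_add, ← smul_add, smul_smul, smul_smul, bernoulliDiff]
      have e2 : 2 * (g + 2) - 2 = 2 * g + 2 := by omega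
      rw [e2]
      congr 1
      have h1 : (g : ℂ) + 1 ≠ 0 := Nat.cast_add_one_ne_zero g
      have h2 : (g : ℂ) + 2 ≠ 0 := by exact_mod_cast Nat.cast_add_one_ne_zero (R := ℂ) (g + 1)
      have h3 : ((2 * g + 1 + 2).factorial : ℂ) ≠ 0 := by exact_mod_cast Nat.factorial_ne_zero _
      have e3 : 2 * g + 1 + 3 = 2 * (g + 2) := by ring
      have e4 : ((2 * (g + 2)).factorial : ℂ) =
          2 * (g + 2) * (2 * g + 1 + 2).factorial := by
        rw [← e3, Nat.factorial_succ]
        push_cast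
        ring
      have e5 : ((-1 : ℂ)) ^ (2 * g + 1 + 2) = -1 := by
        rw [show 2 * g + 1 + 2 = 2 * (g + 1) + 1 by ring, pow_succ, pow_mul]
        simp
      rw [e3, e4, e5]
      have h5 : (g : ℂ) + 2 - 1 ≠ 0 := by
        rwa [show (g : ℂ) + 2 - 1 = g + 1 by ring]
      push_cast
      field_simp
      ring
    · have hodd : Odd (n + 3) := by
        obtain ⟨k, hk⟩ := Nat.not_even_iff_odd.1 hev
        exact ⟨k + 1, by omega⟩
      rw [if_neg (fun h => hev h.1), Hol.iterate_D_zero, bernoulliDiff,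
        bernoulli_eq_zero_of_odd hodd (by omega)]
      simp

/-- The second difference of the correction, `(exp X + exp (-X) - 2) c` with `X = ε ∂_x`, is
`log x + log (x + a)`. -/
theorem shift_correction : Coef.shift 1 (correction a) + Coef.shift (-1) (correction a) =
    HahnSeries.C (logX a + logXa a) + (correction a + correction a) := by
  ext1
  funext n
  set c := correction a with hc
  have hlow : ∀ i : ℤ, i < -2 → c.coeff i = 0 := by
    intro i hi
    rw [hc, coeff_correction, if_neg (by omega), if_neg (by omega), if_pos (by omega)]
    simp
  obtain ⟨N, hN⟩ : ∃ N : ℕ, N = (n + 2).toNat := ⟨_, rfl⟩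
  have hz : ∀ j, N + 1 ≤ j → Hol.D^[j] (c.coeff (n - j)) = 0 := by
    intro j hj
    rw [hlow _ (by omega), Hol.iterate_D_zero]
  rw [HahnSeries.coeff_add, HahnSeries.coeff_add, HahnSeries.coeff_add,
    Coef.coeff_shift_eq_sum _ _ _ _ hz, Coef.coeff_shift_eq_sum _ _ _ _ hz,
    ← Finset.sum_add_distrib]
  have h1 : ∀ j ∈ Finset.range (N + 1),
      (((1 : ℤ) : ℂ) ^ j / (j.factorial : ℂ)) • Hol.D^[j] (c.coeff (n - j)) +
        (((-1 : ℤ) : ℂ) ^ j / (j.factorial : ℂ)) • Hol.D^[j] (c.coeff (n - j)) =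
      coshCoeff j • Hol.D^[j] (c.coeff (n - j)) +
        if j = 0 then c.coeff n + c.coeff n else 0 := by
    intro j _
    rw [← add_smul, coshCoeff]
    split_ifs with h
    · subst h
      simp
      norm_num [two_smul]
    · rw [sub_zero, add_zero]
      congr 1
      push_cast
      rw [one_pow]
      ring
  rw [Finset.sum_congr rfl h1, Finset.sum_add_distrib, Finset.sum_ite_eq' (Finset.range (N + 1)),
    if_pos (by simp)]
  congr 1
  rcases lt_or_ge n (-2) with hn | hn
  · rw [Finset.sum_eq_zero, HahnSeries.C_apply, HahnSeries.coeff_single_of_ne (by omega)]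
    intro j _
    rw [hlow _ (by omega), Hol.iterate_D_zero, smul_zero]
  -- Every term with `j ≥ 2` is a multiple of the derivative of order `N - 2` of the logarithms; the
  -- coefficients add up to that of `X ^ 2`.
  · have hn' : n = N - 2 := by omega
    have h2 : ∀ j ∈ Finset.range (N + 1), coshCoeff j • Hol.D^[j] (c.coeff (n - j)) =
        (bernoulliDiff (N - j) * coshCoeff j) • Hol.D^[N - 2] (logX a + logXa a) := by
      intro j hj
      have hj' := Finset.mem_range.1 hj
      match j with
      | 0 => simp [coshCoeff]; norm_num
      | 1 => simp [coshCoeff]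
      | j + 2 =>
        have e1 : n - ((j + 2 : ℕ) : ℤ) = ((N - (j + 2) : ℕ) : ℤ) - 2 := by omega
        rw [e1, Function.iterate_add_apply, D_D_coeff_correction, Hol.iterate_D_smul,
          ← Function.iterate_add_apply, smul_smul, mul_comm]
        congr 2
        omega
    have h3 := sum_bernoulliDiff_mul_coshCoeff N
    rw [← Finset.Nat.sum_antidiagonal_swap, Finset.Nat.sum_antidiagonal_eq_sum_range_succ_mk] at h3
    rw [Finset.sum_congr rfl h2, ← Finset.sum_smul]
    simp only [Prod.swap] at h3
    rw [h3, HahnSeries.C_apply, HahnSeries.coeff_single]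
    split_ifs with h h' h'
    · rw [h, one_smul]
      rfl
    · omega
    · omega
    · rw [zero_smul]

end Correction

/-! ### Uniqueness of the solution -/

theorem coeff_sub_congr {R : Type*} [CommRing R] {f f' g g' : MvPowerSeries ℕ R} {ν : ℕ →₀ ℕ}
    (h : MvPowerSeries.coeff ν f = MvPowerSeries.coeff ν f')
    (h' : MvPowerSeries.coeff ν g = MvPowerSeries.coeff ν g') :
    MvPowerSeries.coeff ν (f - g) = MvPowerSeries.coeff ν (f' - g') := by
  rw [map_sub, map_sub, h, h']

section Uniqueness

variable {a : ℂ}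

/-- Equality of the coefficients of all monomials of degree at most `N`.  It is compatible with the
operations from which the Toda equations are built. -/
def EqUpTo (N : ℕ) (f g : Ser (dom a)) : Prop :=
  ∀ ν : ℕ →₀ ℕ, ν.degree ≤ N → MvPowerSeries.coeff ν f = MvPowerSeries.coeff ν g

namespace EqUpTo

variable {N : ℕ} {f f' g g' : Ser (dom a)}

theorem refl (f : Ser (dom a)) : EqUpTo N f f := fun _ _ => rfl

theorem add (h : EqUpTo N f f') (h' : EqUpTo N g g') : EqUpTo N (f + g) (f' + g') := by
  intro ν hν
  rw [map_add, map_add, h ν hν, h' ν hν]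

theorem mul (h : EqUpTo N f f') (h' : EqUpTo N g g') : EqUpTo N (f * g) (f' * g') := by
  classical
  intro ν hν
  rw [MvPowerSeries.coeff_mul, MvPowerSeries.coeff_mul]
  refine Finset.sum_congr rfl fun p hp => ?_
  have hs := congrArg Finsupp.degree (Finset.HasAntidiagonal.mem_antidiagonal.1 hp)
  rw [map_add] at hs
  rw [h p.1 (by omega), h' p.2 (by omega)]

set_option synthInstance.maxHeartbeats 400000 in
set_option maxHeartbeats 2000000 in
theorem sub (h : EqUpTo N f f') (h' : EqUpTo N g g') : EqUpTo N (f - g) (f' - g') :=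
  fun ν hν => coeff_sub_congr (R := Coef (dom a)) (h ν hν) (h' ν hν)

theorem shift (k : ℤ) (h : EqUpTo N f f') : EqUpTo N (Ser.shift k f) (Ser.shift k f') := by
  intro ν hν
  rw [Ser.coeff_shift, Ser.coeff_shift, h ν hν]

theorem lax_comp {V W V' W' : Ser (dom a)} (hV : EqUpTo N V V') (hW : EqUpTo N W W')
    {B B' : DiffOp (dom a)} (hB : ∀ k, EqUpTo N (B k) (B' k)) (k : ℤ) :
    EqUpTo N ((lax V W).comp B k) ((lax V' W').comp B' k) := by
  rw [lax_comp_apply, lax_comp_apply]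
  exact (((hB _).shift 1).add (hV.mul (hB _))).add (hW.mul ((hB _).shift (-1)))

theorem comp_lax {V W V' W' : Ser (dom a)} (hV : EqUpTo N V V') (hW : EqUpTo N W W')
    {B B' : DiffOp (dom a)} (hB : ∀ k, EqUpTo N (B k) (B' k)) (k : ℤ) :
    EqUpTo N (B.comp (lax V W) k) (B'.comp (lax V' W') k) := by
  rw [comp_lax_apply _ _ (shift_one a), comp_lax_apply _ _ (shift_one a)]
  exact ((hB _).add ((hB _).mul (hV.shift _))).add ((hB _).mul (hW.shift _))

theorem lax_pow {V W V' W' : Ser (dom a)} (hV : EqUpTo N V V') (hW : EqUpTo N W W') (n : ℕ)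
    (k : ℤ) : EqUpTo N ((lax V W).pow n k) ((lax V' W').pow n k) := by
  induction n generalizing k with
  | zero => exact refl _
  | succ n ih => exact lax_comp hV hW ih k

theorem plus {B B' : DiffOp (dom a)} (hB : ∀ k, EqUpTo N (B k) (B' k)) (k : ℤ) :
    EqUpTo N (B.plus k) (B'.plus k) := by
  rw [plus_apply, plus_apply]
  split_ifs
  · exact hB k
  · exact refl _

/-- The flows of the Toda lattice hierarchy determine the coefficients of the next degree. -/
theorem d_lax {V W V' W' : Ser (dom a)} (h : IsTodaSolution V W) (h' : IsTodaSolution V' W')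
    (hV : EqUpTo N V V') (hW : EqUpTo N W W') (i : ℕ) (k : ℤ) :
    EqUpTo N (Ser.d i (lax V W k)) (Ser.d i (lax V' W' k)) := by
  rw [h i k, h' i k]
  exact (refl _).mul ((comp_lax hV hW (plus (lax_pow hV hW (i + 1))) k).sub
    (lax_comp hV hW (plus (lax_pow hV hW (i + 1))) k))

/-- The derivatives determine the coefficients of positive degree. -/
theorem succ (h : ∀ i, EqUpTo N (Ser.d i f) (Ser.d i f')) (h0 : EqUpTo N f f') :
    EqUpTo (N + 1) f f' := by
  intro ν hν
  rcases eq_or_ne ν 0 with rfl | hne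
  · exact h0 0 (by simp)
  · obtain ⟨i, hi⟩ : ∃ i, ν i ≠ 0 := by
      by_contra hc
      push Not at hc
      exact hne (Finsupp.ext hc)
    obtain ⟨κ, rfl⟩ : ∃ κ, ν = κ + Finsupp.single i 1 := by
      refine ⟨ν - Finsupp.single i 1, (tsub_add_cancel_of_le ?_).symm⟩
      rw [Finsupp.single_le_iff]
      omega
    rw [map_add, Finsupp.degree_single] at hν
    have h1 := h i κ (by omega)
    rw [Ser.coeff_d, Ser.coeff_d] at h1
    have h2 : ((κ i + 1 : ℕ) : Coef (dom a)) = (κ i : Coef (dom a)) + 1 := by push_cast; rfl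
    refine natCast_mul_cancel (Nat.succ_ne_zero (κ i)) ?_
    rw [Nat.succ_eq_add_one, h2, mul_comm, h1, mul_comm]

end EqUpTo

/-- A solution of the Toda lattice hierarchy is determined by its initial data. -/
theorem eq_of_isTodaSolution {V W V' W' : Ser (dom a)} (h : IsTodaSolution V W)
    (h' : IsTodaSolution V' W')
    (hV : MvPowerSeries.constantCoeff V = MvPowerSeries.constantCoeff V')
    (hW : MvPowerSeries.constantCoeff W = MvPowerSeries.constantCoeff W') : V = V' ∧ W = W' := by
  have key : ∀ N, EqUpTo N V V' ∧ EqUpTo N W W' := by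
    intro N
    induction N with
    | zero =>
      refine ⟨fun ν hν => ?_, fun ν hν => ?_⟩
      · rw [(Finsupp.degree_eq_zero_iff ν).1 (by omega)]
        exact hV
      · rw [(Finsupp.degree_eq_zero_iff ν).1 (by omega)]
        exact hW
    | succ N ih =>
      have h0 : ∀ V W : Ser (dom a), lax V W 0 = V := fun V W => by rw [lax_apply]; simp
      have h1 : ∀ V W : Ser (dom a), lax V W (-1) = W := fun V W => by rw [lax_apply]; simp
      refine ⟨EqUpTo.succ (fun i => ?_) ih.1, EqUpTo.succ (fun i => ?_) ih.2⟩
      · have := EqUpTo.d_lax h h' ih.1 ih.2 i 0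
        rwa [h0, h0] at this
      · have := EqUpTo.d_lax h h' ih.1 ih.2 i (-1)
        rwa [h1, h1] at this
  refine ⟨?_, ?_⟩
  · ext1 ν
    exact (key ν.degree).1 ν le_rfl
  · ext1 ν
    exact (key ν.degree).2 ν le_rfl

theorem constantCoeff_toTodaTimes {U : Opens ℂ} (f : Ser U) :
    MvPowerSeries.constantCoeff (toTodaTimes f) = MvPowerSeries.constantCoeff f := by
  rw [toTodaTimes, ← MvPowerSeries.coeff_zero_eq_constantCoeff_apply, MvPowerSeries.coeff_rescale,
    Finsupp.prod_zero_index, one_mul, MvPowerSeries.coeff_zero_eq_constantCoeff_apply]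

end Uniqueness

end DessinToda

end

theorem mainTheorem1 (a : ℂ) (ha : a ≠ 0) :
    ∃ W : DessinToda.Ser (DessinToda.dom a),
      (DessinToda.correctedZ a).ratio.HasValue W ∧
      DessinToda.IsTodaSolution (DessinToda.toTodaTimes (DessinToda.dessinV a))
        (DessinToda.toTodaTimes W) ∧
      DessinToda.IsTauFunction
        (DessinToda.FormalExp.exp (DessinToda.toTodaTimes (DessinToda.correctedZ a).log))
        (DessinToda.toTodaTimes (DessinToda.dessinV a)) (DessinToda.toTodaTimes W) ∧
      MvPowerSeries.constantCoeff (DessinToda.dessinV a) =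
        HahnSeries.C (2 * DessinToda.xFun a + DessinToda.constFun a a) +
          DessinToda.eps (DessinToda.dom a) ∧
      MvPowerSeries.constantCoeff W =
        HahnSeries.C (DessinToda.xFun a * (DessinToda.xFun a + DessinToda.constFun a a)) ∧
      ∀ V' W' : DessinToda.Ser (DessinToda.dom a),
        DessinToda.IsTodaSolution V' W' →
        MvPowerSeries.constantCoeff V' =
          HahnSeries.C (2 * DessinToda.xFun a + DessinToda.constFun a a) +
            DessinToda.eps (DessinToda.dom a) →
        MvPowerSeries.constantCoeff W' =
          HahnSeries.C (DessinToda.xFun a * (DessinToda.xFun a + DessinToda.constFun a a)) →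
        V' = DessinToda.toTodaTimes (DessinToda.dessinV a) ∧
          W' = DessinToda.toTodaTimes W := by
  refine ⟨DessinToda.dessinW a,
    DessinToda.hasValue_ratio_correctedZ a (DessinToda.shift_correction a),
    DessinToda.isTodaSolution_dessin a,
    DessinToda.isTauFunction_dessin a (DessinToda.shift_correction a),
    DessinToda.constantCoeff_dessinV a, DessinToda.constantCoeff_dessinW a,
    fun V' W' h hV hW => ?_⟩
  refine DessinToda.eq_of_isTodaSolution h (DessinToda.isTodaSolution_dessin a) ?_ ?_
  · rw [hV, DessinToda.constantCoeff_toTodaTimes, DessinToda.constantCoeff_dessinV]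
  · rw [hW, DessinToda.constantCoeff_toTodaTimes, DessinToda.constantCoeff_dessinW]
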